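/- Fix a prime $p$ and an integer $n\ge 0$. Let $BP_*=\mathbb Z_{(p)}[v_1,v_2,\dots]$ with $|v_i|=2(p^i-1)$, where the $v_i$ are the Hazewinkel generators, let $v_0=p$, let $I_{n+1}=(v_0,v_1,\dots,v_n)\subset BP_*$, and let $BP_*BP=BP_*[t_1,t_2,\dots]$ with its usual Hopf algebroid structure. Let $E(n)_*=\mathbb Z_{(p)}[v_1,\dots,v_n][v_n^{-1}]$ (so $E(0)_*=\mathbb Q$), a $BP_*$-algebra by $v_i\mapsto 0$ for $i>n$, and let $E(n)_*E(n)=E(n)_*\otimes_{BP_*}BP_*BP\otimes_{BP_*}E(n)_*$. All modules and comodules are $\mathbb Z$-graded, and all maps preserve degrees. For a $BP_*BP$-comodule $M$, let $T_nM\subseteq M$ be its largest subcomodule consisting of $v_n$-torsion elements (elements killed by some power of $v_n$). Let $\Phi_*\colon BP_*BP\text{-comod}\to E(n)_*E(n)\text{-comod}$ be the functor $M\mapsto E(n)_*\otimes_{BP_*}M$, let $\Phi^*$ be its right adjoint, and let $L_n=\Phi^*\Phi_*$. Let $T_n^k$ and $L_n^k$ be the $k$-th right derived functors of $T_n$ and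 $L_n$ on the abelian category of $BP_*BP$-comodules. For a graded $BP_*$-module $M$ and $S\subseteq\{0,\dots,n\}$ put $v_S=\prod_{i\in S}v_i$. Let $H^k_{I_{n+1}}(M)$ be the $k$-th cohomology of the stable Koszul complex $$K^\bullet(I_{n+1})\otimes_{BP_*} M,\qquad K^\bullet(I_{n+1})=\bigotimes_{i=0}^n\bigl(BP_*\to BP_*[1/v_i]\bigr),\qquad K^k(I_{n+1})=\bigoplus_{|S|=k}BP_*[1/v_S],$$ and let $\check CH^k_{I_{n+1}}(M)$ be the $k$-th cohomology of $\check C^\bullet(I_{n+1})\otimes_{BP_*}M$, where $\check C^k(I_{n+1})=\bigoplus_{|S|=k+1}BP_*[1/v_S]$ for $k\ge 0$, with the usual alternating differential. Theorem. The following hold. 1. For every $BP_*BP$-comodule $M$, the subcomodule $T_nM$ consists of all $v_n$-torsion elements of $M$. 2. For every $k\ge 0$ there is an isomorphism of graded $BP_*$-modules $T_n^k(M)\cong H^k_{I_{n+1}}(M)$, natural in the $BP_*BP$-comodule $M$. 3. For every $k\ge 0$ there is an isomorphism of graded $BP_*$-modules $L_n^k(M)\cong \check CH^k_{I_{n+1}}(M)$,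 natural in the $BP_*BP$-comodule $M$. 4. If $J$ is an injective object of the category of $BP_*BP$-comodules, then $H^k_{I_{n+1}}(J)=0$ for all $k>0$. -/

import Mathlib

open CategoryTheory CategoryTheory.Limits

namespace BPCom
noncomputable section

/-! ## Internal gradings -/

section Internal

variable {M N : Type} [AddCommGroup M] [AddCommGroup N] {D : ℤ → AddSubgroup M}
  {E : ℤ → AddSubgroup N}

lemma internal_induction (h : DirectSum.IsInternal D) {P : M → Prop} (x : M)
    (hom : ∀ i, ∀ y ∈ D i, P y) (add : ∀ y z, P y → P z → P (y + z)) : P x := by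
  obtain ⟨y, rfl⟩ := h.2 x
  induction y using DirectSum.induction_on with
  | zero => simpa using hom 0 0 (zero_mem _)
  | of i y => simpa using hom i y y.2
  | add y z hy hz => simpa using add _ _ hy hz

/-- The family of homogeneous components of an element. -/
def comp (h : DirectSum.IsInternal D) : M →+ (ℤ →₀ M) :=
  (DirectSum.toAddMonoid fun i => (Finsupp.singleAddHom i).comp (D i).subtype).comp
    (AddEquiv.ofBijective (DirectSum.coeAddMonoidHom D) h).symm.toAddMonoidHom

lemma comp_of_mem (h : DirectSum.IsInternal D) {i : ℤ} {x : M} (hx : x ∈ D i) :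
    comp h x = Finsupp.single i x := by
  have : (AddEquiv.ofBijective (DirectSum.coeAddMonoidHom D) h).symm x =
      DirectSum.of (fun i => D i) i ⟨x, hx⟩ := by
    rw [AddEquiv.symm_apply_eq]
    exact (DirectSum.coeAddMonoidHom_of D i ⟨x, hx⟩).symm
  change DirectSum.toAddMonoid (fun i => (Finsupp.singleAddHom i).comp (D i).subtype)
    ((AddEquiv.ofBijective (DirectSum.coeAddMonoidHom D) h).symm x) = _
  rw [this, DirectSum.toAddMonoid_of]
  rfl

lemma comp_mem (h : DirectSum.IsInternal D) (x : M) (i : ℤ) : comp h x i ∈ D i := by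
  classical
  refine internal_induction h (P := fun x => comp h x i ∈ D i) x ?_ ?_
  · intro j y hy
    rw [comp_of_mem h hy, Finsupp.single_apply]
    split_ifs with hij
    · exact hij ▸ hy
    · exact zero_mem _
  · intro y z hy hz
    simpa using add_mem hy hz

lemma comp_sum (h : DirectSum.IsInternal D) (x : M) :
    (comp h x).sum (fun _ y => y) = x := by
  refine internal_induction h (P := fun x => (comp h x).sum (fun _ y => y) = x) x ?_ ?_
  · intro j y hy
    rw [comp_of_mem h hy, Finsupp.sum_single_index rfl]
  · intro y z hy hz
    rw [map_add, Finsupp.sum_add_index' (fun _ => rfl) (fun _ _ _ => rfl), hy, hz]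

lemma comp_map (h : DirectSum.IsInternal D) (h' : DirectSum.IsInternal E) (f : M →+ N)
    (hf : ∀ i, ∀ x ∈ D i, f x ∈ E i) (x : M) (i : ℤ) :
    comp h' (f x) i = f (comp h x i) := by
  classical
  refine internal_induction h (P := fun x => comp h' (f x) i = f (comp h x i)) x ?_ ?_
  · intro j y hy
    rw [comp_of_mem h hy, comp_of_mem h' (hf j y hy), Finsupp.single_apply, Finsupp.single_apply]
    split_ifs <;> simp
  · intro y z hy hz
    simp [hy, hz]

lemma mem_of_map_mem (h : DirectSum.IsInternal D) (h' : DirectSum.IsInternal E) (f : M →+ N)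
    (hf : ∀ i, ∀ x ∈ D i, f x ∈ E i) (inj : Function.Injective f) {x : M} {i : ℤ}
    (hx : f x ∈ E i) : x ∈ D i := by
  classical
  have : comp h x i = x := inj (by rw [← comp_map h h' f hf, comp_of_mem h' hx]; simp)
  rw [← this]; exact comp_mem h x i

lemma internal_of_indep (hs : ∀ x, x ∈ ⨆ i, D i)
    (hi : ∀ c : ℤ →₀ M, (∀ i, c i ∈ D i) → c.sum (fun _ y => y) = 0 → c = 0) :
    DirectSum.IsInternal D := by
  classical
  constructor
  · rw [injective_iff_map_eq_zero]
    intro z hz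
    let c : ℤ →₀ M := Finsupp.onFinset z.support (fun i => (z i : M)) (by
      intro i hi'; simpa using hi')
    have hc : c = 0 := by
      apply hi c (fun i => (z i).2)
      rw [← hz, DirectSum.coeAddMonoidHom_eq_dfinsuppSum]
      rw [Finsupp.onFinset_sum _ (fun _ => rfl)]
      rfl
    ext i
    have := DFunLike.congr_fun hc i
    simpa [c] using this
  · intro x
    refine AddSubgroup.iSup_induction D (C := fun x => ∃ a, DirectSum.coeAddMonoidHom D a = x)
      (hs x) ?_ ?_ ?_
    · intro i y hy
      exact ⟨DirectSum.of (fun i => D i) i ⟨y, hy⟩, by simp⟩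
    · exact ⟨0, by simp⟩
    · rintro y z ⟨a, rfl⟩ ⟨b, rfl⟩
      exact ⟨a + b, by simp⟩

lemma internal_of_comp (hs : ∀ x, x ∈ ⨆ i, D i) (c : M →+ (ℤ →₀ M))
    (hc : ∀ i, ∀ x ∈ D i, c x = Finsupp.single i x) : DirectSum.IsInternal D := by
  apply internal_of_indep hs
  intro d hd h0
  have := congrArg c h0
  rw [map_zero, Finsupp.sum, map_sum] at this
  rw [← this]
  conv_lhs => rw [← Finsupp.sum_single d, Finsupp.sum]
  exact Finset.sum_congr rfl fun i _ => (hc i _ (hd i)).symm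

lemma internal_mem_iSup (h : DirectSum.IsInternal D) (x : M) : x ∈ ⨆ i, D i :=
  internal_induction h (P := fun x => x ∈ ⨆ i, D i) x
    (fun i _ hy => AddSubgroup.mem_iSup_of_mem i hy) (fun _ _ => add_mem)

lemma internal_indep (h : DirectSum.IsInternal D) (c : ℤ →₀ M) (hc : ∀ i, c i ∈ D i)
    (h0 : c.sum (fun _ y => y) = 0) : c = 0 := by
  have := congrArg (comp h) h0
  rw [map_zero, Finsupp.sum, map_sum] at this
  rw [← this]
  conv_lhs => rw [← Finsupp.sum_single c, Finsupp.sum]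
  exact Finset.sum_congr rfl fun i _ => (comp_of_mem h (hc i)).symm

end Internal

/-! ## Graded commutative rings and graded modules -/

/-- A (commutative, not sign-commutative) `ℤ`-graded ring. -/
structure GRing : Type 1 where
  carrier : Type
  [ring : CommRing carrier]
  deg : ℤ → AddSubgroup carrier
  one_mem : (1 : carrier) ∈ deg 0
  mul_mem : ∀ {i j : ℤ} {a b : carrier}, a ∈ deg i → b ∈ deg j → a * b ∈ deg (i + j)
  isInternal : DirectSum.IsInternal deg

instance : CoeSort GRing Type := ⟨GRing.carrier⟩
instance (A : GRing) : CommRing A := A.ring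

/-- A degree-preserving ring homomorphism. -/
structure GRing.Hom (A B : GRing) where
  hom : A →+* B
  mem : ∀ i, ∀ a ∈ A.deg i, hom a ∈ B.deg i

/-- A `ℤ`-graded module over a graded ring. -/
structure GMod (A : GRing) : Type 1 where
  carrier : Type
  [addCommGroup : AddCommGroup carrier]
  [module : Module A carrier]
  deg : ℤ → AddSubgroup carrier
  smul_mem : ∀ {i j : ℤ} {a : A} {x : carrier}, a ∈ A.deg i → x ∈ deg j → a • x ∈ deg (i + j)
  isInternal : DirectSum.IsInternal deg

namespace GMod

variable {A : GRing}

instance : CoeSort (GMod A) Type := ⟨GMod.carrier⟩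
instance (M : GMod A) : AddCommGroup M := M.addCommGroup
instance (M : GMod A) : Module A M := M.module

/-- A morphism of graded modules is a linear map that preserves degrees. -/
@[ext]
structure Hom (M N : GMod A) where
  lin : M →ₗ[A] N
  mem : ∀ i, ∀ x ∈ M.deg i, lin x ∈ N.deg i

@[simps id_lin comp_lin]
instance : Category (GMod A) where
  Hom M N := Hom M N
  id M := ⟨LinearMap.id, fun _ _ h => h⟩
  comp f g := ⟨g.lin.comp f.lin, fun i x h => g.mem i _ (f.mem i x h)⟩

@[ext]
lemma hom_ext {M N : GMod A} {f g : M ⟶ N} (h : ∀ x, f.lin x = g.lin x) : f = g :=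
  Hom.ext (LinearMap.ext h)

@[simp] lemma id_apply {M : GMod A} (x : M) : Hom.lin (𝟙 M) x = x := rfl
@[simp] lemma comp_apply {M N P : GMod A} (f : M ⟶ N) (g : N ⟶ P) (x : M) :
    (f ≫ g).lin x = g.lin (f.lin x) := rfl

variable {M N : GMod A}

instance : Zero (M ⟶ N) := ⟨⟨0, fun _ _ _ => zero_mem _⟩⟩
instance : Add (M ⟶ N) := ⟨fun f g => ⟨f.lin + g.lin, fun i x h => add_mem (f.mem i x h) (g.mem i x h)⟩⟩
instance : Neg (M ⟶ N) := ⟨fun f => ⟨-f.lin, fun i x h => neg_mem (f.mem i x h)⟩⟩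
instance : Sub (M ⟶ N) := ⟨fun f g => ⟨f.lin - g.lin, fun i x h => sub_mem (f.mem i x h) (g.mem i x h)⟩⟩
instance : SMul ℕ (M ⟶ N) := ⟨fun n f => ⟨n • f.lin, fun i x h => nsmul_mem (f.mem i x h) n⟩⟩
instance : SMul ℤ (M ⟶ N) := ⟨fun n f => ⟨n • f.lin, fun i x h => zsmul_mem (f.mem i x h) n⟩⟩

instance : AddCommGroup (M ⟶ N) :=
  Function.Injective.addCommGroup (fun f : M ⟶ N => f.lin) (fun _ _ h => Hom.ext h)
    rfl (fun _ _ => rfl) (fun _ => rfl) (fun _ _ => rfl) (fun _ _ => rfl) (fun _ _ => rfl)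

@[simp] lemma zero_apply (x : M) : Hom.lin (0 : M ⟶ N) x = 0 := rfl
@[simp] lemma add_apply (f g : M ⟶ N) (x : M) : (f + g).lin x = f.lin x + g.lin x := rfl
@[simp] lemma neg_apply (f : M ⟶ N) (x : M) : (-f).lin x = -f.lin x := rfl
@[simp] lemma zsmul_apply (n : ℤ) (f : M ⟶ N) (x : M) : (n • f).lin x = n • f.lin x := rfl

instance : Preadditive (GMod A) where
  add_comp _ _ _ f f' g := by ext x; simp
  comp_add _ _ _ f g g' := by ext x; simp

/-- The underlying ungraded module. -/
@[simps]
def forget (A : GRing) : GMod A ⥤ ModuleCat.{0} A where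
  obj M := ModuleCat.of A M
  map f := ModuleCat.ofHom f.lin

instance : (forget A).Faithful where
  map_injective {M N f g} h := by
    ext x
    exact congrArg (fun k : (forget A).obj M ⟶ (forget A).obj N => k.hom x) h

instance : (forget A).Additive where

/-- The homogeneous components of an element of a graded module. -/
def cmp (M : GMod A) : M →+ (ℤ →₀ M) := comp M.isInternal

lemma cmp_hom (f : M ⟶ N) (x : M) (i : ℤ) : N.cmp (f.lin x) i = f.lin (M.cmp x i) :=
  comp_map M.isInternal N.isInternal f.lin.toAddMonoidHom f.mem x i

/-- A submodule is homogeneous if it contains the homogeneous components of its elements. -/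
def IsHomogeneous (M : GMod A) (S : Submodule A M) : Prop := ∀ x ∈ S, ∀ i, M.cmp x i ∈ S

/-- A homogeneous submodule as a graded module. -/
def sub (M : GMod A) (S : Submodule A M) (hS : M.IsHomogeneous S) : GMod A where
  carrier := S
  deg i := (M.deg i).comap S.subtype.toAddMonoidHom
  smul_mem ha hx := M.smul_mem ha hx
  isInternal := by
    classical
    apply internal_of_indep
    · intro x
      have : x = ∑ i ∈ (M.cmp x).support, (⟨M.cmp x i, hS x x.2 i⟩ : S) := by
        apply Subtype.ext
        rw [AddSubmonoidClass.coe_finsetSum]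
        exact (comp_sum M.isInternal (x : M)).symm
      rw [this]
      exact sum_mem fun i _ => AddSubgroup.mem_iSup_of_mem i (comp_mem M.isInternal (x : M) i)
    · intro c hc h0
      have : c.mapRange (fun y : S => (y : M)) rfl = 0 := by
        apply internal_indep M.isInternal
        · intro i; exact hc i
        · rw [Finsupp.sum_mapRange_index (fun _ => rfl)]
          have := congrArg (fun y : S => (y : M)) h0
          simpa [Finsupp.sum] using this
      ext i
      simpa using DFunLike.congr_fun this i

/-- The inclusion of a homogeneous submodule. -/
def subι (M : GMod A) (S : Submodule A M) (hS : M.IsHomogeneous S) : M.sub S hS ⟶ M :=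
  ⟨S.subtype, fun _ _ h => h⟩

/-- The quotient by a homogeneous submodule. -/
def quot (M : GMod A) (S : Submodule A M) (hS : M.IsHomogeneous S) : GMod A where
  carrier := M ⧸ S
  deg i := (M.deg i).map S.mkQ.toAddMonoidHom
  smul_mem := by
    rintro i j a _ ha ⟨x, hx, rfl⟩
    exact ⟨a • x, M.smul_mem ha hx, by simp⟩
  isInternal := by
    classical
    let c : (M ⧸ S) →+ (ℤ →₀ (M ⧸ S)) := QuotientAddGroup.lift S.toAddSubgroup
      ((Finsupp.mapRange.addMonoidHom S.mkQ.toAddMonoidHom).comp M.cmp) (by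
        intro x hx
        ext i
        simpa using hS x hx i)
    have key : ∀ x : M, c (S.mkQ x) =
      Finsupp.mapRange.addMonoidHom S.mkQ.toAddMonoidHom (M.cmp x) := fun x => rfl
    apply internal_of_comp _ c
    · rintro i _ ⟨x, hx, rfl⟩
      refine (key x).trans ?_
      rw [cmp, comp_of_mem _ hx]
      simp
    · intro x
      obtain ⟨x, rfl⟩ := S.mkQ_surjective x
      refine internal_induction M.isInternal (P := fun x => S.mkQ x ∈ _) x ?_ ?_
      · intro i y hy
        exact AddSubgroup.mem_iSup_of_mem i ⟨y, hy, rfl⟩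
      · intro y z hy hz
        rw [map_add]; exact add_mem hy hz

/-- The projection to a quotient. -/
def quotπ (M : GMod A) (S : Submodule A M) (hS : M.IsHomogeneous S) : M ⟶ M.quot S hS :=
  ⟨S.mkQ, fun _ x h => ⟨x, h, rfl⟩⟩

lemma exists_lift {X Y Z : GMod A} (f : X ⟶ Z) (i : Y ⟶ Z) (hi : Function.Injective i.lin)
    (h : ∀ x, f.lin x ∈ LinearMap.range i.lin) : ∃ g : X ⟶ Y, g ≫ i = f := by
  let e := LinearEquiv.ofInjective i.lin hi
  let g : X →ₗ[A] Y := e.symm.toLinearMap.comp (f.lin.codRestrict _ h)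
  have hg : ∀ x, i.lin (g x) = f.lin x := fun x =>
    congrArg Subtype.val (e.apply_symm_apply (f.lin.codRestrict _ h x))
  refine ⟨⟨g, fun k x hx => ?_⟩, by ext x; exact hg x⟩
  refine mem_of_map_mem Y.isInternal Z.isInternal i.lin.toAddMonoidHom i.mem hi ?_
  exact (hg x).symm ▸ f.mem k x hx

lemma ker_homogeneous (f : M ⟶ N) : M.IsHomogeneous (LinearMap.ker f.lin) := by
  intro x hx i
  rw [LinearMap.mem_ker] at *
  rw [← cmp_hom, hx]; simp

lemma kernel_w (f : M ⟶ N) : M.subι _ (ker_homogeneous f) ≫ f = 0 := by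
  ext x
  exact LinearMap.mem_ker.1 (Subtype.property x)

lemma range_homogeneous (f : M ⟶ N) : N.IsHomogeneous (LinearMap.range f.lin) := by
  rintro _ ⟨x, rfl⟩ i
  exact ⟨_, (cmp_hom f x i).symm⟩

lemma mono_of_injective (i : M ⟶ N) (hi : Function.Injective i.lin) : Mono i where
  right_cancellation g h e := by
    ext x
    exact hi (congrArg (fun k => Hom.lin k x) e)

/-- An injective map onto the kernel of `f` is a categorical kernel of `f`. -/
def isLimitOfExact {K : GMod A} {f : M ⟶ N} (i : K ⟶ M) (w : i ≫ f = 0)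
    (hi : Function.Injective i.lin)
    (he : ∀ x, f.lin x = 0 → x ∈ LinearMap.range i.lin) : IsLimit (KernelFork.ofι i w) :=
  haveI := mono_of_injective i hi
  KernelFork.IsLimit.ofι' i w fun {W} k hk =>
    have h := exists_lift k i hi fun x => he _ (by
      have := congrArg (fun g : W ⟶ N => g.lin x) hk
      simpa using this)
    ⟨h.choose, h.choose_spec⟩

/-- A surjective map with the right kernel is a categorical cokernel of `f`. -/
def isColimitOfExact {Q : GMod A} {f : M ⟶ N} (q : N ⟶ Q) (w : f ≫ q = 0)
    (hq : Function.Surjective q.lin) (hdeg : ∀ i, ∀ y ∈ Q.deg i, ∃ x ∈ N.deg i, q.lin x = y)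
    (he : ∀ x, q.lin x = 0 → x ∈ LinearMap.range f.lin) :
    IsColimit (CokernelCofork.ofπ q w) :=
  haveI : Epi q := ⟨fun g h e => by
    ext x
    obtain ⟨y, rfl⟩ := hq x
    exact congrArg (fun k => Hom.lin k y) e⟩
  CokernelCofork.IsColimit.ofπ' q w fun {W} k hk => by
    have hk' : LinearMap.ker q.lin ≤ LinearMap.ker k.lin := by
      intro x hx
      obtain ⟨y, rfl⟩ := he x hx
      exact congrArg (fun g : M ⟶ W => g.lin y) hk
    let l : Q →ₗ[A] W := ((LinearMap.ker q.lin).liftQ k.lin hk').comp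
      (q.lin.quotKerEquivOfSurjective hq).symm.toLinearMap
    have hl : ∀ x, l (q.lin x) = k.lin x := by
      intro x
      have : (q.lin.quotKerEquivOfSurjective hq).symm (q.lin x) =
          (LinearMap.ker q.lin).mkQ x := by
        rw [LinearEquiv.symm_apply_eq]; rfl
      simp only [l, LinearMap.comp_apply, LinearEquiv.coe_coe, this]
      simp
    refine ⟨⟨l, fun i y hy => ?_⟩, by ext x; exact hl x⟩
    obtain ⟨x, hx, rfl⟩ := hdeg i y hy
    exact (hl x).symm ▸ k.mem i x hx

instance : HasKernels (GMod A) where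
  has_limit {M N} f := ⟨⟨_, isLimitOfExact (M.subι _ (ker_homogeneous f))
    (kernel_w f) (Subtype.val_injective) (fun x hx => ⟨⟨x, hx⟩, rfl⟩)⟩⟩

lemma cokernel_w (f : M ⟶ N) : f ≫ N.quotπ _ (range_homogeneous f) = 0 := by
  ext x
  exact (Submodule.Quotient.mk_eq_zero _).2 ⟨x, rfl⟩

/-- The explicit cokernel. -/
def isColimitQuot (f : M ⟶ N) :
    IsColimit (CokernelCofork.ofπ (N.quotπ _ (range_homogeneous f)) (cokernel_w f)) :=
  isColimitOfExact _ _ (Submodule.mkQ_surjective _) (fun _ _ h => h)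
    (fun _ h => (Submodule.Quotient.mk_eq_zero _).1 h)

instance : HasCokernels (GMod A) where
  has_colimit f := ⟨⟨_, isColimitQuot f⟩⟩

/-- The direct sum of two graded modules. -/
def prod (M N : GMod A) : GMod A where
  carrier := M × N
  deg i := (M.deg i).prod (N.deg i)
  smul_mem ha hx := ⟨M.smul_mem ha hx.1, N.smul_mem ha hx.2⟩
  isInternal := by
    apply internal_of_indep
    · rintro ⟨x, y⟩
      have h1 : ((x, 0) : M × N) ∈ ⨆ i, (M.deg i).prod (N.deg i) :=
        internal_induction M.isInternal (P := fun x => ((x, 0) : M × N) ∈ _) x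
          (fun i y hy => AddSubgroup.mem_iSup_of_mem i ⟨hy, zero_mem _⟩)
          (fun y z hy hz => by simpa using add_mem hy hz)
      have h2 : ((0, y) : M × N) ∈ ⨆ i, (M.deg i).prod (N.deg i) :=
        internal_induction N.isInternal (P := fun x => ((0, x) : M × N) ∈ _) y
          (fun i y hy => AddSubgroup.mem_iSup_of_mem i ⟨zero_mem _, hy⟩)
          (fun y z hy hz => by simpa using add_mem hy hz)
      simpa using add_mem h1 h2
    · intro c hc h0
      have e1 : c.mapRange Prod.fst rfl = 0 := by
        apply internal_indep M.isInternal _ (fun i => (hc i).1)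
        rw [Finsupp.sum_mapRange_index (fun _ => rfl)]
        have := congrArg Prod.fst h0
        simpa [Finsupp.sum, Prod.fst_sum] using this
      have e2 : c.mapRange Prod.snd rfl = 0 := by
        apply internal_indep N.isInternal _ (fun i => (hc i).2)
        rw [Finsupp.sum_mapRange_index (fun _ => rfl)]
        have := congrArg Prod.snd h0
        simpa [Finsupp.sum, Prod.snd_sum] using this
      ext i
      · simpa using DFunLike.congr_fun e1 i
      · simpa using DFunLike.congr_fun e2 i

instance : HasBinaryBiproducts (GMod A) where
  has_binary_biproduct M N := HasBinaryBiproduct.mk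
    { bicone :=
        { pt := prod M N
          fst := ⟨LinearMap.fst A M N, fun _ _ h => h.1⟩
          snd := ⟨LinearMap.snd A M N, fun _ _ h => h.2⟩
          inl := ⟨LinearMap.inl A M N, fun _ _ h => ⟨h, zero_mem _⟩⟩
          inr := ⟨LinearMap.inr A M N, fun _ _ h => ⟨zero_mem _, h⟩⟩
          inl_fst := by ext x; rfl
          inl_snd := by ext x; rfl
          inr_fst := by ext x; rfl
          inr_snd := by ext x; rfl }
      isBilimit := isBinaryBilimitOfTotal _ (by
        ext x
        obtain ⟨a, b⟩ := x
        exact Prod.ext (add_zero a) (zero_add b)) }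

/-- The zero graded module. -/
def zero (A : GRing) : GMod A where
  carrier := PUnit
  deg _ := ⊤
  smul_mem _ _ := trivial
  isInternal := internal_of_indep (fun x => by rw [Subsingleton.elim x 0]; exact zero_mem _)
    (fun c _ _ => by ext)

instance : HasZeroObject (GMod A) :=
  ⟨⟨zero A, (IsZero.iff_id_eq_zero _).2 (by ext; rfl)⟩⟩

instance : HasFiniteProducts (GMod A) :=
  haveI : HasTerminal (GMod A) := HasZeroObject.hasTerminal
  hasFiniteProducts_of_has_binary_and_terminal

lemma injective_of_mono (f : M ⟶ N) [Mono f] : Function.Injective f.lin := by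
  rw [← LinearMap.ker_eq_bot]
  have h : M.subι _ (ker_homogeneous f) = 0 := by
    rw [← cancel_mono f, kernel_w, zero_comp]
  rw [eq_bot_iff]
  intro x hx
  exact congrArg (fun g => Hom.lin g (⟨x, hx⟩ : LinearMap.ker f.lin)) h

lemma surjective_of_epi (f : M ⟶ N) [Epi f] : Function.Surjective f.lin := by
  rw [← LinearMap.range_eq_top]
  have h : N.quotπ _ (range_homogeneous f) = 0 := by
    rw [← cancel_epi f, cokernel_w, comp_zero]
  rw [eq_top_iff]
  intro x _
  have : (LinearMap.range f.lin).mkQ x = 0 := congrArg (fun g => Hom.lin g x) h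
  simpa using this

lemma exists_deg_of_surjective (f : M ⟶ N) (hf : Function.Surjective f.lin) (i : ℤ) (y : N)
    (hy : y ∈ N.deg i) : ∃ x ∈ M.deg i, f.lin x = y := by
  obtain ⟨x, rfl⟩ := hf y
  refine ⟨M.cmp x i, comp_mem _ _ _, ?_⟩
  rw [← cmp_hom, cmp, comp_of_mem _ hy]; simp

instance : Abelian (GMod A) where
  normalMonoOfMono {M N} f _ := ⟨
    { Z := _, g := _, w := cokernel_w f
      isLimit := isLimitOfExact f _ (injective_of_mono f)
        (fun _ h => (Submodule.Quotient.mk_eq_zero _).1 h) }⟩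
  normalEpiOfEpi {M N} f _ := ⟨
    { W := _, g := M.subι _ (ker_homogeneous f), w := kernel_w f
      isColimit := isColimitOfExact f _ (surjective_of_epi f)
        (exists_deg_of_surjective f (surjective_of_epi f)) (fun x hx => ⟨⟨x, hx⟩, rfl⟩) }⟩

/-- An additive functor preserves finite limits if it sends kernels to kernels, elementwise. -/
lemma preservesFiniteLimits_of_exact {B : GRing} (F : GMod A ⥤ GMod B) [F.Additive]
    (h : ∀ {K M N : GMod A} (i : K ⟶ M) (f : M ⟶ N), Function.Injective i.lin →
      (∀ x, f.lin x = 0 ↔ x ∈ LinearMap.range i.lin) →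
      Function.Injective (F.map i).lin ∧
        ∀ x, (F.map f).lin x = 0 → x ∈ LinearMap.range (F.map i).lin) :
    PreservesFiniteLimits F := by
  have : ∀ {M N : GMod A} (f : M ⟶ N), PreservesLimit (parallelPair f 0) F := by
    intro M N f
    have hx := h (M.subι _ (ker_homogeneous f)) f Subtype.val_injective
      (fun x => ⟨fun hx => ⟨⟨x, hx⟩, rfl⟩, by rintro ⟨y, rfl⟩; exact Subtype.property y⟩)
    refine preservesLimit_of_preserves_limit_cone
      (isLimitOfExact (M.subι _ (ker_homogeneous f)) (kernel_w f)
        (Subtype.val_injective) (fun x hx => ⟨⟨x, hx⟩, rfl⟩)) ?_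
    refine (KernelFork.isLimitMapConeEquiv (KernelFork.ofι _ (kernel_w f)) F).symm ?_
    refine isLimitOfExact _ ?_ hx.1 hx.2
    rw [← F.map_comp]
    change F.map (M.subι _ (ker_homogeneous f) ≫ f) = 0
    rw [kernel_w, F.map_zero]
  exact F.preservesFiniteLimits_of_preservesKernels

end GMod

/-! ## Enough injective graded modules -/

section Cofree

variable (A : GRing) (N : ModuleCat.{0} A)

/-- The group `⨁_{i ∈ ℤ} N`, with the action of `A` in which a homogeneous element of degree `i`
also shifts the index by `i`; this is the cofree graded module on `N`. -/
def Cof : Type := ℤ →₀ N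

namespace Cof

instance : AddCommGroup (Cof A N) := inferInstanceAs (AddCommGroup (ℤ →₀ N))

/-- The inclusion of a summand. -/
def single (i : ℤ) : N →+ Cof A N := Finsupp.singleAddHom i

variable {A N}

/-- Maps out of the direct sum. -/
def lift {X : Type} [AddCommGroup X] (f : ℤ → N →+ X) : Cof A N →+ X := Finsupp.liftAddHom f

@[simp] lemma lift_single {X : Type} [AddCommGroup X] (f : ℤ → N →+ X) (i : ℤ) (n : N) :
    lift (A := A) f (single A N i n) = f i n := Finsupp.liftAddHom_apply_single f i n

@[elab_as_elim]
lemma induction {P : Cof A N → Prop} (x : Cof A N)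
    (h : ∀ j n, P (single A N j n)) (add : ∀ y z, P y → P z → P (y + z)) : P x :=
  Finsupp.induction_linear (motive := P) x
    (by have := h 0 0; rw [map_zero] at this; exact this) add h

variable (A N)

/-- The action of `A` on the cofree graded module. -/
def act : A →+ Cof A N →+ Cof A N :=
  (Finsupp.liftAddHom fun i : ℤ => AddMonoidHom.mk' (fun a : A =>
      lift fun j => (single A N (i + j)).comp (DistribSMul.toAddMonoidHom N a)) (by
        intro a b; ext x
        induction x using induction with
        | h j n => simp [add_smul]
        | add y z hy hz => rw [map_add, map_add, hy, hz])).comp (comp A.isInternal)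

variable {A N}

lemma act_single {i : ℤ} {a : A} (ha : a ∈ A.deg i) (j : ℤ) (n : N) :
    act A N a (single A N j n) = single A N (i + j) (a • n) := by
  simp [act, comp_of_mem _ ha]

instance : Module A (Cof A N) where
  smul a x := act A N a x
  smul_zero a := map_zero (act A N a)
  smul_add a := map_add (act A N a)
  zero_smul x := congrArg (fun f : Cof A N →+ Cof A N => f x) (map_zero (act A N))
  add_smul a b x := congrArg (fun f : Cof A N →+ Cof A N => f x) (map_add (act A N) a b)
  one_smul x := by
    change act A N 1 x = x
    induction x using induction with
    | h j n => rw [act_single A.one_mem]; simp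
    | add y z hy hz =>
      rw [map_add, hy, hz]
  mul_smul a b x := by
    change act A N (a * b) x = act A N a (act A N b x)
    induction x using induction with
    | h j n =>
      refine internal_induction A.isInternal (P := fun a => act A N (a * b) _ =
        act A N a (act A N b _)) a ?_ ?_
      · intro k a ha
        refine internal_induction A.isInternal (P := fun b => act A N (a * b) _ =
          act A N a (act A N b _)) b ?_ ?_
        · intro l b hb
          rw [act_single (A.mul_mem ha hb), act_single hb, act_single ha, mul_smul,
            add_assoc]
        · intro b b' h h'
          rw [mul_add, map_add, map_add, AddMonoidHom.add_apply, AddMonoidHom.add_apply, map_add,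
            h, h']
      · intro a a' h h'
        rw [add_mul, map_add, map_add, AddMonoidHom.add_apply, AddMonoidHom.add_apply, h, h']
    | add y z hy hz => rw [map_add, map_add, map_add, hy, hz]

lemma smul_single {i : ℤ} {a : A} (ha : a ∈ A.deg i) (j : ℤ) (n : N) :
    a • single A N j n = single A N (i + j) (a • n) := act_single ha j n

end Cof

/-- The cofree graded module. -/
def cof : GMod A where
  carrier := Cof A N
  deg i := (Cof.single A N i).range
  smul_mem := by
    rintro i j a _ ha ⟨n, rfl⟩
    exact ⟨a • n, (Cof.smul_single ha j n).symm⟩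
  isInternal := by
    apply internal_of_comp _
      (Cof.lift fun j => (Finsupp.singleAddHom j).comp (Cof.single A N j))
    · rintro i _ ⟨n, rfl⟩
      simp
    · intro x
      induction x using Cof.induction with
      | h j n => exact AddSubgroup.mem_iSup_of_mem j ⟨n, rfl⟩
      | add y z hy hz => exact add_mem hy hz

variable {A N}

/-- The sum of the components. -/
def Cof.sum : Cof A N →ₗ[A] N where
  toFun := Cof.lift fun _ => AddMonoidHom.id N
  map_add' := map_add _
  map_smul' a x := by
    induction x using Cof.induction with
    | h j n =>
      refine internal_induction A.isInternal (P := fun a =>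
        Cof.lift _ (a • Cof.single A N j n) = a • Cof.lift _ (Cof.single A N j n)) a ?_ ?_
      · intro i a ha
        rw [Cof.smul_single ha]; simp
      · intro a b h h'
        rw [add_smul, map_add, h, h', add_smul]
    | add y z hy hz =>
      rw [smul_add, map_add, hy, hz, map_add]
      exact (smul_add _ _ _).symm

/-- The sum of the components. -/
def cofSum : cof A N →ₗ[A] N := Cof.sum

lemma cofSum_single (i : ℤ) (n : N) : cofSum (Cof.single A N i n) = n :=
  Cof.lift_single _ _ _

/-- The map to the cofree graded module that corresponds to a map of ungraded modules. -/
def toCofFun {M : GMod A} (f : M →ₗ[A] N) : M →+ Cof A N :=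
  (Finsupp.liftAddHom fun i : ℤ => (Cof.single A N i).comp f.toAddMonoidHom).comp M.cmp

lemma toCofFun_of_mem {M : GMod A} (f : M →ₗ[A] N) {i : ℤ} {x : M} (hx : x ∈ M.deg i) :
    toCofFun f x = Cof.single A N i (f x) := by
  simp [toCofFun, GMod.cmp, comp_of_mem _ hx]

/-- The map to the cofree graded module that corresponds to a map of ungraded modules. -/
def toCof {M : GMod A} (f : M →ₗ[A] N) : M ⟶ cof A N where
  lin :=
    { toFun := toCofFun f
      map_add' := map_add _
      map_smul' a x := by
        change toCofFun f (a • x) = a • toCofFun f x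
        refine internal_induction A.isInternal (P := fun a => toCofFun f (a • x) = a • _) a ?_ ?_
        · intro i a ha
          refine internal_induction M.isInternal (P := fun x => toCofFun f (a • x) = a • _) x ?_ ?_
          · intro j x hx
            rw [toCofFun_of_mem f hx, toCofFun_of_mem f (M.smul_mem ha hx), Cof.smul_single ha,
              map_smul]
          · intro y z hy hz
            rw [smul_add, map_add, hy, hz, map_add, smul_add]
        · intro a b h h'
          rw [add_smul, map_add, h, h', add_smul] }
  mem i x hx := ⟨f x, (toCofFun_of_mem f hx).symm⟩

lemma toCof_of_mem {M : GMod A} (f : M →ₗ[A] N) {i : ℤ} {x : M} (hx : x ∈ M.deg i) :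
    (toCof f).lin x = Cof.single A N i (f x) := toCofFun_of_mem f hx

lemma cofSum_toCof {M : GMod A} (f : M →ₗ[A] N) (x : M) : cofSum ((toCof f).lin x) = f x := by
  refine internal_induction M.isInternal (P := fun x => cofSum ((toCof f).lin x) = f x) x ?_ ?_
  · intro i x hx
    rw [toCof_of_mem f hx, cofSum_single]
  · intro y z hy hz
    rw [map_add, map_add, hy, hz, map_add]

lemma toCof_cofSum {M : GMod A} (g : M ⟶ cof A N) : toCof (cofSum.comp g.lin) = g := by
  ext x
  refine internal_induction M.isInternal
    (P := fun x => (toCof (cofSum.comp g.lin)).lin x = g.lin x) x ?_ ?_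
  · intro i x hx
    obtain ⟨n, hn⟩ := g.mem i x hx
    rw [toCof_of_mem _ hx, LinearMap.comp_apply, ← hn, cofSum_single]
  · intro y z hy hz
    rw [map_add, hy, hz, map_add]

/-- The universal property of the cofree graded module. -/
def cofEquiv (M : GMod A) (N : ModuleCat.{0} A) :
    ((GMod.forget A).obj M ⟶ N) ≃ (M ⟶ cof A N) where
  toFun f := toCof f.hom
  invFun g := ModuleCat.ofHom (cofSum.comp g.lin)
  left_inv f := ModuleCat.hom_ext (LinearMap.ext fun x => cofSum_toCof f.hom x)
  right_inv g := toCof_cofSum g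

instance : (GMod.forget A).IsLeftAdjoint :=
  (Adjunction.adjunctionOfEquivRight (F := GMod.forget A) cofEquiv (by
    intro X' X Y f g
    rw [← Equiv.eq_symm_apply]
    apply ModuleCat.hom_ext
    ext x
    exact (cofSum_toCof g.hom (f.lin x)).symm)).isLeftAdjoint

instance : EnoughInjectives (GMod A) := by
  have : (GMod.forget A).PreservesMonomorphisms := ⟨fun f _ =>
    (ModuleCat.mono_iff_injective _).2 (GMod.injective_of_mono f)⟩
  exact EnoughInjectives.of_adjunction (Adjunction.ofIsLeftAdjoint (GMod.forget A))

end Cofree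

/-! ## Restriction and extension of scalars for graded modules -/

/-- The ring `B`, viewed as an algebra over `A` through `f`. -/
def Tw {A B : GRing} (_ : A.Hom B) : Type := B

section

variable {A B : GRing} (f : A.Hom B)

instance : CommRing (Tw f) := inferInstanceAs (CommRing B)
instance : Algebra A (Tw f) := RingHom.toAlgebra (S := Tw f) f.hom

/-- The underlying group of the extension of scalars `B ⊗_A M`. -/
def Ten (M : GMod A) : Type := TensorProduct A (Tw f) M

instance (M : GMod A) : AddCommGroup (Ten f M) :=
  inferInstanceAs (AddCommGroup (TensorProduct A (Tw f) M))

/-- Pure tensors. -/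
def tm {M : GMod A} (b : B) (m : M) : Ten f M := TensorProduct.tmul A (show Tw f from b) m

variable {M N : GMod A}

lemma tm_add (b : B) (m m' : M) : tm f b (m + m') = tm f b m + tm f b m' :=
  TensorProduct.tmul_add _ _ _
lemma add_tm (b b' : B) (m : M) : tm f (b + b') m = tm f b m + tm f b' m :=
  TensorProduct.add_tmul _ _ _
lemma zero_tm (m : M) : tm f 0 m = 0 := TensorProduct.zero_tmul _ _
lemma tm_zero (b : B) : tm f b (0 : M) = 0 := TensorProduct.tmul_zero _ _
lemma tm_smul (b : B) (a : A) (m : M) : tm f b (a • m) = tm f (b * f.hom a) m := by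
  refine (TensorProduct.tmul_smul _ _ _).trans ((TensorProduct.smul_tmul' _ _ _).trans ?_)
  rw [mul_comm]; rfl

@[elab_as_elim]
lemma Ten.induction {P : Ten f M → Prop} (x : Ten f M) (tm : ∀ b m, P (tm f b m))
    (add : ∀ y z, P y → P z → P (y + z)) : P x :=
  TensorProduct.induction_on (motive := P) x
    (by have := tm 0 0; rw [zero_tm] at this; exact this) tm add

/-- The universal property of the tensor product. -/
def Ten.lift {X : Type} [AddCommGroup X] (φ : B →+ M →+ X)
    (h : ∀ b a m, φ (b * f.hom a) m = φ b (a • m)) : Ten f M →+ X :=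
  TensorProduct.liftAddHom (R := A) (M := Tw f) (N := M) φ (by
    intro a b m
    exact (congrArg (fun c : B => φ c m) (mul_comm (f.hom a) b)).trans (h b a m))

@[simp] lemma Ten.lift_tm {X : Type} [AddCommGroup X] (φ : B →+ M →+ X)
    (h : ∀ b a m, φ (b * f.hom a) m = φ b (a • m)) (b : B) (m : M) :
    Ten.lift f φ h (tm f b m) = φ b m := rfl

instance : Module B (Ten f M) :=
  inferInstanceAs (Module (Tw f) (TensorProduct A (Tw f) M))

lemma smul_tm (b b' : B) (m : M) : b • tm f b' m = tm f (b * b') m := rfl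

/-- The elements of degree `k` of the extension of scalars. -/
def Ten.deg (M : GMod A) (k : ℤ) : AddSubgroup (Ten f M) :=
  AddSubgroup.closure {x | ∃ i j b m, b ∈ B.deg i ∧ m ∈ M.deg j ∧ i + j = k ∧ x = tm f b m}

lemma tm_mem {i j : ℤ} {b : B} {m : M} (hb : b ∈ B.deg i) (hm : m ∈ M.deg j) :
    tm f b m ∈ Ten.deg f M (i + j) :=
  AddSubgroup.subset_closure ⟨i, j, b, m, hb, hm, rfl, rfl⟩

lemma Ten.deg_induction {k : ℤ} {X : Type} [AddCommGroup X] (S : AddSubgroup X)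
    (φ : Ten f M →+ X)
    (h : ∀ i j b m, b ∈ B.deg i → m ∈ M.deg j → i + j = k → φ (tm f b m) ∈ S)
    (x : Ten f M) (hx : x ∈ Ten.deg f M k) : φ x ∈ S := by
  have : Ten.deg f M k ≤ S.comap φ := by
    rw [Ten.deg, AddSubgroup.closure_le]
    rintro _ ⟨i, j, b, m, hb, hm, hk, rfl⟩
    exact h i j b m hb hm hk
  exact this hx

/-- The decomposition of a tensor whose first factor is homogeneous. -/
def Ten.compAux₁ (M : GMod A) (i : ℤ) (b : B) : M →+ (ℤ →₀ Ten f M) :=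
  (Finsupp.liftAddHom fun j : ℤ => (Finsupp.singleAddHom (i + j)).comp
    (AddMonoidHom.mk' (fun m : M => tm f b m) (tm_add f b))).comp M.cmp

lemma Ten.compAux₁_of_mem {i j : ℤ} (b : B) {m : M} (hm : m ∈ M.deg j) :
    Ten.compAux₁ f M i b m = Finsupp.single (i + j) (tm f b m) := by
  simp only [Ten.compAux₁, GMod.cmp, AddMonoidHom.comp_apply, comp_of_mem _ hm]
  exact (Finsupp.liftAddHom_apply_single _ _ _)

/-- The decomposition of a tensor into homogeneous components. -/
def Ten.compAux (M : GMod A) : B →+ M →+ (ℤ →₀ Ten f M) :=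
  (Finsupp.liftAddHom fun i : ℤ => AddMonoidHom.mk' (fun b : B => Ten.compAux₁ f M i b) (by
        intro b b'
        refine AddMonoidHom.ext fun m => ?_
        refine internal_induction M.isInternal (P := fun m => Ten.compAux₁ f M i (b + b') m =
          (Ten.compAux₁ f M i b + Ten.compAux₁ f M i b') m) m ?_ ?_
        · intro j m hm
          simp [Ten.compAux₁_of_mem f _ hm, add_tm]
        · intro y z hy hz
          rw [map_add, hy, hz, map_add])).comp (comp B.isInternal)

lemma Ten.compAux_of_mem {i j : ℤ} {b : B} {m : M} (hb : b ∈ B.deg i) (hm : m ∈ M.deg j) :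
    Ten.compAux f M b m = Finsupp.single (i + j) (tm f b m) := by
  rw [← Ten.compAux₁_of_mem f b hm, Ten.compAux, AddMonoidHom.comp_apply, comp_of_mem _ hb,
    Finsupp.liftAddHom_apply_single]
  rfl

lemma Ten.compAux_smul (b : B) (a : A) (m : M) :
    Ten.compAux f M (b * f.hom a) m = Ten.compAux f M b (a • m) := by
  refine internal_induction A.isInternal
    (P := fun a => Ten.compAux f M (b * f.hom a) m = Ten.compAux f M b (a • m)) a ?_ ?_
  · intro i a ha
    refine internal_induction B.isInternal
      (P := fun b => Ten.compAux f M (b * f.hom a) m = Ten.compAux f M b (a • m)) b ?_ ?_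
    · intro j b hb
      refine internal_induction M.isInternal
        (P := fun m => Ten.compAux f M (b * f.hom a) m = Ten.compAux f M b (a • m)) m ?_ ?_
      · intro k m hm
        rw [compAux_of_mem f (B.mul_mem hb (f.mem i a ha)) hm,
          compAux_of_mem f hb (M.smul_mem ha hm), tm_smul, add_assoc]
      · intro y z hy hz
        rw [map_add, hy, hz, smul_add, map_add]
    · intro y z hy hz
      rw [add_mul, map_add, map_add, AddMonoidHom.add_apply, AddMonoidHom.add_apply, hy, hz]
  · intro y z hy hz
    rw [map_add, mul_add, map_add, AddMonoidHom.add_apply, hy, hz, add_smul, map_add]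

/-- Extension of scalars `B ⊗_A M`, with the total grading. -/
def extObj (M : GMod A) : GMod B where
  carrier := Ten f M
  deg := Ten.deg f M
  smul_mem {i j b x} hb hx := by
    refine Ten.deg_induction f (Ten.deg f M (i + j))
      (DistribSMul.toAddMonoidHom (Ten f M) b) ?_ x hx
    rintro k l b' m hb' hm rfl
    rw [← add_assoc]
    exact tm_mem f (B.mul_mem hb hb') hm
  isInternal := by
    apply internal_of_comp _ (Ten.lift f (Ten.compAux f M) (Ten.compAux_smul f))
    · intro i x hx
      have h : (Ten.lift f (Ten.compAux f M) (Ten.compAux_smul f) -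
          (Finsupp.singleAddHom i : Ten f M →+ (ℤ →₀ Ten f M)) : Ten f M →+ (ℤ →₀ Ten f M)) x ∈
            (⊥ : AddSubgroup (ℤ →₀ Ten f M)) := by
        refine Ten.deg_induction f ⊥ _ ?_ x hx
        rintro k l b m hb hm rfl
        simp [Ten.compAux_of_mem f hb hm]
      exact sub_eq_zero.1 h
    · intro x
      induction x using Ten.induction with
      | tm b m =>
        refine internal_induction B.isInternal (P := fun b => tm f b m ∈ _) b ?_ ?_
        · intro i b hb
          refine internal_induction M.isInternal (P := fun m => tm f b m ∈ _) m ?_ ?_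
          · intro j m hm
            exact AddSubgroup.mem_iSup_of_mem (i + j) (tm_mem f hb hm)
          · intro y z hy hz
            rw [tm_add]; exact add_mem hy hz
        · intro y z hy hz
          rw [add_tm]; exact add_mem hy hz
      | add y z hy hz => exact add_mem hy hz

/-- Restriction of scalars along `f`. -/
def resObj (N : GMod B) : GMod A where
  carrier := N
  module := Module.compHom N f.hom
  deg := N.deg
  smul_mem ha hx := N.smul_mem (f.mem _ _ ha) hx
  isInternal := N.isInternal

lemma res_smul (N : GMod B) (a : A) (x : N) :
    a • (show resObj f N from x) = (f.hom a • x : N) := rfl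

/-- Restriction of scalars as a functor. -/
def res : GMod B ⥤ GMod A where
  obj := resObj f
  map g := ⟨{ toFun := g.lin, map_add' := map_add g.lin,
              map_smul' := fun a x => g.lin.map_smul (f.hom a) x }, g.mem⟩

/-- An element of a restriction of scalars, as an element of the given module. -/
def unres {N : GMod B} (x : (res f).obj N) : N := x

lemma unres_smul {N : GMod B} (a : A) (x : (res f).obj N) :
    unres f (a • x) = f.hom a • unres f x := rfl

/-- The map out of `B ⊗_A M` that corresponds to a map `M → N`. -/
def extDescFun {N : GMod B} (g : M ⟶ (res f).obj N) : Ten f M →+ N :=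
  Ten.lift f (AddMonoidHom.mk' (fun b =>
    (DistribSMul.toAddMonoidHom N b).comp (AddMonoidHom.mk' (fun m => unres f (g.lin m))
      (map_add g.lin)))
      (by intro b b'; exact AddMonoidHom.ext fun m => add_smul b b' (unres f (g.lin m)))) (by
        intro b a m
        change (b * f.hom a) • unres f (g.lin m) = b • unres f (g.lin (a • m))
        rw [map_smul, mul_smul, unres_smul])

/-- The map out of `B ⊗_A M` that corresponds to a map `M → N`. -/
def extDesc {N : GMod B} (g : M ⟶ (res f).obj N) : extObj f M ⟶ N where
  lin :=
    { toFun := extDescFun f g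
      map_add' := map_add _
      map_smul' b x := by
        change extDescFun f g (show Ten f M from b • (show Ten f M from x)) =
          b • extDescFun f g (show Ten f M from x)
        induction (show Ten f M from x) using Ten.induction with
        | tm b' m => exact mul_smul b b' (unres f (g.lin m))
        | add y z hy hz => rw [smul_add, map_add, hy, hz, map_add, smul_add] }
  mem k x hx := by
    refine Ten.deg_induction f (N.deg k) (extDescFun f g) ?_ x hx
    rintro i j b m hb hm rfl
    exact N.smul_mem hb (g.mem j m hm)

lemma extDesc_tm {N : GMod B} (g : M ⟶ (res f).obj N) (b : B) (m : M) :
    (extDesc f g).lin (tm f b m) = b • unres f (g.lin m) := rfl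

lemma ext_hom_ext {N : GMod B} {g h : extObj f M ⟶ N}
    (e : ∀ b m, g.lin (tm f b m) = h.lin (tm f b m)) : g = h := by
  ext x
  induction x using Ten.induction with
  | tm b m => exact e b m
  | add y z hy hz => exact (map_add g.lin y z).trans ((congrArg₂ _ hy hz).trans
      (map_add h.lin y z).symm)

/-- The unit `M → B ⊗_A M`. -/
def extUnit (M : GMod A) : M ⟶ (res f).obj (extObj f M) where
  lin :=
    { toFun := tm f 1
      map_add' := tm_add f 1
      map_smul' a m := by
        rw [tm_smul, one_mul]
        exact ((smul_tm f (f.hom a) 1 m).trans (by rw [mul_one])).symm }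
  mem i m hm := by
    have := tm_mem f B.one_mem hm
    rwa [zero_add] at this

lemma extUnit_apply (m : M) : (extUnit f M).lin m = tm f 1 m := rfl

/-- Extension of scalars as a functor. -/
def ext : GMod A ⥤ GMod B where
  obj := extObj f
  map {M N} g := extDesc f (g ≫ extUnit f N)
  map_id M := ext_hom_ext f fun b m => by
    refine (extDesc_tm f _ b m).trans ((smul_tm f b 1 m).trans ?_)
    rw [mul_one]; rfl
  map_comp {M N P} g h := ext_hom_ext f fun b m => by
    refine (extDesc_tm f _ b m).trans ((smul_tm f b 1 _).trans ?_)
    symm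
    refine (congrArg (extDesc f (h ≫ extUnit f P)).lin
      ((extDesc_tm f (g ≫ extUnit f N) b m).trans (smul_tm f b 1 _))).trans ?_
    rw [mul_one]
    refine (extDesc_tm f _ b _).trans ((smul_tm f b 1 _).trans ?_)
    rw [mul_one]; rfl

lemma ext_map_tm (g : M ⟶ N) (b : B) (m : M) :
    ((ext f).map g).lin (tm f b m) = tm f b (g.lin m) := by
  refine (extDesc_tm f _ b m).trans ((smul_tm f b 1 _).trans ?_)
  rw [mul_one]

lemma res_map_apply {X Y : GMod B} (g : X ⟶ Y) (x : X) : ((res f).map g).lin x = g.lin x := rfl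

/-- Extension of scalars is left adjoint to restriction. -/
def extRes : ext f ⊣ res f := Adjunction.mkOfHomEquiv
  { homEquiv M N :=
      { toFun g := extUnit f M ≫ (res f).map g
        invFun g := extDesc f g
        left_inv g := ext_hom_ext f fun b m => by
          refine (extDesc_tm f _ b m).trans ((g.lin.map_smul b (tm f 1 m)).symm.trans ?_)
          exact congrArg g.lin ((smul_tm f b 1 m).trans (by rw [mul_one]))
        right_inv g := by
          ext m
          exact (extDesc_tm f g 1 m).trans (one_smul B (unres f (g.lin m))) }
    homEquiv_naturality_left_symm {M M' N} g h := ext_hom_ext f fun b m => by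
      symm
      exact (congrArg (extDesc f h).lin (ext_map_tm f g b m)).trans rfl
    homEquiv_naturality_right _ _ := rfl }

instance : (ext f).Additive where
  map_add {M N g h} := ext_hom_ext f fun b m => by
    refine (ext_map_tm f (g + h) b m).trans ((tm_add f b _ _).trans ?_)
    exact congrArg₂ _ (ext_map_tm f g b m).symm (ext_map_tm f h b m).symm

instance : (res f).Additive where

end

/-! ## Graded polynomial rings -/

/-- Composition of degree-preserving ring homomorphisms. -/
def GRing.Hom.comp {A B C : GRing} (g : B.Hom C) (f : A.Hom B) : A.Hom C :=
  ⟨g.hom.comp f.hom, fun i a h => g.mem i _ (f.mem i a h)⟩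

lemma GRing.pow_mem (A : GRing) {i : ℤ} {a : A} (h : a ∈ A.deg i) (n : ℕ) :
    a ^ n ∈ A.deg (n * i) := by
  induction n with
  | zero => simpa using A.one_mem
  | succ n ih =>
    have := A.mul_mem ih h
    rw [pow_succ]
    convert this using 1
    push_cast; ring_nf

section Poly

variable {ι : Type} (w : ι → ℤ) (R : GRing)

/-- The polynomial ring `R[x_i : i ∈ ι]`, where `x_i` has degree `w i`. -/
def poly : GRing where
  carrier := MvPolynomial ι R
  deg k :=
    { carrier := {q | ∀ E, q.coeff E ∈ R.deg (k - Finsupp.weight w E)}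
      zero_mem' := fun E => by simp [zero_mem]
      add_mem' := fun ha hb E => by rw [MvPolynomial.coeff_add]; exact add_mem (ha E) (hb E)
      neg_mem' := fun ha E => by rw [MvPolynomial.coeff_neg]; exact neg_mem (ha E) }
  one_mem E := by
    classical
    rw [MvPolynomial.coeff_one]
    split_ifs with h
    · rw [← h]; simpa using R.one_mem
    · exact zero_mem _
  mul_mem {i j a b} ha hb E := by
    classical
    rw [MvPolynomial.coeff_mul]
    refine sum_mem fun x hx => ?_
    have := R.mul_mem (ha x.1) (hb x.2)
    rw [Finset.HasAntidiagonal.mem_antidiagonal] at hx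
    rw [← hx, map_add]
    convert this using 1
    ring_nf
  isInternal := by
    classical
    apply internal_of_indep
    · intro q
      induction q using MvPolynomial.induction_on' with
      | monomial E r =>
        refine internal_induction R.isInternal (P := fun r => MvPolynomial.monomial E r ∈ _) r ?_ ?_
        · intro i r hr
          refine AddSubgroup.mem_iSup_of_mem (i + Finsupp.weight w E) ?_
          intro F
          rw [MvPolynomial.coeff_monomial]
          split_ifs with h
          · rw [← h]; simpa using hr
          · exact zero_mem _
        · intro y z hy hz
          rw [map_add]; exact add_mem hy hz
      | add p q hp hq => exact add_mem hp hq
    · intro c hc h0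
      ext i E
      have : Finsupp.equivMapDomain (Equiv.subRight (Finsupp.weight w E))
          (c.mapRange (MvPolynomial.coeff E) (MvPolynomial.coeff_zero E)) = 0 := by
        apply internal_indep R.isInternal
        · intro j
          have := hc (j + Finsupp.weight w E) E
          simpa using this
        · rw [Finsupp.sum_equivMapDomain, Finsupp.sum_mapRange_index (fun _ => rfl)]
          have := congrArg (MvPolynomial.coeff E) h0
          simpa [Finsupp.sum, MvPolynomial.coeff_sum] using this
      have := DFunLike.congr_fun this (i - Finsupp.weight w E)
      simpa using this

lemma poly_mem {k : ℤ} {q : MvPolynomial ι R} :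
    q ∈ (poly w R).deg k ↔ ∀ E, q.coeff E ∈ R.deg (k - Finsupp.weight w E) := Iff.rfl

lemma polyC_mem {i : ℤ} {r : R} (h : r ∈ R.deg i) : MvPolynomial.C r ∈ (poly w R).deg i := by
  classical
  intro E
  rw [MvPolynomial.coeff_C]
  split_ifs with h'
  · rw [← h']; simpa using h
  · exact zero_mem _

lemma polyX_mem (n : ι) : MvPolynomial.X n ∈ (poly w R).deg (w n) := by
  classical
  intro E
  rw [MvPolynomial.coeff_X]
  split_ifs with h'
  · rw [← h']; simpa [Finsupp.weight_apply] using R.one_mem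
  · exact zero_mem _

/-- The inclusion of the constants. -/
def polyC : R.Hom (poly w R) := ⟨MvPolynomial.C, fun _ _ => polyC_mem w R⟩

variable {R}

/-- A homomorphism out of a graded polynomial ring is degree-preserving if it is so on constants
and variables. -/
def polyHom {S : GRing} (g : MvPolynomial ι R →+* S)
    (hC : ∀ i, ∀ r ∈ R.deg i, g (MvPolynomial.C r) ∈ S.deg i)
    (hX : ∀ n, g (MvPolynomial.X n) ∈ S.deg (w n)) : (poly w R).Hom S where
  hom := g
  mem k q hq := by
    have h1 : ∀ E : ι →₀ ℕ, g (MvPolynomial.monomial E 1) ∈ S.deg (Finsupp.weight w E) := by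
      intro E
      induction E using Finsupp.induction_linear with
      | zero =>
        have : MvPolynomial.monomial (0 : ι →₀ ℕ) (1 : R) = 1 := rfl
        rw [this, map_one, map_zero]; exact S.one_mem
      | add E F hE hF =>
        have : MvPolynomial.monomial (E + F) (1 : R) =
            MvPolynomial.monomial E 1 * MvPolynomial.monomial F 1 := by
          rw [MvPolynomial.monomial_mul, one_mul]
        rw [this, map_mul, map_add]; exact S.mul_mem hE hF
      | single n e =>
        rw [← MvPolynomial.X_pow_eq_monomial, map_pow]
        have := S.pow_mem (hX n) e
        simpa [Finsupp.weight_apply] using this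
    change g (show MvPolynomial ι R from q) ∈ _
    rw [MvPolynomial.as_sum (show MvPolynomial ι R from q), map_sum]
    refine sum_mem fun E _ => ?_
    have h2 : ∀ r : R, MvPolynomial.monomial E r =
        MvPolynomial.C r * MvPolynomial.monomial E 1 := fun r => by
      rw [MvPolynomial.C_mul_monomial, mul_one]
    rw [h2, map_mul]
    have := S.mul_mem (hC _ _ (hq E)) (h1 E)
    simpa using this

/-- The map on polynomial rings induced by a map of coefficient rings. -/
def polyMap {S : GRing} (f : R.Hom S) : (poly w R).Hom (poly w S) :=
  polyHom w (MvPolynomial.map f.hom)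
    (fun i r hr => (MvPolynomial.map_C f.hom r).symm ▸ polyC_mem w S (f.mem i r hr))
    (fun n => (MvPolynomial.map_X f.hom n).symm ▸ polyX_mem w S n)

variable (R) in
/-- Monomials. -/
def polyMono (E : ι →₀ ℕ) : R →+ poly w R :=
  (MvPolynomial.monomial E : R →ₗ[R] MvPolynomial ι R).toAddMonoidHom

@[elab_as_elim]
lemma poly_induction {P : poly w R → Prop} (q : poly w R) (mono : ∀ E r, P (polyMono w R E r))
    (add : ∀ y z, P y → P z → P (y + z)) : P q :=
  MvPolynomial.induction_on' (show MvPolynomial ι R from q) mono add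

lemma polyMono_mul_C (E : ι →₀ ℕ) (r s : R) :
    polyMono w R E r * (polyC w R).hom s = polyMono w R E (r * s) := by
  rw [mul_comm, mul_comm r]; exact MvPolynomial.C_mul_monomial

lemma polyMap_mono {S : GRing} (f : R.Hom S) (E : ι →₀ ℕ) (r : R) :
    (polyMap w f).hom (polyMono w R E r) = polyMono w S E (f.hom r) :=
  MvPolynomial.map_monomial _ _ _

end Poly

/-! ## Base change of polynomial rings -/

/-- Restrictions of scalars along equal maps agree. -/
def resChange {A B : GRing} {f g : A.Hom B} (h : ∀ a, f.hom a = g.hom a) (X : GMod B) :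
    (res f).obj X ⟶ (res g).obj X where
  lin :=
    { toFun x := x
      map_add' _ _ := rfl
      map_smul' a x := by
        change f.hom a • unres f x = g.hom a • unres f x
        rw [h] }
  mem _ _ hx := hx

/-- For `f : A → B` and `g : B → C` with composite `k`, the canonical map
`B ⊗_A M → C ⊗_A M`. -/
def extChange {A B C : GRing} (f : A.Hom B) (g : B.Hom C) (k : A.Hom C)
    (h : ∀ a, k.hom a = g.hom (f.hom a)) (M : GMod A) :
    (ext f).obj M ⟶ (res g).obj ((ext k).obj M) :=
  extDesc f (N := (res g).obj ((ext k).obj M))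
    (extUnit k M ≫ resChange (g := g.comp f) h ((ext k).obj M))

lemma extChange_tm {A B C : GRing} (f : A.Hom B) (g : B.Hom C) (k : A.Hom C)
    (h : ∀ a, k.hom a = g.hom (f.hom a)) {M : GMod A} (b : B) (m : M) :
    (extChange f g k h M).lin (tm f b m) = tm k (g.hom b) m := by
  refine (extDesc_tm f (N := (res g).obj ((ext k).obj M)) _ b m).trans ?_
  refine (smul_tm k (g.hom b) 1 m).trans ?_
  rw [mul_one]

section Beta

variable {ι : Type} (w : ι → ℤ) {A₀ A B : GRing} (f : A.Hom B) (g : A₀.Hom B) (M : GMod A₀)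

/-- The canonical map `Q ⊗_A (B ⊗_{A₀} M) → R ⊗_{A₀} M` given by compatible maps of `Q` and `B`
to `R`. -/
def asc {Q R : GRing} (k : A.Hom Q) (j : Q.Hom R) (l : B.Hom R)
    (h : ∀ a, l.hom (f.hom a) = j.hom (k.hom a)) :
    (ext k).obj ((res f).obj ((ext g).obj M)) ⟶ (res j).obj ((ext (l.comp g)).obj M) :=
  extDesc k (N := (res j).obj ((ext (l.comp g)).obj M))
    ((res f).map (extChange g l (l.comp g) (fun _ => rfl) M) ≫
      resChange (f := l.comp f) (g := j.comp k) h _)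

variable {M}

section Tmm

variable {Q : GRing} (k : A.Hom Q)

/-- Pure tensors of three factors. -/
def tmm (q : Q) (b : B) (m : M) : Ten k ((res f).obj ((ext g).obj M)) :=
  tm k (M := (res f).obj ((ext g).obj M)) q (tm g b m)

lemma tmm_add (q : Q) (b : B) (m m' : M) :
    tmm f g k q b (m + m') = tmm f g k q b m + tmm f g k q b m' :=
  (congrArg (tm k (M := (res f).obj ((ext g).obj M)) _)
        (tm_add g b m m')).trans (tm_add _ _ _ _)

lemma tmm_add' (q : Q) (b b' : B) (m : M) :
    tmm f g k q (b + b') m = tmm f g k q b m + tmm f g k q b' m :=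
  (congrArg (tm k (M := (res f).obj ((ext g).obj M)) _)
        (add_tm g b b' m)).trans (tm_add _ _ _ _)

lemma add_tmm (q q' : Q) (b : B) (m : M) :
    tmm f g k (q + q') b m = tmm f g k q b m + tmm f g k q' b m :=
  add_tm k (M := (res f).obj ((ext g).obj M)) q q' (tm g b m)

lemma tmm_smul (q : Q) (a : A) (b : B) (m : M) :
    tmm f g k q (f.hom a * b) m = tmm f g k (q * k.hom a) b m :=
  tm_smul k (M := (res f).obj ((ext g).obj M)) q a (show Ten g M from tm g b m)

@[elab_as_elim]
lemma tmm_induction {P : Ten k ((res f).obj ((ext g).obj M)) → Prop}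
    (x : Ten k ((res f).obj ((ext g).obj M)))
    (tmm : ∀ q b m, P (tmm f g k q b m)) (add : ∀ y z, P y → P z → P (y + z)) : P x := by
  induction x using Ten.induction with
  | tm q y =>
    exact Ten.induction g (P := fun y : Ten g M =>
      P (tm k (M := (res f).obj ((ext g).obj M)) q y)) y (tmm q) fun y z hy hz =>
        (tm_add k (M := (res f).obj ((ext g).obj M)) q y z).symm ▸ add _ _ hy hz
  | add y z hy hz => exact add y z hy hz

lemma asc_tm {R : GRing} (j : Q.Hom R) (l : B.Hom R)
    (h : ∀ a, l.hom (f.hom a) = j.hom (k.hom a)) (q : Q) (b : B) (m : M) :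
    (asc f g M k j l h).lin (tmm f g k q b m) =
      tm (l.comp g) (j.hom q * l.hom b) m := by
  refine (extDesc_tm k (N := (res j).obj ((ext (l.comp g)).obj M)) _ q _).trans ?_
  have := extChange_tm g l (l.comp g) (fun _ => rfl) b m
  exact (congrArg (fun x : Ten (l.comp g) M => j.hom q • x) this).trans (smul_tm _ _ _ m)

end Tmm

variable (M) in
/-- For `f : A → B` and `g : A₀ → B`, the canonical map
`A[t] ⊗_A (B ⊗_{A₀} M) → B[t] ⊗_{A₀} M`. -/
def beta : (ext (polyC w A)).obj ((res f).obj ((ext g).obj M)) ⟶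
    (res (polyMap w f)).obj ((ext ((polyC w B).comp g)).obj M) :=
  asc f g M (polyC w A) (polyMap w f) (polyC w B) (fun a => (MvPolynomial.map_C f.hom a).symm)

lemma beta_tm (q : poly w A) (b : B) (m : M) :
    (beta w f g M).lin (tmm f g (polyC w A) q b m) =
      tm ((polyC w B).comp g) ((polyMap w f).hom q * (polyC w B).hom b) m :=
  asc_tm ..

variable (M) in
/-- `beta` as a homomorphism of groups. -/
def betaFun : Ten (polyC w A) ((res f).obj ((ext g).obj M)) →+ Ten ((polyC w B).comp g) M :=
  (beta w f g M).lin.toAddMonoidHom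

lemma betaFun_tm (q : poly w A) (b : B) (m : M) :
    betaFun w f g M (tmm f g (polyC w A) q b m) =
      tm ((polyC w B).comp g) ((polyMap w f).hom q * (polyC w B).hom b) m := beta_tm w f g q b m

variable (M) in
/-- The inverse of `beta`, as a bilinear map. -/
def betaInvAux : poly w B →+ M →+ Ten (polyC w A) ((res f).obj ((ext g).obj M)) :=
  (Finsupp.liftAddHom fun E : ι →₀ ℕ => AddMonoidHom.mk' (fun b : B =>
    AddMonoidHom.mk' (fun m : M => tmm f g (polyC w A) (polyMono w A E 1) b m) (tmm_add f g (polyC w A) _ b))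
      (fun b b' => AddMonoidHom.ext fun m => tmm_add' f g (polyC w A) _ b b' m)).comp
        (AddMonoidAlgebra.coeffAddEquiv : MvPolynomial ι B ≃+ _).toAddMonoidHom

lemma betaInvAux_monomial (E : ι →₀ ℕ) (b : B) (m : M) :
    betaInvAux w f g M (polyMono w B E b) m = tmm f g (polyC w A) (polyMono w A E 1) b m :=
  congrArg (fun k : M →+ Ten (polyC w A) ((res f).obj ((ext g).obj M)) => k m)
    (Finsupp.liftAddHom_apply_single _ E b)

variable (M) in
/-- The inverse of `beta`. -/
def betaInv : Ten ((polyC w B).comp g) M →+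
    Ten (polyC w A) ((res f).obj ((ext g).obj M)) :=
  Ten.lift _ (betaInvAux w f g M) (by
      intro q a m
      change betaInvAux w f g M (q * (polyC w B).hom (g.hom a)) m = _
      induction q using poly_induction with
      | mono E b =>
        rw [polyMono_mul_C, betaInvAux_monomial, betaInvAux_monomial]
        exact congrArg (tm (polyC w A) (M := (res f).obj ((ext g).obj M)) _)
          (tm_smul g b a m).symm
      | add p q hp hq =>
        rw [add_mul, map_add, map_add, AddMonoidHom.add_apply, AddMonoidHom.add_apply, hp, hq])

lemma betaInv_tm (E : ι →₀ ℕ) (b : B) (m : M) :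
    betaInv w f g M (tm ((polyC w B).comp g) (polyMono w B E b) m) =
      tmm f g (polyC w A) (polyMono w A E 1) b m :=
  betaInvAux_monomial w f g E b m

lemma betaInv_betaFun (x : Ten (polyC w A) ((res f).obj ((ext g).obj M))) :
    betaInv w f g M (betaFun w f g M x) = x := by
  induction x using tmm_induction with
  | tmm q b m =>
    rw [betaFun_tm]
    induction q using poly_induction with
    | mono E a =>
      rw [polyMap_mono, polyMono_mul_C, betaInv_tm, tmm_smul, polyMono_mul_C, one_mul]
    | add p q hp hq => rw [map_add, add_mul, add_tm, map_add, hp, hq, add_tmm]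
  | add y z hy hz => rw [map_add, map_add, hy, hz]

lemma beta_injective : Function.Injective (beta w f g M).lin :=
  Function.LeftInverse.injective (betaInv_betaFun w f g)

lemma betaFun_surjective : Function.Surjective (betaFun w f g M) := by
  intro x
  change x ∈ AddMonoidHom.range _
  induction x using Ten.induction with
  | tm q m =>
    induction q using poly_induction with
    | mono E b =>
      refine ⟨tmm f g (polyC w A) (polyMono w A E 1) b m, ?_⟩
      rw [betaFun_tm, polyMap_mono, polyMono_mul_C, map_one, one_mul]
    | add p q hp hq => rw [add_tm]; exact add_mem hp hq
  | add y z hy hz => exact add_mem hy hz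

lemma beta_surjective : Function.Surjective (beta w f g M).lin := betaFun_surjective w f g

end Beta

/-! ## Comodules over a polynomial bialgebroid -/

/-- The structure maps of a Hopf algebroid `(A, Γ)` such that `Γ` is a polynomial ring `A[t]` over
its left unit. The ring `Γ ⊗_A Γ` is `Γ[t]`, where `γ ⊗ γ'` is the product of the constant `γ` with
the image of `γ'` under the right unit; `Γ ⊗_A Γ ⊗_A Γ` is `Γ[t][t]` in the same way.
The conjugation plays no role in the definition of comodules. -/
structure Bialgebroid : Type 1 where
  ι : Type
  w : ι → ℤ
  A : GRing
  etaR : A.Hom (poly w A)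
  eps : (poly w A).Hom A
  Delta : (poly w A).Hom (poly w (poly w A))
  eps_etaL : ∀ a, eps.hom ((polyC w A).hom a) = a
  eps_etaR : ∀ a, eps.hom (etaR.hom a) = a
  Delta_etaL : ∀ a, Delta.hom ((polyC w A).hom a) =
    (polyC w (poly w A)).hom ((polyC w A).hom a)
  Delta_etaR : ∀ a, Delta.hom (etaR.hom a) = (polyMap w etaR).hom (etaR.hom a)
  /-- The map `1 ⊗ ε`. -/
  oneEps : (poly w (poly w A)).Hom (poly w A)
  oneEps_left : ∀ x, oneEps.hom ((polyC w (poly w A)).hom x) = x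
  oneEps_right : ∀ x, oneEps.hom ((polyMap w etaR).hom x) = etaR.hom (eps.hom x)
  oneEps_Delta : ∀ x, oneEps.hom (Delta.hom x) = x
  epsOne_Delta : ∀ x, (polyMap w eps).hom (Delta.hom x) = x
  /-- The map `1 ⊗ Δ`. -/
  oneDelta : (poly w (poly w A)).Hom (poly w (poly w (poly w A)))
  oneDelta_left : ∀ x, oneDelta.hom ((polyC w (poly w A)).hom x) =
    (polyC w (poly w (poly w A))).hom ((polyC w (poly w A)).hom x)
  oneDelta_right : ∀ x, oneDelta.hom ((polyMap w etaR).hom x) =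
    (polyMap w (polyMap w etaR)).hom (Delta.hom x)
  coassoc : ∀ x, (polyMap w Delta).hom (Delta.hom x) = oneDelta.hom (Delta.hom x)

/-- An identity on elements, between restrictions of scalars along the identity map. -/
def resId {A : GRing} {f : A.Hom A} (h : ∀ a, f.hom a = a) (M : GMod A) : (res f).obj M ⟶ M where
  lin :=
    { toFun x := x
      map_add' _ _ := rfl
      map_smul' a x := by
        change f.hom a • unres f x = a • unres f x
        rw [h] }
  mem _ _ hx := hx

/-- The inverse of `resId`. -/
def resIdInv {A : GRing} {f : A.Hom A} (h : ∀ a, f.hom a = a) (M : GMod A) :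
    M ⟶ (res f).obj M where
  lin :=
    { toFun x := x
      map_add' _ _ := rfl
      map_smul' a x := by
        change a • (show M from x) = f.hom a • unres f x
        rw [h]; rfl }
  mem _ _ hx := hx

lemma GMod.isIso_of_bijective {A : GRing} {M N : GMod A} (f : M ⟶ N)
    (h : Function.Bijective f.lin) : IsIso f := by
  have := GMod.mono_of_injective f h.1
  have : Epi f := ⟨fun g k e => by
    ext x
    obtain ⟨y, rfl⟩ := h.2 x
    exact congrArg (fun k => GMod.Hom.lin k y) e⟩
  exact isIso_of_mono_of_epi f

lemma GMod.injective_of_isIso {A : GRing} {M N : GMod A} (f : M ⟶ N) [IsIso f] :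
    Function.Injective f.lin := GMod.injective_of_mono f

namespace Bialgebroid

variable (H : Bialgebroid)

/-- `Γ`. -/
abbrev G : GRing := poly H.w H.A
/-- `Γ ⊗_A Γ`. -/
abbrev G2 : GRing := poly H.w H.G
/-- `Γ ⊗_A Γ ⊗_A Γ`. -/
abbrev G3 : GRing := poly H.w H.G2
/-- The left unit. -/
abbrev etaL : H.A.Hom H.G := polyC H.w H.A
/-- The map `a ↦ a ⊗ 1`. -/
abbrev etaL2 : H.A.Hom H.G2 := (polyC H.w H.G).comp H.etaL
/-- The map `a ↦ a ⊗ 1 ⊗ 1`. -/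
abbrev etaL3 : H.A.Hom H.G3 := (polyC H.w H.G2).comp H.etaL2
/-- The right unit into `Γ ⊗_A Γ`. -/
abbrev etaR2 : H.A.Hom H.G2 := (polyMap H.w H.etaR).comp H.etaR
/-- The right unit into `Γ ⊗_A Γ ⊗_A Γ`. -/
abbrev etaR3 : H.A.Hom H.G3 := (polyMap H.w H.etaR2).comp H.etaR

/-- The functor `M ↦ M ⊗_A Γ`, where `A` acts on `M ⊗_A Γ` through the right unit. -/
def W : GMod H.A ⥤ GMod H.A := ext H.etaL ⋙ res H.etaR

variable (M N : GMod H.A)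

instance : H.W.Additive := inferInstanceAs (ext H.etaL ⋙ res H.etaR).Additive

/-- The element `m ⊗ γ`. -/
def t1 {M : GMod H.A} (γ : H.G) (m : M) : H.W.obj M := tm H.etaL γ m

/-- The element `m ⊗ γ ⊗ γ'`. -/
def t2 {M : GMod H.A} (γ' γ : H.G) (m : M) : H.W.obj (H.W.obj M) := tmm H.etaR H.etaL H.etaL γ' γ m

variable {M N}

@[elab_as_elim]
lemma W_ind {P : H.W.obj M → Prop} (x : H.W.obj M) (tm : ∀ γ m, P (H.t1 γ m))
    (add : ∀ y z, P y → P z → P (y + z)) : P x :=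
  Ten.induction H.etaL (P := P) x tm add

lemma W_map_t1 (f : M ⟶ N) (γ : H.G) (m : M) : (H.W.map f).lin (H.t1 γ m) = H.t1 γ (f.lin m) :=
  ext_map_tm _ _ _ _

lemma W_hom_ext {f g : H.W.obj M ⟶ N} (h : ∀ γ m, f.lin (H.t1 γ m) = g.lin (H.t1 γ m)) :
    f = g := by
  ext x
  induction x using W_ind with
  | tm γ m => exact h γ m
  | add y z hy hz => rw [map_add, map_add, hy, hz]

lemma t2_eq (γ' γ : H.G) (m : M) : H.t2 γ' γ m = H.t1 γ' (H.t1 γ m) := rfl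

@[elab_as_elim]
lemma WW_ind {P : H.W.obj (H.W.obj M) → Prop} (x : H.W.obj (H.W.obj M))
    (tm : ∀ γ' γ m, P (H.t2 γ' γ m))
    (add : ∀ y z, P y → P z → P (y + z)) : P x :=
  tmm_induction H.etaR H.etaL H.etaL (P := P) x tm add

/-- The counit `m ⊗ γ ↦ ε(γ) m`. -/
def cu (M : GMod H.A) : H.W.obj M ⟶ M :=
  (res H.etaR).map (extDesc H.etaL (N := (res H.eps).obj M)
    (resIdInv (f := H.eps.comp H.etaL) H.eps_etaL M)) ≫
    resId (f := H.eps.comp H.etaR) H.eps_etaR M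

lemma cu_t1 (γ : H.G) (m : M) : (H.cu M).lin (H.t1 γ m) = H.eps.hom γ • m := rfl

/-- The isomorphism of `(M ⊗_A Γ) ⊗_A Γ` with `M ⊗_A (Γ ⊗_A Γ)`. -/
def b2 (M : GMod H.A) : H.W.obj (H.W.obj M) ⟶ (res H.etaR2).obj ((ext H.etaL2).obj M) :=
  (res H.etaR).map (beta H.w H.etaR H.etaL M)

/-- `b2` as a group homomorphism. -/
def b2' (M : GMod H.A) : H.W.obj (H.W.obj M) →+ Ten H.etaL2 M := (H.b2 M).lin.toAddMonoidHom

lemma b2'_t2 (γ' γ : H.G) (m : M) : H.b2' M (H.t2 γ' γ m) =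
    tm H.etaL2 ((polyMap H.w H.etaR).hom γ' * (polyC H.w H.G).hom γ) m :=
  beta_tm H.w H.etaR H.etaL γ' γ m

lemma b2'_injective : Function.Injective (H.b2' M) := beta_injective H.w H.etaR H.etaL

/-- The map `m ⊗ γ ↦ m ⊗ Δ(γ)`. -/
def d2 (M : GMod H.A) : H.W.obj M ⟶ (res H.etaR2).obj ((ext H.etaL2).obj M) :=
  (res H.etaR).map (extChange H.etaL H.Delta H.etaL2 (fun a => (H.Delta_etaL a).symm) M) ≫
    resChange (f := H.Delta.comp H.etaR) (g := H.etaR2) H.Delta_etaR _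

/-- `d2` as a group homomorphism. -/
def d2' (M : GMod H.A) : H.W.obj M →+ Ten H.etaL2 M := (H.d2 M).lin.toAddMonoidHom

lemma d2'_t1 (γ : H.G) (m : M) : H.d2' M (H.t1 γ m) = tm H.etaL2 (H.Delta.hom γ) m :=
  extChange_tm H.etaL H.Delta H.etaL2 (fun a => (H.Delta_etaL a).symm) γ m

lemma exists_cm (M : GMod H.A) : ∃ g : H.W.obj M ⟶ H.W.obj (H.W.obj M), g ≫ H.b2 M = H.d2 M :=
  GMod.exists_lift _ _ (beta_injective _ _ _) fun x =>
    (beta_surjective H.w H.etaR H.etaL (show Ten H.etaL2 M from (H.d2 M).lin x))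

/-- The comultiplication `m ⊗ γ ↦ m ⊗ Δ(γ)`. -/
def cm (M : GMod H.A) : H.W.obj M ⟶ H.W.obj (H.W.obj M) := (H.exists_cm M).choose

lemma cm_spec (x : H.W.obj M) : H.b2' M ((H.cm M).lin x) = H.d2' M x :=
  congrArg (fun g => GMod.Hom.lin g x) (H.exists_cm M).choose_spec

lemma b2'_cm (γ : H.G) (m : M) :
    H.b2' M ((H.cm M).lin (H.t1 γ m)) = tm H.etaL2 (H.Delta.hom γ) m := by
  rw [cm_spec, d2'_t1]

/-- The change of rings for tensor products, as a homomorphism of groups. -/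
def chg {A B C : GRing} (f : A.Hom B) (g : B.Hom C) (k : A.Hom C)
    (h : ∀ a, k.hom a = g.hom (f.hom a)) (M : GMod A) : Ten f M →+ Ten k M :=
  (extChange f g k h M).lin.toAddMonoidHom

lemma chg_tm {A B C : GRing} (f : A.Hom B) (g : B.Hom C) (k : A.Hom C)
    (h : ∀ a, k.hom a = g.hom (f.hom a)) {M : GMod A} (b : B) (m : M) :
    chg f g k h M (tm f b m) = tm k (g.hom b) m := extChange_tm ..

lemma cu_comp (x : H.W.obj (H.W.obj M)) : (H.cu (H.W.obj M)).lin x =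
    chg H.etaL2 H.oneEps H.etaL (fun _ => (H.oneEps_left _).symm) M (H.b2' M x) := by
  induction x using WW_ind with
  | tm γ' γ m =>
    rw [b2'_t2]
    refine Eq.trans ?_ (chg_tm ..).symm
    rw [map_mul, H.oneEps_left, H.oneEps_right]
    rfl
  | add y z hy hz => rw [map_add, map_add, map_add, hy, hz]; rfl

lemma W_cu (x : H.W.obj (H.W.obj M)) : (H.W.map (H.cu M)).lin x =
    chg H.etaL2 (polyMap H.w H.eps) H.etaL (fun a => by
      refine ((MvPolynomial.map_C _ _).trans ?_).symm
      exact congrArg _ (H.eps_etaL a)) M (H.b2' M x) := by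
  induction x using WW_ind with
  | tm γ' γ m =>
    rw [b2'_t2]
    refine Eq.trans ?_ (chg_tm ..).symm
    rw [t2_eq, W_map_t1, cu_t1]
    refine (tm_smul H.etaL _ _ m).trans ?_
    congr 1
    rw [map_mul]
    congr 1
    · refine Eq.trans ?_ (MvPolynomial.map_map ..).symm
      have : H.eps.hom.comp H.etaR.hom = RingHom.id _ := RingHom.ext H.eps_etaR
      rw [this]; exact (MvPolynomial.map_id _).symm
    · exact (MvPolynomial.map_C _ _).symm
  | add y z hy hz => rw [map_add, map_add, map_add, hy, hz]; rfl

/-- The map `((M ⊗_A Γ) ⊗_A Γ) ⊗_A Γ → M ⊗_A (Γ ⊗_A Γ ⊗_A Γ)`. -/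
def b3 (M : GMod H.A) : H.W.obj (H.W.obj (H.W.obj M)) →+ Ten H.etaL3 M :=
  (betaFun H.w H.etaR2 H.etaL2 M).comp ((ext H.etaL).map (H.b2 M)).lin.toAddMonoidHom

lemma b3_t1 (γ'' : H.G) (x : H.W.obj (H.W.obj M)) : H.b3 M (H.t1 γ'' x) =
    betaFun H.w H.etaR2 H.etaL2 M (tm H.etaL (M := (res H.etaR2).obj ((ext H.etaL2).obj M)) γ''
      (H.b2' M x)) :=
  congrArg (betaFun H.w H.etaR2 H.etaL2 M) (ext_map_tm _ (H.b2 M) γ'' x)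

lemma b3_t2 (γ'' γ' γ : H.G) (m : M) : H.b3 M (H.t1 γ'' (H.t2 γ' γ m)) =
    tm H.etaL3 ((polyMap H.w H.etaR2).hom γ'' * (polyC H.w H.G2).hom
      ((polyMap H.w H.etaR).hom γ' * (polyC H.w H.G).hom γ)) m := by
  rw [b3_t1, b2'_t2]
  exact betaFun_tm ..

lemma b3_injective : Function.Injective (H.b3 M) := by
  have : IsIso (H.b2 M) := GMod.isIso_of_bijective _ ⟨beta_injective _ _ _, beta_surjective _ _ _⟩
  exact (beta_injective _ _ _).comp (GMod.injective_of_isIso ((ext H.etaL).map (H.b2 M)))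

lemma b3_W_cm (x : H.W.obj (H.W.obj M)) : H.b3 M ((H.W.map (H.cm M)).lin x) =
    chg H.etaL2 (polyMap H.w H.Delta) H.etaL3 (fun a => by
      refine ((MvPolynomial.map_C _ _).trans ?_).symm
      exact congrArg _ (H.Delta_etaL a)) M (H.b2' M x) := by
  induction x using WW_ind with
  | tm γ' γ m =>
    rw [b2'_t2]
    refine Eq.trans ?_ (chg_tm ..).symm
    rw [t2_eq, W_map_t1, b3_t1, b2'_cm]
    refine (betaFun_tm ..).trans ?_
    congr 1
    rw [map_mul]
    congr 1
    · refine Eq.trans ?_ (MvPolynomial.map_map ..).symm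
      have : H.Delta.hom.comp H.etaR.hom = H.etaR2.hom := RingHom.ext H.Delta_etaR
      rw [this]; rfl
    · exact (MvPolynomial.map_C _ _).symm
  | add y z hy hz => rw [map_add, map_add, map_add, map_add, hy, hz]

/-- The map `(M ⊗ Γ) ⊗ (Γ ⊗ Γ) → M ⊗ (Γ ⊗ Γ ⊗ Γ)`. -/
def c3 (M : GMod H.A) : Ten H.etaL2 (H.W.obj M) →+ Ten H.etaL3 M :=
  (asc H.etaR H.etaL M H.etaL2 (polyMap H.w (polyMap H.w H.etaR))
    ((polyC H.w H.G2).comp (polyC H.w H.G)) (fun a => by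
      symm
      refine (MvPolynomial.map_C _ _).trans (congrArg _ ?_)
      exact MvPolynomial.map_C _ _)).lin.toAddMonoidHom

lemma c3_tm (q : H.G2) (γ : H.G) (m : M) : H.c3 M (tm H.etaL2 q (H.t1 γ m)) =
    tm H.etaL3 ((polyMap H.w (polyMap H.w H.etaR)).hom q *
      (polyC H.w H.G2).hom ((polyC H.w H.G).hom γ)) m :=
  asc_tm H.etaR H.etaL H.etaL2 (polyMap H.w (polyMap H.w H.etaR))
    ((polyC H.w H.G2).comp (polyC H.w H.G)) _ q γ m

lemma t2_add (γ' γ : H.G) (m m' : M) :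
    H.t2 γ' γ (m + m') = H.t2 γ' γ m + H.t2 γ' γ m' := tmm_add H.etaR H.etaL H.etaL γ' γ m m'

lemma c3_aux (γ'' γ' γ : H.G) : (polyMap H.w (polyMap H.w H.etaR)).hom
      ((polyMap H.w H.etaR).hom γ'' * (polyC H.w H.G).hom γ') *
        (polyC H.w H.G2).hom ((polyC H.w H.G).hom γ) =
    (polyMap H.w H.etaR2).hom γ'' * (polyC H.w H.G2).hom
      ((polyMap H.w H.etaR).hom γ' * (polyC H.w H.G).hom γ) := by
  rw [map_mul, map_mul, mul_assoc]
  have h1 : (polyMap H.w (polyMap H.w H.etaR)).hom ((polyMap H.w H.etaR).hom γ'') =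
    (polyMap H.w H.etaR2).hom γ'' := MvPolynomial.map_map ..
  have h2 : (polyMap H.w (polyMap H.w H.etaR)).hom ((polyC H.w H.G).hom γ') =
    (polyC H.w H.G2).hom ((polyMap H.w H.etaR).hom γ') := MvPolynomial.map_C _ _
  rw [h1, h2]

lemma c3_b2_t (γ'' γ' γ : H.G) (m : M) :
    H.c3 M (H.b2' (H.W.obj M) (H.t2 γ'' γ' (H.t1 γ m))) = H.b3 M (H.t1 γ'' (H.t2 γ' γ m)) := by
  refine (congrArg (H.c3 M) (H.b2'_t2 γ'' γ' (H.t1 γ m))).trans ?_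
  refine (H.c3_tm _ γ m).trans (Eq.trans ?_ (H.b3_t2 γ'' γ' γ m).symm)
  rw [c3_aux]

lemma c3_b2_t2 (γ'' γ' : H.G) (y : H.W.obj M) :
    H.c3 M (H.b2' (H.W.obj M) (H.t2 γ'' γ' y)) = H.b3 M (H.t2 γ'' γ' y) := by
  induction y using W_ind with
  | tm γ m => exact c3_b2_t H γ'' γ' γ m
  | add y z hy hz =>
    rw [t2_add, map_add, map_add, map_add, hy, hz]

lemma c3_b2 (x : H.W.obj (H.W.obj (H.W.obj M))) : H.c3 M (H.b2' _ x) = H.b3 M x := by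
  induction x using WW_ind with
  | tm γ'' γ' y => exact c3_b2_t2 H γ'' γ' y
  | add y z hy hz => rw [map_add, map_add, map_add, hy, hz]

lemma b3_cm (x : H.W.obj (H.W.obj M)) : H.b3 M ((H.cm (H.W.obj M)).lin x) =
    chg H.etaL2 H.oneDelta H.etaL3 (fun _ => (H.oneDelta_left _).symm) M (H.b2' M x) := by
  induction x using WW_ind with
  | tm γ' γ m =>
    rw [← c3_b2, t2_eq, b2'_cm, c3_tm, ← t2_eq, b2'_t2]
    refine Eq.trans ?_ (chg_tm ..).symm
    rw [map_mul, H.oneDelta_left, H.oneDelta_right]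
  | add y z hy hz => rw [map_add, map_add, map_add, map_add, hy, hz]

/-- The comonad `M ↦ M ⊗_A Γ`, whose coalgebras are the (right) comodules over `(A, Γ)`. -/
def comonad : Comonad (GMod H.A) where
  toFunctor := H.W
  ε :=
    { app := H.cu
      naturality M N f := H.W_hom_ext fun γ m => by
        rw [GMod.comp_apply, GMod.comp_apply, W_map_t1, cu_t1, cu_t1]
        exact (f.lin.map_smul _ _).symm }
  δ :=
    { app := H.cm
      naturality M N f := H.W_hom_ext fun γ m => by
        apply H.b2'_injective
        rw [GMod.comp_apply, GMod.comp_apply, W_map_t1, b2'_cm]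
        have : ∀ x : H.W.obj (H.W.obj M), H.b2' N ((H.W.map (H.W.map f)).lin x) =
            ((ext H.etaL2).map f).lin (H.b2' M x) := by
          intro x
          induction x using WW_ind with
          | tm γ' γ m =>
            rw [b2'_t2, t2_eq, W_map_t1, W_map_t1, ← t2_eq, b2'_t2]
            exact (ext_map_tm ..).symm
          | add y z hy hz =>
            rw [map_add, map_add, hy, hz, map_add]
            exact (((ext H.etaL2).map f).lin.map_add _ _).symm
        refine Eq.trans ?_ (this _).symm
        rw [b2'_cm]
        exact (ext_map_tm ..).symm }
  coassoc M := H.W_hom_ext fun γ m => by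
    apply H.b3_injective
    rw [GMod.comp_apply, GMod.comp_apply, b3_W_cm, b3_cm, b2'_cm]
    refine (chg_tm ..).trans (Eq.trans ?_ (chg_tm ..).symm)
    rw [H.coassoc]
  left_counit M := H.W_hom_ext fun γ m => by
    rw [GMod.comp_apply, cu_comp, b2'_cm]
    refine (chg_tm ..).trans ?_
    rw [H.oneEps_Delta]; rfl
  right_counit M := H.W_hom_ext fun γ m => by
    change (H.W.map (H.cu M)).lin ((H.cm M).lin _) = _
    rw [W_cu, b2'_cm]
    refine (chg_tm ..).trans ?_
    rw [H.epsOne_Delta]; rfl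

end Bialgebroid

/-! ## The category of coalgebras over an exact comonad -/

section Coalg

variable {C : Type 1} [Category.{0} C] [Abelian C] (G : Comonad C) [G.Additive]
  [PreservesFiniteLimits G.toFunctor]

instance : HasFiniteLimits G.Coalgebra := ⟨fun _ _ _ =>
  ⟨fun D => Comonad.forget_creates_limits_of_comonad_preserves D⟩⟩

instance : HasCokernels G.Coalgebra := ⟨fun f =>
  Comonad.hasColimit_of_comp_forget_hasColimit (T := G) (parallelPair f 0)⟩

instance : PreservesFiniteLimits G.forget := ⟨fun _ _ _ => inferInstance⟩

instance {X Y : G.Coalgebra} (f : X ⟶ Y) : IsIso (Abelian.coimageImageComparison f) := by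
  have : IsIso (G.forget.map (Abelian.coimageImageComparison f)) := by
    have : PreservesColimit (parallelPair f 0) G.forget := inferInstance
    have := Arrow.isIso_iff_isIso_of_isIso
      (Abelian.PreservesCoimageImageComparison.iso G.forget f).inv
    exact this.1 inferInstance
  exact isIso_of_reflects_iso _ G.forget

instance : Abelian G.Coalgebra := Abelian.ofCoimageImageComparisonIsIso

instance [EnoughInjectives C] : EnoughInjectives G.Coalgebra :=
  EnoughInjectives.of_adjunction G.adj

end Coalg

/-! ## The category of comodules -/

section Flat

variable {A B : GRing} (f : A.Hom B)

lemma ext_map_eq_lTensor {M N : GMod A} (g : M ⟶ N) (x : Ten f M) :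
    (((ext f).map g).lin x : Ten f N) = (LinearMap.lTensor (Tw f) g.lin : Ten f M → Ten f N) x := by
  induction x using Ten.induction with
  | tm b m => exact ext_map_tm f g b m
  | add y z hy hz =>
    exact (((ext f).map g).lin.map_add y z).trans ((congrArg₂ _ hy hz).trans
      (map_add (LinearMap.lTensor (Tw f) g.lin) y z).symm)

lemma ext_exact [Module.Flat A (Tw f)] {K M N : GMod A} (i : K ⟶ M) (g : M ⟶ N)
    (hi : Function.Injective i.lin) (h : ∀ x, g.lin x = 0 ↔ x ∈ LinearMap.range i.lin) :
    Function.Injective ((ext f).map i).lin ∧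
      ∀ x, ((ext f).map g).lin x = 0 → x ∈ LinearMap.range ((ext f).map i).lin := by
  constructor
  · have : (((ext f).map i).lin : Ten f K → Ten f M) = LinearMap.lTensor (Tw f) i.lin :=
      funext (ext_map_eq_lTensor f i)
    intro x y hxy
    exact Module.Flat.lTensor_preserves_injective_linearMap (M := Tw f) i.lin hi
      ((ext_map_eq_lTensor f i x).symm.trans (hxy.trans (ext_map_eq_lTensor f i y)))
  · intro x hx
    obtain ⟨y, hy⟩ := (Module.Flat.lTensor_exact (M := Tw f) (f := i.lin) (g := g.lin) h _).1
      ((ext_map_eq_lTensor f g x).symm.trans hx)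
    exact ⟨y, (ext_map_eq_lTensor f i y).trans hy⟩

end Flat

namespace Bialgebroid

variable (H : Bialgebroid)

instance : Module.Flat H.A (Tw H.etaL) :=
  Module.Flat.of_linearEquiv (M := MvPolynomial H.ι H.A) (N := Tw H.etaL)
    { toFun := fun x => x
      invFun := fun x => x
      map_add' := fun _ _ => rfl
      map_smul' := fun a x => (MvPolynomial.smul_eq_C_mul (show MvPolynomial H.ι H.A from x) a).symm
      left_inv := fun _ => rfl
      right_inv := fun _ => rfl }

instance : PreservesFiniteLimits H.W :=
  GMod.preservesFiniteLimits_of_exact _ fun i f hi h => ext_exact H.etaL i f hi h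

instance : H.comonad.Additive := inferInstanceAs H.W.Additive
instance : PreservesFiniteLimits H.comonad.toFunctor := inferInstanceAs (PreservesFiniteLimits H.W)

/-- The category of (graded, right) comodules over `(A, Γ)`. -/
abbrev Comod : Type 1 := H.comonad.Coalgebra

/-- The underlying graded `A`-module of a comodule. -/
abbrev U : H.Comod ⥤ GMod H.A := H.comonad.forget

end Bialgebroid

/-! ## Logarithms -/

lemma sum_antidiagonal_assoc {R : Type} [AddCommMonoid R] (f : ℕ → ℕ → ℕ → R) (n : ℕ) :
    ∑ x ∈ Finset.HasAntidiagonal.antidiagonal n, ∑ y ∈ Finset.HasAntidiagonal.antidiagonal x.1, f y.1 y.2 x.2 =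
      ∑ x ∈ Finset.HasAntidiagonal.antidiagonal n, ∑ y ∈ Finset.HasAntidiagonal.antidiagonal x.2, f x.1 y.1 y.2 := by
  rw [Finset.sum_sigma', Finset.sum_sigma']
  refine Finset.sum_bij' (fun s _ => ⟨(s.2.1, s.2.2 + s.1.2), (s.2.2, s.1.2)⟩)
    (fun s _ => ⟨(s.1.1 + s.2.1, s.2.2), (s.1.1, s.2.1)⟩) ?_ ?_ ?_ ?_ ?_
  · rintro ⟨⟨a, b⟩, ⟨c, d⟩⟩ h
    simp only [Finset.mem_sigma, Finset.HasAntidiagonal.mem_antidiagonal] at h ⊢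
    obtain ⟨h1, h2⟩ := h
    constructor <;> (try simp only at *) <;> omega
  · rintro ⟨⟨a, b⟩, ⟨c, d⟩⟩ h
    simp only [Finset.mem_sigma, Finset.HasAntidiagonal.mem_antidiagonal] at h ⊢
    obtain ⟨h1, h2⟩ := h
    constructor <;> (try simp only at *) <;> omega
  · rintro ⟨⟨a, b⟩, ⟨c, d⟩⟩ h
    simp only [Finset.mem_sigma, Finset.HasAntidiagonal.mem_antidiagonal] at h
    obtain ⟨h1, rfl⟩ := h
    rfl
  · rintro ⟨⟨a, b⟩, ⟨c, d⟩⟩ h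
    simp only [Finset.mem_sigma, Finset.HasAntidiagonal.mem_antidiagonal] at h
    obtain ⟨h1, rfl⟩ := h
    rfl
  · rintro ⟨⟨a, b⟩, ⟨c, d⟩⟩ h
    rfl

/-- A sequence that satisfies a recursive condition can be chosen term by term. -/
lemma exists_seq {R : Type} (r₀ : R) (P : ℕ → (ℕ → R) → Prop)
    (hloc : ∀ n d d', (∀ k ≤ n, d k = d' k) → P n d → P n d')
    (hstep : ∀ n d, (∀ k < n, P k d) → ∃ x, P n (Function.update d n x)) : ∃ d, ∀ n, P n d := by
  classical
  have : Nonempty R := ⟨r₀⟩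
  choose! g hg using hstep
  let D : ℕ → ℕ → R := fun n => Nat.rec (fun _ => r₀)
    (fun n d => Function.update d n (g n d)) n
  have hD : ∀ n, D (n + 1) = Function.update (D n) n (g n (D n)) := fun _ => rfl
  have hst : ∀ n m k, k < n → D (n + m) k = D n k := by
    intro n m k hk
    induction m with
    | zero => rfl
    | succ m ih =>
      rw [← add_assoc, hD, Function.update_of_ne (by omega), ih]
  have hst' : ∀ n m k, n ≤ m → k < n → D m k = D n k := by
    intro n m k h hk
    obtain ⟨i, rfl⟩ := Nat.exists_eq_add_of_le h
    exact hst n i k hk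
  have key : ∀ n, ∀ m, n < m → P n (D m) := by
    intro n
    induction n using Nat.strong_induction_on with
    | _ n ih =>
      intro m hm
      have := hg n (D n) fun k hk => ih k hk n hk
      rw [← hD] at this
      exact hloc n _ _ (fun k hk => (hst' (n + 1) m k hm (by omega)).symm) this
  refine ⟨fun n => D (n + 1) n, fun n => hloc n (D (n + 1)) _ (fun k hk => ?_)
    (key n (n + 1) (by omega))⟩
  exact hst' (k + 1) (n + 1) k (by omega) (by omega)

section Log

variable (p : ℕ) {Q : Type} [CommRing Q]

/-- The sequence `1, 0, 0, …`. -/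
def dlt (n : ℕ) : Q := if n = 0 then 1 else 0

/-- The sequence `n ↦ ∑_{a+b=n} p^b s_a r_b^{p^a}`. -/
def st (s r : ℕ → Q) (n : ℕ) : Q :=
  ∑ x ∈ Finset.HasAntidiagonal.antidiagonal n, (p : Q) ^ x.2 * s x.1 * r x.2 ^ p ^ x.1

/-- For a sequence `v_1, v_2, …`, the elements `λ_n = p^n ℓ_n`, where `ℓ_0 = 1` and
`p ℓ_n = ∑_{0 ≤ i < n} ℓ_i v_{n-i}^{p^i}`. The value `v 0` is not used. -/
def lam (v : ℕ → Q) : ℕ → Q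
  | 0 => 1
  | n + 1 => ∑ i : Fin (n + 1), (p : Q) ^ (n - i.1) * lam v i.1 * v (n + 1 - i.1) ^ p ^ i.1
  decreasing_by exact i.2

lemma lam_zero (v : ℕ → Q) : lam p v 0 = 1 := by rw [lam]

lemma lam_succ (v : ℕ → Q) (n : ℕ) : lam p v (n + 1) =
    ∑ i ∈ Finset.range (n + 1), (p : Q) ^ (n - i) * lam p v i * v (n + 1 - i) ^ p ^ i := by
  rw [lam, ← Fin.sum_univ_eq_sum_range
    (fun i => (p : Q) ^ (n - i) * lam p v i * v (n + 1 - i) ^ p ^ i)]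

variable {p}

lemma map_lam {Q' : Type} [CommRing Q'] (f : Q →+* Q') (v : ℕ → Q) (n : ℕ) :
    f (lam p v n) = lam p (fun k => f (v k)) n := by
  induction n using Nat.strong_induction_on with
  | _ n ih =>
    cases n with
    | zero => rw [lam_zero, lam_zero, map_one]
    | succ n =>
      rw [lam_succ, lam_succ, map_sum]
      refine Finset.sum_congr rfl fun i hi => ?_
      rw [map_mul, map_mul, map_pow, map_pow, map_natCast, ih i (Finset.mem_range.1 hi)]

lemma map_st {Q' : Type} [CommRing Q'] (f : Q →+* Q') (s r : ℕ → Q) (n : ℕ) :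
    f (st p s r n) = st p (fun k => f (s k)) (fun k => f (r k)) n := by
  simp [st, map_sum]

lemma torsionFree_pow (hp : ∀ x : Q, (p : Q) * x = 0 → x = 0) (n : ℕ) (x : Q)
    (h : (p : Q) ^ n * x = 0) : x = 0 := by
  induction n with
  | zero => simpa using h
  | succ n ih =>
    rw [pow_succ', mul_assoc] at h
    exact ih (hp _ h)

variable [Fact p.Prime]

lemma zero_pow_p (a : ℕ) : (0 : Q) ^ p ^ a = 0 :=
  zero_pow (pow_ne_zero _ (Fact.out : p.Prime).ne_zero)

lemma p_mul_lam (v : ℕ → Q) (h0 : v 0 = 0) (n : ℕ) :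
    (p : Q) * lam p v n = st p (lam p v) v n + p * dlt n := by
  cases n with
  | zero => simp [lam_zero, st, h0, dlt]
  | succ n =>
    have h1 : st p (lam p v) v (n + 1) = ∑ i ∈ Finset.range (n + 1),
        (p : Q) ^ (n + 1 - i) * lam p v i * v (n + 1 - i) ^ p ^ i := by
      rw [st, Finset.Nat.sum_antidiagonal_eq_sum_range_succ_mk, Finset.sum_range_succ]
      simp [h0, zero_pow_p]
    rw [h1, lam_succ, Finset.mul_sum]
    simp only [dlt, Nat.succ_ne_zero, if_false, mul_zero, add_zero]
    refine Finset.sum_congr rfl fun i hi => ?_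
    have := Finset.mem_range.1 hi
    have e : n + 1 - i = (n - i) + 1 := by omega
    rw [e, pow_succ']
    ring

lemma st_congr {s s' r r' : ℕ → Q} {n : ℕ} (hs : ∀ k ≤ n, s k = s' k) (hr : ∀ k ≤ n, r k = r' k) :
    st p s r n = st p s' r' n := by
  refine Finset.sum_congr rfl fun x hx => ?_
  rw [Finset.HasAntidiagonal.mem_antidiagonal] at hx
  rw [hs x.1 (by omega), hr x.2 (by omega)]

lemma st_dlt (s : ℕ → Q) (n : ℕ) : st p s dlt n = s n := by
  rw [st, Finset.sum_eq_single (n, 0)]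
  · simp [dlt]
  · rintro ⟨a, b⟩ h h'
    rw [Finset.HasAntidiagonal.mem_antidiagonal] at h
    have : b ≠ 0 := by
      rintro rfl
      exact h' (by simp_all)
    simp [dlt, this, zero_pow_p]
  · simp

lemma st_update [DecidableEq ℕ] (s r : ℕ → Q) (h : s 0 = 1) (n : ℕ) (x : Q) :
    st p s (Function.update r n x) n =
      p ^ n * x + st p s (Function.update r n 0) n := by
  have h0 : (0, n) ∈ Finset.HasAntidiagonal.antidiagonal n := by simp
  rw [st, st, ← Finset.add_sum_erase _ _ h0, ← Finset.add_sum_erase _ _ h0]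
  simp only [Function.update_self, h, pow_zero, pow_one, mul_one, mul_zero, zero_add]
  congr 1
  refine Finset.sum_congr rfl fun y hy => ?_
  obtain ⟨a, b⟩ := y
  rw [Finset.mem_erase, Finset.HasAntidiagonal.mem_antidiagonal] at hy
  have : b ≠ n := by
    rintro rfl
    exact hy.1 (by simp; omega)
  simp [Function.update_of_ne this]

lemma st_inj (hp : ∀ x : Q, (p : Q) * x = 0 → x = 0) {s r r' : ℕ → Q} (h : s 0 = 1)
    (e : ∀ n, st p s r n = st p s r' n) (n : ℕ) : r n = r' n := by
  classical
  induction n using Nat.strong_induction_on with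
  | _ n ih =>
    have := e n
    rw [← Function.update_eq_self n r, ← Function.update_eq_self n r', st_update s r h,
      st_update s r' h] at this
    have h1 : st p s (Function.update r n 0) n = st p s (Function.update r' n 0) n := by
      refine st_congr (fun _ _ => rfl) fun k hk => ?_
      by_cases hkn : k = n
      · subst hkn; simp
      · rw [Function.update_of_ne hkn, Function.update_of_ne hkn, ih k (by omega)]
    rw [h1, add_left_inj] at this
    exact sub_eq_zero.1 (torsionFree_pow hp n _ (by rw [mul_sub, this, sub_self]))

lemma eq_lam (hp : ∀ x : Q, (p : Q) * x = 0 → x = 0) {s w : ℕ → Q} (h0 : w 0 = 0)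
    (e : ∀ n, (p : Q) * s n = st p s w n + p * dlt n) (n : ℕ) : s n = lam p w n := by
  induction n using Nat.strong_induction_on with
  | _ n ih =>
    have : st p s w n = st p (lam p w) w n := by
      refine Finset.sum_congr rfl fun x hx => ?_
      rw [Finset.HasAntidiagonal.mem_antidiagonal] at hx
      by_cases hx2 : x.2 = 0
      · rw [hx2, h0, zero_pow_p (p := p), mul_zero, mul_zero]
      · rw [ih x.1 (by omega)]
    exact sub_eq_zero.1 (hp _ (by rw [mul_sub, e, p_mul_lam (p := p) w h0, this, sub_self]))

lemma lam_inj (hp : ∀ x : Q, (p : Q) * x = 0 → x = 0) {v v' : ℕ → Q} (h0 : v 0 = 0)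
    (h0' : v' 0 = 0) (e : ∀ n, lam p v n = lam p v' n) (n : ℕ) : v n = v' n := by
  have : lam p v = lam p v' := funext e
  refine st_inj hp (lam_zero p v) (fun n => ?_) n
  have h1 := p_mul_lam (p := p) v h0 n
  have h2 := p_mul_lam (p := p) v' h0' n
  rw [← this] at h2
  exact add_right_cancel (h1.symm.trans h2)

end Log

/-! ## The functional equation lemma -/

section FEL

variable {p : ℕ} [Fact p.Prime] {τ : Type} (v : ℕ → MvPolynomial τ ℤ)

/-- A form of the functional equation. -/
def IT (s : ℕ → MvPolynomial τ ℤ) : Prop :=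
  ∀ n, (p : MvPolynomial τ ℤ) ^ (n + 1) ∣ p * s n - ∑ x ∈ Finset.HasAntidiagonal.antidiagonal n,
    p ^ x.1 * v x.1 * MvPolynomial.expand (p ^ x.1) (s x.2)

lemma p_dvd_expand (j : ℕ) (r : MvPolynomial τ ℤ) :
    (p : MvPolynomial τ ℤ) ∣ r ^ p ^ j - MvPolynomial.expand (p ^ j) r := by
  induction j with
  | zero => simp
  | succ j ih =>
    have h1 : ∀ q : MvPolynomial τ ℤ, (p : MvPolynomial τ ℤ) ∣ q ^ p - MvPolynomial.expand p q := by
      intro q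
      have := (MvPolynomial.C_dvd_iff_zmod p (q ^ p - MvPolynomial.expand p q)).2 (by
        rw [map_sub, map_pow, MvPolynomial.map_expand, MvPolynomial.expand_zmod, sub_self])
      simpa using this
    have h2 := dvd_add (ih.trans (sub_dvd_pow_sub_pow _ _ p)) (h1 (MvPolynomial.expand (p ^ j) r))
    rw [sub_add_sub_cancel, ← pow_mul, ← MvPolynomial.expand_mul] at h2
    rwa [pow_succ, mul_comm (p ^ j) p, MvPolynomial.expand_mul, mul_comm p (p ^ j), ← MvPolynomial.expand_mul]

lemma p_torsionFree (x : MvPolynomial τ ℤ) (h : (p : MvPolynomial τ ℤ) * x = 0) : x = 0 := by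
  rcases mul_eq_zero.1 h with h | h
  · exact absurd (Nat.cast_eq_zero.1 h) (Fact.out : p.Prime).ne_zero
  · exact h

variable {v}

lemma IT.mul {s : ℕ → MvPolynomial τ ℤ} (hs : IT (p := p) v s) :
    IT (p := p) v (fun n => p * s n) := by
  intro n
  have := (hs n).mul_left (p : MvPolynomial τ ℤ)
  rw [mul_sub, Finset.mul_sum] at this
  convert this using 2
  refine Finset.sum_congr rfl fun x _ => ?_
  rw [map_mul, map_natCast]; ring

lemma IT.sub {s r : ℕ → MvPolynomial τ ℤ} (hs : IT (p := p) v s) (hr : IT (p := p) v r) :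
    IT (p := p) v (fun n => s n - r n) := by
  intro n
  have := dvd_sub (hs n) (hr n)
  convert this using 1
  simp only [map_sub, mul_sub, Finset.sum_sub_distrib]
  ring

lemma IT.st {s : ℕ → MvPolynomial τ ℤ} (hs : IT (p := p) v s) (r : ℕ → MvPolynomial τ ℤ) :
    IT (p := p) v (st p s r) := by
  intro n
  have e : (p : MvPolynomial τ ℤ) * BPCom.st p s r n - ∑ x ∈ Finset.HasAntidiagonal.antidiagonal n,
      p ^ x.1 * v x.1 * MvPolynomial.expand (p ^ x.1) (BPCom.st p s r x.2) =
      ∑ x ∈ Finset.HasAntidiagonal.antidiagonal n, (p : MvPolynomial τ ℤ) ^ x.2 *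
        (r x.2 ^ p ^ x.1 * (p * s x.1 - ∑ y ∈ Finset.HasAntidiagonal.antidiagonal x.1,
          p ^ y.1 * v y.1 * MvPolynomial.expand (p ^ y.1) (s y.2)) +
        ∑ y ∈ Finset.HasAntidiagonal.antidiagonal x.1, p ^ y.1 * v y.1 * MvPolynomial.expand (p ^ y.1) (s y.2) *
          (r x.2 ^ p ^ x.1 - MvPolynomial.expand (p ^ y.1) (r x.2) ^ p ^ y.2)) := by
    have : ∀ x : ℕ × ℕ, (p : MvPolynomial τ ℤ) ^ x.2 *
        (r x.2 ^ p ^ x.1 * (p * s x.1 - ∑ y ∈ Finset.HasAntidiagonal.antidiagonal x.1,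
          p ^ y.1 * v y.1 * MvPolynomial.expand (p ^ y.1) (s y.2)) +
        ∑ y ∈ Finset.HasAntidiagonal.antidiagonal x.1, p ^ y.1 * v y.1 * MvPolynomial.expand (p ^ y.1) (s y.2) *
          (r x.2 ^ p ^ x.1 - MvPolynomial.expand (p ^ y.1) (r x.2) ^ p ^ y.2)) =
        p * (p ^ x.2 * s x.1 * r x.2 ^ p ^ x.1) -
        ∑ y ∈ Finset.HasAntidiagonal.antidiagonal x.1, p ^ x.2 * (p ^ y.1 * v y.1 *
          MvPolynomial.expand (p ^ y.1) (s y.2) *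
          MvPolynomial.expand (p ^ y.1) (r x.2) ^ p ^ y.2) := by
      intro x
      simp only [mul_sub, Finset.sum_sub_distrib, ← Finset.mul_sum, ← Finset.sum_mul]
      ring
    simp only [this, Finset.sum_sub_distrib, ← Finset.mul_sum]
    congr 1
    simp only [Finset.mul_sum]
    rw [sum_antidiagonal_assoc (fun a b c => (p : MvPolynomial τ ℤ) ^ c * (p ^ a * v a *
          MvPolynomial.expand (p ^ a) (s b) * MvPolynomial.expand (p ^ a) (r c) ^ p ^ b))]
    refine Finset.sum_congr rfl fun x _ => ?_
    rw [BPCom.st, map_sum, Finset.mul_sum]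
    refine Finset.sum_congr rfl fun y _ => ?_
    simp only [map_mul, map_pow, map_natCast]
    ring
  rw [e]
  refine Finset.dvd_sum fun x hx => ?_
  rw [Finset.HasAntidiagonal.mem_antidiagonal] at hx
  rw [← hx, show x.1 + x.2 + 1 = x.2 + (x.1 + 1) by omega, pow_add]
  refine mul_dvd_mul_left _ (dvd_add ((hs x.1).mul_left _) (Finset.dvd_sum fun y hy => ?_))
  rw [Finset.HasAntidiagonal.mem_antidiagonal] at hy
  rw [← hy, add_assoc, pow_add (p : MvPolynomial τ ℤ), mul_assoc, mul_assoc]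
  refine mul_dvd_mul_left _ (Dvd.dvd.mul_left (Dvd.dvd.mul_left ?_ _) _)
  rw [pow_add p, pow_mul (r x.2)]
  exact dvd_sub_pow_of_dvd_sub (p_dvd_expand y.1 (r x.2)) y.2

lemma sum_dlt_left (n : ℕ) : ∑ x ∈ Finset.HasAntidiagonal.antidiagonal n,
    p ^ x.2 * (p * dlt x.1) * v x.2 ^ p ^ x.1 = (p : MvPolynomial τ ℤ) * (p ^ n * v n) := by
  rw [Finset.sum_eq_single (0, n)]
  · simp [dlt]; ring
  · rintro ⟨a, b⟩ h h'
    rw [Finset.HasAntidiagonal.mem_antidiagonal] at h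
    have : a ≠ 0 := by
      rintro rfl
      exact h' (by simp_all)
    simp [dlt, this]
  · simp

lemma sum_dlt_right (n : ℕ) : ∑ x ∈ Finset.HasAntidiagonal.antidiagonal n,
    p ^ x.1 * v x.1 * (p * dlt x.2) = (p : MvPolynomial τ ℤ) * (p ^ n * v n) := by
  rw [Finset.sum_eq_single (n, 0)]
  · simp [dlt]; ring
  · rintro ⟨a, b⟩ h h'
    rw [Finset.HasAntidiagonal.mem_antidiagonal] at h
    have : b ≠ 0 := by
      rintro rfl
      exact h' (by simp_all)
    simp [dlt, this]
  · simp

lemma IT.lam_left (h0 : v 0 = 0) (n : ℕ) (ih : ∀ k < n, (p : MvPolynomial τ ℤ) * lam p v k =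
    ∑ y ∈ Finset.HasAntidiagonal.antidiagonal k,
      p ^ y.1 * v y.1 * MvPolynomial.expand (p ^ y.1) (lam p v y.2) + p * dlt k) :
    (p : MvPolynomial τ ℤ) * BPCom.st p (BPCom.lam p v) v n =
      ∑ x ∈ Finset.HasAntidiagonal.antidiagonal n,
        ∑ y ∈ Finset.HasAntidiagonal.antidiagonal x.1,
          p ^ x.2 * (p ^ y.1 * v y.1 * MvPolynomial.expand (p ^ y.1) (BPCom.lam p v y.2)) *
            v x.2 ^ p ^ (y.1 + y.2) + p * (p ^ n * v n) := by
  rw [← sum_dlt_left, BPCom.st, Finset.mul_sum, ← Finset.sum_add_distrib]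
  refine Finset.sum_congr rfl fun x hx => ?_
  rw [Finset.HasAntidiagonal.mem_antidiagonal] at hx
  by_cases hx2 : x.2 = 0
  · simp [hx2, h0, zero_pow_p]
  · have := ih x.1 (by omega)
    have e : (p : MvPolynomial τ ℤ) * (p ^ x.2 * lam p v x.1 * v x.2 ^ p ^ x.1) =
      p ^ x.2 * (p * lam p v x.1) * v x.2 ^ p ^ x.1 := by ring
    rw [e, this, mul_add, add_mul, Finset.mul_sum, Finset.sum_mul]
    congr 1
    refine Finset.sum_congr rfl fun y hy => ?_
    rw [Finset.HasAntidiagonal.mem_antidiagonal] at hy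
    rw [hy]

lemma IT.lam_right (h0 : v 0 = 0) (hv : ∀ j k, MvPolynomial.expand (p ^ j) (v k) = v k ^ p ^ j)
    (n : ℕ) : (p : MvPolynomial τ ℤ) * ∑ x ∈ Finset.HasAntidiagonal.antidiagonal n,
        p ^ x.1 * v x.1 * MvPolynomial.expand (p ^ x.1) (BPCom.lam p v x.2) =
      ∑ x ∈ Finset.HasAntidiagonal.antidiagonal n,
        ∑ y ∈ Finset.HasAntidiagonal.antidiagonal x.2,
          p ^ y.2 * (p ^ x.1 * v x.1 * MvPolynomial.expand (p ^ x.1) (BPCom.lam p v y.1)) *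
            v y.2 ^ p ^ (x.1 + y.1) + p * (p ^ n * v n) := by
  rw [← sum_dlt_right, Finset.mul_sum, ← Finset.sum_add_distrib]
  refine Finset.sum_congr rfl fun x hx => ?_
  have := congrArg (MvPolynomial.expand (p ^ x.1)) (p_mul_lam (p := p) v h0 x.2)
  rw [map_mul, map_natCast, map_add, map_mul, map_natCast, BPCom.st, map_sum] at this
  have hd : MvPolynomial.expand (p ^ x.1) (dlt x.2 : MvPolynomial τ ℤ) = dlt x.2 := by
    unfold dlt; split_ifs <;> simp
  rw [mul_left_comm, this, mul_add, Finset.mul_sum, hd]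
  congr 1
  refine Finset.sum_congr rfl fun y hy => ?_
  rw [map_mul, map_mul, map_pow, map_pow, map_natCast, hv, pow_add p, pow_mul]
  ring

lemma IT.lam_key (h0 : v 0 = 0) (hv : ∀ j k, MvPolynomial.expand (p ^ j) (v k) = v k ^ p ^ j)
    (n : ℕ) : (p : MvPolynomial τ ℤ) * lam p v n =
      ∑ x ∈ Finset.HasAntidiagonal.antidiagonal n,
        p ^ x.1 * v x.1 * MvPolynomial.expand (p ^ x.1) (lam p v x.2) + p * dlt n := by
  induction n using Nat.strong_induction_on with
  | _ n ih =>
    refine sub_eq_zero.1 (p_torsionFree (p := p) _ ?_)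
    rw [mul_sub, sub_eq_zero, p_mul_lam v h0 n, mul_add, mul_add, IT.lam_left h0 n ih,
      IT.lam_right h0 hv n, sum_antidiagonal_assoc (fun a b c => (p : MvPolynomial τ ℤ) ^ c *
        (p ^ a * v a * MvPolynomial.expand (p ^ a) (BPCom.lam p v b)) * v c ^ p ^ (a + b))]

lemma IT.lam (h0 : v 0 = 0) (hv : ∀ j k, MvPolynomial.expand (p ^ j) (v k) = v k ^ p ^ j) :
    IT (p := p) v (lam p v) := by
  intro n
  rw [IT.lam_key h0 hv n, add_sub_cancel_left]
  unfold dlt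
  split_ifs with h
  · simp [h]
  · simp

/-- Every integral curve is in the image of the exponential. -/
lemma exists_st_lam (h0 : v 0 = 0) (hv : ∀ j k, MvPolynomial.expand (p ^ j) (v k) = v k ^ p ^ j)
    (s : ℕ → MvPolynomial τ ℤ) (hs : IT (p := p) v s) :
    ∃ d : ℕ → MvPolynomial τ ℤ, ∀ n, s n = st p (lam p v) d n := by
  classical
  refine exists_seq 0 (fun n d => s n = st p (lam p v) d n) ?_ ?_
  · intro n d d' h e
    rw [e]
    exact st_congr (fun _ _ => rfl) h
  · intro n d ih
    have h1 := (hs.sub (IT.st (IT.lam h0 hv) (Function.update d n 0))) n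
    have h2 : ∑ x ∈ Finset.HasAntidiagonal.antidiagonal n, (p : MvPolynomial τ ℤ) ^ x.1 * v x.1 *
        MvPolynomial.expand (p ^ x.1)
          (s x.2 - st p (lam p v) (Function.update d n 0) x.2) = 0 := by
      refine Finset.sum_eq_zero fun x hx => ?_
      rw [Finset.HasAntidiagonal.mem_antidiagonal] at hx
      by_cases hx1 : x.1 = 0
      · rw [hx1, h0, mul_zero, zero_mul]
      · rw [ih x.2 (by omega), st_congr (r := Function.update d n 0) (r' := d) (fun _ _ => rfl) (fun k hk => by
          rw [Function.update_of_ne (by omega)]), sub_self, map_zero, mul_zero]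
    rw [h2, sub_zero, pow_succ'] at h1
    obtain ⟨x, hx⟩ := h1
    refine ⟨x, ?_⟩
    rw [st_update _ _ (lam_zero p v), ← sub_eq_iff_eq_add]
    refine sub_eq_zero.1 (p_torsionFree (p := p) _ ?_)
    rw [mul_sub, hx]; ring

/-- Every integral curve with leading term `1` is the logarithm for some parameters. -/
lemma exists_eq_lam (h0 : v 0 = 0)
    (s : ℕ → MvPolynomial τ ℤ) (hs : IT (p := p) v s) (hs0 : s 0 = 1) :
    ∃ w : ℕ → MvPolynomial τ ℤ, w 0 = 0 ∧ ∀ n, s n = lam p w n := by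
  classical
  obtain ⟨w, hw⟩ := exists_seq 0 (fun n w => (p : MvPolynomial τ ℤ) * s n = st p s w n + p * dlt n)
    (by
      intro n d d' h e
      rw [e, st_congr (fun _ _ => rfl) h]) (by
      intro n d ih
      have h1 := (hs.mul.sub (IT.st hs (Function.update d n 0))) n
      have h2 : ∑ x ∈ Finset.HasAntidiagonal.antidiagonal n, (p : MvPolynomial τ ℤ) ^ x.1 * v x.1 *
          MvPolynomial.expand (p ^ x.1)
            ((p : MvPolynomial τ ℤ) * s x.2 - st p s (Function.update d n 0) x.2) = (p : MvPolynomial τ ℤ) * (p ^ n * v n) := by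
        rw [← sum_dlt_right]
        refine Finset.sum_congr rfl fun x hx => ?_
        rw [Finset.HasAntidiagonal.mem_antidiagonal] at hx
        by_cases hx1 : x.1 = 0
        · rw [hx1, h0, mul_zero, zero_mul, zero_mul]
        · rw [ih x.2 (by omega), st_congr (r := Function.update d n 0) (r' := d) (fun _ _ => rfl) (fun k hk => by
            rw [Function.update_of_ne (by omega)]), add_sub_cancel_left, map_mul, map_natCast]
          congr 2
          unfold dlt; split_ifs <;> simp
      rw [h2, ← mul_sub, pow_succ', mul_dvd_mul_iff_left (by
        exact_mod_cast (Fact.out : p.Prime).ne_zero)] at h1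
      have h3 : (p : MvPolynomial τ ℤ) ^ n ∣ p * s n - st p s (Function.update d n 0) n := by
        have := dvd_add h1 (Dvd.intro (v n) rfl)
        rwa [sub_add_cancel] at this
      have h4 : (p : MvPolynomial τ ℤ) ^ n ∣ p * dlt n := by
        unfold dlt
        split_ifs with h
        · simp [h]
        · simp
      obtain ⟨x, hx⟩ := dvd_sub h3 h4
      refine ⟨x, ?_⟩
      rw [st_update _ _ hs0, ← hx]; ring)
  have w0 : w 0 = 0 := by
    have := hw 0
    simpa [st, hs0, dlt] using this
  exact ⟨w, w0, eq_lam (fun x hx => p_torsionFree x hx) w0 hw⟩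

end FEL

/-! ## The structure maps on generators -/

section Universal

variable (p : ℕ) [Fact p.Prime] {Q : Type} [CommRing Q]

/-- The three families of indeterminates. -/
def uv (i : Fin 3) (c : ℤ) : ℕ → MvPolynomial (Fin 3 × ℕ) ℤ
  | 0 => MvPolynomial.C c
  | n + 1 => MvPolynomial.X (i, n)

/-- Evaluation at three sequences. -/
def ev (u : Fin 3 → ℕ → Q) : MvPolynomial (Fin 3 × ℕ) ℤ →+* Q :=
  MvPolynomial.eval₂Hom (Int.castRingHom Q) (fun x => u x.1 (x.2 + 1))

lemma ev_uv (u : Fin 3 → ℕ → Q) (i : Fin 3) (c : ℤ) (h : u i 0 = c) (n : ℕ) :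
    ev u (uv i c n) = u i n := by
  cases n with
  | zero => simp [ev, uv, h]
  | succ n => simp [ev, uv]

lemma expand_uv (i : Fin 3) (j k : ℕ) :
    MvPolynomial.expand (p ^ j) (uv i 0 k) = uv i 0 k ^ p ^ j := by
  cases k with
  | zero => simp [uv, zero_pow_p]
  | succ n => simp [uv]

/-- The existence of the parameters of the logarithm `∑ ℓ_i t_j^{p^i}`. -/
theorem exists_eta (v t : ℕ → Q) (hv : v 0 = 0) (ht : t 0 = 1) :
    ∃ w : ℕ → Q, w 0 = 0 ∧ ∀ n, lam p w n = st p (lam p v) t n := by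
  obtain ⟨w, hw, h⟩ := exists_eq_lam (p := p) (v := uv 0 0) (by simp [uv])
    (st p (lam p (uv 0 0)) (uv 1 1))
    (IT.st (IT.lam (by simp [uv]) (expand_uv p 0)) _) (by simp [st, lam_zero, uv])
  let u : Fin 3 → ℕ → Q := ![v, t, t]
  refine ⟨fun n => ev u (w n), by simp only [hw, map_zero], fun n => ?_⟩
  rw [← map_lam, ← h, map_st]
  refine st_congr (fun k _ => ?_) (fun k _ => ev_uv u 1 1 (by simpa [u] using ht) k)
  rw [map_lam]
  congr 1
  exact funext fun k => ev_uv u 0 0 (by simpa [u] using hv) k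

/-- The existence of the formal sum of `t_i` and `t'_j`. -/
theorem exists_delta (v t t' : ℕ → Q) (hv : v 0 = 0) (ht : t 0 = 1) (ht' : t' 0 = 1) :
    ∃ d : ℕ → Q, ∀ n, st p (lam p v) d n = st p (st p (lam p v) t) t' n := by
  obtain ⟨d, h⟩ := exists_st_lam (p := p) (v := uv 0 0) (by simp [uv]) (expand_uv p 0)
    (st p (st p (lam p (uv 0 0)) (uv 1 1)) (uv 2 1))
    (IT.st (IT.st (IT.lam (by simp [uv]) (expand_uv p 0)) _) _)
  let u : Fin 3 → ℕ → Q := ![v, t, t']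
  have hl : ∀ k, ev u (lam p (uv 0 0) k) = lam p v k := by
    intro k
    rw [map_lam]
    congr 1
    exact funext fun k => ev_uv u 0 0 (by simpa [u] using hv) k
  refine ⟨fun n => ev u (d n), fun n => ?_⟩
  have := congrArg (ev u) (h n)
  rw [map_st, map_st] at this
  simp only [map_st, hl] at this
  rw [← this]
  have e1 : (fun k => ev u (uv 1 1 k)) = t := funext (ev_uv u 1 1 (by simpa [u] using ht))
  have e2 : (fun k => ev u (uv 2 1 k)) = t' := funext (ev_uv u 2 1 (by simpa [u] using ht'))
  rw [e1, e2]

end Universal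

/-! ## Homogeneity -/

/-- A ring as a graded ring concentrated in degree `0`. -/
def GRing.triv (R : Type) [CommRing R] : GRing where
  carrier := R
  deg i := if i = 0 then ⊤ else ⊥
  one_mem := by simp
  mul_mem {i j a b} ha hb := by
    by_cases hi : i = 0
    · by_cases hj : j = 0
      · simp [hi, hj]
      · simp only [if_neg hj, AddSubgroup.mem_bot] at hb
        rw [hb, mul_zero]; exact zero_mem _
    · simp only [if_neg hi, AddSubgroup.mem_bot] at ha
      rw [ha, zero_mul]; exact zero_mem _
  isInternal := by
    apply internal_of_comp _ (Finsupp.singleAddHom 0)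
    · intro i x hx
      by_cases hi : i = 0
      · rw [hi]; rfl
      · simp only [if_neg hi, AddSubgroup.mem_bot] at hx
        rw [hx]; simp
    · intro x
      exact AddSubgroup.mem_iSup_of_mem 0 (by simp)

section Homog

variable (p : ℕ)

/-- Multiplication by `p` is injective. -/
def TF (Q : Type) [CommRing Q] : Prop := ∀ x : Q, (p : Q) * x = 0 → x = 0

variable {p}

lemma TF.poly {ι : Type} (w : ι → ℤ) {R : GRing} (h : TF p R) : TF p (poly w R) := by
  intro x hx
  refine MvPolynomial.ext _ _ fun E => h _ ?_
  have := congrArg (MvPolynomial.coeff E) (show (p : MvPolynomial ι R) * (show MvPolynomial ι R from x) = 0 from hx)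
  rwa [← map_natCast (MvPolynomial.C : R →+* MvPolynomial ι R), MvPolynomial.coeff_C_mul,
    MvPolynomial.coeff_zero] at this

/-- The degree of the `n`-th generator, `2 (p^n - 1)`. -/
def dg (p n : ℕ) : ℤ := 2 * ((p : ℤ) ^ n - 1)

lemma dg_zero : dg p 0 = 0 := by simp [dg]

lemma dg_add (a b : ℕ) : dg p a + ((p ^ a : ℕ) : ℤ) * dg p b = dg p (a + b) := by
  simp only [dg, pow_add]; push_cast; ring

variable {Q : GRing}

lemma natCast_mem (n : ℕ) : (n : Q) ∈ Q.deg 0 := by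
  rw [← nsmul_one]; exact nsmul_mem Q.one_mem n

lemma natCast_mul_mem (n : ℕ) {k : ℤ} {x : Q} (h : x ∈ Q.deg k) : (n : Q) * x ∈ Q.deg k := by
  rw [← nsmul_eq_mul]; exact nsmul_mem h n

lemma TF.mem (h : TF p Q) {n : ℕ} {k : ℤ} {x : Q} (hx : (p : Q) ^ n * x ∈ Q.deg k) :
    x ∈ Q.deg k := by
  refine mem_of_map_mem Q.isInternal Q.isInternal (AddMonoidHom.mulLeft ((p : Q) ^ n)) ?_ ?_ hx
  · intro i y hy
    have := natCast_mul_mem (p ^ n) hy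
    rwa [Nat.cast_pow] at this
  · intro y z hyz
    exact sub_eq_zero.1 (torsionFree_pow h n _ (by
      rw [mul_sub]; exact sub_eq_zero.2 hyz))

lemma st_term_mem {s r : Q} {a b : ℕ} (hs : s ∈ Q.deg (dg p a)) (hr : r ∈ Q.deg (dg p b)) :
    (p : Q) ^ b * s * r ^ p ^ a ∈ Q.deg (dg p (a + b)) := by
  have := natCast_mul_mem (p ^ b) (Q.mul_mem hs (Q.pow_mem hr (p ^ a)))
  rw [dg_add, Nat.cast_pow] at this
  rwa [mul_assoc]

lemma st_mem {s r : ℕ → Q} {n : ℕ} (hs : ∀ k ≤ n, s k ∈ Q.deg (dg p k))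
    (hr : ∀ k ≤ n, r k ∈ Q.deg (dg p k)) : st p s r n ∈ Q.deg (dg p n) := by
  refine sum_mem fun x hx => ?_
  rw [Finset.HasAntidiagonal.mem_antidiagonal] at hx
  rw [← hx]
  exact st_term_mem (hs _ (by omega)) (hr _ (by omega))

lemma lam_mem {v : ℕ → Q} {n : ℕ} (hv : ∀ k ≤ n, v k ∈ Q.deg (dg p k)) :
    lam p v n ∈ Q.deg (dg p n) := by
  induction n using Nat.strong_induction_on with
  | _ n ih =>
    cases n with
    | zero => rw [lam_zero, dg_zero]; exact Q.one_mem
    | succ n =>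
      rw [lam_succ]
      refine sum_mem fun i hi => ?_
      rw [Finset.mem_range] at hi
      have h1 := ih i hi fun k hk => hv k (by omega)
      have h2 := natCast_mul_mem (p ^ (n - i))
        (Q.mul_mem h1 (Q.pow_mem (hv (n + 1 - i) (by omega)) (p ^ i)))
      rw [dg_add, Nat.cast_pow, ← mul_assoc] at h2
      convert h2 using 2
      congr 1
      omega

variable [Fact p.Prime]

lemma of_st_mem (h : TF p Q) {s r : ℕ → Q} (hs0 : s 0 = 1) (hs : ∀ k, s k ∈ Q.deg (dg p k))
    (hsr : ∀ k, st p s r k ∈ Q.deg (dg p k)) (n : ℕ) : r n ∈ Q.deg (dg p n) := by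
  classical
  induction n using Nat.strong_induction_on with
  | _ n ih =>
    have h1 := hsr n
    rw [← Function.update_eq_self n r, st_update s r hs0] at h1
    refine h.mem (n := n) ?_
    rw [← add_sub_cancel_right ((p : Q) ^ n * r n) (st p s (Function.update r n 0) n)]
    refine sub_mem h1 (st_mem (fun k _ => hs k) fun k hk => ?_)
    by_cases hkn : k = n
    · subst hkn; rw [Function.update_self]; exact zero_mem _
    · rw [Function.update_of_ne hkn]; exact ih k (by omega)

lemma of_lam_mem (h : TF p Q) {w : ℕ → Q} (h0 : w 0 = 0)
    (hl : ∀ k, lam p w k ∈ Q.deg (dg p k)) (n : ℕ) : w n ∈ Q.deg (dg p n) := by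
  refine of_st_mem h (lam_zero p w) hl (fun k => ?_) n
  have := p_mul_lam (p := p) w h0 k
  rw [← sub_eq_iff_eq_add] at this
  rw [← this]
  refine sub_mem (natCast_mul_mem p (hl k)) (natCast_mul_mem p ?_)
  unfold dlt
  split_ifs with h
  · rw [h, dg_zero]; exact Q.one_mem
  · exact zero_mem _

end Homog

/-! ## Maps out of polynomial rings -/

section PolyMaps

variable {ι : Type} (w : ι → ℤ)

/-- The variables. -/
def polyX (R : GRing) (n : ι) : poly w R := (MvPolynomial.X n : MvPolynomial ι R)

variable {R S : GRing}

/-- The homomorphism out of a polynomial ring with given values on constants and variables. -/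
def polyDesc (f : R.Hom S) (u : ι → S) (hu : ∀ n, u n ∈ S.deg (w n)) : (poly w R).Hom S :=
  polyHom w (MvPolynomial.eval₂Hom f.hom u)
    (fun i r hr => by rw [MvPolynomial.eval₂Hom_C]; exact f.mem i r hr)
    (fun n => by rw [MvPolynomial.eval₂Hom_X']; exact hu n)

@[simp] lemma polyDesc_C (f : R.Hom S) (u : ι → S) (hu : ∀ n, u n ∈ S.deg (w n)) (r : R) :
    (polyDesc w f u hu).hom ((polyC w R).hom r) = f.hom r := MvPolynomial.eval₂Hom_C _ _ _

@[simp] lemma polyDesc_X (f : R.Hom S) (u : ι → S) (hu : ∀ n, u n ∈ S.deg (w n)) (n : ι) :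
    (polyDesc w f u hu).hom (polyX w R n) = u n := MvPolynomial.eval₂Hom_X' _ _ _

@[simp] lemma polyMap_C (f : R.Hom S) (r : R) :
    (polyMap w f).hom ((polyC w R).hom r) = (polyC w S).hom (f.hom r) := MvPolynomial.map_C _ _

@[simp] lemma polyMap_X (f : R.Hom S) (n : ι) :
    (polyMap w f).hom (polyX w R n) = polyX w S n := MvPolynomial.map_X _ _

lemma poly_ext {T : Type} [CommRing T] {f g : poly w R →+* T}
    (hC : ∀ r, f ((polyC w R).hom r) = g ((polyC w R).hom r))
    (hX : ∀ n, f (polyX w R n) = g (polyX w R n)) (x : poly w R) : f x = g x :=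
  congrArg (fun k : MvPolynomial ι R →+* T => k x) (MvPolynomial.ringHom_ext (f := f) (g := g) hC hX)

/-- The identity. -/
def GRing.Hom.id (R : GRing) : R.Hom R := ⟨RingHom.id R, fun _ _ h => h⟩

end PolyMaps

/-! ## The Hopf algebroid `(BP_*, BP_*BP)` -/

section BP

variable (p : ℕ) [hp : Fact p.Prime]

instance : (Ideal.span {(p : ℤ)}).IsPrime :=
  (Ideal.span_singleton_prime (by exact_mod_cast hp.out.ne_zero)).2
    (Nat.prime_iff_prime_int.1 hp.out)

/-- The ring `ℤ_(p)`. -/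
abbrev Zloc : Type := Localization.AtPrime (Ideal.span {(p : ℤ)})

lemma Zloc.tf : TF p (Zloc p) := by
  intro x hx
  have : IsDomain (Zloc p) := IsLocalization.isDomain_localization
    (Ideal.primeCompl_le_nonZeroDivisors _)
  rcases mul_eq_zero.1 hx with h | h
  · have inj : Function.Injective (algebraMap ℤ (Zloc p)) :=
      IsLocalization.injective _ (Ideal.primeCompl_le_nonZeroDivisors (Ideal.span {(p : ℤ)}))
    have h2 : algebraMap ℤ (Zloc p) p = algebraMap ℤ (Zloc p) 0 := by simpa using h
    exact absurd (by exact_mod_cast inj h2) hp.out.ne_zero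
  · exact h

/-- The degrees of `v_{i+1}` and of `t_{i+1}`. -/
def wt (i : ℕ) : ℤ := dg p (i + 1)

/-- `BP_* = ℤ_(p)[v_1, v_2, …]`, with `v_{i+1} = X i` in degree `2 (p^{i+1} - 1)`. -/
def BP : GRing := poly (wt p) (GRing.triv (Zloc p))

/-- `BP_*BP = BP_*[t_1, t_2, …]`, with `t_{i+1} = X i` in degree `2 (p^{i+1} - 1)`. -/
abbrev BPBP : GRing := poly (wt p) (BP p)

/-- `BP_*BP ⊗ BP_*BP = BP_*BP[t_1, t_2, …]`, in which the variables are the elements `1 ⊗ t_i`. -/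
abbrev BPBP2 : GRing := poly (wt p) (BPBP p)

/-- The sequence `c, X_0, X_1, …` in a polynomial ring. -/
def gens (R : GRing) (c : R) : ℕ → poly (wt p) R
  | 0 => (polyC (wt p) R).hom c
  | n + 1 => polyX (wt p) R n

/-- The sequence `0, v_1, v_2, …` in `BP_*`. -/
def vs : ℕ → BP p := gens p (GRing.triv (Zloc p)) 0

/-- The sequence `1, t_1, t_2, …` in `R[t]`. -/
abbrev ts (R : GRing) : ℕ → poly (wt p) R := gens p R 1

lemma gens_mem (R : GRing) (c : R) (hc : c ∈ R.deg 0) (n : ℕ) :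
    gens p R c n ∈ (poly (wt p) R).deg (dg p n) := by
  cases n with
  | zero => rw [dg_zero]; exact (polyC (wt p) R).mem 0 c hc
  | succ n => exact polyX_mem (wt p) R n

lemma vs_mem (n : ℕ) : vs p n ∈ (BP p).deg (dg p n) := gens_mem p _ 0 (zero_mem _) n

lemma ts_mem (R : GRing) (n : ℕ) : ts p R n ∈ (poly (wt p) R).deg (dg p n) :=
  gens_mem p _ 1 R.one_mem n

lemma vs_zero : vs p 0 = 0 := map_zero _
lemma ts_zero (R : GRing) : ts p R 0 = 1 := map_one _

lemma BP.tf : TF p (BP p) := TF.poly (wt p) (R := GRing.triv (Zloc p)) (Zloc.tf p)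
lemma BPBP.tf : TF p (BPBP p) := TF.poly _ (BP.tf p)
lemma BPBP2.tf : TF p (BPBP2 p) := TF.poly _ (BPBP.tf p)

variable {p}

/-- The image of the sequence of logarithm coefficients under a map of rings. -/
lemma hom_lam {A B : GRing} (f : A.Hom B) (v : ℕ → A) :
    (fun n => f.hom (lam p v n)) = lam p (fun n => f.hom (v n)) := funext fun _ => map_lam _ _ _

lemma hom_st {A B : GRing} (f : A.Hom B) (s r : ℕ → A) :
    (fun n => f.hom (st p s r n)) = st p (fun n => f.hom (s n)) (fun n => f.hom (r n)) :=
  funext fun _ => map_st _ _ _ _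

variable (p)

/-- The sequence `ℓ_0, p ℓ_1, p^2 ℓ_2, …` in `BP_*`. -/
abbrev ells : ℕ → BP p := lam p (vs p)

lemma exists_etaR : ∃ w : ℕ → BPBP p, w 0 = 0 ∧
    ∀ n, lam p w n = st p (fun k => (polyC (wt p) (BP p)).hom (ells p k)) (ts p (BP p)) n := by
  rw [hom_lam]
  exact exists_eta p _ _ (by rw [vs_zero, map_zero]) (ts_zero p _)

/-- The sequence of the elements `η_R(v_n)`. -/
def etas : ℕ → BPBP p := (exists_etaR p).choose

lemma etas_zero : etas p 0 = 0 := (exists_etaR p).choose_spec.1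

lemma lam_etas : lam p (etas p) =
    st p (fun k => (polyC (wt p) (BP p)).hom (ells p k)) (ts p (BP p)) :=
  funext (exists_etaR p).choose_spec.2

lemma etas_mem (n : ℕ) : etas p n ∈ (BPBP p).deg (dg p n) := by
  refine of_lam_mem (BPBP.tf p) (etas_zero p) (fun k => ?_) n
  rw [lam_etas]
  exact st_mem (fun k _ => (polyC (wt p) (BP p)).mem _ _ (lam_mem fun j _ => vs_mem p j))
    (fun k _ => ts_mem p _ k)

/-- The constants in `BP_*`. -/
def cst : (GRing.triv (Zloc p)).Hom (BP p) := polyC (wt p) (GRing.triv (Zloc p))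

/-- The map of graded rings `ℤ_(p)[v] → R` with given values on the generators. -/
def BP.desc {R : GRing} (f : (BP p).Hom R) (u : ℕ → R) (hu : ∀ n, u n ∈ R.deg (dg p n)) :
    (BP p).Hom R :=
  polyDesc (wt p) (f.comp (cst p)) (fun n => u (n + 1))
    (fun n => hu (n + 1))

/-- The right unit `η_R : BP_* → BP_*BP`, given by `η_R(ℓ_n) = ∑_{i+j=n} ℓ_i t_j^{p^i}`. -/
def etaR : (BP p).Hom (BPBP p) := BP.desc p (polyC (wt p) (BP p)) (etas p) (etas_mem p)

lemma etaR_vs (n : ℕ) : (etaR p).hom (vs p n) = etas p n := by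
  cases n with
  | zero => rw [vs_zero, map_zero, etas_zero]
  | succ n => exact polyDesc_X (wt p) _ (fun n => etas p (n + 1)) (fun n => etas_mem p (n + 1)) n

lemma BP_ext {T : Type} [CommRing T] {f g : BP p →+* T}
    (hC : ∀ r, f ((cst p).hom r) = g ((cst p).hom r))
    (hX : ∀ n, f (vs p n) = g (vs p n)) (x : BP p) : f x = g x :=
  poly_ext (wt p) hC (fun n => hX (n + 1)) x

/-- The formula for the right unit. -/
theorem etaR_ells (n : ℕ) : (etaR p).hom (ells p n) =
    st p (fun k => (polyC (wt p) (BP p)).hom (ells p k)) (ts p (BP p)) n := by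
  rw [map_lam, ← lam_etas]
  congr 1
  exact funext fun n => etaR_vs p n

lemma exists_Delta : ∃ d : ℕ → BPBP2 p, ∀ n,
    st p (fun k => (polyC (wt p) (BPBP p)).hom ((polyC (wt p) (BP p)).hom (ells p k))) d n =
    st p (st p (fun k => (polyC (wt p) (BPBP p)).hom ((polyC (wt p) (BP p)).hom (ells p k)))
      (fun k => (polyC (wt p) (BPBP p)).hom (ts p (BP p) k))) (ts p (BPBP p)) n := by
  have := hom_lam (p := p) ((polyC (wt p) (BPBP p)).comp (polyC (wt p) (BP p))) (vs p)
  refine this ▸ exists_delta p _ _ _ ?_ ?_ (ts_zero p _)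
  · rw [vs_zero, map_zero]
  · rw [ts_zero, map_one]

/-- The sequence of the elements `Δ(t_n)`. -/
def deltas : ℕ → BPBP2 p := (exists_Delta p).choose

lemma st_deltas : 
    st p (fun k => (polyC (wt p) (BPBP p)).hom ((polyC (wt p) (BP p)).hom (ells p k))) (deltas p) =
    st p (st p (fun k => (polyC (wt p) (BPBP p)).hom ((polyC (wt p) (BP p)).hom (ells p k)))
      (fun k => (polyC (wt p) (BPBP p)).hom (ts p (BP p) k))) (ts p (BPBP p)) :=
  funext (exists_Delta p).choose_spec

lemma CC_ells_mem (k : ℕ) : (polyC (wt p) (BPBP p)).hom ((polyC (wt p) (BP p)).hom (ells p k)) ∈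
    (BPBP2 p).deg (dg p k) :=
  (polyC (wt p) (BPBP p)).mem _ _ ((polyC (wt p) (BP p)).mem _ _ (lam_mem fun j _ => vs_mem p j))

lemma CC_ells_zero : (polyC (wt p) (BPBP p)).hom ((polyC (wt p) (BP p)).hom (ells p 0)) = 1 := by
  have : ells p 0 = 1 := lam_zero p _
  rw [this, map_one, map_one]

lemma deltas_mem (n : ℕ) : deltas p n ∈ (BPBP2 p).deg (dg p n) := by
  refine of_st_mem (BPBP2.tf p) (CC_ells_zero p) (CC_ells_mem p) (fun k => ?_) n
  rw [st_deltas]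
  exact st_mem (fun k _ => st_mem (fun k _ => CC_ells_mem p k)
    (fun k _ => (polyC (wt p) (BPBP p)).mem _ _ (ts_mem p _ k))) (fun k _ => ts_mem p _ k)

/-- The comultiplication `Δ : BP_*BP → BP_*BP ⊗ BP_*BP`, given by `Δ(a) = a ⊗ 1` for `a ∈ BP_*` and
`∑_{i+j=n} ℓ_i Δ(t_j)^{p^i} = ∑_{i+j+k=n} ℓ_i t_j^{p^i} ⊗ t_k^{p^{i+j}}`. -/
def Delta : (BPBP p).Hom (BPBP2 p) :=
  polyDesc (wt p) ((polyC (wt p) (BPBP p)).comp (polyC (wt p) (BP p))) (fun n => deltas p (n + 1))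
    (fun n => deltas_mem p (n + 1))

lemma deltas_zero : deltas p 0 = 1 := by
  have := congrFun (st_deltas p) 0
  simpa [st, lam_zero, ts_zero] using this

lemma Delta_C (a : BP p) : (Delta p).hom ((polyC (wt p) (BP p)).hom a) =
    (polyC (wt p) (BPBP p)).hom ((polyC (wt p) (BP p)).hom a) := polyDesc_C ..

lemma Delta_ts (n : ℕ) : (Delta p).hom (ts p (BP p) n) = deltas p n := by
  cases n with
  | zero => rw [ts_zero, map_one, deltas_zero]
  | succ n => exact polyDesc_X ..

/-- The map `R[t] → R` that sends the variables to zero. -/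
abbrev aug (R : GRing) : (poly (wt p) R).Hom R :=
  polyDesc (wt p) (GRing.Hom.id _) (fun _ => 0) fun _ => zero_mem _

lemma aug_C (R : GRing) (r : R) : (aug p R).hom ((polyC (wt p) R).hom r) = r := polyDesc_C ..

lemma aug_ts (R : GRing) (n : ℕ) : (aug p R).hom (ts p R n) = dlt n := by
  cases n with
  | zero => rw [ts_zero, map_one]; rfl
  | succ n => exact polyDesc_X ..

lemma map_ts {R S : GRing} (f : R.Hom S) (n : ℕ) :
    (polyMap (wt p) f).hom (ts p R n) = ts p S n := by
  cases n with
  | zero => rw [ts_zero, map_one, ts_zero]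
  | succ n => exact polyMap_X ..

/-- The map `1 ⊗ Δ`. -/
def oneDelta : (BPBP2 p).Hom (poly (wt p) (BPBP2 p)) :=
  polyDesc (wt p) ((polyC (wt p) (BPBP2 p)).comp (polyC (wt p) (BPBP p)))
    (fun n => (polyMap (wt p) (polyMap (wt p) (etaR p))).hom (deltas p (n + 1)))
    (fun n => GRing.Hom.mem _ _ _ (deltas_mem p (n + 1)))

lemma oneDelta_ts (n : ℕ) : (oneDelta p).hom (ts p (BPBP p) n) =
    (polyMap (wt p) (polyMap (wt p) (etaR p))).hom (deltas p n) := by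
  cases n with
  | zero => rw [ts_zero, deltas_zero, map_one, map_one]
  | succ n => exact polyDesc_X ..

/-- The counit `ε : BP_*BP → BP_*`, given by `ε(t_i) = 0` for `i > 0`. -/
abbrev eps : (BPBP p).Hom (BP p) := aug p (BP p)

lemma etaR_C (r : GRing.triv (Zloc p)) : (etaR p).hom ((cst p).hom r) =
    (polyC (wt p) (BP p)).hom ((cst p).hom r) :=
  polyDesc_C (wt p) ((polyC (wt p) (BP p)).comp (cst p)) (fun n => etas p (n + 1))
    (fun n => etas_mem p (n + 1)) r

lemma eps_etaR (a : BP p) : (eps p).hom ((etaR p).hom a) = a := by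
  refine BP_ext p (f := (eps p).hom.comp (etaR p).hom) (g := RingHom.id _) ?_ ?_ a
  · intro r
    exact (congrArg (eps p).hom (etaR_C p r)).trans (aug_C p _ _)
  · intro n
    change (eps p).hom ((etaR p).hom (vs p n)) = vs p n
    rw [etaR_vs]
    refine lam_inj (BP.tf p) (v := fun n => (eps p).hom (etas p n)) (by
      simp only [etas_zero, map_zero]) (vs_zero p) (fun n => ?_) n
    rw [← map_lam, lam_etas, map_st]
    simp only [aug_C, aug_ts]
    exact st_dlt _ _

lemma lam_etaR {T : Type} [CommRing T] (f : BPBP p →+* T) :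
    lam p (fun n => f ((etaR p).hom (vs p n))) =
      st p (fun n => f ((polyC (wt p) (BP p)).hom (ells p n))) (fun n => f (ts p (BP p) n)) := by
  funext n
  simp only [etaR_vs]
  rw [← map_lam, lam_etas, map_st]

lemma Delta_etaR (a : BP p) :
    (Delta p).hom ((etaR p).hom a) = (polyMap (wt p) (etaR p)).hom ((etaR p).hom a) := by
  refine BP_ext p (f := (Delta p).hom.comp (etaR p).hom)
    (g := (polyMap (wt p) (etaR p)).hom.comp (etaR p).hom) ?_ ?_ a
  · intro r
    change (Delta p).hom ((etaR p).hom _) = (polyMap (wt p) (etaR p)).hom ((etaR p).hom _)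
    rw [etaR_C, Delta_C, polyMap_C, etaR_C]
  · intro n
    change (Delta p).hom ((etaR p).hom (vs p n)) =
      (polyMap (wt p) (etaR p)).hom ((etaR p).hom (vs p n))
    refine lam_inj (BPBP2.tf p) (v := fun n => (Delta p).hom ((etaR p).hom (vs p n)))
      (v' := fun n => (polyMap (wt p) (etaR p)).hom ((etaR p).hom (vs p n))) ?_ ?_ (fun n => ?_) n
    · simp only [vs_zero, map_zero]
    · simp only [vs_zero, map_zero]
    · rw [lam_etaR, lam_etaR]
      simp only [Delta_C, Delta_ts, polyMap_C, map_ts, etaR_ells]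
      rw [st_deltas]
      refine st_congr (fun k _ => ?_) (fun _ _ => rfl)
      rw [map_st]

lemma st_CC_inj {r r' : ℕ → BPBP2 p} (h : ∀ n, st p (fun k => (polyC (wt p) (BPBP p)).hom
    ((polyC (wt p) (BP p)).hom (ells p k))) r n = st p (fun k => (polyC (wt p) (BPBP p)).hom
    ((polyC (wt p) (BP p)).hom (ells p k))) r' n) (n : ℕ) : r n = r' n :=
  st_inj (BPBP2.tf p) (CC_ells_zero p) h n

lemma oneEps_Delta (x : BPBP p) : (aug p (BPBP p)).hom ((Delta p).hom x) = x := by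
  refine poly_ext (wt p) (f := (aug p (BPBP p)).hom.comp (Delta p).hom) (g := RingHom.id _) ?_ ?_ x
  · intro r
    change (aug p (BPBP p)).hom ((Delta p).hom _) = _
    rw [Delta_C, aug_C]; rfl
  · intro n
    change (aug p (BPBP p)).hom ((Delta p).hom (ts p (BP p) (n + 1))) = ts p (BP p) (n + 1)
    rw [Delta_ts]
    refine st_inj (BPBP.tf p) (s := fun k => (polyC (wt p) (BP p)).hom (ells p k))
      (r := fun n => (aug p (BPBP p)).hom (deltas p n)) (by
        simp only [lam_zero, map_one]) (fun n => ?_) (n + 1)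
    have := congrArg (aug p (BPBP p)).hom (congrFun (st_deltas p) n)
    rw [map_st, map_st] at this
    simp only [aug_C, map_st, aug_ts] at this
    rw [this]
    exact st_dlt _ _

lemma epsOne_Delta (x : BPBP p) : (polyMap (wt p) (eps p)).hom ((Delta p).hom x) = x := by
  refine poly_ext (wt p) (f := (polyMap (wt p) (eps p)).hom.comp (Delta p).hom)
    (g := RingHom.id _) ?_ ?_ x
  · intro r
    change (polyMap (wt p) (eps p)).hom ((Delta p).hom _) = _
    rw [Delta_C, polyMap_C, aug_C]; rfl
  · intro n
    change (polyMap (wt p) (eps p)).hom ((Delta p).hom (ts p (BP p) (n + 1))) =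
      ts p (BP p) (n + 1)
    rw [Delta_ts]
    refine st_inj (BPBP.tf p) (s := fun k => (polyC (wt p) (BP p)).hom (ells p k))
      (r := fun n => (polyMap (wt p) (eps p)).hom (deltas p n)) (by
        simp only [lam_zero, map_one]) (fun n => ?_) (n + 1)
    have := congrArg (polyMap (wt p) (eps p)).hom (congrFun (st_deltas p) n)
    rw [map_st, map_st] at this
    simp only [polyMap_C, aug_C, map_st, aug_ts, map_ts] at this
    rw [this]
    refine st_congr (fun k _ => ?_) (fun _ _ => rfl)
    have e : (fun k => (polyC (wt p) (BP p)).hom (dlt k : BP p)) = dlt := by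
      funext k
      unfold dlt; split_ifs <;> simp
    rw [e]
    exact st_dlt _ _

lemma oneDelta_C (x : BPBP p) : (oneDelta p).hom ((polyC (wt p) (BPBP p)).hom x) =
    (polyC (wt p) (BPBP2 p)).hom ((polyC (wt p) (BPBP p)).hom x) := polyDesc_C ..

lemma oneDelta_right (x : BPBP p) : (oneDelta p).hom ((polyMap (wt p) (etaR p)).hom x) =
    (polyMap (wt p) (polyMap (wt p) (etaR p))).hom ((Delta p).hom x) := by
  refine poly_ext (wt p) (f := (oneDelta p).hom.comp (polyMap (wt p) (etaR p)).hom)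
    (g := (polyMap (wt p) (polyMap (wt p) (etaR p))).hom.comp (Delta p).hom) ?_ ?_ x
  · intro r
    change (oneDelta p).hom ((polyMap (wt p) (etaR p)).hom _) =
      (polyMap (wt p) (polyMap (wt p) (etaR p))).hom ((Delta p).hom _)
    rw [polyMap_C, oneDelta_C, Delta_C, polyMap_C, polyMap_C]
  · intro n
    change (oneDelta p).hom ((polyMap (wt p) (etaR p)).hom (ts p (BP p) (n + 1))) =
      (polyMap (wt p) (polyMap (wt p) (etaR p))).hom ((Delta p).hom (ts p (BP p) (n + 1)))
    rw [map_ts, oneDelta_ts, Delta_ts]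

lemma BPBP3.tf : TF p (poly (wt p) (BPBP2 p)) := TF.poly _ (BPBP2.tf p)

/-- The coefficients of the logarithm in `BP_*BP ⊗ BP_*BP ⊗ BP_*BP`. -/
abbrev ells3 (k : ℕ) : poly (wt p) (BPBP2 p) := (polyC (wt p) (BPBP2 p)).hom
  ((polyC (wt p) (BPBP p)).hom ((polyC (wt p) (BP p)).hom (ells p k)))

lemma coassoc_left : st p (ells3 p) (fun n => (polyMap (wt p) (Delta p)).hom (deltas p n)) =
    st p (st p (st p (ells3 p) (fun k => (polyC (wt p) (BPBP2 p)).hom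
      ((polyC (wt p) (BPBP p)).hom (ts p (BP p) k))))
      (fun k => (polyC (wt p) (BPBP2 p)).hom (ts p (BPBP p) k))) (ts p (BPBP2 p)) := by
  funext n
  have h1 := congrArg (polyMap (wt p) (Delta p)).hom (congrFun (st_deltas p) n)
  rw [map_st, map_st] at h1
  simp only [polyMap_C, map_st, map_ts, Delta_C, Delta_ts] at h1
  rw [h1]
  refine st_congr (fun k _ => ?_) (fun _ _ => rfl)
  have h2 := congrArg (polyC (wt p) (BPBP2 p)).hom (congrFun (st_deltas p) k)
  rw [map_st, map_st] at h2
  simp only [map_st] at h2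
  exact h2

lemma coassoc_right : st p (ells3 p) (fun n => (oneDelta p).hom (deltas p n)) =
    st p (st p (st p (ells3 p) (fun k => (polyC (wt p) (BPBP2 p)).hom
      ((polyC (wt p) (BPBP p)).hom (ts p (BP p) k))))
      (fun k => (polyC (wt p) (BPBP2 p)).hom (ts p (BPBP p) k))) (ts p (BPBP2 p)) := by
  funext n
  have h1 := congrArg (oneDelta p).hom (congrFun (st_deltas p) n)
  rw [map_st, map_st] at h1
  simp only [oneDelta_C, map_st, oneDelta_ts] at h1
  rw [h1]
  have h2 := congrArg (polyMap (wt p) (polyMap (wt p) (etaR p))).hom (congrFun (st_deltas p) n)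
  rw [map_st, map_st] at h2
  simp only [polyMap_C, map_st, map_ts, etaR_ells] at h2
  exact h2

lemma coassoc (x : BPBP p) : (polyMap (wt p) (Delta p)).hom ((Delta p).hom x) =
    (oneDelta p).hom ((Delta p).hom x) := by
  refine poly_ext (wt p) (f := (polyMap (wt p) (Delta p)).hom.comp (Delta p).hom)
    (g := (oneDelta p).hom.comp (Delta p).hom) ?_ ?_ x
  · intro r
    change (polyMap (wt p) (Delta p)).hom ((Delta p).hom _) = (oneDelta p).hom ((Delta p).hom _)
    rw [Delta_C, polyMap_C, oneDelta_C, Delta_C]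
  · intro n
    change (polyMap (wt p) (Delta p)).hom ((Delta p).hom (ts p (BP p) (n + 1))) =
      (oneDelta p).hom ((Delta p).hom (ts p (BP p) (n + 1)))
    rw [Delta_ts]
    refine st_inj (BPBP3.tf p) (s := ells3 p)
      (r := fun n => (polyMap (wt p) (Delta p)).hom (deltas p n))
      (r' := fun n => (oneDelta p).hom (deltas p n)) ?_ (fun n => ?_) (n + 1)
    · change (polyC (wt p) (BPBP2 p)).hom ((polyC (wt p) (BPBP p)).hom
        ((polyC (wt p) (BP p)).hom (lam p (vs p) 0))) = 1
      rw [lam_zero, map_one, map_one, map_one]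
    · rw [coassoc_left, coassoc_right]

/-- The Hopf algebroid `(BP_*, BP_*BP)`. -/
def BPH : Bialgebroid where
  ι := ℕ
  w := wt p
  A := BP p
  etaR := etaR p
  eps := eps p
  Delta := Delta p
  eps_etaL := aug_C p _
  eps_etaR := eps_etaR p
  Delta_etaL := Delta_C p
  Delta_etaR := Delta_etaR p
  oneEps := aug p _
  oneEps_left := aug_C p _
  oneEps_right x := by
    refine poly_ext (wt p) (f := (aug p (BPBP p)).hom.comp (polyMap (wt p) (etaR p)).hom)
      (g := (etaR p).hom.comp (eps p).hom) ?_ ?_ x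
    · intro r
      change (aug p (BPBP p)).hom ((polyMap (wt p) (etaR p)).hom _) = (etaR p).hom ((eps p).hom _)
      rw [polyMap_C, aug_C, aug_C]
    · intro n
      change (aug p (BPBP p)).hom ((polyMap (wt p) (etaR p)).hom _) = (etaR p).hom ((eps p).hom _)
      rw [polyMap_X, polyDesc_X, polyDesc_X, map_zero]
  oneEps_Delta := oneEps_Delta p
  epsOne_Delta := epsOne_Delta p
  oneDelta := oneDelta p
  oneDelta_left := oneDelta_C p
  oneDelta_right := oneDelta_right p
  coassoc := coassoc p

end BP

/-! ## Localization of graded rings -/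

section Away

variable (A : GRing) (α : A) {d : ℤ} (hα : α ∈ A.deg d)

/-- The image of an element in the localization. -/
def toAway : A →+* Localization.Away α := algebraMap A (Localization.Away α)

lemma toAway_unit : IsUnit (toAway A α α) := IsLocalization.Away.algebraMap_isUnit α

/-- The elements of degree `i` in `A[1/α]` are the fractions `a / α^s` with `a` of degree
`i + s d`. -/
def awayDeg (i : ℤ) : AddSubgroup (Localization.Away α) where
  carrier := {x | ∃ s : ℕ, ∃ a ∈ A.deg (i + s * d), x * toAway A α α ^ s = toAway A α a}
  zero_mem' := ⟨0, 0, zero_mem _, by simp⟩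
  add_mem' := by
    rintro x y ⟨s, a, ha, hx⟩ ⟨t, b, hb, hy⟩
    refine ⟨s + t, a * α ^ t + b * α ^ s, add_mem ?_ ?_, ?_⟩
    · have := A.mul_mem ha (A.pow_mem hα t)
      convert this using 1
      push_cast; ring_nf
    · have := A.mul_mem hb (A.pow_mem hα s)
      convert this using 1
      push_cast; ring_nf
    · rw [map_add, map_mul, map_mul, map_pow, map_pow, ← hx, ← hy]; ring
  neg_mem' := by
    rintro x ⟨s, a, ha, hx⟩
    exact ⟨s, -a, neg_mem ha, by rw [neg_mul, hx, map_neg]⟩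

/-- The localization `A[1/α]` as a graded ring, where `α` is homogeneous of degree `d`. -/
def away : GRing where
  carrier := Localization.Away α
  deg := awayDeg A α hα
  one_mem := ⟨0, 1, by simpa using A.one_mem, by simp⟩
  mul_mem := by
    rintro i j x y ⟨s, a, ha, hx⟩ ⟨t, b, hb, hy⟩
    refine ⟨s + t, a * b, ?_, ?_⟩
    · have := A.mul_mem ha hb
      convert this using 1
      push_cast; ring_nf
    · rw [map_mul, ← hx, ← hy]; ring
  isInternal := by
    classical
    apply internal_of_indep
    · intro x
      obtain ⟨s, a, hx⟩ : ∃ (s : ℕ) (a : A), x * toAway A α α ^ s = toAway A α a := by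
        obtain ⟨s, a, h⟩ := IsLocalization.Away.surj α x
        exact ⟨s, a, h⟩
      obtain ⟨β, hβ⟩ := (toAway_unit A α).exists_right_inv
      have hx' : x = toAway A α a * β ^ s := by
        rw [← hx, mul_assoc, ← mul_pow, hβ, one_pow, mul_one]
      rw [hx']
      refine internal_induction A.isInternal (P := fun a => toAway A α a * β ^ s ∈ _) a ?_ ?_
      · intro i y hy
        refine AddSubgroup.mem_iSup_of_mem (i - s * d) ⟨s, y, by simpa using hy, ?_⟩
        rw [mul_assoc, ← mul_pow, mul_comm β, hβ, one_pow, mul_one]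
      · intro y z hy hz
        rw [map_add, add_mul]; exact add_mem hy hz
    · intro c hc h0
      choose s a ha hx using hc
      let N := c.support.sup s
      have hN : ∀ i ∈ c.support, s i ≤ N := fun i hi => Finset.le_sup hi
      let b : ℤ → A := fun i => a i * α ^ (N - s i)
      have hb : ∀ i ∈ c.support, b i ∈ A.deg (i + N * d) := by
        intro i hi
        have := A.mul_mem (ha i) (A.pow_mem hα (N - s i))
        rw [Nat.cast_sub (hN i hi)] at this
        convert this using 1
        ring_nf
      have hbc : ∀ i ∈ c.support, c i * toAway A α α ^ N = toAway A α (b i) := by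
        intro i hi
        rw [map_mul, ← hx, map_pow, mul_assoc, ← pow_add, Nat.add_sub_cancel' (hN i hi)]
      have hsum : toAway A α (∑ i ∈ c.support, b i) = 0 := by
        rw [map_sum, ← Finset.sum_congr rfl hbc, ← Finset.sum_mul]
        rw [Finsupp.sum] at h0
        rw [h0, zero_mul]
      obtain ⟨⟨_, m, rfl⟩, hm⟩ := (IsLocalization.map_eq_zero_iff (Submonoid.powers α)
        (Localization.Away α) _).1 hsum
      have hm' : ∑ i ∈ c.support, α ^ m * b i = 0 := by rw [← Finset.mul_sum]; exact hm
      have hz : ∀ i ∈ c.support, α ^ m * b i = 0 := by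
        intro i hi
        have h1 := congrArg (comp A.isInternal) hm'
        rw [map_sum, map_zero] at h1
        have h2 : ∀ j ∈ c.support, comp A.isInternal (α ^ m * b j) =
            Finsupp.single (m * d + (j + N * d)) (α ^ m * b j) := fun j hj =>
          comp_of_mem _ (A.mul_mem (A.pow_mem hα m) (hb j hj))
        rw [Finset.sum_congr rfl h2] at h1
        have h3 := DFunLike.congr_fun h1 (m * d + (i + N * d))
        rw [Finsupp.finsetSum_apply, Finset.sum_eq_single i] at h3
        · simpa using h3
        · intro j _ hji
          rw [Finsupp.single_apply, if_neg (by
            intro h; exact hji (by linarith))]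
        · intro h; exact absurd hi h
      ext i
      by_cases hi : i ∈ c.support
      · have h1 := congrArg (toAway A α) (hz i hi)
        rw [map_mul, map_pow, map_zero, ← hbc i hi] at h1
        have h2 := ((toAway_unit A α).pow m).mul_right_eq_zero.1 h1
        exact ((toAway_unit A α).pow N).mul_left_eq_zero.1 h2
      · simpa using hi

lemma toAway_mem {i : ℤ} {a : A} (h : a ∈ A.deg i) : toAway A α a ∈ awayDeg A α hα i :=
  ⟨0, a, by simpa using h, by simp⟩

/-- The canonical map `A → A[1/α]`. -/
def awayMap : A.Hom (away A α hα) := ⟨toAway A α, fun _ _ h => toAway_mem A α hα h⟩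

lemma toAway_unit' {β γ : A} (h : γ = α * β) : IsUnit (toAway A γ α) := by
  have e : toAway A γ γ = toAway A γ α * toAway A γ β :=
    (congrArg (toAway A γ) h).trans (map_mul _ _ _)
  exact isUnit_of_mul_isUnit_left (e ▸ toAway_unit A γ)

/-- The canonical map `A[1/α] → A[1/αβ]`. -/
def awayLift {β γ : A} (h : γ = α * β) : Localization.Away α →+* Localization.Away γ :=
  IsLocalization.Away.lift α (g := toAway A γ) (toAway_unit' A α h)

lemma awayLift_toAway {β γ : A} (h : γ = α * β) (a : A) :
    awayLift A α h (toAway A α a) = toAway A γ a := IsLocalization.Away.lift_eq _ _ _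

lemma awayLift_mem {β γ : A} {e f : ℤ} (hβ : β ∈ A.deg e) (hγ : γ ∈ A.deg f) (h : γ = α * β)
    (hd : f = d + e) (i : ℤ) (x : Localization.Away α) (hx : x ∈ awayDeg A α hα i) :
    awayLift A α h x ∈ awayDeg A γ hγ i := by
  obtain ⟨s, a, ha, hx⟩ := hx
  refine ⟨s, a * β ^ s, ?_, ?_⟩
  · have := A.mul_mem ha (A.pow_mem hβ s)
    convert this using 1
    rw [hd]; ring_nf
  · have h1 := congrArg (awayLift A α h) hx
    rw [map_mul, map_pow, awayLift_toAway, awayLift_toAway] at h1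
    have e : toAway A γ γ = toAway A γ α * toAway A γ β :=
      (congrArg (toAway A γ) h).trans (map_mul _ _ _)
    rw [e, mul_pow, ← mul_assoc, h1, map_mul, map_pow]

/-- The canonical map `A[1/α] → A[1/αβ]` of graded rings. -/
def awayTrans {β γ : A} {e f : ℤ} (hβ : β ∈ A.deg e) (hγ : γ ∈ A.deg f) (h : γ = α * β)
    (hd : f = d + e) : (away A α hα).Hom (away A γ hγ) :=
  ⟨awayLift A α h, awayLift_mem A α hα hβ hγ h hd⟩

lemma awayTrans_awayMap {β γ : A} {e f : ℤ} (hβ : β ∈ A.deg e) (hγ : γ ∈ A.deg f) (h : γ = α * β)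
    (hd : f = d + e) (a : A) :
    (awayTrans A α hα hβ hγ h hd).hom ((awayMap A α hα).hom a) = (awayMap A γ hγ).hom a :=
  awayLift_toAway A α h a

lemma away_hom_ext {T : Type} [CommRing T] {f g : away A α hα →+* T}
    (h : ∀ a, f ((awayMap A α hα).hom a) = g ((awayMap A α hα).hom a)) : f = g :=
  IsLocalization.ringHom_ext (R := A) (Submonoid.powers α) (S := Localization.Away α)
    (j := f) (k := g) (RingHom.ext h)

end Away

/-! ## Torsion subcomodules -/

section Torsion

variable {A : GRing} (G : Comonad (GMod A)) [PreservesFiniteLimits G.toFunctor]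

/-- A submodule of a comodule is a subcomodule if it is homogeneous and the coaction maps it into
the image of `G S`. -/
def IsSubcomodule (M : G.Coalgebra) (S : Submodule A M.A) : Prop :=
  ∃ hS : M.A.IsHomogeneous S, ∀ x ∈ S,
    M.a.lin x ∈ LinearMap.range (G.toFunctor.map (M.A.subι S hS)).lin

variable {G}

namespace IsSubcomodule

variable {M N : G.Coalgebra} {S : Submodule A M.A}

/-- The underlying graded module of a subcomodule. -/
def obj (h : IsSubcomodule G M S) : GMod A := M.A.sub S h.choose

/-- The inclusion of a subcomodule. -/
def ι (h : IsSubcomodule G M S) : h.obj ⟶ M.A := M.A.subι S h.choose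

instance (h : IsSubcomodule G M S) : Mono h.ι :=
  GMod.mono_of_injective _ (Subtype.val_injective)

lemma exists_a (h : IsSubcomodule G M S) :
    ∃ a : h.obj ⟶ G.toFunctor.obj h.obj, a ≫ G.toFunctor.map h.ι = h.ι ≫ M.a :=
  GMod.exists_lift _ _ (GMod.injective_of_mono (G.toFunctor.map h.ι))
    fun x => h.choose_spec _ (Subtype.property x)

/-- The coaction on a subcomodule. -/
def act (h : IsSubcomodule G M S) : h.obj ⟶ G.toFunctor.obj h.obj := h.exists_a.choose

lemma act_ι (h : IsSubcomodule G M S) : h.act ≫ G.toFunctor.map h.ι = h.ι ≫ M.a :=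
  h.exists_a.choose_spec

/-- A subcomodule as a comodule. -/
def coalg (h : IsSubcomodule G M S) : G.Coalgebra where
  A := h.obj
  a := h.act
  counit := by
    have e : G.ε.app h.obj ≫ h.ι = G.toFunctor.map h.ι ≫ G.ε.app M.A := (G.ε.naturality h.ι).symm
    rw [← cancel_mono h.ι, Category.assoc, e, ← Category.assoc, act_ι,
      Category.assoc, M.counit, Category.comp_id, Category.id_comp]
  coassoc := by
    have e : G.δ.app h.obj ≫ G.toFunctor.map (G.toFunctor.map h.ι) =
        G.toFunctor.map h.ι ≫ G.δ.app M.A := (G.δ.naturality h.ι).symm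
    rw [← cancel_mono (G.toFunctor.map (G.toFunctor.map h.ι)), Category.assoc, e, ← Category.assoc, act_ι, Category.assoc, M.coassoc, Category.assoc,
      ← G.toFunctor.map_comp, act_ι, G.toFunctor.map_comp, ← Category.assoc, ← Category.assoc,
      act_ι]

/-- The inclusion of a subcomodule, as a map of comodules. -/
def incl (h : IsSubcomodule G M S) : h.coalg ⟶ M := ⟨h.ι, h.act_ι⟩

instance (h : IsSubcomodule G M S) : Mono h.incl :=
  G.forget.mono_of_mono_map (inferInstanceAs (Mono h.ι))

lemma exists_hom (h : IsSubcomodule G M S) {L : G.Coalgebra} (f : L ⟶ M)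
    (hf : ∀ x, f.f.lin x ∈ S) : ∃ g : L ⟶ h.coalg, g ≫ h.incl = f := by
  obtain ⟨g, hg⟩ := GMod.exists_lift f.f h.ι Subtype.val_injective fun x => ⟨⟨_, hf x⟩, rfl⟩
  refine ⟨⟨g, ?_⟩, by ext1; exact hg⟩
  change L.a ≫ G.toFunctor.map g = g ≫ h.act
  rw [← cancel_mono (G.toFunctor.map h.ι), Category.assoc, Category.assoc, act_ι,
    ← G.toFunctor.map_comp, hg, f.h, ← Category.assoc, hg]

end IsSubcomodule

variable (v : A)

/-- The largest subcomodule in which every element is `v`-torsion. -/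
def tors (M : G.Coalgebra) : Submodule A M.A :=
  sSup {S | IsSubcomodule G M S ∧ ∀ x ∈ S, ∃ k : ℕ, v ^ k • x = 0}

lemma tors_ind {M : G.Coalgebra} {P : M.A → Prop} {x : M.A} (hx : x ∈ tors v M)
    (mem : ∀ S, IsSubcomodule G M S → (∀ x ∈ S, ∃ k : ℕ, v ^ k • x = 0) → ∀ x ∈ S, P x)
    (add : ∀ x y, P x → P y → P (x + y)) : P x := by
  rw [tors, sSup_eq_iSup'] at hx
  refine Submodule.iSup_induction _ (motive := P) hx (fun S x hx => mem S S.2.1 S.2.2 x hx) ?_ add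
  refine mem ⊥ ⟨?_, ?_⟩ ?_ 0 (zero_mem _)
  · intro x hx i
    rw [Submodule.mem_bot] at hx
    rw [hx]; simp
  · intro x hx
    have : M.a.lin x = 0 := by rw [(Submodule.mem_bot _).1 hx, map_zero]
    exact this ▸ zero_mem _
  · intro x hx
    rw [Submodule.mem_bot] at hx
    exact ⟨0, by rw [hx, smul_zero]⟩

lemma le_tors {M : G.Coalgebra} {S : Submodule A M.A} (h : IsSubcomodule G M S)
    (hS : ∀ x ∈ S, ∃ k : ℕ, v ^ k • x = 0) : S ≤ tors v M := le_sSup ⟨h, hS⟩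

lemma tors_isSubcomodule (M : G.Coalgebra) : IsSubcomodule G M (tors v M) := by
  have hom : M.A.IsHomogeneous (tors v M) := by
    intro x hx i
    refine tors_ind v (P := fun x => M.A.cmp x i ∈ tors v M) hx ?_ ?_
    · intro S h hS x hx
      exact le_tors v h hS (h.1 x hx i)
    · intro x y hx hy
      rw [map_add, Finsupp.add_apply]; exact add_mem hx hy
  refine ⟨hom, fun x hx => ?_⟩
  refine tors_ind v (P := fun x => M.a.lin x ∈ _) hx ?_ ?_
  · intro S h hS x hx
    obtain ⟨y, hy⟩ := h.2 x hx
    obtain ⟨g, hg⟩ := GMod.exists_lift (M.A.subι S h.1) (M.A.subι _ hom) Subtype.val_injective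
      (fun x => ⟨⟨_, le_tors v h hS (Subtype.property x)⟩, rfl⟩)
    refine ⟨(G.toFunctor.map g).lin y, ?_⟩
    rw [← hy, ← hg, G.toFunctor.map_comp]; rfl
  · intro x y hx hy
    rw [map_add]; exact add_mem hx hy

lemma map_tors {M N : G.Coalgebra} (f : M ⟶ N) {x : M.A} (hx : x ∈ tors v M) :
    f.f.lin x ∈ tors v N := by
  refine tors_ind v (P := fun x => f.f.lin x ∈ tors v N) hx ?_ ?_
  · intro S h hS x hx
    refine le_tors v (S := S.map f.f.lin) ⟨?_, ?_⟩ ?_ ⟨x, hx, rfl⟩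
    · rintro _ ⟨y, hy, rfl⟩ i
      exact ⟨_, h.1 y hy i, (GMod.cmp_hom f.f y i).symm⟩
    · rintro _ ⟨y, hy, rfl⟩
      obtain ⟨z, hz⟩ := h.2 y hy
      obtain ⟨g, hg⟩ := GMod.exists_lift (M.A.subι S h.1 ≫ f.f) (N.A.subι (S.map f.f.lin) (by
          rintro _ ⟨y, hy, rfl⟩ i
          exact ⟨_, h.1 y hy i, (GMod.cmp_hom f.f y i).symm⟩)) Subtype.val_injective
        (fun x => ⟨⟨_, _, Subtype.property x, rfl⟩, rfl⟩)
      refine ⟨(G.toFunctor.map g).lin z, ?_⟩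
      have e1 := congrArg (fun k => GMod.Hom.lin k y) f.h
      have e2 := congrArg (fun k => GMod.Hom.lin (G.toFunctor.map k) z) hg
      simp only [G.toFunctor.map_comp, GMod.comp_apply] at e1 e2
      rw [e2, hz, e1]
    · rintro _ ⟨y, hy, rfl⟩
      obtain ⟨k, hk⟩ := hS y hy
      exact ⟨k, by rw [← map_smul, hk, map_zero]⟩
  · intro x y hx hy
    rw [map_add]; exact add_mem hx hy

lemma exists_torsMap {M N : G.Coalgebra} (f : M ⟶ N) :
    ∃ g : (tors_isSubcomodule v M).coalg ⟶ (tors_isSubcomodule v N).coalg,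
      g ≫ (tors_isSubcomodule v N).incl = (tors_isSubcomodule v M).incl ≫ f :=
  (tors_isSubcomodule v N).exists_hom ((tors_isSubcomodule v M).incl ≫ f)
    fun x => map_tors v f (Subtype.property x)

/-- The functor that takes a comodule to its largest `v`-torsion subcomodule. -/
def torsFunctor : G.Coalgebra ⥤ G.Coalgebra where
  obj M := (tors_isSubcomodule v M).coalg
  map f := (exists_torsMap v f).choose
  map_id M := by
    rw [← cancel_mono (tors_isSubcomodule v M).incl, (exists_torsMap v _).choose_spec,
      Category.comp_id, Category.id_comp]
  map_comp {M N P} f g := by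
    rw [← cancel_mono (tors_isSubcomodule v P).incl, (exists_torsMap v _).choose_spec,
      Category.assoc, (exists_torsMap v g).choose_spec, ← Category.assoc, ← Category.assoc,
      (exists_torsMap v f).choose_spec]

instance torsFunctor_additive [G.Additive] : (torsFunctor (G := G) v).Additive where
  map_add {M N f g} := by
    let i : (torsFunctor v).obj N ⟶ N := (tors_isSubcomodule v N).incl
    let j : (torsFunctor v).obj M ⟶ M := (tors_isSubcomodule v M).incl
    have : Mono i := inferInstanceAs (Mono (tors_isSubcomodule v N).incl)
    have key : ∀ h : M ⟶ N, (torsFunctor v).map h ≫ i = j ≫ h := fun h =>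
      (exists_torsMap v h).choose_spec
    rw [← cancel_mono i, Preadditive.add_comp, key, key, key, Preadditive.comp_add]

/-- The inclusion of the largest `v`-torsion subcomodule. -/
def torsIncl : torsFunctor (G := G) v ⟶ 𝟭 G.Coalgebra where
  app M := (tors_isSubcomodule v M).incl
  naturality _ _ f := (exists_torsMap v f).choose_spec

end Torsion

/-! ## The functors `Φ_*`, `Φ^*` and `L_n` -/

section Ln

variable (H : Bialgebroid) {B : GRing} (f : H.A.Hom B)

/-- For a map of graded rings `f : A → B`, the adjunction between comodules over `(A, Γ)` and graded
`B`-modules, with left adjoint `M ↦ B ⊗_A M` and right adjoint `N ↦ N ⊗_A Γ`. -/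
def adjB : H.U ⋙ ext f ⊣ res f ⋙ H.comonad.cofree := H.comonad.adj.comp (extRes f)

/-- The category of comodules over `(B, B ⊗_A Γ ⊗_A B)`: the coalgebras over the comonad
`N ↦ N ⊗_B (B ⊗_A Γ ⊗_A B) = (N ⊗_A Γ) ⊗_A B` on graded `B`-modules. Its counit is induced by
`b ⊗ γ ⊗ b' ↦ b ε(γ) b'`, and its comultiplication is `n ⊗ γ ⊗ b ↦ ∑ n ⊗ γ' ⊗ 1 ⊗ γ'' ⊗ b`. -/
abbrev ComodB : Type 1 := (adjB H f).toComonad.Coalgebra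

/-- The functor `M ↦ B ⊗_A M` from comodules over `(A, Γ)` to comodules over
`(B, B ⊗_A Γ ⊗_A B)`. -/
def PhiLower : H.Comod ⥤ ComodB H f := Comonad.comparison (adjB H f)

/-- The right adjoint of the functor `M ↦ B ⊗_A M` on comodules. -/
def PhiUpper : ComodB H f ⥤ H.Comod := Comonad.ComonadicityInternal.rightAdjointComparison (adjB H f)

/-- The adjunction. -/
def PhiAdj : PhiLower H f ⊣ PhiUpper H f := Comonad.ComonadicityInternal.comparisonAdjunction (adjB H f)

instance : H.comonad.cofree.Additive where
  map_add {M N g h} := by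
    ext1
    exact H.W.map_add

instance : (adjB H f).toComonad.Additive :=
  inferInstanceAs ((res f ⋙ H.comonad.cofree) ⋙ H.U ⋙ ext f).Additive

instance : (PhiLower H f).Additive where
  map_add {M N g h} := by
    ext1
    exact (H.U ⋙ ext f).map_add

instance : (PhiUpper H f).Additive := (PhiAdj H f).right_adjoint_additive

/-- The composite of the functor `M ↦ B ⊗_A M` on comodules and its right adjoint. -/
def PhiLoc : H.Comod ⥤ H.Comod := PhiLower H f ⋙ PhiUpper H f

instance PhiLoc_additive : (PhiLoc H f).Additive := inferInstanceAs (PhiLower H f ⋙ PhiUpper H f).Additive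

end Ln

/-! ## The ring `E(n)_*` -/

section En

variable (p : ℕ) [hp : Fact p.Prime] (n : ℕ)

/-- The sequence `v_0 = p, v_1, v_2, …` in `BP_*`. -/
def vv : ℕ → BP p
  | 0 => p
  | k + 1 => vs p (k + 1)

lemma vv_mem (k : ℕ) : vv p k ∈ (BP p).deg (dg p k) := by
  cases k with
  | zero => rw [dg_zero]; exact natCast_mem p
  | succ k => exact vs_mem p (k + 1)

/-- The graded ring `ℤ_(p)[v_1, …, v_n]`. -/
abbrev BPn : GRing := poly (fun i : Fin n => wt p i) (GRing.triv (Zloc p))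

/-- The element `v_{i+1}` of `ℤ_(p)[v_1, …, v_n]` if `i < n`, and zero otherwise. -/
def vn (i : ℕ) : BPn p n :=
  if h : i < n then polyX (fun i : Fin n => wt p i) (GRing.triv (Zloc p)) ⟨i, h⟩ else 0

lemma vn_mem (i : ℕ) : vn p n i ∈ (BPn p n).deg (wt p i) := by
  unfold vn
  split_ifs with h
  · exact polyX_mem (fun i : Fin n => wt p i) (GRing.triv (Zloc p)) ⟨i, h⟩
  · exact zero_mem _

/-- The map `BP_* → ℤ_(p)[v_1, …, v_n]` that sends `v_i` to `v_i` for `i ≤ n` and to zero for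
`i > n`. -/
def toBPn : (BP p).Hom (BPn p n) :=
  polyDesc (wt p) (polyC (fun i : Fin n => wt p i) (GRing.triv (Zloc p))) (vn p n) (vn_mem p n)

/-- The graded ring `E(n)_* = ℤ_(p)[v_1, …, v_n][1/v_n]`; for `n = 0` this is `ℚ`. -/
def En : GRing := away (BPn p n) ((toBPn p n).hom (vv p n)) ((toBPn p n).mem _ _ (vv_mem p n))

/-- The map `BP_* → E(n)_*`. -/
def toEn : (BP p).Hom (En p n) := (awayMap (BPn p n) _ _).comp (toBPn p n)

/-- The category of graded `BP_*BP`-comodules. -/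
abbrev BPComod : Type 1 := (BPH p).Comod

/-- The functor `L_n = Φ^*Φ_*`, where `Φ_*` is the functor `M ↦ E(n)_* ⊗ M` from
`BP_*BP`-comodules to `E(n)_*E(n)`-comodules and `Φ^*` is its right adjoint. -/
def Ln : BPComod p ⥤ BPComod p := PhiLoc (BPH p) (toEn p n)

instance : (Ln p n).Additive := PhiLoc_additive (BPH p) (toEn p n)

/-- The functor `T_n` that takes a comodule to its largest subcomodule that consists of
`v_n`-torsion elements. -/
def Tn : BPComod p ⥤ BPComod p := torsFunctor (G := (BPH p).comonad) (vv p n)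

instance : (Tn p n).Additive :=
  torsFunctor_additive (G := (BPH p).comonad) (vv p n)

/-- The inclusion of `T_n M` in `M`. -/
def TnIncl : Tn p n ⟶ 𝟭 (BPComod p) := torsIncl (G := (BPH p).comonad) (vv p n)

end En

/-! ## Local cohomology and Čech cohomology -/

section Koszul

instance (A : GRing) : HasFiniteBiproducts (GMod A) := HasFiniteBiproducts.of_hasFiniteProducts

variable {A : GRing} {m : ℕ} (α : Fin m → A) {d : Fin m → ℤ}

lemma prod_mem_deg (hα : ∀ i, α i ∈ A.deg (d i)) (S : Finset (Fin m)) : ∏ i ∈ S, α i ∈ A.deg (∑ i ∈ S, d i) := by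
  classical
  induction S using Finset.induction_on with
  | empty => exact A.one_mem
  | insert i S hi ih =>
    rw [Finset.prod_insert hi, Finset.sum_insert hi]; exact A.mul_mem (hα i) ih

variable (hα : ∀ i, α i ∈ A.deg (d i))

/-- The localization `A[1/α_S]`, where `α_S` is the product of the `α_i` with `i ∈ S`. -/
def awayS (S : Finset (Fin m)) : GRing := away A (∏ i ∈ S, α i) (prod_mem_deg α hα S)

/-- The canonical map `A → A[1/α_S]`. -/
def toS (S : Finset (Fin m)) : A.Hom (awayS α hα S) := awayMap A _ (prod_mem_deg α hα S)

/-- The canonical map `A[1/α_S] → A[1/α_T]` for `S ⊆ T`. -/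
def transS {S T : Finset (Fin m)} (h : S ⊆ T) : (awayS α hα S).Hom (awayS α hα T) :=
  awayTrans A _ _ (prod_mem_deg α hα (T \ S)) (prod_mem_deg α hα T)
    ((Finset.prod_sdiff h).symm.trans (mul_comm _ _))
    ((Finset.sum_sdiff h).symm.trans (add_comm _ _))

lemma transS_toS {S T : Finset (Fin m)} (h : S ⊆ T) (a : A) :
    (transS α hα h).hom ((toS α hα S).hom a) = (toS α hα T).hom a := awayTrans_awayMap ..

lemma transS_transS {S T R : Finset (Fin m)} (h : S ⊆ T) (h' : T ⊆ R) (x : awayS α hα S) :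
    (transS α hα h').hom ((transS α hα h).hom x) = (transS α hα (h.trans h')).hom x := by
  have : (transS α hα h').hom.comp (transS α hα h).hom = (transS α hα (h.trans h')).hom := by
    refine away_hom_ext A _ (prod_mem_deg α hα S) fun a => ?_
    change (transS α hα h').hom ((transS α hα h).hom ((toS α hα S).hom a)) =
      (transS α hα (h.trans h')).hom ((toS α hα S).hom a)
    rw [transS_toS, transS_toS, transS_toS]
  exact congrArg (fun g => g x) this

/-- The functor `M ↦ A[1/α_S] ⊗_A M`. -/
def Loc (S : Finset (Fin m)) : GMod A ⥤ GMod A := ext (toS α hα S) ⋙ res (toS α hα S)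

/-- The canonical map `A[1/α_S] ⊗_A M → A[1/α_T] ⊗_A M` for `S ⊆ T`. -/
def locMap {S T : Finset (Fin m)} (h : S ⊆ T) (M : GMod A) :
    (Loc α hα S).obj M ⟶ (Loc α hα T).obj M :=
  (res (toS α hα S)).map (extChange (toS α hα S) (transS α hα h) (toS α hα T)
      (fun a => (transS_toS α hα h a).symm) M) ≫
    resChange (f := (transS α hα h).comp (toS α hα S)) (g := toS α hα T) (transS_toS α hα h) _

lemma locMap_tm {S T : Finset (Fin m)} (h : S ⊆ T) {M : GMod A} (b : awayS α hα S) (x : M) :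
    (locMap α hα h M).lin (tm (toS α hα S) b x) = tm (toS α hα T) ((transS α hα h).hom b) x :=
  extChange_tm (toS α hα S) (transS α hα h) (toS α hα T)
      (fun a => (transS_toS α hα h a).symm) b x

lemma Loc_hom_ext {S : Finset (Fin m)} {M N : GMod A} {f g : (Loc α hα S).obj M ⟶ N}
    (h : ∀ b x, f.lin (tm (toS α hα S) b x) = g.lin (tm (toS α hα S) b x)) : f = g := by
  ext x
  refine Ten.induction (toS α hα S) (P := fun x => f.lin x = g.lin x) x h fun y z hy hz => ?_
  exact (map_add f.lin y z).trans ((congrArg₂ _ hy hz).trans (map_add g.lin y z).symm)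

lemma locMap_comp {S T R : Finset (Fin m)} (h : S ⊆ T) (h' : T ⊆ R) (M : GMod A) :
    locMap α hα h M ≫ locMap α hα h' M = locMap α hα (h.trans h') M := by
  refine Loc_hom_ext α hα fun b x => ?_
  refine (congrArg (locMap α hα h' M).lin (locMap_tm α hα h b x)).trans ?_
  refine (locMap_tm α hα h' _ x).trans (Eq.trans ?_ (locMap_tm α hα (h.trans h') b x).symm)
  rw [transS_transS]

lemma locMap_naturality {S T : Finset (Fin m)} (h : S ⊆ T) {M N : GMod A} (f : M ⟶ N) :
    locMap α hα h M ≫ (Loc α hα T).map f = (Loc α hα S).map f ≫ locMap α hα h N := by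
  refine Loc_hom_ext α hα fun b x => ?_
  refine (congrArg ((Loc α hα T).map f).lin (locMap_tm α hα h b x)).trans ?_
  refine (ext_map_tm (toS α hα T) f _ x).trans ?_
  symm
  refine (congrArg (locMap α hα h N).lin (ext_map_tm (toS α hα S) f b x)).trans ?_
  exact locMap_tm α hα h b (f.lin x)

/-- The number `(-1)^r`, where `r` is the number of elements of `T` that are less than `j`. -/
def sgn (j : Fin m) (T : Finset (Fin m)) : ℤ := (-1) ^ (T.filter fun i => i < j).card

lemma sgn_erase {j l : Fin m} {T : Finset (Fin m)} (hj : j ∈ T) :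
    sgn l (T.erase j) = if j < l then -sgn l T else sgn l T := by
  unfold sgn
  have e : (T.erase j).filter (fun i => i < l) = (T.filter fun i => i < l).erase j := by
    ext i; simp only [Finset.mem_filter, Finset.mem_erase]; tauto
  rw [e]
  split_ifs with h
  · have hm : j ∈ T.filter fun i => i < l := Finset.mem_filter.2 ⟨hj, h⟩
    have := Finset.card_erase_add_one hm
    rw [← this, pow_succ]; ring
  · have hm : j ∉ T.filter fun i => i < l := fun hm => h (Finset.mem_filter.1 hm).2
    rw [Finset.erase_eq_of_notMem hm]

lemma sgn_swap {j l : Fin m} {T : Finset (Fin m)} (hj : j ∈ T) (hl : l ∈ T) (h : j ≠ l) :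
    sgn j T * sgn l (T.erase j) + sgn l T * sgn j (T.erase l) = 0 := by
  rw [sgn_erase hj, sgn_erase hl]
  rcases lt_or_gt_of_ne h with h | h
  · rw [if_pos h, if_neg h.le.not_gt]; ring
  · rw [if_pos (show l < j from h), if_neg (not_lt_of_gt h)]; ring

variable (c : ℕ)

/-- The direct sum of the modules `A[1/α_S] ⊗_A M` with `|S| = k + c`. -/
abbrev KX (k : ℕ) (M : GMod A) : GMod A :=
  ⨁ fun S : {S : Finset (Fin m) // S.card = k + c} => (Loc α hα S.1).obj M

open Classical in
/-- The projection to the summand of `S`, followed by the canonical map to `A[1/α_T] ⊗_A M`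
if `S ⊆ T`, where `|S| = k + c`. -/
def KXπ (k : ℕ) (M : GMod A) (S T : Finset (Fin m)) : KX α hα c k M ⟶ (Loc α hα T).obj M :=
  if h : S.card = k + c ∧ S ⊆ T then
    biproduct.π (fun S : {S : Finset (Fin m) // S.card = k + c} => (Loc α hα S.1).obj M) ⟨S, h.1⟩ ≫
      locMap α hα h.2 M
  else 0

lemma KXπ_pos (k : ℕ) (M : GMod A) {S T : Finset (Fin m)} (h1 : S.card = k + c) (h2 : S ⊆ T) :
    KXπ α hα c k M S T =
      biproduct.π (fun S : {S : Finset (Fin m) // S.card = k + c} => (Loc α hα S.1).obj M)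
        ⟨S, h1⟩ ≫ locMap α hα h2 M := dif_pos ⟨h1, h2⟩

lemma KXπ_locMap (k : ℕ) (M : GMod A) {S T R : Finset (Fin m)} (h : S ⊆ T) (h' : T ⊆ R) :
    KXπ α hα c k M S T ≫ locMap α hα h' M = KXπ α hα c k M S R := by
  by_cases hS : S.card = k + c
  · rw [KXπ_pos α hα c k M hS h, KXπ_pos α hα c k M hS (h.trans h'), Category.assoc, locMap_comp]
  · rw [KXπ, dif_neg fun x => hS x.1, KXπ, dif_neg fun x => hS x.1, zero_comp]

/-- The differential: the component that corresponds to `T` is the alternating sum, over `j ∈ T`,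
of the maps given by `T ∖ {j} ⊆ T`. -/
def KXd (k : ℕ) (M : GMod A) : KX α hα c k M ⟶ KX α hα c (k + 1) M :=
  biproduct.lift fun T => ∑ j ∈ T.1, sgn j T.1 • KXπ α hα c k M (T.1.erase j) T.1

lemma KXd_KXπ (k : ℕ) (M : GMod A) {S T : Finset (Fin m)} (hS : S.card = k + 1 + c) (h : S ⊆ T) :
    KXd α hα c k M ≫ KXπ α hα c (k + 1) M S T =
      ∑ j ∈ S, sgn j S • KXπ α hα c k M (S.erase j) T := by
  rw [KXπ_pos α hα c (k + 1) M hS h, KXd, ← Category.assoc, biproduct.lift_π,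
    Preadditive.sum_comp]
  refine Finset.sum_congr rfl fun j _ => ?_
  rw [Preadditive.zsmul_comp, KXπ_locMap α hα c k M (Finset.erase_subset j S) h]

lemma KXd_KXd (k : ℕ) (M : GMod A) : KXd α hα c k M ≫ KXd α hα c (k + 1) M = 0 := by
  refine biproduct.hom_ext _ _ fun T => ?_
  obtain ⟨T, hT⟩ := T
  rw [zero_comp, Category.assoc]
  conv_lhs => rw [KXd.eq_def α hα c (k + 1)]
  rw [biproduct.lift_π, Preadditive.comp_sum]
  have h1 : ∀ j ∈ T, KXd α hα c k M ≫ (sgn j T • KXπ α hα c (k + 1) M (T.erase j) T) =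
      ∑ l ∈ T.erase j, (sgn j T * sgn l (T.erase j)) •
        KXπ α hα c k M ((T.erase j).erase l) T := by
    intro j hj
    rw [Preadditive.comp_zsmul, KXd_KXπ α hα c k M _ (Finset.erase_subset j T), Finset.smul_sum]
    · exact Finset.sum_congr rfl fun l _ => (mul_smul _ _ _).symm
    · rw [Finset.card_erase_of_mem hj, hT]; omega
  refine (Finset.sum_congr rfl h1).trans ?_
  rw [Finset.sum_sigma']
  refine Finset.sum_involution (fun x _ => ⟨x.2, x.1⟩) ?_ ?_ ?_ ?_
  · rintro ⟨j, l⟩ hx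
    simp only [Finset.mem_sigma, Finset.mem_erase] at hx
    obtain ⟨hj, hlj, hl⟩ := hx
    change (sgn j T * sgn l (T.erase j)) • KXπ α hα c k M ((T.erase j).erase l) T +
      (sgn l T * sgn j (T.erase l)) • KXπ α hα c k M ((T.erase l).erase j) T = 0
    rw [Finset.erase_right_comm, ← add_smul, sgn_swap hj hl hlj.symm, zero_smul]
  · rintro ⟨j, l⟩ hx _ h
    simp only [Finset.mem_sigma, Finset.mem_erase] at hx
    exact hx.2.1 (congrArg Sigma.fst h)
  · rintro ⟨j, l⟩ hx
    simp only [Finset.mem_sigma, Finset.mem_erase] at hx ⊢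
    exact ⟨hx.2.2, hx.2.1.symm, hx.1⟩
  · rintro ⟨j, l⟩ hx; rfl

/-- The map on the terms of the complexes that is induced by a map of modules. -/
def KXmap (k : ℕ) {M N : GMod A} (f : M ⟶ N) : KX α hα c k M ⟶ KX α hα c k N :=
  biproduct.map fun S => (Loc α hα S.1).map f

lemma KXmap_KXπ (k : ℕ) {M N : GMod A} (f : M ⟶ N) {S T : Finset (Fin m)} :
    KXmap α hα c k f ≫ KXπ α hα c k N S T = KXπ α hα c k M S T ≫ (Loc α hα T).map f := by
  by_cases h : S.card = k + c ∧ S ⊆ T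
  · rw [KXπ_pos α hα c k N h.1 h.2, KXπ_pos α hα c k M h.1 h.2, Category.assoc, locMap_naturality,
      KXmap, ← Category.assoc, biproduct.map_π, Category.assoc]
  · rw [KXπ, dif_neg h, KXπ, dif_neg h, zero_comp, comp_zero]

instance (S : Finset (Fin m)) : (Loc α hα S).Additive :=
  inferInstanceAs (ext (toS α hα S) ⋙ res (toS α hα S)).Additive

lemma KXmap_KXd (k : ℕ) {M N : GMod A} (f : M ⟶ N) :
    KXmap α hα c k f ≫ KXd α hα c k N = KXd α hα c k M ≫ KXmap α hα c (k + 1) f := by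
  refine biproduct.hom_ext _ _ fun T => ?_
  rw [Category.assoc, Category.assoc, KXd, biproduct.lift_π, KXmap, KXmap, biproduct.map_π,
    KXd, ← Category.assoc, biproduct.lift_π, Preadditive.comp_sum, Preadditive.sum_comp]
  refine Finset.sum_congr rfl fun j _ => ?_
  rw [Preadditive.comp_zsmul, Preadditive.zsmul_comp]
  congr 1
  exact KXmap_KXπ α hα c k f

/-- The cochain complex with term `⨁_{|S| = k + c} A[1/α_S] ⊗_A M` in degree `k ≥ 0`. For `c = 0`
this is the stable Koszul complex `K^•(α) ⊗_A M`, for `c = 1` this is the Čech complex. -/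
def koszulObj (M : GMod A) : CochainComplex (GMod A) ℕ :=
  CochainComplex.of (fun k => KX α hα c k M) (fun k => KXd α hα c k M)
    (fun k => KXd_KXd α hα c k M)

lemma koszulObj_d (M : GMod A) (k : ℕ) : (koszulObj α hα c M).d k (k + 1) = KXd α hα c k M :=
  CochainComplex.of_d (fun k => KX α hα c k M) (fun k => KXd α hα c k M) k

lemma KXmap_id (k : ℕ) (M : GMod A) : KXmap α hα c k (𝟙 M) = 𝟙 _ := by
  refine biproduct.hom_ext _ _ fun S => ?_
  rw [KXmap, biproduct.map_π, (Loc α hα S.1).map_id, Category.comp_id, Category.id_comp]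

lemma KXmap_comp (k : ℕ) {M N P : GMod A} (f : M ⟶ N) (g : N ⟶ P) :
    KXmap α hα c k (f ≫ g) = KXmap α hα c k f ≫ KXmap α hα c k g := by
  refine biproduct.hom_ext _ _ fun S => ?_
  simp only [KXmap, Category.assoc, biproduct.map_π, biproduct.map_π_assoc, Functor.map_comp]

/-- The functor that takes `M` to `koszulObj α hα c M`. -/
def koszul : GMod A ⥤ CochainComplex (GMod A) ℕ where
  obj M := koszulObj α hα c M
  map {M N} f := CochainComplex.ofHom (X := koszulObj α hα c M) (Y := koszulObj α hα c N)
    (fun k => KXmap α hα c k f) (fun k => by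
      rw [koszulObj_d, koszulObj_d]; exact KXmap_KXd α hα c k f)
  map_id M := HomologicalComplex.hom_ext _ _ fun k => KXmap_id α hα c k M
  map_comp f g := HomologicalComplex.hom_ext _ _ fun k => KXmap_comp α hα c k f g

/-- The local cohomology functor `H^k_I` for the ideal `I` generated by the `α_i`. -/
def localCoh (k : ℕ) : GMod A ⥤ GMod A :=
  koszul α hα 0 ⋙ HomologicalComplex.homologyFunctor _ _ k

/-- The Čech cohomology functor for the ideal generated by the `α_i`. -/
def cechCoh (k : ℕ) : GMod A ⥤ GMod A :=
  koszul α hα 1 ⋙ HomologicalComplex.homologyFunctor _ _ k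

end Koszul

section

variable (p : ℕ) [hp : Fact p.Prime] (n : ℕ)

/-- The functor that takes a comodule to its underlying graded `BP_*`-module. -/
abbrev BPforget : BPComod p ⥤ GMod (BP p) := (BPH p).U

/-- The local cohomology of graded `BP_*`-modules with respect to the ideal
`I_{n+1} = (v_0, …, v_n)`, where `v_0 = p`. -/
def HI (k : ℕ) : GMod (BP p) ⥤ GMod (BP p) :=
  localCoh (fun i : Fin (n + 1) => vv p i) (fun i => vv_mem p i) k

/-- The Čech cohomology of graded `BP_*`-modules with respect to the ideal
`I_{n+1} = (v_0, …, v_n)`, where `v_0 = p`. -/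
def CHI (k : ℕ) : GMod (BP p) ⥤ GMod (BP p) :=
  cechCoh (fun i : Fin (n + 1) => vv p i) (fun i => vv_mem p i) k

end

end
end BPCom

namespace BPCom
noncomputable section

/-! ## Formal sums -/

section FormalSum

variable {p : ℕ} [Fact p.Prime]

lemma IT.add {τ : Type} {v : ℕ → MvPolynomial τ ℤ} {s r : ℕ → MvPolynomial τ ℤ}
    (hs : IT (p := p) v s) (hr : IT (p := p) v r) : IT (p := p) v (fun n => s n + r n) := by
  intro n
  have := dvd_add (hs n) (hr n)
  convert this using 1
  simp only [map_add, mul_add, Finset.sum_add_distrib]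
  ring

/-- Every integral curve is obtained from a given one with leading term `1`. -/
lemma exists_eq_st {τ : Type} {v : ℕ → MvPolynomial τ ℤ} (h0 : v 0 = 0)
    (s u : ℕ → MvPolynomial τ ℤ) (hs : IT (p := p) v s) (hu : IT (p := p) v u) (u0 : u 0 = 1) :
    ∃ d : ℕ → MvPolynomial τ ℤ, ∀ n, s n = st p u d n := by
  classical
  refine exists_seq 0 (fun n d => s n = st p u d n) ?_ ?_
  · intro n d d' h e
    rw [e]
    exact st_congr (fun _ _ => rfl) h
  · intro n d ih
    have h1 := (hs.sub (IT.st hu (Function.update d n 0))) n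
    have h2 : ∑ x ∈ Finset.HasAntidiagonal.antidiagonal n, (p : MvPolynomial τ ℤ) ^ x.1 * v x.1 *
        MvPolynomial.expand (p ^ x.1)
          (s x.2 - st p u (Function.update d n 0) x.2) = 0 := by
      refine Finset.sum_eq_zero fun x hx => ?_
      rw [Finset.HasAntidiagonal.mem_antidiagonal] at hx
      by_cases hx1 : x.1 = 0
      · rw [hx1, h0, mul_zero, zero_mul]
      · rw [ih x.2 (by omega), st_congr (r := Function.update d n 0) (r' := d) (fun _ _ => rfl)
          (fun k hk => by rw [Function.update_of_ne (by omega)]), sub_self, map_zero, mul_zero]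
    rw [h2, sub_zero, pow_succ'] at h1
    obtain ⟨x, hx⟩ := h1
    refine ⟨x, ?_⟩
    rw [st_update _ _ u0, ← sub_eq_iff_eq_add]
    refine sub_eq_zero.1 (p_torsionFree (p := p) _ ?_)
    rw [mul_sub, hx]; ring

lemma ev_lam {Q : Type} [CommRing Q] (u : Fin 3 → ℕ → Q) (h : u 0 0 = 0) (n : ℕ) :
    ev u (lam p (uv 0 0) n) = lam p (u 0) n := by
  rw [map_lam]
  congr 1
  exact funext fun k => ev_uv u 0 0 (by simpa using h) k

/-- The parameters of the inverse of a strict isomorphism. -/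
theorem exists_inverse {Q : Type} [CommRing Q] (v t : ℕ → Q) (hv : v 0 = 0) (ht : t 0 = 1) :
    ∃ c : ℕ → Q, ∀ n, lam p v n = st p (st p (lam p v) t) c n := by
  obtain ⟨d, h⟩ := exists_eq_st (p := p) (v := uv 0 0) (by simp [uv])
    (lam p (uv 0 0)) (st p (lam p (uv 0 0)) (uv 1 1))
    (IT.lam (by simp [uv]) (expand_uv p 0))
    (IT.st (IT.lam (by simp [uv]) (expand_uv p 0)) _) (by simp [st, lam_zero, uv])
  let u : Fin 3 → ℕ → Q := ![v, t, t]
  have hl : ∀ k, ev u (lam p (uv 0 0) k) = lam p v k := ev_lam u hv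
  refine ⟨fun n => ev u (d n), fun n => ?_⟩
  have := congrArg (ev u) (h n)
  rw [map_st] at this
  simp only [map_st, hl] at this
  rw [this]
  have e1 : (fun k => ev u (uv 1 1 k)) = t := funext (ev_uv u 1 1 (by simpa [u] using ht))
  rw [e1]

/-- Truncation of a sequence. -/
def trunc {Q : Type} [CommRing Q] (N : ℕ) (x : ℕ → Q) (k : ℕ) : Q := if k < N then x k else 0

lemma trunc_zero {Q : Type} [CommRing Q] (N : ℕ) (x : ℕ → Q) (h : x 0 = 0) : trunc N x 0 = 0 := by
  simp [trunc, h]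

lemma lam_st_zero {Q : Type} [CommRing Q] (s : ℕ → Q) (n : ℕ) : st p s 0 n = 0 := by
  refine Finset.sum_eq_zero fun x _ => ?_
  rw [Pi.zero_apply, zero_pow_p (p := p), mul_zero]

lemma st_trunc {Q : Type} [CommRing Q] (s x : ℕ → Q) (h : s 0 = 1) (N : ℕ) :
    st p s x N = p ^ N * x N + st p s (trunc N x) N := by
  classical
  rw [← Function.update_eq_self N x, st_update s x h, Function.update_self]
  congr 1
  refine st_congr (fun _ _ => rfl) fun k hk => ?_
  by_cases hkN : k = N
  · subst hkN; simp [trunc]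
  · rw [Function.update_of_ne hkN, trunc, if_pos (by omega), Function.update_of_ne hkN]

lemma st_inj_of_le {Q : Type} [CommRing Q] (hp : TF p Q) {s r r' : ℕ → Q} (h : s 0 = 1)
    (N : ℕ) (e : ∀ n ≤ N, st p s r n = st p s r' n) (n : ℕ) (hn : n ≤ N) : r n = r' n := by
  induction n using Nat.strong_induction_on with
  | _ n ih =>
    have := e n hn
    have h1 : st p s (trunc n r) n = st p s (trunc n r') n := by
      refine st_congr (fun _ _ => rfl) fun k hk => ?_
      by_cases hkn : k < n
      · rw [trunc, trunc, if_pos hkn, if_pos hkn, ih k hkn (by omega)]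
      · rw [trunc, trunc, if_neg hkn, if_neg hkn]
    rw [st_trunc s r h, st_trunc s r' h, h1, add_left_inj] at this
    exact sub_eq_zero.1 (torsionFree_pow hp n _ (by rw [mul_sub, this, sub_self]))

lemma ev_congr_zero {Q : Type} [CommRing Q] (v : ℕ → Q) (P : MvPolynomial (Fin 3 × ℕ) ℤ)
    (hP : ev (![uv 0 0, 0, 0] : Fin 3 → ℕ → MvPolynomial (Fin 3 × ℕ) ℤ) P = 0) :
    ev ![v, 0, 0] P = 0 := by
  have : (ev ![v, 0, 0] : MvPolynomial (Fin 3 × ℕ) ℤ →+* Q).comp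
      (ev (![uv 0 0, 0, 0] : Fin 3 → ℕ → MvPolynomial (Fin 3 × ℕ) ℤ)) = ev ![v, 0, 0] := by
    refine MvPolynomial.ringHom_ext (fun r => by simp) ?_
    rintro ⟨i, k⟩
    fin_cases i <;> simp [ev, uv]
  rw [← this, RingHom.comp_apply, hP, map_zero]

variable (p) in
/-- The formal sum of two sequences is given by universal polynomials. -/
lemma exists_formalSum : ∃ P : ℕ → MvPolynomial (Fin 3 × ℕ) ℤ,
    (∀ N, ev (![uv 0 0, 0, 0] : Fin 3 → ℕ → MvPolynomial (Fin 3 × ℕ) ℤ) (P N) = 0) ∧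
    ∀ (Q : Type) [CommRing Q] (v x y : ℕ → Q), v 0 = 0 → x 0 = 0 → y 0 = 0 →
      TF p Q → ∃ d : ℕ → Q, d 0 = 0 ∧
        (∀ n, st p (lam p v) d n = st p (lam p v) x n + st p (lam p v) y n) ∧
        ∀ N, d N = x N + y N + ev ![v, trunc N x, trunc N y] (P N) := by
  let U := MvPolynomial (Fin 3 × ℕ) ℤ
  have key : ∀ x y : ℕ → U, ∃ d : ℕ → U, ∀ n, st p (lam p (uv 0 0)) x n +
      st p (lam p (uv 0 0)) y n = st p (lam p (uv 0 0)) d n := fun x y =>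
    exists_st_lam (p := p) (v := uv 0 0) (by simp [uv]) (expand_uv p 0) _
      (IT.add (IT.st (IT.lam (by simp [uv]) (expand_uv p 0)) x)
        (IT.st (IT.lam (by simp [uv]) (expand_uv p 0)) y))
  choose D hD using key
  let P : ℕ → U := fun N => D (trunc N (uv 1 0)) (trunc N (uv 2 0)) N
  have tU : TF p U := fun x hx => p_torsionFree x hx
  refine ⟨P, fun N => ?_, fun Q _ v x y hv hx hy tf => ?_⟩
  · let e := ev (![uv 0 0, 0, 0] : Fin 3 → ℕ → MvPolynomial (Fin 3 × ℕ) ℤ)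
    have h1 : ∀ i : Fin 3, i ≠ 0 → (fun k => e (trunc N (uv i 0) k)) = 0 := by
      intro i hi
      funext k
      have : e (uv i 0 k) = 0 := by
        rw [ev_uv _ i 0 (by fin_cases i <;> simp [uv]) k]
        fin_cases i <;> simp_all
      unfold trunc
      split_ifs
      · exact this
      · exact map_zero e
    refine st_inj tU (lam_zero p (uv 0 0)) (r := fun n => e (D (trunc N (uv 1 0)) (trunc N (uv 2 0)) n))
      (r' := 0) (fun n => ?_) N
    have := congrArg e (hD (trunc N (uv 1 0)) (trunc N (uv 2 0)) n)
    have hl : (fun k => e (lam p (uv 0 0) k)) = lam p (uv 0 0) :=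
      funext (ev_lam (![uv 0 0, 0, 0] : Fin 3 → ℕ → MvPolynomial (Fin 3 × ℕ) ℤ) (by simp [uv]))
    rw [map_add, map_st, map_st, map_st, hl, h1 1 (by simp), h1 2 (by simp), lam_st_zero, add_zero]
      at this
    rw [← this, lam_st_zero]
  · let e := ev (![v, x, y] : Fin 3 → ℕ → Q)
    have hl : (fun k => e (lam p (uv 0 0) k)) = lam p v :=
      funext (ev_lam (![v, x, y] : Fin 3 → ℕ → Q) (by simpa using hv))
    have hx' : (fun k => e (uv 1 0 k)) = x := funext (ev_uv _ 1 0 (by simpa using hx))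
    have hy' : (fun k => e (uv 2 0 k)) = y := funext (ev_uv _ 2 0 (by simpa using hy))
    have hd : ∀ n, st p (lam p v) (fun n => e (D (uv 1 0) (uv 2 0) n)) n =
        st p (lam p v) x n + st p (lam p v) y n := by
      intro n
      have := congrArg e (hD (uv 1 0) (uv 2 0) n)
      rw [map_add, map_st, map_st, map_st, hl, hx', hy'] at this
      exact this.symm
    refine ⟨fun n => e (D (uv 1 0) (uv 2 0) n), ?_, hd, fun N => ?_⟩
    · have := hd 0
      simpa [st, lam_zero, hx, hy] using this
    · let f := ev (![v, trunc N x, trunc N y] : Fin 3 → ℕ → Q)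
      have hl' : (fun k => f (lam p (uv 0 0) k)) = lam p v :=
        funext (ev_lam (![v, trunc N x, trunc N y] : Fin 3 → ℕ → Q) (by simpa using hv))
      have ht : ∀ i : Fin 3, ∀ z : ℕ → Q, z 0 = 0 →
          (![v, trunc N x, trunc N y] : Fin 3 → ℕ → Q) i = trunc N z →
          (fun k => f (trunc N (uv i 0) k)) = trunc N z := by
        intro i z hz hi
        funext k
        unfold trunc
        split_ifs with hk
        · rw [ev_uv _ i 0 (by rw [hi, trunc_zero N z hz]; simp) k, hi, trunc, if_pos hk]
        · exact map_zero f
      have h2 : ∀ n, st p (lam p v) (fun n => f (D (trunc N (uv 1 0)) (trunc N (uv 2 0)) n)) n =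
          st p (lam p v) (trunc N x) n + st p (lam p v) (trunc N y) n := by
        intro n
        have := congrArg f (hD (trunc N (uv 1 0)) (trunc N (uv 2 0)) n)
        rw [map_add, map_st, map_st, map_st, hl', ht 1 x hx rfl, ht 2 y hy rfl] at this
        exact this.symm
      set d := fun n => e (D (uv 1 0) (uv 2 0) n) with hd_def
      set d' := fun n => f (D (trunc N (uv 1 0)) (trunc N (uv 2 0)) n) with hd'_def
      have l0 : lam p v 0 = 1 := lam_zero p v
      have htr : ∀ (z : ℕ → Q) n, n < N → st p (lam p v) (trunc N z) n = st p (lam p v) z n := by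
        intro z n hn
        refine st_congr (fun _ _ => rfl) fun k hk => ?_
        rw [trunc, if_pos (by omega)]
      have h3 : ∀ k < N, d' k = d k := by
        rcases Nat.eq_zero_or_pos N with h | h
        · intro k hk; omega
        · intro k hk
          refine st_inj_of_le tf l0 (N - 1) (fun n hn => ?_) k (by omega)
          rw [h2, hd, htr x n (by omega), htr y n (by omega)]
      have h4 : st p (lam p v) (trunc N d') N = st p (lam p v) (trunc N d) N := by
        refine st_congr (fun _ _ => rfl) fun k _ => ?_
        unfold trunc
        split_ifs with hk
        · exact h3 k hk
        · rfl
      have e1 := hd N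
      have e2 := h2 N
      rw [st_trunc _ d l0, st_trunc _ x l0, st_trunc _ y l0] at e1
      rw [st_trunc _ d' l0, h4] at e2
      refine sub_eq_zero.1 (torsionFree_pow tf N _ ?_)
      change (p : Q) ^ N * (d N - (x N + y N + d' N)) = 0
      linear_combination e1 - e2

lemma ev_mem {Q : Type} [CommRing Q] (S : Subring Q) (u : Fin 3 → ℕ → Q)
    (h : ∀ i k, u i k ∈ S) (P : MvPolynomial (Fin 3 × ℕ) ℤ) : ev u P ∈ S := by
  induction P using MvPolynomial.induction_on with
  | C a => simp [ev]
  | add a b ha hb => rw [map_add]; exact add_mem ha hb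
  | mul_X a i ha =>
    rw [map_mul]
    refine mul_mem ha ?_
    simpa [ev] using h i.1 (i.2 + 1)

lemma trunc_mem {Q : Type} [CommRing Q] (S : AddSubgroup Q) (N : ℕ) (x : ℕ → Q)
    (h : ∀ k < N, x k ∈ S) (k : ℕ) : trunc N x k ∈ S := by
  unfold trunc
  split_ifs with hk
  · exact h k hk
  · exact zero_mem _

lemma ev_mem_ideal {Q : Type} [CommRing Q] (b : Ideal Q) (v x y : ℕ → Q) (hx : ∀ k, x k ∈ b)
    (hy : ∀ k, y k ∈ b) (P : MvPolynomial (Fin 3 × ℕ) ℤ)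
    (hP : ev (![uv 0 0, 0, 0] : Fin 3 → ℕ → MvPolynomial (Fin 3 × ℕ) ℤ) P = 0) :
    ev ![v, x, y] P ∈ b := by
  rw [← Ideal.Quotient.eq_zero_iff_mem]
  have : (Ideal.Quotient.mk b).comp (ev ![v, x, y]) =
      ev ![fun k => Ideal.Quotient.mk b (v k), 0, 0] := by
    refine MvPolynomial.ringHom_ext (fun r => by simp) ?_
    rintro ⟨i, k⟩
    fin_cases i
    · simp [ev]
    · simpa [ev] using Ideal.Quotient.eq_zero_iff_mem.2 (hx _)
    · simpa [ev] using Ideal.Quotient.eq_zero_iff_mem.2 (hy _)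
  rw [← RingHom.comp_apply, this]
  exact ev_congr_zero _ P hP

/-- Formal sums of finite families of sequences. -/
lemma exists_formalSum_family {Q : Type} [CommRing Q] (tf : TF p Q) (v : ℕ → Q) (hv : v 0 = 0)
    (x : ℕ → ℕ → Q) (hx : ∀ c, x c 0 = 0) (r : ℕ) : ∃ d : ℕ → Q, d 0 = 0 ∧
      (∀ n, st p (lam p v) d n = ∑ c ∈ Finset.range r, st p (lam p v) (x c) n) ∧
      (∀ (N : ℕ) (S : Subring Q), (∀ k, v k ∈ S) → (∀ c < r, ∀ k < N, x c k ∈ S) →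
        d N - ∑ c ∈ Finset.range r, x c N ∈ S) ∧
      (∀ (N : ℕ) (b : Ideal Q), (∀ c < r, ∀ k < N, x c k ∈ b) →
        d N - ∑ c ∈ Finset.range r, x c N ∈ b) := by
  obtain ⟨P, hP0, hP⟩ := exists_formalSum p
  induction r with
  | zero => exact ⟨0, rfl, fun n => by simp [lam_st_zero], by simp, by simp⟩
  | succ r ih =>
    obtain ⟨d, d0, hd, hS, hb⟩ := ih
    obtain ⟨d', d0', hd', hN⟩ := hP Q v d (x r) hv d0 (hx r) tf
    have hz : ∀ N, d' N - ∑ c ∈ Finset.range (r + 1), x c N =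
        (d N - ∑ c ∈ Finset.range r, x c N) + ev ![v, trunc N d, trunc N (x r)] (P N) := by
      intro N
      rw [hN, Finset.sum_range_succ]; ring
    refine ⟨d', d0', fun n => by rw [hd', hd, Finset.sum_range_succ], ?_, ?_⟩
    · intro N S hvS hxS
      rw [hz]
      refine add_mem (hS N S hvS fun c hc => hxS c (by omega)) (ev_mem S _ ?_ _)
      intro i k
      fin_cases i
      · exact hvS k
      · refine trunc_mem S.toAddSubgroup N d (fun k hk => ?_) k
        have h1 := hS k S hvS fun c hc l hl => hxS c (by omega) l (by omega)
        have h2 : ∑ c ∈ Finset.range r, x c k ∈ S := sum_mem fun c hc =>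
          hxS c (by have := Finset.mem_range.1 hc; omega) k hk
        simpa using add_mem h1 h2
      · exact trunc_mem S.toAddSubgroup N (x r) (fun k hk => hxS r (by omega) k hk) k
    · intro N b hxb
      rw [hz]
      refine add_mem (hb N b fun c hc => hxb c (by omega)) (ev_mem_ideal b _ _ _ ?_ ?_ _ (hP0 N))
      · refine trunc_mem b.toAddSubgroup N d fun k hk => ?_
        have h1 := hb k b fun c hc l hl => hxb c (by omega) l (by omega)
        have h2 : ∑ c ∈ Finset.range r, x c k ∈ b := sum_mem fun c hc =>
          hxb c (by have := Finset.mem_range.1 hc; omega) k hk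
        change d k ∈ b
        simpa using add_mem h1 h2
      · exact trunc_mem b.toAddSubgroup N (x r) fun k hk => hxb r (by omega) k hk

end FormalSum

/-! ## The right unit modulo invariant ideals -/

section RightUnit

variable {p : ℕ} [Fact p.Prime] {Q : Type} [CommRing Q]

/-- The sequence `m ↦ f(m - c)`, extended by zero. -/
def shiftSeq (f : ℕ → Q) (c m : ℕ) : Q := if c ≤ m then f (m - c) else 0

lemma sum_st_shiftSeq (L : ℕ → Q) (f : ℕ → ℕ → Q) {m N : ℕ} (hm : m ≤ N) :
    ∑ c ∈ Finset.range (N + 1), st p L (shiftSeq (f c) c) m =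
      ∑ x ∈ Finset.HasAntidiagonal.antidiagonal m, ∑ y ∈ Finset.HasAntidiagonal.antidiagonal x.2,
        (p : Q) ^ (y.1 + y.2) * L x.1 * f y.1 y.2 ^ p ^ x.1 := by
  simp only [st]
  rw [Finset.sum_comm]
  refine Finset.sum_congr rfl fun x hx => ?_
  rw [Finset.HasAntidiagonal.mem_antidiagonal] at hx
  rw [Finset.Nat.sum_antidiagonal_eq_sum_range_succ_mk]
  have hsub : Finset.range (x.2 + 1) ⊆ Finset.range (N + 1) := by
    intro c hc
    rw [Finset.mem_range] at *
    omega
  rw [← Finset.sum_subset hsub]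
  · refine Finset.sum_congr rfl fun c hc => ?_
    have : c ≤ x.2 := by rw [Finset.mem_range] at hc; omega
    simp only [shiftSeq, if_pos this, Nat.add_sub_cancel' this]
  · intro c _ hc
    have : ¬ c ≤ x.2 := by rw [Finset.mem_range] at hc; omega
    simp only [shiftSeq, if_neg this, zero_pow_p (p := p), mul_zero]

lemma exists_pt (v t : ℕ → Q) : ∃ z : ℕ → Q, z 0 = 0 ∧
    (∀ n, st p (lam p v) (fun k => p * z k) n = p ^ (n + 1) * t n - p * t 0 * dlt n) ∧
    ∀ N, N ≠ 0 → ∀ S : Subring Q, (∀ k, v k ∈ S) → (∀ k < N, t k ∈ S) → z N - t N ∈ S := by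
  have hlamS : ∀ (S : Subring Q), (∀ k, v k ∈ S) → ∀ n, lam p v n ∈ S := by
    intro S hS n
    have := map_lam (p := p) S.subtype (fun k => (⟨v k, hS k⟩ : S)) n
    rw [show lam p v n = lam p (fun k => S.subtype (⟨v k, hS k⟩ : S)) n from rfl, ← this]
    exact Subtype.property _
  obtain ⟨z, hz⟩ := exists_seq (0 : Q) (fun n z => z n = if n = 0 then 0 else t n -
      ∑ a ∈ Finset.range n, if a = 0 then 0 else
        (p : Q) ^ (p ^ a - a - 1) * lam p v a * z (n - a) ^ p ^ a) (by
      intro n d d' h e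
      rw [← h n le_rfl, e]
      split_ifs
      · rfl
      · congr 1
        refine Finset.sum_congr rfl fun a _ => ?_
        split_ifs
        · rfl
        · rw [h _ (by omega)]) (by
      intro n d _
      refine ⟨if n = 0 then 0 else t n - ∑ a ∈ Finset.range n, if a = 0 then 0 else
        (p : Q) ^ (p ^ a - a - 1) * lam p v a * d (n - a) ^ p ^ a, ?_⟩
      rw [Function.update_self]
      split_ifs
      · rfl
      · congr 1
        refine Finset.sum_congr rfl fun a ha => ?_
        split_ifs
        · rfl
        · rw [Function.update_of_ne (by rw [Finset.mem_range] at ha; omega)])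
  have hz0 : z 0 = 0 := by simpa using hz 0
  refine ⟨z, hz0, fun n => ?_, fun N hN S hS hk => ?_⟩
  · by_cases hn : n = 0
    · subst hn
      simp [st, hz0, dlt]
    · rw [st, Finset.Nat.sum_antidiagonal_eq_sum_range_succ_mk, Finset.sum_range_succ,
        Nat.sub_self, hz0, mul_zero, zero_pow_p (p := p), mul_zero, add_zero]
      simp only [dlt, if_neg hn, mul_zero, sub_zero]
      have h1 := hz n
      rw [if_neg hn, eq_sub_iff_add_eq] at h1
      rw [← h1, mul_add, Finset.mul_sum]
      obtain ⟨m, rfl⟩ : ∃ m, n = m + 1 := ⟨n - 1, by omega⟩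
      rw [Finset.sum_range_succ' _ m, Finset.sum_range_succ' _ m]
      simp only [if_true, mul_zero, add_zero, Nat.succ_ne_zero, if_false, Nat.sub_zero, pow_zero,
        pow_one, lam_zero, mul_one]
      rw [add_comm]
      congr 1
      · ring
      · refine Finset.sum_congr rfl fun a ha => ?_
        rw [Finset.mem_range] at ha
        have e1 : a + 1 + 1 ≤ p ^ (a + 1) := Nat.lt_pow_self (Fact.out : p.Prime).one_lt
        have e2 : m + 1 - (a + 1) + p ^ (a + 1) = (m + 1 + 1) + (p ^ (a + 1) - (a + 1) - 1) := by
          omega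
        have : (p : Q) ^ (m + 1 - (a + 1)) * (p : Q) ^ p ^ (a + 1) =
            (p : Q) ^ (m + 1 + 1) * (p : Q) ^ (p ^ (a + 1) - (a + 1) - 1) := by
          rw [← pow_add, ← pow_add, e2]
        rw [mul_pow]
        linear_combination (lam p v (a + 1) * z (m + 1 - (a + 1)) ^ p ^ (a + 1)) * this
  · have hzS : ∀ k < N, z k ∈ S := by
      intro k
      induction k using Nat.strong_induction_on with
      | _ k ih =>
        intro hkN
        rw [hz k]
        split_ifs with h0
        · exact zero_mem _
        · refine sub_mem (hk k hkN) (sum_mem fun a ha => ?_)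
          split_ifs with ha0
          · exact zero_mem _
          · rw [Finset.mem_range] at ha
            exact mul_mem (mul_mem (pow_mem (_root_.natCast_mem S p) _) (hlamS S hS a))
              (pow_mem (ih _ (by omega) (by omega)) _)
    rw [hz N, if_neg hN, sub_sub_cancel_left]
    refine neg_mem (sum_mem fun a ha => ?_)
    split_ifs with ha0
    · exact zero_mem _
    · rw [Finset.mem_range] at ha
      exact mul_mem (mul_mem (pow_mem (_root_.natCast_mem S p) _) (hlamS S hS a))
        (pow_mem (hzS _ (by omega)) _)

end RightUnit

section RightUnitFormula

set_option linter.unusedSectionVars false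

variable {p : ℕ} [Fact p.Prime] {Q : Type} [CommRing Q]

/-- The sequences whose formal sum is the left-hand side of the formula for the right unit. -/
def leftFam (v t z : ℕ → Q) (c : ℕ) : ℕ → Q :=
  if c = 0 then fun k => p * z k else shiftSeq (fun b => v c * t b ^ p ^ c) c

/-- The sequences whose formal sum is the right-hand side of the formula for the right unit. -/
def rightFam (t w : ℕ → Q) (j : ℕ) : ℕ → Q := shiftSeq (fun b => t j * w b ^ p ^ j) j

lemma sum_leftFam {v t z : ℕ → Q} (hv : v 0 = 0) (ht : t 0 = 1)
    (hz : ∀ n, st p (lam p v) (fun k => p * z k) n = p ^ (n + 1) * t n - p * t 0 * dlt n)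
    {m N : ℕ} (h : m ≤ N) :
    ∑ c ∈ Finset.range (N + 1), st p (lam p v) (leftFam (p := p) v t z c) m =
      p * st p (lam p v) t m - p * dlt m := by
  have h1 := sum_st_shiftSeq (p := p) (lam p v) (fun c b => v c * t b ^ p ^ c) h
  rw [Finset.sum_range_succ'] at h1 ⊢
  have h2 : st p (lam p v) (shiftSeq (fun b => v 0 * t b ^ p ^ 0) 0) m = 0 := by
    rw [show shiftSeq (fun b => v 0 * t b ^ p ^ 0) 0 = (0 : ℕ → Q) by
      funext k; simp [shiftSeq, hv]]
    exact lam_st_zero _ _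
  rw [h2, add_zero] at h1
  simp only [leftFam, Nat.succ_ne_zero, if_false, if_true]
  rw [h1, hz, ht, ← sum_antidiagonal_assoc (fun a b c =>
    (p : Q) ^ (b + c) * lam p v a * (v b * t c ^ p ^ b) ^ p ^ a)]
  have h3 : ∀ x ∈ Finset.HasAntidiagonal.antidiagonal m,
      ∑ y ∈ Finset.HasAntidiagonal.antidiagonal x.1,
        (p : Q) ^ (y.2 + x.2) * lam p v y.1 * (v y.2 * t x.2 ^ p ^ y.2) ^ p ^ y.1 =
      p * ((p : Q) ^ x.2 * lam p v x.1 * t x.2 ^ p ^ x.1) -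
        p * ((p : Q) ^ x.2 * dlt x.1 * t x.2 ^ p ^ x.1) := by
    intro x _
    have : ∑ y ∈ Finset.HasAntidiagonal.antidiagonal x.1,
        (p : Q) ^ (y.2 + x.2) * lam p v y.1 * (v y.2 * t x.2 ^ p ^ y.2) ^ p ^ y.1 =
        st p (lam p v) v x.1 * ((p : Q) ^ x.2 * t x.2 ^ p ^ x.1) := by
      rw [st, Finset.sum_mul]
      refine Finset.sum_congr rfl fun y hy => ?_
      rw [Finset.HasAntidiagonal.mem_antidiagonal] at hy
      rw [mul_pow, ← pow_mul, ← pow_add, add_comm y.2 y.1, hy, pow_add]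
      ring
    rw [this, ← sub_eq_iff_eq_add.2 (p_mul_lam v hv x.1)]
    ring
  rw [Finset.sum_congr rfl h3, Finset.sum_sub_distrib, ← Finset.mul_sum, ← Finset.mul_sum]
  have h4 : ∑ x ∈ Finset.HasAntidiagonal.antidiagonal m,
      (p : Q) ^ x.2 * dlt x.1 * t x.2 ^ p ^ x.1 = p ^ m * t m := by
    rw [Finset.sum_eq_single (0, m)]
    · simp [dlt]
    · rintro ⟨a, b⟩ hab hne
      rw [Finset.HasAntidiagonal.mem_antidiagonal] at hab
      have : a ≠ 0 := by
        rintro rfl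
        exact hne (by simp_all)
      simp [dlt, this]
    · simp
  rw [h4, st]
  ring

lemma sum_rightFam {v t w : ℕ → Q} (hw : w 0 = 0) (hl : ∀ n, lam p w n = st p (lam p v) t n)
    {m N : ℕ} (h : m ≤ N) :
    ∑ j ∈ Finset.range (N + 1), st p (lam p v) (rightFam (p := p) t w j) m =
      p * st p (lam p v) t m - p * dlt m := by
  have h1 := sum_st_shiftSeq (p := p) (lam p v) (fun c b => t c * w b ^ p ^ c) h
  simp only [rightFam]
  rw [h1, ← sum_antidiagonal_assoc (fun a b c =>
    (p : Q) ^ (b + c) * lam p v a * (t b * w c ^ p ^ b) ^ p ^ a), ← hl, p_mul_lam w hw,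
    add_sub_cancel_right, st]
  refine Finset.sum_congr rfl fun x _ => ?_
  rw [hl, st, Finset.mul_sum, Finset.sum_mul]
  refine Finset.sum_congr rfl fun y hy => ?_
  rw [Finset.HasAntidiagonal.mem_antidiagonal] at hy
  rw [mul_pow, ← pow_mul, ← pow_add, add_comm y.2 y.1, hy, pow_add]
  ring

/-- The comparison of the two sides of the formula for the right unit. -/
lemma exists_fam_comparison (tf : TF p Q) {v t z w : ℕ → Q} (hv : v 0 = 0) (ht : t 0 = 1)
    (hw : w 0 = 0) (hl : ∀ n, lam p w n = st p (lam p v) t n) (hz0 : z 0 = 0)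
    (hz : ∀ n, st p (lam p v) (fun k => p * z k) n = p ^ (n + 1) * t n - p * t 0 * dlt n) (N : ℕ) :
    (∀ S : Subring Q, (∀ k, v k ∈ S) →
      (∀ k < N, ∀ c, leftFam (p := p) v t z c k ∈ S ∧ rightFam (p := p) t w c k ∈ S) →
      ∑ c ∈ Finset.range (N + 1), leftFam (p := p) v t z c N -
        ∑ c ∈ Finset.range (N + 1), rightFam (p := p) t w c N ∈ S) ∧
    (∀ b : Ideal Q,
      (∀ k < N, ∀ c, leftFam (p := p) v t z c k ∈ b ∧ rightFam (p := p) t w c k ∈ b) →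
      ∑ c ∈ Finset.range (N + 1), leftFam (p := p) v t z c N -
        ∑ c ∈ Finset.range (N + 1), rightFam (p := p) t w c N ∈ b) := by
  obtain ⟨d, -, hd, hdS, hdb⟩ := exists_formalSum_family tf v hv (leftFam (p := p) v t z) (by
    intro c
    unfold leftFam
    split_ifs with h
    · simp [hz0]
    · simp [shiftSeq, h]) (N + 1)
  obtain ⟨e, -, he, heS, heb⟩ := exists_formalSum_family tf v hv (rightFam (p := p) t w) (by
    intro c
    simp only [rightFam, shiftSeq]
    split_ifs with h
    · rw [Nat.zero_sub, hw, zero_pow_p, mul_zero]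
    · rfl) (N + 1)
  have hde : d N = e N := by
    refine st_inj_of_le tf (lam_zero p v) N (fun n hn => ?_) N le_rfl
    rw [hd, he, sum_leftFam hv ht hz hn, sum_rightFam hw hl hn]
  constructor
  · intro S hS h
    have h1 := hdS N S hS fun c _ k hk => (h k hk c).1
    have h2 := heS N S hS fun c _ k hk => (h k hk c).2
    have := sub_mem h2 h1
    rw [hde] at this
    convert this using 1
    ring
  · intro b h
    have h1 := hdb N b fun c _ k hk => (h k hk c).1
    have h2 := heb N b fun c _ k hk => (h k hk c).2
    have := sub_mem h2 h1
    rw [hde] at this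
    convert this using 1
    ring

variable (tf : TF p Q) {v t w : ℕ → Q} (hv : v 0 = 0) (ht : t 0 = 1)
    (hw : w 0 = 0) (hl : ∀ n, lam p w n = st p (lam p v) t n)

lemma pow_p_mem_ideal {b : Ideal Q} {x : Q} (h : x ∈ b) (j : ℕ) : x ^ p ^ j ∈ b :=
  Ideal.pow_mem_of_mem b h _ (pow_pos (Fact.out : p.Prime).pos _)

lemma leftFam_mem_ideal {b : Ideal Q} {k : ℕ} (hp : (p : Q) ∈ b)
    (hb : ∀ m, 1 ≤ m → m < k → v m ∈ b) (z : ℕ → Q) {c m : ℕ} (h : m < k ∨ c < k) :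
    leftFam (p := p) v t z c m ∈ b := by
  unfold leftFam
  split_ifs with hc
  · exact b.mul_mem_right _ hp
  · unfold shiftSeq
    split_ifs with hcm
    · exact b.mul_mem_right _ (hb c (by omega) (by omega))
    · exact zero_mem _

lemma rightFam_mem_ideal {b : Ideal Q} {c m : ℕ} (h : c ≤ m → w (m - c) ∈ b) :
    rightFam (p := p) t w c m ∈ b := by
  unfold rightFam shiftSeq
  split_ifs with hcm
  · exact b.mul_mem_left _ (pow_p_mem_ideal (h hcm) c)
  · exact zero_mem _

lemma rightFam_zero (ht : t 0 = 1) (m : ℕ) : rightFam (p := p) t w 0 m = w m := by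
  simp [rightFam, shiftSeq, ht]

include tf hv ht hw hl

/-- The right unit preserves the invariant ideals. -/
lemma eta_mem_ideal {b : Ideal Q} {k : ℕ} (hp : (p : Q) ∈ b)
    (hb : ∀ m, 1 ≤ m → m < k → v m ∈ b) {N : ℕ} (hN : N < k) : w N ∈ b := by
  obtain ⟨z, hz0, hz, -⟩ := exists_pt (p := p) v t
  induction N using Nat.strong_induction_on with
  | _ N ih =>
    have key := (exists_fam_comparison tf hv ht hw hl hz0 hz N).2 b fun m hm c =>
      ⟨leftFam_mem_ideal hp hb z (Or.inl (by omega)),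
        rightFam_mem_ideal fun _ => ih _ (by omega) (by omega)⟩
    have h1 : ∑ c ∈ Finset.range (N + 1), leftFam (p := p) v t z c N ∈ b :=
      sum_mem fun c _ => leftFam_mem_ideal hp hb z (Or.inl hN)
    rw [Finset.sum_range_succ' (fun c => rightFam (p := p) t w c N), rightFam_zero ht] at key
    have h2 : ∑ c ∈ Finset.range N, rightFam (p := p) t w (c + 1) N ∈ b :=
      sum_mem fun c _ => rightFam_mem_ideal fun h => ih _ (by omega) (by omega)
    have := sub_mem (sub_mem h1 key) h2
    convert this using 1
    ring

/-- The right unit on the first generator outside of an invariant ideal. -/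
lemma eta_sub_mem_ideal {b : Ideal Q} {k : ℕ} (hk : k ≠ 0) (hp : (p : Q) ∈ b)
    (hb : ∀ m, 1 ≤ m → m < k → v m ∈ b) : w k - v k ∈ b := by
  obtain ⟨z, hz0, hz, -⟩ := exists_pt (p := p) v t
  have hwb : ∀ m < k, w m ∈ b := fun m hm => eta_mem_ideal tf hv ht hw hl hp hb hm
  have key := (exists_fam_comparison tf hv ht hw hl hz0 hz k).2 b fun m hm c =>
    ⟨leftFam_mem_ideal hp hb z (Or.inl hm), rightFam_mem_ideal fun _ => hwb _ (by omega)⟩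
  rw [Finset.sum_range_succ' (fun c => rightFam (p := p) t w c k), rightFam_zero ht,
    Finset.sum_range_succ] at key
  have h1 : ∑ c ∈ Finset.range k, leftFam (p := p) v t z c k ∈ b :=
    sum_mem fun c hc => leftFam_mem_ideal hp hb z (Or.inr (Finset.mem_range.1 hc))
  have h2 : ∑ c ∈ Finset.range k, rightFam (p := p) t w (c + 1) k ∈ b :=
    sum_mem fun c _ => rightFam_mem_ideal fun h => hwb _ (by omega)
  have h3 : leftFam (p := p) v t z k k = v k := by simp [leftFam, shiftSeq, hk, ht]
  rw [h3] at key
  have := sub_mem (sub_mem h1 key) h2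
  convert this using 1
  ring

/-- Membership of the right units in a subring that contains the first variables. -/
lemma eta_mem_subring {b : Ideal Q} {S : Subring Q} (hS : ∀ k, v k ∈ S) (hbS : ∀ x ∈ b, x ∈ S)
    {k j : ℕ} (hp : k ≠ 0 → (p : Q) ∈ b) (hb : ∀ m, 1 ≤ m → m < k → v m ∈ b)
    (htS : ∀ m < j, t m ∈ S) :
    (∀ m < k + j, w m ∈ S) ∧ (j ≠ 0 → w (k + j) - (if k = 0 then p * t j else
      v k * t j ^ p ^ k - v k ^ p ^ j * t j) ∈ S) := by
  obtain ⟨z, hz0, hz, hzS⟩ := exists_pt (p := p) v t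
  have hwb : ∀ m < k, w m ∈ b := fun m hm =>
    eta_mem_ideal tf hv ht hw hl (hp (by omega)) hb hm
  have hz1 : ∀ m < j, z m ∈ S := by
    intro m hm
    rcases Nat.eq_zero_or_pos m with h | h
    · rw [h, hz0]; exact zero_mem _
    · have := add_mem (hzS m (by omega) S hS fun i hi => htS i (by omega)) (htS m hm)
      simpa using this
  have hpz : ∀ x : Q, k ≠ 0 ∨ x ∈ S → (p : Q) * x ∈ S := by
    rintro x (h | h)
    · exact hbS _ (b.mul_mem_right _ (hp h))
    · exact mul_mem (_root_.natCast_mem S p) h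
  have hleft : ∀ m c, c ≠ 0 → (m < k + j ∨ (m = k + j ∧ c ≠ k)) →
      leftFam (p := p) v t z c m ∈ S := by
    intro m c hc0 h
    simp only [leftFam, shiftSeq, if_neg hc0]
    split_ifs with hcm
    · by_cases hck : c < k
      · exact hbS _ (b.mul_mem_right _ (hb c (by omega) hck))
      · exact mul_mem (hS c) (pow_mem (htS _ (by omega)) _)
    · exact zero_mem _
  have hleft0 : ∀ m < k + j, leftFam (p := p) v t z 0 m ∈ S := by
    intro m hm
    simp only [leftFam, if_true]
    refine hpz _ ?_
    by_cases hk : k = 0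
    · exact Or.inr (hz1 m (by omega))
    · exact Or.inl hk
  have hright : ∀ m c, (c ≤ m → k ≤ m - c → w (m - c) ∈ S ∧ t c ∈ S) →
      rightFam (p := p) t w c m ∈ S := by
    intro m c h
    simp only [rightFam, shiftSeq]
    split_ifs with hcm
    · by_cases hk : m - c < k
      · exact hbS _ (b.mul_mem_left _ (pow_p_mem_ideal (hwb _ hk) c))
      · exact mul_mem (h hcm (by omega)).2 (pow_mem (h hcm (by omega)).1 _)
    · exact zero_mem _
  have hwS : ∀ m < k + j, w m ∈ S := by
    intro m
    induction m using Nat.strong_induction_on with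
    | _ m ih =>
      intro hm
      by_cases hmk : m < k
      · exact hbS _ (hwb m hmk)
      have hL : ∀ c i, i ≤ m → leftFam (p := p) v t z c i ∈ S := by
        intro c i hi
        by_cases hc : c = 0
        · rw [hc]; exact hleft0 i (by omega)
        · exact hleft i c hc (Or.inl (by omega))
      have hR : ∀ c i, i ≤ m → (c ≠ 0 ∨ i < m) → rightFam (p := p) t w c i ∈ S := fun c i hi h =>
        hright i c fun h1 h2 => ⟨ih _ (by omega) (by omega), htS _ (by omega)⟩
      have key := (exists_fam_comparison tf hv ht hw hl hz0 hz m).1 S hS fun i hi c =>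
        ⟨hL c i hi.le, hR c i hi.le (Or.inr hi)⟩
      rw [Finset.sum_range_succ' (fun c => rightFam (p := p) t w c m), rightFam_zero ht] at key
      have h1 : ∑ c ∈ Finset.range (m + 1), leftFam (p := p) v t z c m ∈ S :=
        sum_mem fun c _ => hL c m le_rfl
      have h2 : ∑ c ∈ Finset.range m, rightFam (p := p) t w (c + 1) m ∈ S :=
        sum_mem fun c _ => hR (c + 1) m le_rfl (Or.inl (by omega))
      have := sub_mem (sub_mem h1 key) h2
      convert this using 1
      ring
  refine ⟨hwS, fun hj => ?_⟩
  have key := (exists_fam_comparison tf hv ht hw hl hz0 hz (k + j)).1 S hS fun i hi c =>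
    ⟨by
      by_cases hc : c = 0
      · rw [hc]; exact hleft0 i hi
      · exact hleft i c hc (Or.inl hi),
      hright i c fun h1 h2 => ⟨hwS _ (by omega), htS _ (by omega)⟩⟩
  rw [Finset.sum_range_succ' (fun c => rightFam (p := p) t w c (k + j)), rightFam_zero ht] at key
  have hj' : j - 1 ∈ Finset.range (k + j) := by rw [Finset.mem_range]; omega
  have hk' : k ∈ Finset.range (k + j + 1) := by rw [Finset.mem_range]; omega
  rw [← Finset.add_sum_erase _ _ hj', ← Finset.add_sum_erase _ _ hk'] at key
  have h2 : ∑ c ∈ (Finset.range (k + j)).erase (j - 1),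
      rightFam (p := p) t w (c + 1) (k + j) ∈ S := by
    refine sum_mem fun c hc => hright _ _ fun h1 h2 => ?_
    rw [Finset.mem_erase, Finset.mem_range] at hc
    exact ⟨hwS _ (by omega), htS _ (by omega)⟩
  have e2 : rightFam (p := p) t w (j - 1 + 1) (k + j) = t j * w k ^ p ^ j := by
    rw [Nat.sub_add_cancel (by omega)]
    simp [rightFam, shiftSeq]
  rw [e2] at key
  by_cases hk : k = 0
  · subst hk
    have h1 : ∑ c ∈ (Finset.range (0 + j + 1)).erase 0, leftFam (p := p) v t z c (0 + j) ∈ S := by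
      refine sum_mem fun c hc => ?_
      rw [Finset.mem_erase] at hc
      exact hleft _ c hc.1 (Or.inr ⟨rfl, hc.1⟩)
    have h3 : (p : Q) * (z j - t j) ∈ S :=
      mul_mem (_root_.natCast_mem S p) (hzS j hj S hS htS)
    have e1 : leftFam (p := p) v t z 0 (0 + j) = p * z j := by simp [leftFam]
    rw [e1, hw, zero_pow_p, mul_zero] at key
    rw [if_pos rfl]
    have := sub_mem (sub_mem (add_mem h1 h3) key) h2
    convert this using 1
    ring
  · have h1 : ∑ c ∈ (Finset.range (k + j + 1)).erase k, leftFam (p := p) v t z c (k + j) ∈ S := by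
      refine sum_mem fun c hc => ?_
      rw [Finset.mem_erase] at hc
      by_cases hc0 : c = 0
      · subst hc0
        simp only [leftFam, if_true]
        exact hpz _ (Or.inl hk)
      · exact hleft _ c hc0 (Or.inr ⟨rfl, hc.1⟩)
    have e1 : leftFam (p := p) v t z k (k + j) = v k * t j ^ p ^ k := by
      simp [leftFam, shiftSeq, hk]
    have h3 : t j * (w k ^ p ^ j - v k ^ p ^ j) ∈ S := by
      obtain ⟨x, hx⟩ := sub_dvd_pow_sub_pow (w k) (v k) (p ^ j)
      refine hbS _ (b.mul_mem_left _ ?_)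
      rw [hx]
      exact b.mul_mem_right _ (eta_sub_mem_ideal tf hv ht hw hl hk (hp hk) hb)
    rw [e1] at key
    rw [if_neg hk]
    have := sub_mem (sub_mem (sub_mem h1 key) h2) h3
    convert this using 1
    ring

end RightUnitFormula

/-! ## The right unit and the conjugation of `BP_*BP` -/

section RightUnitBP

variable (p : ℕ) [hp : Fact p.Prime]

/-- The invariant ideal `(v_0, …, v_{k-1})`. -/
def invIdeal (k : ℕ) : Ideal (BP p) := Ideal.span (vv p '' Set.Iio k)

lemma vv_mem_invIdeal {m k : ℕ} (h : m < k) : vv p m ∈ invIdeal p k :=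
  Ideal.subset_span ⟨m, h, rfl⟩

/-- The extension of the invariant ideal to `BP_*BP` along the left unit. -/
def invIdealL (k : ℕ) : Ideal (BPBP p) := (invIdeal p k).map (polyC (wt p) (BP p)).hom

lemma C_mem_invIdealL {k : ℕ} {a : BP p} (h : a ∈ invIdeal p k) :
    (polyC (wt p) (BP p)).hom a ∈ invIdealL p k := Ideal.mem_map_of_mem _ h

/-- The polynomials in `t_1, …, t_l`. -/
def lowPoly (l : ℕ) : Subring (BPBP p) :=
  (MvPolynomial.supported (BP p) (Set.Iio l)).toSubring

lemma C_mem_lowPoly (l : ℕ) (a : BP p) : (polyC (wt p) (BP p)).hom a ∈ lowPoly p l :=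
  Subalgebra.algebraMap_mem (MvPolynomial.supported (BP p) (Set.Iio l)) a

lemma ts_mem_lowPoly {m l : ℕ} (h : m ≤ l) : ts p (BP p) m ∈ lowPoly p l := by
  cases m with
  | zero => rw [ts_zero]; exact one_mem _
  | succ m => 
    exact show (MvPolynomial.X m : MvPolynomial ℕ (BP p)) ∈
      MvPolynomial.supported (BP p) (Set.Iio l) from
      Algebra.subset_adjoin ⟨m, show m < l by omega, rfl⟩

/-- The elements that are polynomials in `t_1, …, t_l` modulo an ideal. -/
def lowPolyMod (l : ℕ) (b : Ideal (BPBP p)) : Subring (BPBP p) where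
  carrier := {x | ∃ s ∈ lowPoly p l, x - s ∈ b}
  mul_mem' := by
    rintro x y ⟨s, hs, hx⟩ ⟨r, hr, hy⟩
    refine ⟨s * r, mul_mem hs hr, ?_⟩
    have := add_mem (b.mul_mem_right y hx) (b.mul_mem_left s hy)
    convert this using 1
    ring
  one_mem' := ⟨1, one_mem _, by simp⟩
  add_mem' := by
    rintro x y ⟨s, hs, hx⟩ ⟨r, hr, hy⟩
    refine ⟨s + r, add_mem hs hr, ?_⟩
    have := add_mem hx hy
    convert this using 1
    ring
  zero_mem' := ⟨0, zero_mem _, by simp⟩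
  neg_mem' := by
    rintro x ⟨s, hs, hx⟩
    refine ⟨-s, neg_mem hs, ?_⟩
    have := neg_mem hx
    convert this using 1
    ring

lemma natCast_mem_invIdealL {k : ℕ} (h : k ≠ 0) : (p : BPBP p) ∈ invIdealL p k := by
  have := C_mem_invIdealL p (vv_mem_invIdeal p (Nat.pos_of_ne_zero h))
  have h2 : (polyC (wt p) (BP p)).hom (vv p 0) = (p : BPBP p) := map_natCast _ p
  rwa [h2] at this

lemma vs_mem_invIdealL {k m : ℕ} (h1 : 1 ≤ m) (h : m < k) :
    (polyC (wt p) (BP p)).hom (vs p m) ∈ invIdealL p k := by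
  obtain ⟨i, rfl⟩ : ∃ i, m = i + 1 := ⟨m - 1, by omega⟩
  exact C_mem_invIdealL p (vv_mem_invIdeal p h)

lemma lam_etas' (n : ℕ) : lam p (etas p) n =
    st p (lam p fun k => (polyC (wt p) (BP p)).hom (vs p k)) (ts p (BP p)) n := by
  rw [lam_etas, hom_lam]

lemma polyC_vs_zero : (polyC (wt p) (BP p)).hom (vs p 0) = 0 := by rw [vs_zero, map_zero]

lemma etaR_vv_zero : (etaR p).hom (vv p 0) = (p : BPBP p) := map_natCast _ p

lemma etaR_vv_succ (m : ℕ) : (etaR p).hom (vv p (m + 1)) = etas p (m + 1) := etaR_vs p (m + 1)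

/-- The ideals `(v_0, …, v_{k-1})` are invariant. -/
lemma etaR_mem_invIdealL {m k : ℕ} (h : m < k) : (etaR p).hom (vv p m) ∈ invIdealL p k := by
  cases m with
  | zero => rw [etaR_vv_zero]; exact natCast_mem_invIdealL p (by omega)
  | succ m =>
    rw [etaR_vv_succ]
    exact eta_mem_ideal (BPBP.tf p) (polyC_vs_zero p) (ts_zero p _) (etas_zero p) (lam_etas' p)
      (natCast_mem_invIdealL p (by omega)) (fun i h1 h2 => vs_mem_invIdealL p h1 h2) h

/-- `η_R(v_k) = v_k` modulo `(v_0, …, v_{k-1})`. -/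
lemma etaR_sub_mem_invIdealL (k : ℕ) :
    (etaR p).hom (vv p k) - (polyC (wt p) (BP p)).hom (vv p k) ∈ invIdealL p k := by
  cases k with
  | zero =>
    have h2 : (polyC (wt p) (BP p)).hom (vv p 0) = (p : BPBP p) := map_natCast _ p
    rw [etaR_vv_zero, h2, sub_self]
    exact zero_mem _
  | succ m =>
    rw [etaR_vv_succ]
    exact eta_sub_mem_ideal (BPBP.tf p) (polyC_vs_zero p) (ts_zero p _) (etas_zero p) (lam_etas' p)
      (Nat.succ_ne_zero m) (natCast_mem_invIdealL p (by omega))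
      (fun i h1 h2 => vs_mem_invIdealL p h1 h2)

lemma eta_low_aux (k l : ℕ) :
    (∀ m < k + (l + 1), etas p m ∈ lowPolyMod p l (invIdealL p k)) ∧
    (etas p (k + (l + 1)) - (if k = 0 then (p : BPBP p) * ts p (BP p) (l + 1) else
      (polyC (wt p) (BP p)).hom (vs p k) * ts p (BP p) (l + 1) ^ p ^ k -
        (polyC (wt p) (BP p)).hom (vs p k) ^ p ^ (l + 1) * ts p (BP p) (l + 1)) ∈
          lowPolyMod p l (invIdealL p k)) := by
  have := eta_mem_subring (BPBP.tf p) (polyC_vs_zero p) (ts_zero p _) (etas_zero p) (lam_etas' p)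
    (b := invIdealL p k) (S := lowPolyMod p l (invIdealL p k)) (k := k) (j := l + 1)
    (fun m => ⟨_, C_mem_lowPoly p l _, by rw [sub_self]; exact zero_mem _⟩)
    (fun x hx => ⟨0, zero_mem _, by rwa [sub_zero]⟩) (fun h => natCast_mem_invIdealL p h)
    (fun i h1 h2 => vs_mem_invIdealL p h1 h2)
    (fun m hm => ⟨_, ts_mem_lowPoly p (show m ≤ l by omega), by rw [sub_self]; exact zero_mem _⟩)
  exact ⟨this.1, this.2 (Nat.succ_ne_zero l)⟩

/-- Modulo `(v_0, …, v_{k-1})`, the element `η_R(v_m)` only involves `t_1, …, t_{m-k}`. -/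
lemma exists_low (k l m : ℕ) (h : m ≤ k + l) :
    ∃ s ∈ lowPoly p l, (etaR p).hom (vv p m) - s ∈ invIdealL p k := by
  cases m with
  | zero => exact ⟨p, _root_.natCast_mem _ p, by rw [etaR_vv_zero, sub_self]; exact zero_mem _⟩
  | succ m => rw [etaR_vv_succ]; exact (eta_low_aux p k l).1 (m + 1) (by omega)

/-- Modulo `(v_0, …, v_{k-1})`, the leading term of `η_R(v_{k+l+1})`. -/
lemma exists_lead (k l : ℕ) : ∃ b : BP p, ∃ s ∈ lowPoly p l, (k = 0 → b = 0) ∧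
    (etaR p).hom (vv p (k + l + 1)) - ((polyC (wt p) (BP p)).hom (vv p k) *
      ts p (BP p) (l + 1) ^ p ^ k + (polyC (wt p) (BP p)).hom b * ts p (BP p) (l + 1) + s) ∈
      invIdealL p k := by
  obtain ⟨s, hs, h⟩ := (eta_low_aux p k l).2
  rw [etaR_vv_succ]
  by_cases hk : k = 0
  · subst hk
    refine ⟨0, s, hs, fun _ => rfl, ?_⟩
    have h2 : (polyC (wt p) (BP p)).hom (vv p 0) = (p : BPBP p) := map_natCast _ p
    rw [if_pos rfl] at h
    rw [h2, map_zero, pow_zero, pow_one, zero_mul, add_zero]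
    convert h using 1
    rw [← sub_sub, add_assoc 0 l 1]
  · refine ⟨-vs p k ^ p ^ (l + 1), s, hs, fun h => absurd h hk, ?_⟩
    rw [if_neg hk] at h
    obtain ⟨i, rfl⟩ : ∃ i, k = i + 1 := ⟨k - 1, by omega⟩
    rw [map_neg, map_pow]
    convert h using 1
    rw [add_assoc (i + 1) l 1]
    change _ - ((polyC (wt p) (BP p)).hom (vs p (i + 1)) * _ + _ + _) = _
    ring

lemma exists_conj_ts : ∃ c : ℕ → BPBP p, ∀ n,
    (polyC (wt p) (BP p)).hom (ells p n) =
      st p (fun k => (etaR p).hom (ells p k)) c n := by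
  obtain ⟨c, hc⟩ := exists_inverse (p := p) (fun k => (polyC (wt p) (BP p)).hom (vs p k))
    (ts p (BP p)) (polyC_vs_zero p) (ts_zero p _)
  refine ⟨c, fun n => ?_⟩
  rw [map_lam, hc]
  refine st_congr (fun k _ => ?_) (fun _ _ => rfl)
  rw [etaR_ells, hom_lam]

/-- The conjugates of the elements `t_n`. -/
def conjTs : ℕ → BPBP p := (exists_conj_ts p).choose

lemma st_conjTs (n : ℕ) : st p (fun k => (etaR p).hom (ells p k)) (conjTs p) n =
    (polyC (wt p) (BP p)).hom (ells p n) := ((exists_conj_ts p).choose_spec n).symm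

lemma etaR_ells_zero : (etaR p).hom (ells p 0) = 1 := by
  have : ells p 0 = 1 := lam_zero p _
  rw [this, map_one]

lemma conjTs_zero : conjTs p 0 = 1 := by
  have := st_conjTs p 0
  simpa [st, lam_zero] using this

/-- The conjugation of `BP_*BP`. -/
def conj : BPBP p →+* BPBP p :=
  MvPolynomial.eval₂Hom (R := BP p) (S₁ := BPBP p) (etaR p).hom fun n => conjTs p (n + 1)

lemma conj_C (a : BP p) : conj p ((polyC (wt p) (BP p)).hom a) = (etaR p).hom a :=
  MvPolynomial.eval₂Hom_C (R := BP p) (S₁ := BPBP p) _ _ a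

lemma conj_ts (n : ℕ) : conj p (ts p (BP p) n) = conjTs p n := by
  cases n with
  | zero => rw [ts_zero, map_one, conjTs_zero]
  | succ n => exact MvPolynomial.eval₂Hom_X' (R := BP p) (S₁ := BPBP p) _ _ n

lemma conj_etaR (a : BP p) : conj p ((etaR p).hom a) = (polyC (wt p) (BP p)).hom a := by
  refine BP_ext p (f := (conj p).comp (etaR p).hom) (g := (polyC (wt p) (BP p)).hom) ?_ ?_ a
  · intro r
    change conj p ((etaR p).hom _) = _
    rw [etaR_C, conj_C, etaR_C]
  · refine lam_inj (BPBP.tf p) (v := fun n => conj p ((etaR p).hom (vs p n)))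
      (v' := fun n => (polyC (wt p) (BP p)).hom (vs p n)) ?_ ?_ (fun n => ?_)
    · simp only [vs_zero, map_zero]
    · simp only [vs_zero, map_zero]
    · rw [lam_etaR]
      simp only [conj_C, conj_ts]
      rw [st_conjTs, map_lam]

lemma conj_conj (x : BPBP p) : conj p (conj p x) = x := by
  refine poly_ext (wt p) (f := (conj p).comp (conj p)) (g := RingHom.id _) ?_ ?_ x
  · intro a
    change conj p (conj p ((polyC (wt p) (BP p)).hom a)) = (polyC (wt p) (BP p)).hom a
    rw [conj_C, conj_etaR]
  · intro n
    change conj p (conj p (ts p (BP p) (n + 1))) = ts p (BP p) (n + 1)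
    rw [conj_ts]
    refine st_inj (BPBP.tf p) (s := fun k => (polyC (wt p) (BP p)).hom (ells p k))
      (r := fun n => conj p (conjTs p n)) (by simp only [lam_zero, map_one]) (fun n => ?_) (n + 1)
    have := congrArg (conj p) (st_conjTs p n)
    rw [map_st] at this
    simp only [conj_C, conj_etaR] at this
    rw [this, etaR_ells]

/-- The map `BP_*BP ⊗ BP_*BP → BP_*BP` given by the conjugation on the first factor. -/
def conjMul : BPBP2 p →+* BPBP p :=
  MvPolynomial.eval₂Hom (R := BPBP p) (S₁ := BPBP p) (conj p) fun n => ts p (BP p) (n + 1)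

lemma conjMul_C (x : BPBP p) : conjMul p ((polyC (wt p) (BPBP p)).hom x) = conj p x :=
  MvPolynomial.eval₂Hom_C (R := BPBP p) (S₁ := BPBP p) _ _ x

lemma conjMul_ts (n : ℕ) : conjMul p (ts p (BPBP p) n) = ts p (BP p) n := by
  cases n with
  | zero => rw [ts_zero, map_one, ts_zero]
  | succ n => exact MvPolynomial.eval₂Hom_X' (R := BPBP p) (S₁ := BPBP p) _ _ n

lemma conjMul_map_etaR (x : BPBP p) : conjMul p ((polyMap (wt p) (etaR p)).hom x) = x := by
  refine poly_ext (wt p) (f := (conjMul p).comp (polyMap (wt p) (etaR p)).hom)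
    (g := RingHom.id _) ?_ ?_ x
  · intro a
    change conjMul p ((polyMap (wt p) (etaR p)).hom _) = (polyC (wt p) (BP p)).hom a
    rw [polyMap_C, conjMul_C, conj_etaR]
  · intro n
    change conjMul p ((polyMap (wt p) (etaR p)).hom (ts p (BP p) (n + 1))) = ts p (BP p) (n + 1)
    rw [map_ts, conjMul_ts]

lemma conjMul_Delta (x : BPBP p) :
    conjMul p ((Delta p).hom x) = (etaR p).hom ((eps p).hom x) := by
  refine poly_ext (wt p) (f := (conjMul p).comp (Delta p).hom)
    (g := (etaR p).hom.comp (eps p).hom) ?_ ?_ x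
  · intro a
    change conjMul p ((Delta p).hom ((polyC (wt p) (BP p)).hom a)) =
      (etaR p).hom ((eps p).hom ((polyC (wt p) (BP p)).hom a))
    rw [Delta_C, conjMul_C, conj_C, aug_C]
  · intro n
    change conjMul p ((Delta p).hom (ts p (BP p) (n + 1))) =
      (etaR p).hom ((eps p).hom (ts p (BP p) (n + 1)))
    rw [Delta_ts, aug_ts]
    refine st_inj (BPBP.tf p) (s := fun k => (etaR p).hom (ells p k))
      (r := fun n => conjMul p (deltas p n)) (r' := fun n => (etaR p).hom (dlt n))
      (etaR_ells_zero p) (fun n => ?_) (n + 1)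
    have := congrArg (conjMul p) (congrFun (st_deltas p) n)
    rw [map_st, map_st] at this
    simp only [conjMul_C, conjMul_ts, conj_C, conj_ts, map_st] at this
    have h2 : ∀ k, (conj p) ((polyC (wt p) (BP p)).hom (ells p k)) = (etaR p).hom (ells p k) :=
      fun k => conj_C p _
    rw [this]
    have e : (fun k => (etaR p).hom (dlt k : BP p)) = dlt := by
      funext k
      unfold dlt; split_ifs <;> simp
    rw [e, st_dlt, etaR_ells]
    refine st_congr (fun k _ => ?_) (fun _ _ => rfl)
    exact st_conjTs p k

lemma eps_conj (x : BPBP p) : (eps p).hom (conj p x) = (eps p).hom x := by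
  refine poly_ext (wt p) (f := (eps p).hom.comp (conj p)) (g := (eps p).hom) ?_ ?_ x
  · intro a
    change (eps p).hom (conj p ((polyC (wt p) (BP p)).hom a)) =
      (eps p).hom ((polyC (wt p) (BP p)).hom a)
    rw [conj_C, eps_etaR, aug_C]
  · intro n
    change (eps p).hom (conj p (ts p (BP p) (n + 1))) = (eps p).hom (ts p (BP p) (n + 1))
    rw [conj_ts, aug_ts]
    refine st_inj (BP.tf p) (s := ells p) (r := fun n => (eps p).hom (conjTs p n)) (r' := dlt)
      (lam_zero p _) (fun n => ?_) (n + 1)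
    have := congrArg (eps p).hom (st_conjTs p n)
    rw [map_st] at this
    simp only [eps_etaR, aug_C] at this
    rw [st_dlt]
    exact this

end RightUnitBP

/-! ## Tensor products with ungraded modules -/

section TT

variable {A B : GRing} (f : A.Hom B) (X : Type) [AddCommGroup X] [Module A X]

/-- The tensor product of `B` with an ungraded module. -/
def TT : Type := TensorProduct A (Tw f) X

instance : AddCommGroup (TT f X) := inferInstanceAs (AddCommGroup (TensorProduct A (Tw f) X))
instance : Module B (TT f X) := inferInstanceAs (Module (Tw f) (TensorProduct A (Tw f) X))

variable {X}

/-- Pure tensors. -/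
def tt (b : B) (x : X) : TT f X := TensorProduct.tmul A (show Tw f from b) x

lemma tt_add (b : B) (x y : X) : tt f b (x + y) = tt f b x + tt f b y :=
  TensorProduct.tmul_add _ _ _
lemma add_tt (b b' : B) (x : X) : tt f (b + b') x = tt f b x + tt f b' x :=
  TensorProduct.add_tmul _ _ _
lemma zero_tt (x : X) : tt f 0 x = 0 := TensorProduct.zero_tmul _ _
lemma tt_zero (b : B) : tt f b (0 : X) = 0 := TensorProduct.tmul_zero _ _
lemma tt_smul (b : B) (a : A) (x : X) : tt f b (a • x) = tt f (b * f.hom a) x := by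
  refine (TensorProduct.tmul_smul _ _ _).trans ((TensorProduct.smul_tmul' _ _ _).trans ?_)
  rw [mul_comm]; rfl
lemma smul_tt (b b' : B) (x : X) : b • tt f b' x = tt f (b * b') x := rfl

/-- Pure tensors, as a homomorphism in the second variable. -/
def ttHom (b : B) : X →+ TT f X where
  toFun := tt f b
  map_zero' := tt_zero f b
  map_add' := tt_add f b

@[elab_as_elim]
lemma TT.induction {P : TT f X → Prop} (x : TT f X) (tt : ∀ b m, P (tt f b m))
    (add : ∀ y z, P y → P z → P (y + z)) : P x :=
  TensorProduct.induction_on (motive := P) x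
    (by have := tt 0 0; rw [zero_tt] at this; exact this) tt add

/-- The universal property of the tensor product. -/
def TT.lift {Y : Type} [AddCommGroup Y] (φ : B →+ X →+ Y)
    (h : ∀ b a x, φ (b * f.hom a) x = φ b (a • x)) : TT f X →+ Y :=
  TensorProduct.liftAddHom (R := A) (M := Tw f) (N := X) φ (by
    intro a b m
    exact (congrArg (fun c : B => φ c m) (mul_comm (f.hom a) b)).trans (h b a m))

variable {Y Z : Type} [AddCommGroup Y] [Module A Y] [AddCommGroup Z] [Module A Z]

/-- The map on tensor products induced by a linear map. -/
def ttMap (g : X →ₗ[A] Y) : TT f X →ₗ[B] TT f Y := (LinearMap.baseChange (Tw f) g :)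

@[simp] lemma ttMap_tt (g : X →ₗ[A] Y) (b : B) (x : X) : ttMap f g (tt f b x) = tt f b (g x) :=
  rfl

lemma ttMap_comp (g : X →ₗ[A] Y) (h : Y →ₗ[A] Z) (x : TT f X) :
    ttMap f (h.comp g) x = ttMap f h (ttMap f g x) := by
  induction x using TT.induction with
  | tt b x => rfl
  | add y z hy hz => rw [map_add, map_add, map_add, hy, hz]

lemma ttMap_surjective (g : X →ₗ[A] Y) (hg : Function.Surjective g) :
    Function.Surjective (ttMap f g) := LinearMap.lTensor_surjective (Tw f) hg

lemma ttMap_exact (g : X →ₗ[A] Y) (h : Y →ₗ[A] Z) (hgh : Function.Exact g h)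
    (hh : Function.Surjective h) (y : TT f Y) (hy : ttMap f h y = 0) : ∃ x, ttMap f g x = y :=
  (lTensor_exact (Tw f) hgh hh y).1 hy

/-- A ring homomorphism over the base ring induces a map on tensor products. -/
def ttChange {C : GRing} (g : B →+* C) (k : A.Hom C) (h : ∀ a, k.hom a = g (f.hom a)) :
    TT f X →+ TT k X :=
  TT.lift f
    { toFun := fun b => ttHom k (g b)
      map_zero' := by
        ext x
        change tt k (g 0) x = 0
        rw [map_zero, zero_tt]
      map_add' := fun b b' => by
        ext x
        change tt k (g (b + b')) x = tt k (g b) x + tt k (g b') x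
        rw [map_add, add_tt] }
    (fun b a x => by
      change tt k (g (b * f.hom a)) x = tt k (g b) (a • x)
      rw [tt_smul, map_mul, h])

@[simp] lemma ttChange_tt {C : GRing} (g : B →+* C) (k : A.Hom C)
    (h : ∀ a, k.hom a = g (f.hom a)) (b : B) (x : X) :
    ttChange f g k h (tt f b x) = tt k (g b) x := rfl

lemma ttChange_smul {C : GRing} (g : B →+* C) (k : A.Hom C) (h : ∀ a, k.hom a = g (f.hom a))
    (b : B) (x : TT f X) : ttChange f g k h (b • x) = g b • ttChange f g k h x := by
  induction x using TT.induction with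
  | tt b' x =>
    rw [smul_tt, ttChange_tt, ttChange_tt, smul_tt, map_mul]
  | add y z hy hz => rw [smul_add, map_add, map_add, smul_add, hy, hz]

lemma ttChange_ttMap {C : GRing} (g : B →+* C) (k : A.Hom C) (h : ∀ a, k.hom a = g (f.hom a))
    (u : X →ₗ[A] Y) (x : TT f X) :
    ttChange f g k h (ttMap f u x) = ttMap k u (ttChange f g k h x) := by
  induction x using TT.induction with
  | tt b' x => rfl
  | add y z hy hz => rw [map_add, map_add, map_add, map_add, hy, hz]

lemma ext_map_eq_ttMap {M N : GMod A} (g : M ⟶ N) (x : Ten f M) :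
    (((ext f).map g).lin x : Ten f N) = ttMap f g.lin (show TT f M from x) :=
  ext_map_eq_lTensor f g x

end TT

/-! ## Coefficients -/

section Coeff

variable {ι : Type} {w : ι → ℤ} {R : GRing} {X Y : Type} [AddCommGroup X] [Module R X]
  [AddCommGroup Y] [Module R Y]

variable (w R) in
/-- The tensor product of a polynomial ring with a module. -/
abbrev PT (X : Type) [AddCommGroup X] [Module R X] : Type := TT (polyC w R) X

/-- The coefficient of a polynomial. -/
def pcoeff (E : ι →₀ ℕ) : poly w R →+ R :=
  (MvPolynomial.lcoeff R E : MvPolynomial ι R →ₗ[R] R).toAddMonoidHom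

lemma pcoeff_mono [DecidableEq ι] (E F : ι →₀ ℕ) (r : R) :
    pcoeff F (polyMono w R E r) = if E = F then r else 0 := MvPolynomial.coeff_monomial F E r

lemma pcoeff_mul_C (E : ι →₀ ℕ) (b : poly w R) (r : R) :
    pcoeff E (b * (polyC w R).hom r) = pcoeff E b * r := by
  rw [mul_comm, mul_comm _ r]
  exact MvPolynomial.coeff_C_mul (R := R) E r b

/-- The coefficients of an element of `R[t] ⊗ X`. -/
def cf : PT w R X →+ ((ι →₀ ℕ) →₀ X) :=
  TT.lift (polyC w R)
    { toFun := fun b =>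
        { toFun := fun x => Finsupp.mapRange (fun r : R => r • x) (zero_smul _ _)
            (Finsupp.onFinset (MvPolynomial.support (show MvPolynomial ι R from b))
              (fun E => pcoeff E b) fun E h => MvPolynomial.mem_support_iff.2 h)
          map_zero' := by ext E; simp
          map_add' := fun x y => by ext E; simp }
      map_zero' := by ext x E; simp
      map_add' := fun b b' => by ext x E; simp [add_smul] }
    (fun b a x => by
      ext E
      change pcoeff E (b * (polyC w R).hom a) • x = pcoeff E b • a • x
      rw [pcoeff_mul_C, mul_smul])

lemma cf_tt (b : poly w R) (x : X) (E : ι →₀ ℕ) : cf (tt (polyC w R) b x) E = pcoeff E b • x := rfl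

lemma cf_mono (E : ι →₀ ℕ) (r : R) (x : X) :
    cf (tt (polyC w R) (polyMono w R E r) x) = Finsupp.single E (r • x) := by
  classical
  ext F
  rw [cf_tt, pcoeff_mono, Finsupp.single_apply]
  split_ifs
  · rfl
  · rw [zero_smul]

lemma PT_induction {P : PT w R X → Prop} (z : PT w R X)
    (mono : ∀ E x, P (tt (polyC w R) (polyMono w R E 1) x))
    (add : ∀ y z, P y → P z → P (y + z)) : P z := by
  induction z using TT.induction with
  | tt b x =>
    induction b using poly_induction with
    | mono E r =>
      have := mono E (r • x)
      rwa [tt_smul, polyMono_mul_C, one_mul] at this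
    | add b c hb hc => rw [add_tt]; exact add _ _ hb hc
  | add y z hy hz => exact add _ _ hy hz

/-- The element of `R[t] ⊗ X` with given coefficients. -/
def ofCf : ((ι →₀ ℕ) →₀ X) →+ PT w R X :=
  Finsupp.liftAddHom fun E => ttHom (polyC w R) (polyMono w R E 1)

lemma ofCf_single (E : ι →₀ ℕ) (x : X) :
    ofCf (Finsupp.single E x) = tt (polyC w R) (polyMono w R E 1) x :=
  Finsupp.liftAddHom_apply_single _ _ _

lemma ofCf_cf (z : PT w R X) : ofCf (cf z) = z := by
  induction z using PT_induction with
  | mono E x => rw [cf_mono, one_smul, ofCf_single]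
  | add y z hy hz => rw [map_add, map_add, hy, hz]

lemma cf_ofCf (c : (ι →₀ ℕ) →₀ X) : cf (ofCf c : PT w R X) = c := by
  induction c using Finsupp.induction_linear with
  | zero => rw [map_zero, map_zero]
  | add f g hf hg => rw [map_add, map_add, hf, hg]
  | single E x => rw [ofCf_single, cf_mono, one_smul]

lemma PT_ext {y z : PT w R X} (h : ∀ E, cf y E = cf z E) : y = z := by
  rw [← ofCf_cf y, ← ofCf_cf z, Finsupp.ext h]

lemma cf_ttMap (g : X →ₗ[R] Y) (z : PT w R X) (E : ι →₀ ℕ) :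
    cf (ttMap (polyC w R) g z) E = g (cf z E) := by
  induction z using TT.induction with
  | tt b x => rw [ttMap_tt, cf_tt, cf_tt, map_smul]
  | add y z hy hz => rw [map_add, map_add, map_add, Finsupp.add_apply, hy, hz, Finsupp.add_apply,
      map_add]

lemma ttMap_injective (g : X →ₗ[R] Y) (hg : Function.Injective g) :
    Function.Injective (ttMap (polyC w R) g) := fun y z h => PT_ext fun E => hg (by
  rw [← cf_ttMap, ← cf_ttMap, h])

lemma mem_range_ttMap_subtype (K : Submodule R X) (z : PT w R X) (h : ∀ E, cf z E ∈ K) :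
    ∃ y, ttMap (polyC w R) K.subtype y = z := by
  classical
  refine ⟨ofCf ((cf z).sum fun E x => if hx : x ∈ K then Finsupp.single E ⟨x, hx⟩ else 0),
    PT_ext fun E => ?_⟩
  rw [cf_ttMap, cf_ofCf, Finsupp.sum, Finsupp.finsetSum_apply, map_sum]
  rw [Finset.sum_eq_single E]
  · rw [dif_pos (h E), Finsupp.single_eq_same]; rfl
  · intro F _ hF
    split_ifs
    · rw [Finsupp.single_apply, if_neg hF, map_zero]
    · simp
  · intro hE
    rw [Finsupp.notMem_support_iff] at hE
    rw [dif_pos (h E), Finsupp.single_eq_same]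
    exact hE

lemma cf_C_smul (a : R) (z : PT w R X) (E : ι →₀ ℕ) :
    cf ((polyC w R).hom a • z) E = a • cf z E := by
  induction z using TT.induction with
  | tt b x =>
    rw [smul_tt, mul_comm, cf_tt, pcoeff_mul_C, cf_tt, mul_comm, mul_smul]
  | add y z hy hz => rw [smul_add, map_add, map_add, Finsupp.add_apply, hy, hz, Finsupp.add_apply,
      smul_add]

lemma cf_smul [DecidableEq ι] (b : poly w R) (z : PT w R X) (E : ι →₀ ℕ) :
    cf (b • z) E = ∑ x ∈ Finset.HasAntidiagonal.antidiagonal E, pcoeff x.1 b • cf z x.2 := by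
  induction z using TT.induction with
  | tt b' x =>
    rw [smul_tt, cf_tt]
    have : pcoeff E (b * b') = ∑ x ∈ Finset.HasAntidiagonal.antidiagonal E,
        pcoeff x.1 b * pcoeff x.2 b' := MvPolynomial.coeff_mul (R := R) b b' E
    rw [this, Finset.sum_smul]
    exact Finset.sum_congr rfl fun y _ => by rw [cf_tt, mul_smul]
  | add y z hy hz =>
    rw [smul_add, map_add, map_add, Finsupp.add_apply, hy, hz, ← Finset.sum_add_distrib]
    exact Finset.sum_congr rfl fun y _ => by rw [Finsupp.add_apply, smul_add]

lemma cf_pow_smul (a : R) (s : ℕ) (z : PT w R X) (E : ι →₀ ℕ) :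
    cf ((polyC w R).hom a ^ s • z) E = a ^ s • cf z E := by rw [← map_pow, cf_C_smul]

/-- A uniform exponent for the coefficients. -/
lemma exists_pow_C_smul {a : R} {z : PT w R X} (h : ∀ E, ∃ s : ℕ, a ^ s • cf z E = 0) :
    ∃ s : ℕ, (polyC w R).hom a ^ s • z = 0 := by
  choose s hs using h
  refine ⟨(cf z).support.sup s, PT_ext fun E => ?_⟩
  rw [cf_pow_smul, map_zero, Finsupp.zero_apply]
  by_cases hE : E ∈ (cf z).support
  · obtain ⟨k, hk⟩ := Nat.exists_eq_add_of_le (Finset.le_sup (f := s) hE)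
    rw [hk, add_comm, pow_add, mul_smul, hs, smul_zero]
  · rw [Finsupp.notMem_support_iff.1 hE, smul_zero]

/-- A multiplier with constant term `a` can be divided out with respect to an `a`-saturated
submodule. -/
lemma cf_mem_of_smul (K : Submodule R X) {b : poly w R} {z : PT w R X}
    (hK : ∀ x, pcoeff 0 b • x ∈ K → x ∈ K) (h : ∀ E, cf (b • z) E ∈ K) (E : ι →₀ ℕ) :
    cf z E ∈ K := by
  classical
  induction hd : E.degree using Nat.strong_induction_on generalizing E with
  | _ d ih =>
    have h1 := h E
    rw [cf_smul, ← Finset.add_sum_erase _ _ (show (0, E) ∈ Finset.HasAntidiagonal.antidiagonal E by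
      simp)] at h1
    refine hK _ ?_
    refine (Submodule.add_mem_iff_left K (Submodule.sum_mem K fun x hx => ?_)).1 h1
    rw [Finset.mem_erase, Finset.HasAntidiagonal.mem_antidiagonal] at hx
    refine K.smul_mem _ (ih x.2.degree ?_ x.2 rfl)
    have h2 : x.1.degree + x.2.degree = d := by rw [← hd, ← hx.2, map_add]
    have h3 : x.1.degree ≠ 0 := by
      intro h0
      rw [Finsupp.degree_eq_zero_iff] at h0
      exact hx.1 (Prod.ext h0 (by simpa [h0] using hx.2))
    omega

/-- Elements of the extension of an ideal act nilpotently if the generators do. -/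
lemma exists_pow_smul_of_mem_map {I : Ideal R} {S : Set R} (hI : I = Ideal.span S) {z : PT w R X}
    (h : ∀ a ∈ S, ∃ s : ℕ, (polyC w R).hom a ^ s • z = 0) {b : poly w R}
    (hb : b ∈ I.map (polyC w R).hom) : ∃ s : ℕ, b ^ s • z = 0 := by
  have : I.map (polyC w R).hom ≤ (Ideal.torsionOf (poly w R) (PT w R X) z).radical := by
    rw [hI, Ideal.map_span, Ideal.span_le]
    rintro _ ⟨a, ha, rfl⟩
    exact h a ha
  exact this hb

end Coeff

/-! ## Division by polynomials with a given leading term -/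

section Division

variable {ι : Type} {w : ι → ℤ} {R : GRing} {X Y : Type} [AddCommGroup X] [Module R X]
  [AddCommGroup Y] [Module R Y]

open Classical in
/-- The coefficient of `X_l ^ e`, as a polynomial in the other variables. -/
def kap (l : ι) (e : ℕ) : MvPolynomial ι R →ₗ[R] MvPolynomial ι R :=
  (MvPolynomial.basisMonomials ι R).constr R fun E =>
    if E l = e then MvPolynomial.monomial (E.erase l) 1 else 0

open Classical in
lemma kap_monomial (l : ι) (e : ℕ) (E : ι →₀ ℕ) (r : R) :
    kap l e (MvPolynomial.monomial E r) =
      if E l = e then MvPolynomial.monomial (E.erase l) r else 0 := by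
  have h : MvPolynomial.monomial E r = r • MvPolynomial.basisMonomials ι R E := by
    rw [MvPolynomial.coe_basisMonomials, MvPolynomial.smul_monomial, smul_eq_mul, mul_one]
  rw [h, map_smul, kap, Module.Basis.constr_basis]
  split_ifs
  · rw [MvPolynomial.smul_monomial, smul_eq_mul, mul_one]
  · rw [smul_zero]

lemma kap_X_mul (l : ι) (e : ℕ) (f : MvPolynomial ι R) :
    kap l (e + 1) (MvPolynomial.X l * f) = kap l e f := by
  classical
  induction f using MvPolynomial.induction_on' with
  | monomial E r =>
    rw [MvPolynomial.X, MvPolynomial.monomial_mul, one_mul, kap_monomial, kap_monomial]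
    have h1 : (Finsupp.single l 1 + E : ι →₀ ℕ) l = E l + 1 := by simp [add_comm]
    have h2 : (Finsupp.single l 1 + E).erase l = E.erase l := by
      rw [Finsupp.erase_add, Finsupp.erase_single, zero_add]
    rw [h1, h2]
    simp
  | add p q hp hq => rw [mul_add, map_add, map_add, hp, hq]

lemma kap_mul_of_supported {l : ι} {T : Set ι} (hl : l ∉ T) (e : ℕ) {s : MvPolynomial ι R}
    (hs : s ∈ MvPolynomial.supported R T) (f : MvPolynomial ι R) :
    kap l e (s * f) = s * kap l e f := by
  classical
  induction hs using Algebra.adjoin_induction generalizing f with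
  | mem x hx =>
    obtain ⟨i, hi, rfl⟩ := hx
    have hil : i ≠ l := fun h => hl (h ▸ hi)
    induction f using MvPolynomial.induction_on' with
    | monomial E r =>
      rw [MvPolynomial.X, MvPolynomial.monomial_mul, one_mul, kap_monomial, kap_monomial]
      have h1 : (Finsupp.single i 1 + E : ι →₀ ℕ) l = E l := by simp [hil]
      have h2 : (Finsupp.single i 1 + E).erase l = Finsupp.single i 1 + E.erase l := by
        rw [Finsupp.erase_add, Finsupp.erase_of_notMem_support]
        rw [Finsupp.notMem_support_iff, Finsupp.single_apply, if_neg hil]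
      rw [h1, h2]
      split_ifs
      · rw [MvPolynomial.monomial_mul, one_mul]
      · rw [mul_zero]
    | add p q hp hq => rw [mul_add, map_add, map_add, hp, hq, mul_add]
  | algebraMap r =>
    rw [MvPolynomial.algebraMap_eq, ← MvPolynomial.smul_eq_C_mul, ← MvPolynomial.smul_eq_C_mul,
      map_smul]
  | add x y _ _ hx hy => rw [add_mul, map_add, hx, hy, add_mul]
  | mul x y _ _ hx hy => rw [mul_assoc, hx, hy, mul_assoc]

lemma exists_eq_sum_kap (l : ι) (f : MvPolynomial ι R) : ∃ N, ∀ M, N ≤ M →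
    f = ∑ e ∈ Finset.range M, MvPolynomial.X l ^ e * kap l e f ∧ kap l M f = 0 := by
  classical
  induction f using MvPolynomial.induction_on' with
  | monomial E r =>
    refine ⟨E l + 1, fun M hM => ⟨?_, ?_⟩⟩
    · rw [Finset.sum_eq_single (E l)]
      · rw [kap_monomial, if_pos rfl, MvPolynomial.X_pow_eq_monomial, MvPolynomial.monomial_mul,
          one_mul, Finsupp.single_add_erase]
      · intro e _ he
        rw [kap_monomial, if_neg he.symm, mul_zero]
      · intro h
        exact absurd (Finset.mem_range.2 (by omega)) h
    · rw [kap_monomial, if_neg (by omega)]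
  | add p q hp hq =>
    obtain ⟨N, hN⟩ := hp
    obtain ⟨N', hN'⟩ := hq
    refine ⟨max N N', fun M hM => ⟨?_, ?_⟩⟩
    · conv_lhs => rw [(hN M (by omega)).1, (hN' M (by omega)).1]
      rw [← Finset.sum_add_distrib]
      exact Finset.sum_congr rfl fun e _ => by rw [map_add, mul_add]
    · rw [map_add, (hN M (by omega)).2, (hN' M (by omega)).2, add_zero]

/-- The operation `kap` on a graded polynomial ring. -/
def kapP (l : ι) (e : ℕ) : poly w R →+ poly w R :=
  (kap l e : MvPolynomial ι R →ₗ[R] MvPolynomial ι R).toAddMonoidHom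

lemma kapP_mul_C (l : ι) (e : ℕ) (b : poly w R) (a : R) :
    kapP l e (b * (polyC w R).hom a) = kapP l e b * (polyC w R).hom a := by
  have h : ∀ f : MvPolynomial ι R,
      kap l e (f * MvPolynomial.C a) = kap l e f * MvPolynomial.C a := by
    intro f
    rw [mul_comm, ← MvPolynomial.smul_eq_C_mul, map_smul, MvPolynomial.smul_eq_C_mul, mul_comm]
  exact h b

/-- The operation `kap` on tensor products. -/
def kapT (l : ι) (e : ℕ) : PT w R X →+ PT w R X :=
  TT.lift (polyC w R)
    { toFun := fun b => ttHom (polyC w R) (kapP l e b)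
      map_zero' := by
        ext x
        change tt (polyC w R) (kapP l e 0) x = 0
        rw [map_zero, zero_tt]
      map_add' := fun b b' => by
        ext x
        change tt (polyC w R) (kapP l e (b + b')) x = tt (polyC w R) (kapP l e b) x +
          tt (polyC w R) (kapP l e b') x
        rw [map_add, add_tt] }
    (fun b a x => by
      change tt (polyC w R) (kapP l e (b * (polyC w R).hom a)) x =
        tt (polyC w R) (kapP l e b) (a • x)
      rw [tt_smul, kapP_mul_C])

lemma kapT_tt (l : ι) (e : ℕ) (b : poly w R) (x : X) : kapT l e (tt (polyC w R) b x) =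
    tt (polyC w R) (kapP l e b) x := rfl

lemma kapT_X_smul (l : ι) (e : ℕ) (z : PT w R X) :
    kapT l (e + 1) (polyX w R l • z) = kapT l e z := by
  induction z using TT.induction with
  | tt b x =>
    rw [smul_tt, kapT_tt, kapT_tt]
    exact congrArg (fun c : poly w R => tt (polyC w R) c x) (kap_X_mul (R := R) l e b)
  | add y z hy hz => rw [smul_add, map_add, map_add, hy, hz]

lemma kapT_X_pow_smul (l : ι) (e q : ℕ) (z : PT w R X) :
    kapT l (e + q) (polyX w R l ^ q • z) = kapT l e z := by
  induction q with
  | zero => rw [pow_zero, one_smul, add_zero]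
  | succ q ih => rw [pow_succ', mul_smul, ← add_assoc, kapT_X_smul, ih]

lemma kapT_smul_of_supported {l : ι} {T : Set ι} (hl : l ∉ T) (e : ℕ) {s : poly w R}
    (hs : (show MvPolynomial ι R from s) ∈ MvPolynomial.supported R T) (z : PT w R X) :
    kapT l e (s • z) = s • kapT l e z := by
  induction z using TT.induction with
  | tt b x =>
    rw [smul_tt, kapT_tt, kapT_tt, smul_tt]
    exact congrArg (fun c : poly w R => tt (polyC w R) c x) (kap_mul_of_supported hl e hs b)
  | add y z hy hz => rw [smul_add, map_add, map_add, hy, hz, smul_add]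

lemma kapT_C_smul (l : ι) (e : ℕ) (a : R) (z : PT w R X) :
    kapT l e ((polyC w R).hom a • z) = (polyC w R).hom a • kapT l e z :=
  kapT_smul_of_supported (Set.notMem_empty l) e
    (Subalgebra.algebraMap_mem (MvPolynomial.supported R (∅ : Set ι)) a) z

lemma exists_eq_sum_kapT (l : ι) (z : PT w R X) : ∃ N, ∀ M, N ≤ M →
    z = ∑ e ∈ Finset.range M, polyX w R l ^ e • kapT l e z ∧ kapT l M z = 0 := by
  induction z using TT.induction with
  | tt b x =>
    obtain ⟨N, hN⟩ := exists_eq_sum_kap (R := R) l b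
    refine ⟨N, fun M hM => ⟨?_, ?_⟩⟩
    · simp only [kapT_tt, smul_tt]
      have h1 : ∀ (s : Finset ℕ) (c : ℕ → poly w R),
          ∑ e ∈ s, tt (polyC w R) (c e) x = tt (polyC w R) (∑ e ∈ s, c e) x := by
        classical
        intro s c
        induction s using Finset.induction_on with
        | empty => rw [Finset.sum_empty, Finset.sum_empty, zero_tt]
        | insert e s he ih => rw [Finset.sum_insert he, Finset.sum_insert he, ih, add_tt]
      rw [h1]
      exact congrArg (fun c : poly w R => tt (polyC w R) c x) (hN M hM).1
    · rw [kapT_tt]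
      exact (congrArg (fun c : poly w R => tt (polyC w R) c x) (hN M hM).2).trans (zero_tt _ _)
  | add y z hy hz =>
    obtain ⟨N, hN⟩ := hy
    obtain ⟨N', hN'⟩ := hz
    refine ⟨max N N', fun M hM => ⟨?_, ?_⟩⟩
    · conv_lhs => rw [(hN M (by omega)).1, (hN' M (by omega)).1]
      rw [← Finset.sum_add_distrib]
      exact Finset.sum_congr rfl fun e _ => by rw [map_add, smul_add]
    · rw [map_add, (hN M (by omega)).2, (hN' M (by omega)).2, add_zero]

/-- Division by a polynomial with leading term `a X_l ^ q`. -/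
lemma exists_pow_smul_mem_of_lead {l : ι} {T : Set ι} (hl : l ∉ T)
    (G : Submodule (poly w R) (PT w R X)) (hG : ∀ e, ∀ z ∈ G, kapT l e z ∈ G) (a b : R) {q : ℕ}
    (hq : q ≠ 0) (hb : q = 1 → b = 0) {s i : poly w R}
    (hs : (show MvPolynomial ι R from s) ∈ MvPolynomial.supported R T)
    (hi : ∀ z : PT w R X, i • z ∈ G) (z : PT w R X)
    (h : ((polyC w R).hom a * polyX w R l ^ q + (polyC w R).hom b * polyX w R l + s + i) • z ∈ G) :
    ∃ r : ℕ, (polyC w R).hom a ^ r • z ∈ G := by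
  have key : ∀ N (z : PT w R X), (∀ e, N ≤ e → kapT l e z ∈ G) →
      ((polyC w R).hom a * polyX w R l ^ q + (polyC w R).hom b * polyX w R l + s + i) • z ∈ G →
      ∃ r : ℕ, (polyC w R).hom a ^ r • z ∈ G := by
    intro N
    induction N with
    | zero =>
      intro z hz _
      obtain ⟨M, hM⟩ := exists_eq_sum_kapT l z
      refine ⟨0, ?_⟩
      rw [pow_zero, one_smul, (hM M le_rfl).1]
      exact sum_mem fun e _ => G.smul_mem _ (hz e (Nat.zero_le _))
    | succ N ih =>
      intro z hz h
      have h1 := hG (N + q) _ h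
      rw [add_smul, add_smul, add_smul, mul_smul, mul_smul, map_add, map_add, map_add,
        kapT_C_smul, kapT_C_smul, kapT_X_pow_smul, kapT_smul_of_supported hl _ hs] at h1
      have h2 : (polyC w R).hom b • kapT l (N + q) (polyX w R l • z) ∈ G := by
        by_cases hq1 : q = 1
        · rw [hb hq1, map_zero, zero_smul]; exact zero_mem _
        · obtain ⟨q', rfl⟩ : ∃ q', q = q' + 2 := ⟨q - 2, by omega⟩
          rw [show N + (q' + 2) = N + q' + 1 + 1 by omega, kapT_X_smul]
          exact G.smul_mem _ (hz _ (by omega))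
      have h3 : (polyC w R).hom a • kapT l N z ∈ G := by
        have := sub_mem (sub_mem (sub_mem h1 (hG (N + q) _ (hi z)))
          (G.smul_mem s (hz (N + q) (by omega)))) h2
        convert this using 1
        abel
      obtain ⟨r, hr⟩ := ih ((polyC w R).hom a • z) (fun e he => by
        rw [kapT_C_smul]
        rcases eq_or_lt_of_le he with rfl | he
        · exact h3
        · exact G.smul_mem _ (hz e he)) (by rw [smul_comm]; exact G.smul_mem _ h)
      exact ⟨r + 1, by rw [pow_succ, mul_smul]; exact hr⟩
  obtain ⟨N, hN⟩ := exists_eq_sum_kapT l z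
  exact key N z (fun e he => by rw [(hN e he).2]; exact zero_mem _) h

end Division

/-! ## Submodules generated by multiples -/

section Multiples

variable {B : Type} [CommRing B] (g : ℕ → B) (M : Type) [AddCommGroup M] [Module B M]

/-- The submodule `(g_0, …, g_{m-1}) M`. -/
def multiples (m : ℕ) : Submodule B M where
  carrier := {z | ∃ y : ℕ → M, z = ∑ i ∈ Finset.range m, g i • y i}
  zero_mem' := ⟨0, by simp⟩
  add_mem' := by
    rintro _ _ ⟨y, rfl⟩ ⟨y', rfl⟩
    exact ⟨y + y', by simp [Finset.sum_add_distrib]⟩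
  smul_mem' := by
    rintro c _ ⟨y, rfl⟩
    exact ⟨fun i => c • y i, by
      rw [Finset.smul_sum]
      exact Finset.sum_congr rfl fun i _ => smul_comm _ _ _⟩

variable {g M}

lemma multiples_mono {m m' : ℕ} (h : m ≤ m') : multiples g M m ≤ multiples g M m' := by
  rintro _ ⟨y, rfl⟩
  refine ⟨fun i => if i < m then y i else 0, ?_⟩
  rw [← Finset.sum_subset (Finset.range_mono h)]
  · refine Finset.sum_congr rfl fun i hi => ?_
    beta_reduce
    rw [if_pos (Finset.mem_range.1 hi)]
  · intro i _ hi
    beta_reduce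
    rw [if_neg (fun h => hi (Finset.mem_range.2 h)), smul_zero]

lemma smul_mem_multiples {m i : ℕ} (h : i < m) (y : M) : g i • y ∈ multiples g M m := by
  refine ⟨fun j => if j = i then y else 0, ?_⟩
  rw [Finset.sum_eq_single i]
  · beta_reduce
    rw [if_pos rfl]
  · intro j _ hj
    beta_reduce
    rw [if_neg hj, smul_zero]
  · intro hi
    exact absurd (Finset.mem_range.2 h) hi

lemma multiples_succ {m : ℕ} {z : M} (h : z ∈ multiples g M (m + 1)) :
    ∃ y, z - g m • y ∈ multiples g M m := by
  obtain ⟨y, rfl⟩ := h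
  exact ⟨y m, y, by rw [Finset.sum_range_succ, add_sub_cancel_right]⟩

lemma exists_mem_multiples {z : M}
    (h : z ∈ Ideal.span (Set.range g) • (⊤ : Submodule B M)) : ∃ m, z ∈ multiples g M m := by
  have hadd : ∀ x y : M, (∃ m, x ∈ multiples g M m) → (∃ m, y ∈ multiples g M m) →
      ∃ m, x + y ∈ multiples g M m := by
    rintro x y ⟨m, hm⟩ ⟨m', hm'⟩
    exact ⟨max m m', add_mem (multiples_mono (le_max_left _ _) hm)
      (multiples_mono (le_max_right _ _) hm')⟩
  refine Submodule.smul_induction_on h (fun r hr y _ => ?_) hadd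
  clear * - hr hadd
  induction hr using Submodule.span_induction generalizing y with
  | mem x hx =>
    obtain ⟨i, rfl⟩ := hx
    exact ⟨i + 1, smul_mem_multiples (Nat.lt_succ_self i) y⟩
  | zero => exact ⟨0, by rw [zero_smul]; exact zero_mem _⟩
  | add x x' _ _ hx hx' => rw [add_smul]; exact hadd _ _ (hx y) (hx' y)
  | smul c x _ hx => rw [smul_eq_mul, mul_comm, mul_smul]; exact hx (c • y)

lemma map_mem_multiples {M' : Type} [AddCommGroup M'] [Module B M'] (f : M →ₗ[B] M') {m : ℕ} {z : M}
    (h : z ∈ multiples g M m) : f z ∈ multiples g M' m := by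
  obtain ⟨y, rfl⟩ := h
  exact ⟨fun i => f (y i), by simp⟩

lemma multiples_map_surjective {M' : Type} [AddCommGroup M'] [Module B M'] (f : M →ₗ[B] M')
    (hf : Function.Surjective f) {m : ℕ} {z : M'} (h : z ∈ multiples g M' m) :
    ∃ y ∈ multiples g M m, f y = z := by
  obtain ⟨y, rfl⟩ := h
  choose x hx using fun i => hf (y i)
  exact ⟨_, ⟨x, rfl⟩, by simp [hx]⟩

end Multiples

section DivisionBP

variable (p : ℕ) [hp : Fact p.Prime]

lemma pow_p_ne_zero (k : ℕ) : p ^ k ≠ 0 := pow_ne_zero _ hp.out.ne_zero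

lemma pow_p_eq_one {k : ℕ} (h : p ^ k = 1) : k = 0 := by
  by_contra hk
  exact (Nat.one_lt_pow hk hp.out.one_lt).ne' h

variable {p} {X : Type} [AddCommGroup X] [Module (BP p) X]

/-- Division by `η_R(v_{k+l+1})` modulo `(v_0, …, v_{k-1})`. -/
lemma exists_pow_smul_mem_of_etaR (k l : ℕ) (G : Submodule (BPBP p) (PT (wt p) (BP p) X))
    (hG : ∀ e, ∀ z ∈ G, kapT l e z ∈ G) (hI : ∀ i ∈ invIdealL p k, ∀ z : PT (wt p) (BP p) X, i • z ∈ G)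
    (z : PT (wt p) (BP p) X) (h : (etaR p).hom (vv p (k + l + 1)) • z ∈ G) :
    ∃ r : ℕ, (polyC (wt p) (BP p)).hom (vv p k) ^ r • z ∈ G := by
  obtain ⟨b, s, hs, hb, hi⟩ := exists_lead p k l
  refine exists_pow_smul_mem_of_lead (l := l) (T := Set.Iio l) (lt_irrefl l) G hG (vv p k) b
    (pow_p_ne_zero p k) (fun h => hb (pow_p_eq_one p h)) hs (hI _ hi) z ?_
  convert h using 2
  exact add_sub_cancel _ _

lemma invIdealL_smul {k : ℕ} (hX : ∀ a ∈ invIdeal p k, ∀ x : X, a • x = 0) {i : BPBP p}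
    (hi : i ∈ invIdealL p k) (z : PT (wt p) (BP p) X) : i • z = 0 := by
  have : invIdealL p k ≤ Ideal.torsionOf (BPBP p) (PT (wt p) (BP p) X) z := by
    rw [invIdealL, Ideal.map_le_iff_le_comap]
    intro a ha
    refine PT_ext fun E => ?_
    rw [map_zero]
    exact (cf_C_smul a z E).trans (hX a ha _)
  exact this hi

lemma kapT_mem_multiples {k l : ℕ} (hX : ∀ a ∈ invIdeal p k, ∀ x : X, a • x = 0) {m : ℕ} (e : ℕ)
    {z : PT (wt p) (BP p) X}
    (h : z ∈ multiples (fun i => (etaR p).hom (vv p (k + l + i + 1))) (PT (wt p) (BP p) X) m) :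
    kapT (l + m) e z ∈
      multiples (fun i => (etaR p).hom (vv p (k + l + i + 1))) (PT (wt p) (BP p) X) m := by
  obtain ⟨y, rfl⟩ := h
  rw [map_sum]
  refine sum_mem fun i hi => ?_
  rw [Finset.mem_range] at hi
  obtain ⟨s, hs, hsi⟩ := exists_low p k (l + m) (k + l + i + 1) (by omega)
  have h1 : ∀ z : PT (wt p) (BP p) X, (etaR p).hom (vv p (k + l + i + 1)) • z = s • z := by
    intro z
    rw [← sub_eq_zero, ← sub_smul]
    exact invIdealL_smul hX hsi z
  rw [h1, kapT_smul_of_supported (T := Set.Iio (l + m)) (lt_irrefl (l + m)) e hs, ← h1]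
  exact smul_mem_multiples (g := fun i => (etaR p).hom (vv p (k + l + i + 1))) hi _

/-- Up to `v_k`-torsion, the sequence `η_R(v_{n+1}), η_R(v_{n+2}), …` is regular on extended modules
annihilated by `(v_0, …, v_{k-1})`. -/
lemma exists_pow_smul_mem_multiples {k l : ℕ} (hX : ∀ a ∈ invIdeal p k, ∀ x : X, a • x = 0)
    (K : Submodule (BP p) X) (m : ℕ) (h : PT (wt p) (BP p) K)
    (hh : ttMap (polyC (wt p) (BP p)) K.subtype h ∈
      multiples (fun i => (etaR p).hom (vv p (k + l + i + 1))) (PT (wt p) (BP p) X) m) :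
    ∃ r : ℕ, (polyC (wt p) (BP p)).hom (vv p k) ^ r • h ∈
      multiples (fun i => (etaR p).hom (vv p (k + l + i + 1))) (PT (wt p) (BP p) K) m := by
  set g : ℕ → BPBP p := fun i => (etaR p).hom (vv p (k + l + i + 1)) with hg
  set c := (polyC (wt p) (BP p)).hom (vv p k) with hc
  set f := ttMap (polyC (wt p) (BP p)) K.subtype with hf
  set q := ttMap (polyC (wt p) (BP p)) K.mkQ with hq
  have hqf : ∀ y, q (f y) = 0 := by
    intro y
    refine PT_ext fun E => ?_
    rw [hq, hf, cf_ttMap, cf_ttMap, map_zero]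
    exact (Submodule.Quotient.mk_eq_zero K).2 (Subtype.property _)
  have hQ : ∀ a ∈ invIdeal p k, ∀ x : X ⧸ K, a • x = 0 := by
    intro a ha x
    obtain ⟨x, rfl⟩ := K.mkQ_surjective x
    rw [← map_smul, hX a ha, map_zero]
  induction m generalizing h with
  | zero =>
    obtain ⟨y, hy⟩ := hh
    rw [Finset.range_zero, Finset.sum_empty] at hy
    have : h = 0 := ttMap_injective K.subtype K.injective_subtype (by
      rw [map_zero]; exact hy)
    exact ⟨0, by rw [this, smul_zero]; exact zero_mem _⟩
  | succ m ih =>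
    obtain ⟨z, hz⟩ := multiples_succ hh
    have h1 : g m • q z ∈ multiples g (PT (wt p) (BP p) (X ⧸ K)) m := by
      have := map_mem_multiples q hz
      rw [map_sub, hqf, zero_sub, map_smul] at this
      exact neg_mem_iff.1 this
    obtain ⟨r, hr⟩ := exists_pow_smul_mem_of_etaR k (l + m) _
      (fun e z hz => kapT_mem_multiples hQ e hz)
      (fun i hi z => by rw [invIdealL_smul hQ hi]; exact zero_mem _) (q z) (by
        convert h1 using 3
        rw [← add_assoc])
    obtain ⟨y, hy, hyz⟩ := multiples_map_surjective q
      (ttMap_surjective _ _ K.mkQ_surjective) hr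
    obtain ⟨h', hh'⟩ := ttMap_exact (polyC (wt p) (BP p)) K.subtype K.mkQ
      (LinearMap.exact_subtype_mkQ K) K.mkQ_surjective (c ^ r • z - y) (by
        change q _ = 0
        rw [map_sub, map_smul, hyz, sub_self])
    obtain ⟨r', hr'⟩ := ih (c ^ r • h - g m • h') (by
      have e : f (c ^ r • h - g m • h') = c ^ r • (f h - g m • z) + g m • y := by
        have : f h' = c ^ r • z - y := hh'
        rw [map_sub, map_smul, map_smul, this, smul_sub, smul_sub, smul_comm (g m) (c ^ r)]
        abel
      rw [e]
      exact add_mem (Submodule.smul_mem _ _ hz) (Submodule.smul_mem _ _ hy))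
    refine ⟨r' + r, ?_⟩
    have e : c ^ (r' + r) • h = c ^ r' • (c ^ r • h - g m • h') + g m • c ^ r' • h' := by
      rw [smul_sub, pow_add, mul_smul, smul_comm (g m) (c ^ r')]
      abel
    rw [e]
    exact add_mem (multiples_mono (Nat.le_succ m) hr') (smul_mem_multiples (Nat.lt_succ_self m) _)

end DivisionBP

/-! ## Torsion in comodules -/

section ComoduleTorsion

variable {p : ℕ} [hp : Fact p.Prime]

/-- The underlying graded module of a comodule. -/
abbrev und (M : BPComod p) : GMod (BP p) := (BPforget p).obj M

/-- The coaction. -/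
def psi (M : BPComod p) : und M →+ PT (wt p) (BP p) (und M) := M.a.lin.toAddMonoidHom

lemma psi_smul (M : BPComod p) (a : BP p) (x : und M) :
    psi M (a • x) = (etaR p).hom a • psi M x := M.a.lin.map_smul a x

lemma pcoeff_zero (b : BPBP p) : pcoeff 0 b = (eps p).hom b := by
  refine (congrArg (fun g : MvPolynomial ℕ (BP p) →+* BP p => g b)
    (MvPolynomial.ringHom_ext (f := (eps p).hom) (g := MvPolynomial.constantCoeff) ?_ ?_)).symm
  · intro r
    exact (aug_C p (BP p) r).trans (MvPolynomial.constantCoeff_C ℕ r).symm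
  · intro i
    exact (polyDesc_X (wt p) _ _ _ i).trans (MvPolynomial.constantCoeff_X _ i).symm

/-- The counit of the cofree comodule. -/
def cuHom (N : GMod (BP p)) : PT (wt p) (BP p) N →+ N := ((BPH p).cu N).lin.toAddMonoidHom

lemma cuHom_eq_cf (N : GMod (BP p)) (z : PT (wt p) (BP p) N) : cuHom N z = cf z 0 := by
  induction z using TT.induction with
  | tt b x =>
    refine ((BPH p).cu_t1 b x).trans ?_
    rw [cf_tt, pcoeff_zero]
    rfl
  | add y z hy hz => rw [map_add, hy, hz, map_add, Finsupp.add_apply]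

lemma cf_psi_zero (M : BPComod p) (x : und M) : cf (psi M x) 0 = x := by
  rw [← cuHom_eq_cf]
  exact congrArg (fun g : M.A ⟶ M.A => g.lin x) M.counit

lemma psi_hom {M N : BPComod p} (f : M ⟶ N) (x : und M) :
    psi N (((BPforget p).map f).lin x) =
      ttMap (polyC (wt p) (BP p)) ((BPforget p).map f).lin (psi M x) := by
  have := congrArg (fun g : M.A ⟶ (BPH p).comonad.toFunctor.obj N.A => g.lin x) f.h
  exact this.symm.trans (ext_map_eq_ttMap (polyC (wt p) (BP p)) ((BPforget p).map f) _)

/-- The elements killed by a power of `v`. -/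
def powTorsion {R : Type} [CommRing R] (v : R) (X : Type) [AddCommGroup X] [Module R X] :
    Submodule R X where
  carrier := {x | ∃ s : ℕ, v ^ s • x = 0}
  zero_mem' := ⟨0, smul_zero _⟩
  add_mem' := by
    rintro x y ⟨s, hs⟩ ⟨t, ht⟩
    refine ⟨s + t, ?_⟩
    rw [smul_add, pow_add, mul_smul, mul_smul, ht, smul_zero, add_zero, smul_comm, hs, smul_zero]
  smul_mem' := by
    rintro a x ⟨s, hs⟩
    exact ⟨s, by rw [smul_comm, hs, smul_zero]⟩

lemma powTorsion_saturated {R : Type} [CommRing R] {v : R} {X : Type} [AddCommGroup X] [Module R X]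
    {x : X} {s : ℕ} (h : v ^ s • x ∈ powTorsion v X) : x ∈ powTorsion v X := by
  obtain ⟨t, ht⟩ := h
  exact ⟨t + s, by rw [pow_add, mul_smul, ht]⟩

/-- The coefficients of the coaction on a `v`-torsion element are `v`-torsion. -/
lemma cf_psi_mem_powTorsion (M : BPComod p) (v : BP p) {x : und M}
    (hx : x ∈ powTorsion v (und M)) (E : ℕ →₀ ℕ) : cf (psi M x) E ∈ powTorsion v (und M) := by
  obtain ⟨s, hs⟩ := hx
  refine cf_mem_of_smul (powTorsion v (und M)) (b := (etaR p).hom (v ^ s)) ?_ ?_ E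
  · intro y hy
    rw [pcoeff_zero, eps_etaR] at hy
    exact powTorsion_saturated hy
  · intro F
    rw [← psi_smul, hs, map_zero, map_zero]
    exact zero_mem _

lemma cmp_smul {A : GRing} (M : GMod A) {d : ℤ} {a : A} (ha : a ∈ A.deg d) (x : M) (i : ℤ) :
    M.cmp (a • x) (d + i) = a • M.cmp x i := by
  classical
  refine internal_induction M.isInternal (P := fun x => M.cmp (a • x) (d + i) = a • M.cmp x i) x
    ?_ ?_
  · intro j y hy
    rw [GMod.cmp, comp_of_mem _ hy, comp_of_mem _ (M.smul_mem ha hy), Finsupp.single_apply,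
      Finsupp.single_apply]
    by_cases h : j = i
    · rw [if_pos h, if_pos (by rw [h])]
    · rw [if_neg h, if_neg (fun h' => h (add_left_cancel h')), smul_zero]
  · intro y z hy hz
    rw [smul_add, AddMonoidHom.map_add, Finsupp.add_apply, hy, hz, AddMonoidHom.map_add,
      Finsupp.add_apply, smul_add]

lemma powTorsion_homogeneous {A : GRing} (M : GMod A) {d : ℤ} {v : A} (hv : v ∈ A.deg d) :
    M.IsHomogeneous (powTorsion v M) := by
  rintro x ⟨s, hs⟩ i
  refine ⟨s, ?_⟩
  rw [← cmp_smul M (A.pow_mem hv s), hs, map_zero, Finsupp.zero_apply]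

lemma powTorsion_isSubcomodule (M : BPComod p) {d : ℤ} {v : BP p} (hv : v ∈ (BP p).deg d) :
    IsSubcomodule (BPH p).comonad M (powTorsion v (und M)) := by
  refine ⟨powTorsion_homogeneous (und M) hv, fun x hx => ?_⟩
  obtain ⟨y, hy⟩ := mem_range_ttMap_subtype (powTorsion v (und M)) (psi M x)
    (cf_psi_mem_powTorsion M v hx)
  exact ⟨y, (ext_map_eq_ttMap (polyC (wt p) (BP p))
    ((und M).subι _ (powTorsion_homogeneous (und M) hv)) y).trans hy⟩

lemma tors_eq_powTorsion (M : BPComod p) {d : ℤ} {v : BP p} (hv : v ∈ (BP p).deg d) :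
    tors (G := (BPH p).comonad) v M = powTorsion v (und M) := by
  refine le_antisymm (fun x hx => ?_) ?_
  · exact tors_ind (G := (BPH p).comonad) v (P := fun x => x ∈ powTorsion v (und M)) hx
      (fun S _ hS x hx => hS x hx) fun x y hx hy => add_mem hx hy
  · exact le_tors (G := (BPH p).comonad) v (powTorsion_isSubcomodule M hv) fun x hx => hx

lemma mem_range_TnIncl (n : ℕ) (M : BPComod p) (x : und M) :
    x ∈ LinearMap.range ((BPforget p).map ((TnIncl p n).app M)).lin ↔
      ∃ s : ℕ, vv p n ^ s • x = 0 := by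
  have h : LinearMap.range ((BPforget p).map ((TnIncl p n).app M)).lin =
      tors (G := (BPH p).comonad) (vv p n) M :=
    Submodule.range_subtype (tors (G := (BPH p).comonad) (vv p n) M)
  rw [h, tors_eq_powTorsion M (vv_mem p n)]
  rfl

/-- An element that is torsion for all of `v_0, …, v_{k-1}`. -/
def TorsBelow (p : ℕ) [Fact p.Prime] (k : ℕ) {X : Type} [AddCommGroup X] [Module (BP p) X] (x : X) : Prop :=
  ∀ l < k, ∃ s : ℕ, vv p l ^ s • x = 0

lemma exists_pow_smul_of_torsBelow {X : Type} [AddCommGroup X] [Module (BP p) X] {k : ℕ}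
    {z : PT (wt p) (BP p) X} (hz : ∀ E, TorsBelow p k (cf z E)) {i : BPBP p}
    (hi : i ∈ invIdealL p k) : ∃ s : ℕ, i ^ s • z = 0 := by
  refine exists_pow_smul_of_mem_map (I := invIdeal p k) (S := vv p '' Set.Iio k) rfl ?_ hi
  rintro _ ⟨l, hl, rfl⟩
  exact exists_pow_C_smul fun E => hz E l hl

/-- In a comodule, `v_n`-torsion elements are `v_k`-torsion for `k ≤ n`. -/
theorem torsBelow_of_powTorsion (n : ℕ) (M : BPComod p) (x : und M)
    (hx : ∃ s : ℕ, vv p n ^ s • x = 0) : TorsBelow p (n + 1) x := by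
  have key : ∀ k ≤ n + 1, ∀ x : und M, (∃ s : ℕ, vv p n ^ s • x = 0) → TorsBelow p k x := by
    intro k
    induction k with
    | zero => intro _ x _ l hl; omega
    | succ k ih =>
      intro hk x hx l hl
      rcases Nat.lt_succ_iff_lt_or_eq.1 hl with hl | rfl
      · exact ih (by omega) x hx l hl
      rcases Nat.lt_succ_iff_lt_or_eq.1 (show l < n + 1 by omega) with hln | rfl
      swap
      · exact hx
      obtain ⟨j, rfl⟩ : ∃ j, n = l + j + 1 := ⟨n - l - 1, by omega⟩
      set z := psi M x with hz
      have hcf : ∀ E, TorsBelow p l (cf z E) := fun E =>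
        ih (by omega) _ (cf_psi_mem_powTorsion M (vv p (l + j + 1)) hx E)
      obtain ⟨b, s, hs, hb, hi⟩ := exists_lead p l j
      set u := (polyC (wt p) (BP p)).hom (vv p l) * ts p (BP p) (j + 1) ^ p ^ l +
        (polyC (wt p) (BP p)).hom b * ts p (BP p) (j + 1) + s with hu
      have hrad : u ∈ (Ideal.torsionOf (BPBP p) (PT (wt p) (BP p) (und M)) z).radical := by
        have h1 : (etaR p).hom (vv p (l + j + 1)) ∈
            (Ideal.torsionOf (BPBP p) (PT (wt p) (BP p) (und M)) z).radical := by
          obtain ⟨S, hS⟩ := hx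
          refine ⟨S, ?_⟩
          rw [Ideal.mem_torsionOf_iff, ← map_pow, ← psi_smul, hS, map_zero]
        have h2 := sub_mem h1 (show _ ∈ _ from exists_pow_smul_of_torsBelow hcf hi)
        rwa [sub_sub_cancel] at h2
      have step : ∀ z : PT (wt p) (BP p) (und M), u • z = 0 →
          ∃ r : ℕ, (polyC (wt p) (BP p)).hom (vv p l) ^ r • z = 0 := by
        intro z hz
        have := exists_pow_smul_mem_of_lead (l := j) (T := Set.Iio j) (lt_irrefl j)
          (⊥ : Submodule (BPBP p) (PT (wt p) (BP p) (und M)))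
          (fun e z hz => by rw [(Submodule.mem_bot _).1 hz, map_zero]; exact zero_mem _) (vv p l) b
          (pow_p_ne_zero p l) (fun h => hb (pow_p_eq_one p h)) hs (i := 0)
          (fun z => by rw [zero_smul]; exact zero_mem _) z (by
            rw [add_zero]; exact (Submodule.mem_bot _).2 hz)
        obtain ⟨r, hr⟩ := this
        exact ⟨r, (Submodule.mem_bot _).1 hr⟩
      have iter : ∀ (S : ℕ) (z : PT (wt p) (BP p) (und M)), u ^ S • z = 0 →
          ∃ r : ℕ, (polyC (wt p) (BP p)).hom (vv p l) ^ r • z = 0 := by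
        intro S
        induction S with
        | zero => intro z hz; exact ⟨0, by rwa [pow_zero] at hz ⊢⟩
        | succ S ihS =>
          intro z hz
          rw [pow_succ', mul_smul] at hz
          obtain ⟨r, hr⟩ := step _ hz
          rw [smul_comm] at hr
          obtain ⟨r', hr'⟩ := ihS _ hr
          exact ⟨r' + r, by rw [pow_add, mul_smul, hr']⟩
      obtain ⟨S, hS⟩ := hrad
      obtain ⟨r, hr⟩ := iter S z hS
      refine ⟨r, ?_⟩
      have := congrArg (fun z => cf z 0) hr
      beta_reduce at this
      rw [cf_pow_smul, hz, cf_psi_zero, AddMonoidHom.map_zero] at this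
      exact this
  exact key (n + 1) le_rfl x hx

end ComoduleTorsion

/-! ## A flatness criterion -/

section FlatCriterion

variable {A D : Type} [CommRing A] [AddCommGroup D] [Module A D]

variable (D) in
/-- Tensoring with `D` is exact on modules annihilated by `I`. -/
def FlatOn (I : Ideal A) : Prop :=
  ∀ (X Y : Type) [AddCommGroup X] [AddCommGroup Y] [Module A X] [Module A Y],
    (∀ a ∈ I, ∀ y : Y, a • y = 0) → ∀ f : X →ₗ[A] Y, Function.Injective f →
      Function.Injective (LinearMap.lTensor D f)

lemma lTensor_comp_apply {X Y Z : Type} [AddCommGroup X] [AddCommGroup Y] [AddCommGroup Z]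
    [Module A X] [Module A Y] [Module A Z] (g : Y →ₗ[A] Z) (f : X →ₗ[A] Y)
    (x : TensorProduct A D X) : LinearMap.lTensor D g (LinearMap.lTensor D f x) =
      LinearMap.lTensor D (g.comp f) x := (LinearMap.lTensor_comp_apply D g f x).symm

/-- Injectivity after tensoring can be tested on a cover. -/
lemma lTensor_injective_of_cover {X Y F : Type} [AddCommGroup X] [AddCommGroup Y] [AddCommGroup F]
    [Module A X] [Module A Y] [Module A F] (f : X →ₗ[A] Y) (hf : Function.Injective f)
    (π : F →ₗ[A] Y) (hπ : Function.Surjective π)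
    (h : Function.Injective (LinearMap.lTensor D ((LinearMap.range f).comap π).subtype)) :
    Function.Injective (LinearMap.lTensor D f) := by
  set K := (LinearMap.range f).comap π with hK
  let e := LinearEquiv.ofInjective f hf
  let ρ : K →ₗ[A] X := e.symm.toLinearMap.comp ((π.comp K.subtype).codRestrict _ fun k => k.2)
  have hρ : f.comp ρ = π.comp K.subtype := by
    ext k
    exact congrArg Subtype.val (e.apply_symm_apply
      ((π.comp K.subtype).codRestrict _ (fun k : K => k.2) k))
  have hρs : Function.Surjective ρ := by
    intro x
    obtain ⟨y, hy⟩ := hπ (f x)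
    refine ⟨⟨y, ⟨x, hy.symm⟩⟩, hf ?_⟩
    exact (LinearMap.congr_fun hρ _).trans hy
  let j : LinearMap.ker π →ₗ[A] K := Submodule.inclusion (fun y hy => by
    change π y ∈ LinearMap.range f
    rw [LinearMap.mem_ker.1 hy]; exact zero_mem _)
  have hj : K.subtype.comp j = (LinearMap.ker π).subtype := rfl
  have hρj : ρ.comp j = 0 := by
    ext y
    refine hf ?_
    have h1 : f (ρ (j y)) = π y := LinearMap.congr_fun hρ (j y)
    change f (ρ (j y)) = f 0
    rw [h1, map_zero]; exact LinearMap.mem_ker.1 y.2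
  rw [injective_iff_map_eq_zero]
  intro x hx
  obtain ⟨z, rfl⟩ := LinearMap.lTensor_surjective D hρs x
  rw [lTensor_comp_apply, hρ, ← lTensor_comp_apply] at hx
  obtain ⟨w, hw⟩ := (lTensor_exact D (LinearMap.exact_subtype_ker_map π) hπ _).1 hx
  rw [← hj, ← lTensor_comp_apply] at hw
  rw [← h hw, lTensor_comp_apply, hρj, LinearMap.lTensor_zero, LinearMap.zero_apply]

/-- A cover by a free module over `A ⧸ I`. -/
lemma exists_cover (I : Ideal A) {Y : Type} [AddCommGroup Y] [Module A Y]
    (hY : ∀ a ∈ I, ∀ y : Y, a • y = 0) :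
    ∃ π : (Y →₀ A ⧸ I) →ₗ[A] Y, Function.Surjective π := by
  let π : (Y →₀ A ⧸ I) →ₗ[A] Y := Finsupp.lsum A fun y =>
    Submodule.liftQ I (LinearMap.toSpanSingleton A Y y) fun a ha => hY a ha y
  refine ⟨π, fun y => ⟨Finsupp.single y (Submodule.Quotient.mk 1), ?_⟩⟩
  simp only [π, Finsupp.lsum_single]
  exact one_smul A y

lemma smul_regular_lTensor_free {I : Ideal A} {a : A}
    (h : ∀ d : D, a • d ∈ (I • ⊤ : Submodule A D) → d ∈ (I • ⊤ : Submodule A D)) (ι : Type)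
    (y : TensorProduct A D (ι →₀ A ⧸ I)) (hy : a • y = 0) : y = 0 := by
  classical
  refine (TensorProduct.finsuppRight A A D (A ⧸ I) ι).injective (Finsupp.ext fun i => ?_)
  rw [map_zero, Finsupp.zero_apply]
  set z := TensorProduct.finsuppRight A A D (A ⧸ I) ι y i with hz
  have hz0 : a • z = 0 := by
    rw [hz, ← Finsupp.smul_apply, ← map_smul, hy, map_zero, Finsupp.zero_apply]
  let e := TensorProduct.tensorQuotEquivQuotSMul D I
  refine e.injective ?_
  obtain ⟨d, hd⟩ := Submodule.Quotient.mk_surjective _ (e z)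
  have h1 : (Submodule.Quotient.mk (a • d) : D ⧸ (I • ⊤ : Submodule A D)) = 0 := by
    rw [Submodule.Quotient.mk_smul, hd, ← map_smul, hz0, map_zero]
  rw [Submodule.Quotient.mk_eq_zero] at h1
  rw [map_zero, ← hd, Submodule.Quotient.mk_eq_zero]
  exact h d h1

/-- Descent of flatness, for submodules that contain the multiples by a regular element. -/
lemma lTensor_injective_of_smul_mem {I : Ideal A} {a : A} (hJ : FlatOn D (I ⊔ Ideal.span {a}))
    {F : Type} [AddCommGroup F] [Module A F] (hF : ∀ b ∈ I, ∀ y : F, b • y = 0)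
    (hreg : ∀ y : TensorProduct A D F, a • y = 0 → y = 0) (K : Submodule A F)
    (hK : ∀ y : F, a • y ∈ K) : Function.Injective (LinearMap.lTensor D K.subtype) := by
  let j : F →ₗ[A] K := (LinearMap.lsmul A F a).codRestrict K hK
  let i : F →ₗ[A] F := LinearMap.lsmul A F a
  have hji : K.subtype.comp j = i := rfl
  let κ : (K ⧸ LinearMap.range j) →ₗ[A] (F ⧸ LinearMap.range i) :=
    Submodule.mapQ _ _ K.subtype (by
      rintro _ ⟨y, rfl⟩
      exact ⟨y, rfl⟩)
  have hκ : Function.Injective κ := by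
    rw [injective_iff_map_eq_zero]
    intro x hx
    obtain ⟨x, rfl⟩ := Submodule.Quotient.mk_surjective _ x
    rw [Submodule.mapQ_apply, Submodule.Quotient.mk_eq_zero] at hx
    obtain ⟨y, hy⟩ := hx
    rw [Submodule.Quotient.mk_eq_zero]
    exact ⟨y, Subtype.ext hy⟩
  have hκ' := hJ _ _ (fun b hb y => by
    obtain ⟨y, rfl⟩ := Submodule.Quotient.mk_surjective _ y
    rw [← Submodule.Quotient.mk_smul, Submodule.Quotient.mk_eq_zero]
    obtain ⟨c, hc, e, he, rfl⟩ := Submodule.mem_sup.1 hb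
    obtain ⟨e, rfl⟩ := Ideal.mem_span_singleton'.1 he
    rw [add_smul, hF c hc, zero_add, mul_smul, smul_comm]
    exact ⟨e • y, rfl⟩) κ hκ
  rw [injective_iff_map_eq_zero]
  intro x hx
  have h3 : LinearMap.lTensor D (LinearMap.range j).mkQ x = 0 := by
    refine hκ' ?_
    have e1 : κ.comp (LinearMap.range j).mkQ = (LinearMap.range i).mkQ.comp K.subtype := rfl
    rw [map_zero, lTensor_comp_apply, e1, ← lTensor_comp_apply, hx, map_zero]
  obtain ⟨y, rfl⟩ := (lTensor_exact D (f := j) (g := (LinearMap.range j).mkQ)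
    (fun z => by rw [Submodule.mkQ_apply, Submodule.Quotient.mk_eq_zero]; rfl)
    (Submodule.mkQ_surjective _) x).1 h3
  rw [lTensor_comp_apply, hji] at hx
  have e2 : LinearMap.lTensor D i y = a • y := by
    have : i = a • LinearMap.id := rfl
    rw [this, LinearMap.lTensor_smul, LinearMap.lTensor_id]; rfl
  rw [e2] at hx
  rw [hreg y hx, map_zero]

/-- Descent of flatness along a regular element. -/
theorem FlatOn.of_regular {I : Ideal A} {a : A} (hJ : FlatOn D (I ⊔ Ideal.span {a}))
    (h1 : ∀ x : A, a * x ∈ I → x ∈ I)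
    (h2 : ∀ d : D, a • d ∈ (I • ⊤ : Submodule A D) → d ∈ (I • ⊤ : Submodule A D))
    (h4 : ∀ (X Y : Type) [AddCommGroup X] [AddCommGroup Y] [Module A X] [Module A Y],
      (∀ a ∈ I, ∀ y : Y, a • y = 0) → ∀ f : X →ₗ[A] Y, Function.Injective f →
        ∀ x, LinearMap.lTensor D f x = 0 → ∃ s : ℕ, a ^ s • x = 0) :
    FlatOn D I := by
  have hFI : ∀ (ι : Type) (b : A), b ∈ I → ∀ y : ι →₀ A ⧸ I, b • y = 0 := by
    intro ι b hb y
    ext i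
    obtain ⟨x, hx⟩ := Submodule.Quotient.mk_surjective I (y i)
    rw [Finsupp.smul_apply, ← hx, ← Submodule.Quotient.mk_smul, Finsupp.zero_apply,
      Submodule.Quotient.mk_eq_zero]
    exact I.mul_mem_right x hb
  have hFa : ∀ (ι : Type) (y : ι →₀ A ⧸ I), a • y = 0 → y = 0 := by
    intro ι y hy
    ext i
    obtain ⟨x, hx⟩ := Submodule.Quotient.mk_surjective I (y i)
    have := DFunLike.congr_fun hy i
    rw [Finsupp.smul_apply, ← hx, ← Submodule.Quotient.mk_smul, Finsupp.zero_apply,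
      Submodule.Quotient.mk_eq_zero] at this
    rw [← hx, Finsupp.zero_apply, Submodule.Quotient.mk_eq_zero]
    exact h1 x this
  have s1 : ∀ (ι : Type) (K : Submodule A (ι →₀ A ⧸ I)),
      (∀ y : ι →₀ A ⧸ I, a • y ∈ K) → Function.Injective (LinearMap.lTensor D K.subtype) :=
    fun ι K hK => lTensor_injective_of_smul_mem hJ (hFI ι) (smul_regular_lTensor_free h2 ι) K hK
  have s2 : ∀ (X Y : Type) [AddCommGroup X] [AddCommGroup Y] [Module A X] [Module A Y],
      (∀ b ∈ I, ∀ y : Y, b • y = 0) → ∀ f : X →ₗ[A] Y, Function.Injective f →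
        (∀ y : Y, a • y ∈ LinearMap.range f) → Function.Injective (LinearMap.lTensor D f) := by
    intro X Y _ _ _ _ hY f hf hr
    obtain ⟨π, hπ⟩ := exists_cover I hY
    refine lTensor_injective_of_cover f hf π hπ (s1 _ _ fun y => ?_)
    rw [Submodule.mem_comap, map_smul]
    exact hr _
  have s3 : ∀ (ι : Type) (K : Submodule A (ι →₀ A ⧸ I)) (x : TensorProduct A D K),
      a • x = 0 → x = 0 := by
    intro ι K x hx
    have := s2 K K (fun b hb y => Subtype.ext (hFI ι b hb y)) (LinearMap.lsmul A K a) (by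
      rw [injective_iff_map_eq_zero]
      intro y hy
      exact Subtype.ext (hFa ι y (congrArg Subtype.val hy))) fun y => ⟨y, rfl⟩
    refine this ?_
    have e1 : LinearMap.lsmul A K a = a • LinearMap.id := rfl
    rw [e1, LinearMap.lTensor_smul, LinearMap.lTensor_id, LinearMap.smul_apply,
      LinearMap.id_apply, hx, map_zero]
  intro X Y _ _ _ _ hY f hf
  obtain ⟨π, hπ⟩ := exists_cover I hY
  refine lTensor_injective_of_cover f hf π hπ ?_
  rw [injective_iff_map_eq_zero]
  intro x hx
  obtain ⟨s, hs⟩ := h4 _ _ (hFI Y) _ (Submodule.injective_subtype _) x hx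
  induction s with
  | zero => rwa [pow_zero, one_smul] at hs
  | succ s ih =>
    rw [pow_succ', mul_smul] at hs
    exact ih (s3 _ _ _ hs)

lemma FlatOn.flat (h : FlatOn D (⊥ : Ideal A)) : Module.Flat A D := by
  rw [Module.Flat.iff_lTensor_injective']
  intro I
  exact h _ _ (fun a ha y => by rw [(Submodule.mem_bot A).1 ha, zero_smul]) I.subtype
    (Submodule.injective_subtype I)

end FlatCriterion

/-! ## Ideals generated by powers of variables -/

section MonomialIdeal

variable {σ S : Type} [CommRing S]

/-- The ideal generated by `π ^ r` and the powers `X_l ^ r` for `l ∈ Λ`. -/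
def powIdeal (π : S) (r : ℕ) (Λ : Set σ) : Ideal (MvPolynomial σ S) :=
  Ideal.span (insert (MvPolynomial.C (π ^ r)) ((fun l => MvPolynomial.X l ^ r) '' Λ))

lemma mem_powIdeal_iff (π : S) (r : ℕ) (Λ : Set σ) (f : MvPolynomial σ S) :
    f ∈ powIdeal π r Λ ↔ ∀ E, (∀ l ∈ Λ, E l < r) → π ^ r ∣ f.coeff E := by
  classical
  constructor
  · intro hf
    induction hf using Submodule.span_induction with
    | mem x hx =>
      intro E hE
      rcases hx with rfl | ⟨l, hl, rfl⟩
      · rw [MvPolynomial.coeff_C]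
        split_ifs
        · exact dvd_rfl
        · exact dvd_zero _
      · beta_reduce
        rw [MvPolynomial.coeff_X_pow, if_neg]
        · exact dvd_zero _
        · intro h
          have := hE l hl
          rw [← h, Finsupp.single_eq_same] at this
          exact lt_irrefl _ this
    | zero => intro E _; rw [MvPolynomial.coeff_zero]; exact dvd_zero _
    | add x y _ _ hx hy => intro E hE; rw [MvPolynomial.coeff_add]; exact dvd_add (hx E hE) (hy E hE)
    | smul c x _ hx =>
      intro E hE
      rw [smul_eq_mul, MvPolynomial.coeff_mul]
      refine Finset.dvd_sum fun y hy => Dvd.dvd.mul_left (hx y.2 fun l hl => ?_) _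
      rw [Finset.HasAntidiagonal.mem_antidiagonal] at hy
      have := hE l hl
      rw [← hy, Finsupp.add_apply] at this
      omega
  · intro h
    rw [MvPolynomial.as_sum f]
    refine Ideal.sum_mem _ fun E _ => ?_
    by_cases hE : ∀ l ∈ Λ, E l < r
    · obtain ⟨c, hc⟩ := h E hE
      rw [hc, ← MvPolynomial.C_mul_monomial]
      exact Ideal.mul_mem_right _ _ (Ideal.subset_span (Set.mem_insert _ _))
    · push Not at hE
      obtain ⟨l, hl, hle⟩ := hE
      have e : MvPolynomial.monomial E (f.coeff E) = MvPolynomial.X l ^ r *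
          MvPolynomial.monomial (E - Finsupp.single l r) (f.coeff E) := by
        rw [MvPolynomial.X_pow_eq_monomial, MvPolynomial.monomial_mul, one_mul,
          add_tsub_cancel_of_le (Finsupp.single_le_iff.2 hle)]
      rw [e]
      exact Ideal.mul_mem_right _ _ (Ideal.subset_span (Set.mem_insert_of_mem _ ⟨l, hl, rfl⟩))

lemma mem_powIdeal_of_X_mul {π : S} {r : ℕ} {Λ : Set σ} {j : σ} (hj : j ∉ Λ) {f : MvPolynomial σ S}
    (h : MvPolynomial.X j * f ∈ powIdeal π r Λ) : f ∈ powIdeal π r Λ := by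
  classical
  rw [mem_powIdeal_iff] at h ⊢
  intro E hE
  have := h (Finsupp.single j 1 + E) fun l hl => by
    rw [Finsupp.add_apply, Finsupp.single_apply, if_neg (fun e : j = l => hj (by rw [e]; exact hl)),
      zero_add]
    exact hE l hl
  rwa [MvPolynomial.coeff_X_mul] at this

/-- The ideal `powIdeal` in a graded polynomial ring. -/
def polyPowIdeal {σ : Type} (w : σ → ℤ) (R : GRing) (π : R) (r : ℕ) (Λ : Set σ) : Ideal (poly w R) :=
  Ideal.span (insert ((polyC w R).hom (π ^ r)) ((fun l => polyX w R l ^ r) '' Λ))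

lemma mem_polyPowIdeal_of_X_mul {σ : Type} {w : σ → ℤ} {R : GRing} {π : R} {r : ℕ} {Λ : Set σ}
    {j : σ} (hj : j ∉ Λ) {f : poly w R} (h : polyX w R j * f ∈ polyPowIdeal w R π r Λ) :
    f ∈ polyPowIdeal w R π r Λ :=
  mem_powIdeal_of_X_mul (S := R) (π := π) (r := r) hj h

end MonomialIdeal

section InvariantPowers

variable (p : ℕ) [hp : Fact p.Prime]

/-- The ideal `(v_0 ^ r, …, v_{k-1} ^ r)`. -/
def invPow (r k : ℕ) : Ideal (BP p) := Ideal.span ((fun l => vv p l ^ r) '' Set.Iio k)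

lemma invPow_one (k : ℕ) : invPow p 1 k = invIdeal p k := by
  simp only [invPow, invIdeal, pow_one]

lemma image_vv_succ {B : Type} (f : BP p → B) (k : ℕ) :
    (fun l => f (vv p l)) '' Set.Iio (k + 1) =
      insert (f (vv p 0)) ((fun l => f (vv p (l + 1))) '' Set.Iio k) := by
  ext x
  constructor
  · rintro ⟨l, hl, rfl⟩
    cases l with
    | zero => exact Set.mem_insert _ _
    | succ l => exact Set.mem_insert_of_mem _ ⟨l, Nat.lt_of_succ_lt_succ hl, rfl⟩
  · rintro (rfl | ⟨l, hl, rfl⟩)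
    · exact ⟨0, Nat.succ_pos k, rfl⟩
    · exact ⟨l + 1, Nat.succ_lt_succ hl, rfl⟩

lemma vv_zero_eq : vv p 0 = (polyC (wt p) (GRing.triv (Zloc p))).hom (p : GRing.triv (Zloc p)) :=
  (map_natCast (polyC (wt p) (GRing.triv (Zloc p))).hom p).symm

lemma vv_succ_eq (k : ℕ) : vv p (k + 1) = polyX (wt p) (GRing.triv (Zloc p)) k := rfl

lemma invPow_succ (r k : ℕ) : invPow p r (k + 1) =
    polyPowIdeal (wt p) (GRing.triv (Zloc p)) (p : GRing.triv (Zloc p)) r (Set.Iio k) := by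
  rw [invPow, image_vv_succ p (fun x => x ^ r), polyPowIdeal, map_pow, vv_zero_eq]
  rfl

/-- The powers `v_0 ^ r, …, v_{k-1} ^ r, v_k` form a regular sequence. -/
lemma mem_invPow_of_vv_mul {r k : ℕ} {a : BP p} (h : vv p k * a ∈ invPow p r k) :
    a ∈ invPow p r k := by
  cases k with
  | zero =>
    have e : invPow p r 0 = ⊥ := by simp [invPow]
    rw [e, Submodule.mem_bot] at h ⊢
    exact BP.tf p a h
  | succ k =>
    rw [invPow_succ, vv_succ_eq] at h
    rw [invPow_succ]
    have key := @mem_polyPowIdeal_of_X_mul ℕ (wt p) (GRing.triv (Zloc p)) p r (Set.Iio k) k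
      (lt_irrefl k) a
    exact key h

end InvariantPowers

/-! ## The ring `E(n)_*[t_1, t_2, …]` -/

section EnPoly

variable (p : ℕ) [hp : Fact p.Prime] (n : ℕ)

/-- The ring `E(n)_*[t_1, t_2, …] = E(n)_* ⊗_{BP_*} BP_*BP`. -/
abbrev Dn : GRing := poly (wt p) (En p n)

/-- The right unit of `BP_*BP`, with values in `E(n)_* ⊗_{BP_*} BP_*BP`. -/
def phi : (BP p).Hom (Dn p n) := (polyMap (wt p) (toEn p n)).comp (etaR p)

/-- The conjugation of `BP_*BP`, with values in `E(n)_* ⊗_{BP_*} BP_*BP`. -/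
def theta : BPBP p →+* Dn p n := (polyMap (wt p) (toEn p n)).hom.comp (conj p)

/-- The constants. -/
abbrev cD : (En p n).Hom (Dn p n) := polyC (wt p) (En p n)

lemma theta_C (a : BP p) : theta p n ((polyC (wt p) (BP p)).hom a) = (phi p n).hom a := by
  change (polyMap (wt p) (toEn p n)).hom (conj p _) = (polyMap (wt p) (toEn p n)).hom _
  rw [conj_C]

lemma theta_etaR (a : BP p) : theta p n ((etaR p).hom a) = (cD p n).hom ((toEn p n).hom a) := by
  change (polyMap (wt p) (toEn p n)).hom (conj p _) = _
  rw [conj_etaR, polyMap_C]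

lemma toBPn_vv_succ (i : ℕ) : (toBPn p n).hom (vv p (i + 1)) = vn p n i :=
  polyDesc_X (wt p) _ _ _ i

lemma toBPn_cst (r : GRing.triv (Zloc p)) : (toBPn p n).hom ((cst p).hom r) =
    (polyC (fun i : Fin n => wt p i) (GRing.triv (Zloc p))).hom r :=
  polyDesc_C (wt p) _ _ _ r

lemma toBPn_vv_of_lt {m : ℕ} (h : n < m) : (toBPn p n).hom (vv p m) = 0 := by
  obtain ⟨i, rfl⟩ : ∃ i, m = i + 1 := ⟨m - 1, by omega⟩
  rw [toBPn_vv_succ, vn, dif_neg (by omega)]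

lemma toEn_vv_of_lt {m : ℕ} (h : n < m) : (toEn p n).hom (vv p m) = 0 := by
  change (awayMap (BPn p n) _ _).hom ((toBPn p n).hom _) = 0
  rw [toBPn_vv_of_lt p n h, map_zero]

lemma toBPn_surjective : Function.Surjective (toBPn p n).hom := by
  intro b
  refine MvPolynomial.induction_on (motive := fun b => ∃ a, (toBPn p n).hom a = b) b ?_ ?_ ?_
  · intro r
    exact ⟨(cst p).hom r, toBPn_cst p n r⟩
  · rintro x y ⟨a, rfl⟩ ⟨b, rfl⟩
    exact ⟨a + b, map_add _ _ _⟩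
  · rintro x i ⟨a, rfl⟩
    refine ⟨a * vv p (i + 1), ?_⟩
    rw [map_mul, toBPn_vv_succ, vn, dif_pos i.2]
    rfl

lemma isUnit_toEn : IsUnit ((toEn p n).hom (vv p n)) :=
  toAway_unit (BPn p n) ((toBPn p n).hom (vv p n))

lemma exists_toEn (e : En p n) : ∃ (s : ℕ) (a : BP p),
    (toEn p n).hom (vv p n) ^ s * e = (toEn p n).hom a := by
  obtain ⟨⟨b, ⟨_, s, rfl⟩⟩, h⟩ :=
    IsLocalization.surj (Submonoid.powers ((toBPn p n).hom (vv p n))) (show Localization.Away _ from e)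
  obtain ⟨a, rfl⟩ := toBPn_surjective p n b
  refine ⟨s, a, ?_⟩
  rw [mul_comm]
  refine Eq.trans ?_ h
  congr 1
  exact (map_pow (algebraMap (BPn p n) (Localization.Away _)) _ s).symm

lemma isUnit_cD : IsUnit ((cD p n).hom ((toEn p n).hom (vv p n))) := (isUnit_toEn p n).map _

lemma exists_theta (d : Dn p n) : ∃ (s : ℕ) (γ : BPBP p),
    (cD p n).hom ((toEn p n).hom (vv p n)) ^ s * d = theta p n γ := by
  induction d using poly_induction with
  | mono E e =>
    obtain ⟨s, a, h⟩ := exists_toEn p n e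
    refine ⟨s, conj p (polyMono (wt p) (BP p) E a), ?_⟩
    change _ = (polyMap (wt p) (toEn p n)).hom (conj p (conj p _))
    rw [conj_conj, polyMap_mono, ← h, ← map_pow, mul_comm, polyMono_mul_C, mul_comm]
  | add y z hy hz =>
    obtain ⟨s, γ, h⟩ := hy
    obtain ⟨s', γ', h'⟩ := hz
    refine ⟨s + s', (etaR p).hom (vv p n) ^ s' * γ + (etaR p).hom (vv p n) ^ s * γ', ?_⟩
    rw [map_add, map_mul, map_mul, ← h, ← h', map_pow, map_pow, theta_etaR]
    ring

variable {X : Type} [AddCommGroup X] [Module (BP p) X]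

/-- The map `BP_*BP ⊗ X → E(n)_*[t] ⊗ X` induced by `theta`. -/
def thetaT : PT (wt p) (BP p) X →+ TT (phi p n) X :=
  ttChange (polyC (wt p) (BP p)) (theta p n) (phi p n) fun a => (theta_C p n a).symm

lemma thetaT_smul (γ : BPBP p) (z : PT (wt p) (BP p) X) :
    thetaT p n (γ • z) = theta p n γ • thetaT p n z := ttChange_smul _ _ _ _ γ z

lemma exists_thetaT (x : TT (phi p n) X) : ∃ (s : ℕ) (z : PT (wt p) (BP p) X),
    (cD p n).hom ((toEn p n).hom (vv p n)) ^ s • x = thetaT p n z := by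
  induction x using TT.induction with
  | tt d x =>
    obtain ⟨s, γ, h⟩ := exists_theta p n d
    refine ⟨s, tt (polyC (wt p) (BP p)) γ x, ?_⟩
    rw [smul_tt, h]
    rfl
  | add y z hy hz =>
    obtain ⟨s, γ, h⟩ := hy
    obtain ⟨s', γ', h'⟩ := hz
    refine ⟨s + s', (etaR p).hom (vv p n) ^ s' • γ + (etaR p).hom (vv p n) ^ s • γ', ?_⟩
    rw [map_add, thetaT_smul, thetaT_smul, ← h, ← h', map_pow, map_pow, theta_etaR, smul_smul,
      smul_smul, ← pow_add, ← pow_add, smul_add, add_comm s' s]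

/-- The elements `η_R(v_{n+1}), η_R(v_{n+2}), …`. -/
def highEta (i : ℕ) : BPBP p := (etaR p).hom (vv p (n + i + 1))

lemma theta_highEta (i : ℕ) : theta p n (highEta p n i) = 0 := by
  rw [highEta, theta_etaR, toEn_vv_of_lt p n (by omega), map_zero]

section Kernel

/-- The quotient of `BP_*BP` by the elements `η_R(v_i)`, for `i > n`. -/
abbrev QuotHigh : Type := BPBP p ⧸ Ideal.span (Set.range (highEta p n))

/-- The powers of `η_R(v_n)`. -/
abbrev etaPowers : Submonoid (QuotHigh p n) :=
  Submonoid.powers (Ideal.Quotient.mk (Ideal.span (Set.range (highEta p n))) ((etaR p).hom (vv p n)))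

/-- The localization of `BP_*BP ⧸ (η_R(v_{n+1}), …)` at `η_R(v_n)`. -/
abbrev LocHigh : Type := Localization (etaPowers p n)

/-- The map from `BP_*BP` to its localized quotient. -/
def toLocHigh : BPBP p →+* LocHigh p n :=
  (algebraMap (QuotHigh p n) (LocHigh p n)).comp (Ideal.Quotient.mk _)

lemma isUnit_toLocHigh : IsUnit (toLocHigh p n ((etaR p).hom (vv p n))) :=
  IsLocalization.map_units (LocHigh p n) (⟨_, 1, pow_one _⟩ : etaPowers p n)

lemma toLocHigh_highEta (i : ℕ) : toLocHigh p n (highEta p n i) = 0 := by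
  change algebraMap (QuotHigh p n) (LocHigh p n)
    (Ideal.Quotient.mk (Ideal.span (Set.range (highEta p n))) (highEta p n i)) = 0
  rw [Ideal.Quotient.eq_zero_iff_mem.2 (Ideal.subset_span (Set.mem_range_self i)), map_zero]

/-- The map `ℤ_(p)[v_1, …, v_n] → BP_*BP ⧸ (η_R(v_{n+1}), …)` induced by the right unit. -/
def bpnToLoc : BPn p n →+* LocHigh p n :=
  MvPolynomial.eval₂Hom (R := GRing.triv (Zloc p)) (S₁ := LocHigh p n)
    ((toLocHigh p n).comp ((etaR p).hom.comp (cst p).hom))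
    fun i : Fin n => toLocHigh p n ((etaR p).hom (vv p (i + 1)))

lemma bpnToLoc_toBPn (a : BP p) :
    bpnToLoc p n ((toBPn p n).hom a) = toLocHigh p n ((etaR p).hom a) := by
  refine BP_ext p (f := (bpnToLoc p n).comp (toBPn p n).hom)
    (g := (toLocHigh p n).comp (etaR p).hom) ?_ ?_ a
  · intro r
    change bpnToLoc p n ((toBPn p n).hom ((cst p).hom r)) =
      toLocHigh p n ((etaR p).hom ((cst p).hom r))
    rw [toBPn_cst]
    exact MvPolynomial.eval₂Hom_C (R := GRing.triv (Zloc p)) (S₁ := LocHigh p n) _ _ r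
  · intro m
    change bpnToLoc p n ((toBPn p n).hom (vs p m)) = toLocHigh p n ((etaR p).hom (vs p m))
    cases m with
    | zero => rw [vs_zero, map_zero, map_zero, map_zero, map_zero]
    | succ i =>
      change bpnToLoc p n ((toBPn p n).hom (vv p (i + 1))) =
        toLocHigh p n ((etaR p).hom (vv p (i + 1)))
      rw [toBPn_vv_succ, vn]
      split_ifs with h
      · exact MvPolynomial.eval₂Hom_X' (R := GRing.triv (Zloc p)) (S₁ := LocHigh p n) _ _
          (⟨i, h⟩ : Fin n)
      · rw [map_zero]
        have := toLocHigh_highEta p n (i - n)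
        rw [highEta, show n + (i - n) + 1 = i + 1 by omega] at this
        exact this.symm

/-- The map `E(n)_* → (BP_*BP ⧸ (η_R(v_{n+1}), …))[1 / η_R(v_n)]` induced by the right unit. -/
def enToLoc : En p n →+* LocHigh p n :=
  IsLocalization.Away.lift (S := Localization.Away ((toBPn p n).hom (vv p n)))
    ((toBPn p n).hom (vv p n)) (g := bpnToLoc p n) (by
      rw [bpnToLoc_toBPn]; exact isUnit_toLocHigh p n)

lemma enToLoc_toEn (a : BP p) :
    enToLoc p n ((toEn p n).hom a) = toLocHigh p n ((etaR p).hom a) := by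
  rw [← bpnToLoc_toBPn]
  exact IsLocalization.Away.lift_eq (S := Localization.Away ((toBPn p n).hom (vv p n)))
    ((toBPn p n).hom (vv p n)) _ _

/-- The map `E(n)_*[t] → (BP_*BP ⧸ (η_R(v_{n+1}), …))[1 / η_R(v_n)]` induced by the right unit and
the conjugation. -/
def dnToLoc : Dn p n →+* LocHigh p n :=
  MvPolynomial.eval₂Hom (R := En p n) (S₁ := LocHigh p n) (enToLoc p n)
    fun i : ℕ => toLocHigh p n (conjTs p (i + 1))

lemma dnToLoc_theta (γ : BPBP p) : dnToLoc p n (theta p n γ) = toLocHigh p n γ := by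
  have key : ∀ x, dnToLoc p n ((polyMap (wt p) (toEn p n)).hom x) = toLocHigh p n (conj p x) := by
    refine poly_ext (wt p) (f := (dnToLoc p n).comp (polyMap (wt p) (toEn p n)).hom)
      (g := (toLocHigh p n).comp (conj p)) ?_ ?_
    · intro a
      change dnToLoc p n ((polyMap (wt p) (toEn p n)).hom ((polyC (wt p) (BP p)).hom a)) =
        toLocHigh p n (conj p ((polyC (wt p) (BP p)).hom a))
      rw [polyMap_C, conj_C, ← enToLoc_toEn]
      exact MvPolynomial.eval₂Hom_C (R := En p n) (S₁ := LocHigh p n) _ _ _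
    · intro i
      change dnToLoc p n ((polyMap (wt p) (toEn p n)).hom (ts p (BP p) (i + 1))) =
        toLocHigh p n (conj p (ts p (BP p) (i + 1)))
      rw [map_ts, conj_ts]
      exact MvPolynomial.eval₂Hom_X' (R := En p n) (S₁ := LocHigh p n) _ _ _
  rw [← conj_conj p γ, ← key]
  change dnToLoc p n ((polyMap (wt p) (toEn p n)).hom (conj p (conj p (conj p γ)))) = _
  rw [conj_conj]

variable (X)

/-- The quotient of `BP_*BP ⊗ X` by the elements `η_R(v_i)`, for `i > n`. -/
abbrev QuotT : Type := PT (wt p) (BP p) X ⧸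
  (Ideal.span (Set.range (highEta p n)) • ⊤ : Submodule (BPBP p) (PT (wt p) (BP p) X))

/-- The localization of `QuotT` at `η_R(v_n)`. -/
abbrev LocT : Type := LocalizedModule (etaPowers p n) (QuotT p n X)

variable {X}

/-- The map from `BP_*BP ⊗ X` to its localized quotient. -/
def toLocT : PT (wt p) (BP p) X →+ LocT p n X :=
  (LocalizedModule.mkLinearMap (etaPowers p n) (QuotT p n X)).toAddMonoidHom.comp
    (Submodule.mkQ _).toAddMonoidHom

lemma toLocT_smul (γ : BPBP p) (z : PT (wt p) (BP p) X) :
    toLocT p n (γ • z) = toLocHigh p n γ • toLocT p n z := by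
  have h1 : (Submodule.Quotient.mk (γ • z) : QuotT p n X) =
    (Ideal.Quotient.mk (Ideal.span (Set.range (highEta p n))) γ : QuotHigh p n) •
      (Submodule.Quotient.mk z : QuotT p n X) := rfl
  change LocalizedModule.mkLinearMap (etaPowers p n) (QuotT p n X) (Submodule.Quotient.mk (γ • z)) =
    algebraMap (QuotHigh p n) (LocHigh p n) _ •
    LocalizedModule.mkLinearMap (etaPowers p n) (QuotT p n X) (Submodule.Quotient.mk z)
  rw [h1, map_smul, algebraMap_smul]
  rfl

lemma exists_pow_of_toLocT {z : PT (wt p) (BP p) X} (h : toLocT p n z = 0) :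
    ∃ s m : ℕ, (etaR p).hom (vv p n) ^ s • z ∈ multiples (highEta p n) (PT (wt p) (BP p) X) m := by
  obtain ⟨⟨_, s, rfl⟩, hc⟩ := (IsLocalizedModule.eq_zero_iff (etaPowers p n)
    (LocalizedModule.mkLinearMap (etaPowers p n) (QuotT p n X))).1 h
  have h1 : (Submodule.Quotient.mk ((etaR p).hom (vv p n) ^ s • z) : QuotT p n X) = 0 := by
    refine Eq.trans ?_ hc
    change _ = (Ideal.Quotient.mk (Ideal.span (Set.range (highEta p n)))
      ((etaR p).hom (vv p n))) ^ s • (Submodule.Quotient.mk z : QuotT p n X)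
    rw [← map_pow (Ideal.Quotient.mk (Ideal.span (Set.range (highEta p n))))]
    rfl
  rw [Submodule.Quotient.mk_eq_zero] at h1
  obtain ⟨m, hm⟩ := exists_mem_multiples h1
  exact ⟨s, m, hm⟩

/-- The map from `E(n)_*[t] ⊗ X` to the localized quotient of `BP_*BP ⊗ X`. -/
def dnToLocT : TT (phi p n) X →+ LocT p n X :=
  TT.lift (phi p n)
    { toFun := fun d =>
        { toFun := fun x => dnToLoc p n d • toLocT p n (tt (polyC (wt p) (BP p)) 1 x)
          map_zero' := by rw [tt_zero, map_zero, smul_zero]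
          map_add' := fun x y => by rw [tt_add, map_add, smul_add] }
      map_zero' := by
        ext x
        change dnToLoc p n 0 • toLocT p n (tt (polyC (wt p) (BP p)) 1 x) = 0
        rw [map_zero, zero_smul]
      map_add' := fun d d' => by
        ext x
        change dnToLoc p n (d + d') • toLocT p n (tt (polyC (wt p) (BP p)) 1 x) =
          dnToLoc p n d • toLocT p n (tt (polyC (wt p) (BP p)) 1 x) +
          dnToLoc p n d' • toLocT p n (tt (polyC (wt p) (BP p)) 1 x)
        rw [map_add, add_smul] }
    (fun d a x => by
      change dnToLoc p n (d * (phi p n).hom a) • toLocT p n (tt (polyC (wt p) (BP p)) 1 x) =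
        dnToLoc p n d • toLocT p n (tt (polyC (wt p) (BP p)) 1 (a • x))
      rw [map_mul, mul_smul, ← theta_C, dnToLoc_theta, ← toLocT_smul, smul_tt, tt_smul, mul_comm])

lemma dnToLocT_thetaT (z : PT (wt p) (BP p) X) : dnToLocT p n (thetaT p n z) = toLocT p n z := by
  induction z using TT.induction with
  | tt γ x =>
    change dnToLoc p n (theta p n γ) • toLocT p n (tt (polyC (wt p) (BP p)) 1 x) = _
    rw [dnToLoc_theta, ← toLocT_smul, smul_tt, mul_one]
  | add y z hy hz => rw [map_add, map_add, map_add, hy, hz]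

/-- The kernel of `BP_*BP ⊗ X → E(n)_*[t] ⊗ X`. -/
lemma exists_pow_of_thetaT {z : PT (wt p) (BP p) X} (h : thetaT p n z = 0) :
    ∃ s m : ℕ, (etaR p).hom (vv p n) ^ s • z ∈ multiples (highEta p n) (PT (wt p) (BP p) X) m :=
  exists_pow_of_toLocT p n (by rw [← dnToLocT_thetaT, h, map_zero])

end Kernel

end EnPoly

/-! ## Flatness of `E(n)_*[t_1, t_2, …]` over the right unit -/

section Flat

variable (p : ℕ) [hp : Fact p.Prime]

lemma invIdeal_succ (k : ℕ) : invIdeal p (k + 1) = invIdeal p k ⊔ Ideal.span {vv p k} := by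
  rw [invIdeal, invIdeal, ← Ideal.span_union]
  congr 1
  rw [← Set.image_singleton, ← Set.image_union]
  congr 1
  ext x
  simp only [Set.mem_Iio, Set.mem_union, Set.mem_singleton_iff]
  omega

lemma map_etaR_invIdeal (k : ℕ) : (invIdeal p k).map (etaR p).hom = invIdealL p k := by
  refine le_antisymm ?_ ?_
  · rw [invIdeal, Ideal.map_span, Ideal.span_le]
    rintro _ ⟨_, ⟨m, hm, rfl⟩, rfl⟩
    exact etaR_mem_invIdealL p hm
  · induction k with
    | zero =>
      rw [invIdealL, invIdeal]
      simp
    | succ k ih =>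
      rw [invIdealL, invIdeal_succ, Ideal.map_sup, Ideal.map_sup]
      refine sup_le (ih.trans le_sup_left) ?_
      rw [Ideal.map_span, Ideal.span_le, Set.image_singleton, Set.singleton_subset_iff]
      have h := ih (etaR_sub_mem_invIdealL p k)
      have h' : (etaR p).hom (vv p k) ∈ (Ideal.span {vv p k}).map (etaR p).hom :=
        Ideal.mem_map_of_mem _ (Ideal.mem_span_singleton_self _)
      have := sub_mem (Ideal.mem_sup_right (S := (invIdeal p k).map (etaR p).hom) h')
        (Ideal.mem_sup_left h)
      rwa [sub_sub_cancel] at this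

variable (n : ℕ)

lemma map_phi_invIdeal (k : ℕ) : (invIdeal p k).map (phi p n).hom =
    ((invIdeal p k).map (toEn p n).hom).map (cD p n).hom := by
  have e1 : (phi p n).hom = (polyMap (wt p) (toEn p n)).hom.comp (etaR p).hom := rfl
  rw [e1, ← Ideal.map_map, map_etaR_invIdeal, invIdealL, Ideal.map_map, Ideal.map_map]
  congr 1
  ext a
  exact polyMap_C (wt p) (toEn p n) a

lemma phi_sub_mem (k : ℕ) : (phi p n).hom (vv p k) - (cD p n).hom ((toEn p n).hom (vv p k)) ∈
    (invIdeal p k).map (phi p n).hom := by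
  have e1 : (phi p n).hom = (polyMap (wt p) (toEn p n)).hom.comp (etaR p).hom := rfl
  have := Ideal.mem_map_of_mem (polyMap (wt p) (toEn p n)).hom (etaR_sub_mem_invIdealL p k)
  rw [map_sub, polyMap_C, ← map_etaR_invIdeal, Ideal.map_map, ← e1] at this
  exact this

lemma toBPn_vv_zero : (toBPn p n).hom (vv p 0) =
    (polyC (fun i : Fin n => wt p i) (GRing.triv (Zloc p))).hom (p : GRing.triv (Zloc p)) :=
  (map_natCast (toBPn p n).hom p).trans
    (map_natCast (polyC (fun i : Fin n => wt p i) (GRing.triv (Zloc p))).hom p).symm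

lemma map_toBPn_invIdeal_succ {k : ℕ} (hk : k < n) : (invIdeal p (k + 1)).map (toBPn p n).hom =
    polyPowIdeal (fun i : Fin n => wt p i) (GRing.triv (Zloc p)) (p : GRing.triv (Zloc p)) 1
      {i | (i : ℕ) < k} := by
  rw [invIdeal, Ideal.map_span, ← Set.image_comp, polyPowIdeal, pow_one]
  have := image_vv_succ p (fun x => (toBPn p n).hom x) k
  refine congrArg Ideal.span (this.trans ?_)
  rw [toBPn_vv_zero]
  congr 1
  ext x
  constructor
  · rintro ⟨l, hl, rfl⟩
    have hl' : l < k := hl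
    refine ⟨⟨l, hl'.trans hk⟩, hl, ?_⟩
    beta_reduce
    rw [toBPn_vv_succ, vn, dif_pos (hl'.trans hk), pow_one]
  · rintro ⟨i, hi, rfl⟩
    refine ⟨i, hi, ?_⟩
    beta_reduce
    rw [toBPn_vv_succ, vn, dif_pos i.2, pow_one]

lemma mem_map_toBPn_of_mul {k : ℕ} (hk : k ≤ n) {b : BPn p n}
    (h : (toBPn p n).hom (vv p k) * b ∈ (invIdeal p k).map (toBPn p n).hom) :
    b ∈ (invIdeal p k).map (toBPn p n).hom := by
  cases k with
  | zero =>
    have e : (invIdeal p 0).map (toBPn p n).hom = ⊥ := by simp [invIdeal]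
    rw [e, Submodule.mem_bot] at h ⊢
    have h' : (p : BPn p n) * b = 0 := by
      rw [← h]; congr 1; exact (map_natCast (toBPn p n).hom p).symm
    exact TF.poly (fun i : Fin n => wt p i) (R := GRing.triv (Zloc p)) (Zloc.tf p) b h'
  | succ k =>
    rw [map_toBPn_invIdeal_succ p n hk] at h ⊢
    rw [toBPn_vv_succ, vn, dif_pos (show k < n from hk)] at h
    have key := @mem_polyPowIdeal_of_X_mul (Fin n) (fun i : Fin n => wt p i) (GRing.triv (Zloc p))
      (p : GRing.triv (Zloc p)) 1 {i | (i : ℕ) < k} ⟨k, hk⟩ (lt_irrefl k) b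
    exact key h

lemma mem_map_toEn_of_mul {k : ℕ} (hk : k ≤ n) {e : En p n}
    (h : (toEn p n).hom (vv p k) * e ∈ (invIdeal p k).map (toEn p n).hom) :
    e ∈ (invIdeal p k).map (toEn p n).hom := by
  obtain ⟨s, a, ha⟩ := exists_toEn p n e
  have hu := (isUnit_toEn p n).pow s
  rw [← Ideal.unit_mul_mem_iff_mem _ hu, ha]
  have h1 : (toEn p n).hom (vv p k * a) ∈ (invIdeal p k).map (toEn p n).hom := by
    rw [map_mul, ← ha, mul_left_comm]
    exact Ideal.mul_mem_left _ _ h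
  have e2 : (invIdeal p k).map (toEn p n).hom = ((invIdeal p k).map (toBPn p n).hom).map
      (algebraMap (BPn p n) (Localization.Away ((toBPn p n).hom (vv p n)))) :=
    (Ideal.map_map (toBPn p n).hom
      (algebraMap (BPn p n) (Localization.Away ((toBPn p n).hom (vv p n))))).symm
  have h2 : algebraMap (BPn p n) (Localization.Away ((toBPn p n).hom (vv p n)))
      ((toBPn p n).hom (vv p k * a)) ∈ ((invIdeal p k).map (toBPn p n).hom).map
      (algebraMap (BPn p n) (Localization.Away ((toBPn p n).hom (vv p n)))) := e2 ▸ h1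
  rw [IsLocalization.algebraMap_mem_map_algebraMap_iff
    (Submonoid.powers ((toBPn p n).hom (vv p n)))] at h2
  obtain ⟨m, hm, h3⟩ := h2
  rw [map_mul, mul_left_comm] at h3
  have h4 := mem_map_toBPn_of_mul p n hk h3
  have h5 : algebraMap (BPn p n) (Localization.Away ((toBPn p n).hom (vv p n)))
      ((toBPn p n).hom a) ∈ ((invIdeal p k).map (toBPn p n).hom).map
      (algebraMap (BPn p n) (Localization.Away ((toBPn p n).hom (vv p n)))) :=
    (IsLocalization.algebraMap_mem_map_algebraMap_iff
      (Submonoid.powers ((toBPn p n).hom (vv p n))) _ _ _).2 ⟨m, hm, h4⟩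
  rw [e2]
  exact h5

lemma mem_map_phi_of_mul {k : ℕ} (hk : k ≤ n) {d : Dn p n}
    (h : (phi p n).hom (vv p k) * d ∈ (invIdeal p k).map (phi p n).hom) :
    d ∈ (invIdeal p k).map (phi p n).hom := by
  have h1 := sub_mem h (Ideal.mul_mem_right d _ (phi_sub_mem p n k))
  rw [← sub_mul, sub_sub_cancel, map_phi_invIdeal] at h1
  rw [map_phi_invIdeal]
  have h2 := (MvPolynomial.mem_map_C_iff (R := En p n) (σ := ℕ)).1 h1
  refine (MvPolynomial.mem_map_C_iff (R := En p n) (σ := ℕ)).2 fun E => ?_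
  refine mem_map_toEn_of_mul p n hk ?_
  exact Set.mem_of_eq_of_mem (MvPolynomial.coeff_C_mul (R := En p n) E _ d).symm (h2 E)

lemma mem_smul_top_iff (I : Ideal (BP p)) (d : Tw (phi p n)) :
    d ∈ (I • ⊤ : Submodule (BP p) (Tw (phi p n))) ↔ (show Dn p n from d) ∈ I.map (phi p n).hom := by
  rw [Ideal.smul_top_eq_map]
  rfl

lemma smul_ten_eq {X : Type} [AddCommGroup X] [Module (BP p) X] (a : BP p) (x : TT (phi p n) X) :
    (phi p n).hom a • x = (a • (show TensorProduct (BP p) (Tw (phi p n)) X from x) :) :=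
  algebraMap_smul (A := Tw (phi p n)) a (show TensorProduct (BP p) (Tw (phi p n)) X from x)

lemma thetaT_multiples {X : Type} [AddCommGroup X] [Module (BP p) X] {m : ℕ}
    {z : PT (wt p) (BP p) X} (h : z ∈ multiples (highEta p n) (PT (wt p) (BP p) X) m) :
    thetaT p n z = 0 := by
  obtain ⟨y, rfl⟩ := h
  rw [map_sum]
  refine Finset.sum_eq_zero fun i _ => ?_
  rw [thetaT_smul, theta_highEta, zero_smul]

lemma exists_pow_smul_eq_zero_of_ttMap {k : ℕ} (hk : k ≤ n) {X Y : Type} [AddCommGroup X]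
    [AddCommGroup Y] [Module (BP p) X] [Module (BP p) Y]
    (hY : ∀ a ∈ invIdeal p k, ∀ y : Y, a • y = 0) (f : X →ₗ[BP p] Y) (hf : Function.Injective f)
    (x : TT (phi p n) X) (hx : ttMap (phi p n) f x = 0) :
    ∃ s : ℕ, (phi p n).hom (vv p k) ^ s • x = 0 := by
  obtain ⟨s, z, hz⟩ := exists_thetaT p n x
  have h1 : thetaT p n (ttMap (polyC (wt p) (BP p)) f z) = 0 := by
    rw [thetaT, ttChange_ttMap]
    change ttMap (phi p n) f (thetaT p n z) = 0
    rw [← hz, map_smul, hx, smul_zero]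
  obtain ⟨s', m, hm⟩ := exists_pow_of_thetaT p n h1
  rw [← map_smul] at hm
  obtain ⟨l, rfl⟩ := Nat.exists_eq_add_of_le hk
  let e := LinearEquiv.ofInjective f hf
  obtain ⟨r, hr⟩ := exists_pow_smul_mem_multiples (p := p) (k := k) (l := l) hY (LinearMap.range f) m
    (ttMap _ e.toLinearMap ((etaR p).hom (vv p (k + l)) ^ s' • z)) (by
      rw [← ttMap_comp]; exact hm)
  have h2 := map_mem_multiples (ttMap _ e.symm.toLinearMap) hr
  rw [map_smul, ← ttMap_comp, LinearEquiv.symm_comp] at h2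
  have h3 := thetaT_multiples p (k + l) h2
  have h4 : ttMap (polyC (wt p) (BP p)) (LinearMap.id : X →ₗ[BP p] X)
      ((etaR p).hom (vv p (k + l)) ^ s' • z) = (etaR p).hom (vv p (k + l)) ^ s' • z := by
    induction (etaR p).hom (vv p (k + l)) ^ s' • z using TT.induction with
    | tt b x => rfl
    | add y z hy hz => rw [map_add, hy, hz]
  rw [h4, thetaT_smul, thetaT_smul, ← hz, map_pow, map_pow, theta_C, theta_etaR, smul_smul, smul_smul,
    mul_assoc, ← pow_add, mul_comm, mul_smul] at h3
  exact ⟨r, (((isUnit_cD p (k + l)).pow _).smul_eq_zero).1 h3⟩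

theorem flatOn_invIdeal (k : ℕ) (hk : k ≤ n + 1) : FlatOn (Tw (phi p n)) (invIdeal p k) := by
  induction hk using Nat.decreasingInduction with
  | self =>
    intro X Y _ _ _ _ hY f hf
    have hX : ∀ a ∈ (invIdeal p (n + 1)).map (phi p n).hom, ∀ x : TT (phi p n) X, a • x = 0 := by
      intro a ha x
      induction ha using Submodule.span_induction with
      | mem a ha =>
        obtain ⟨a, ha, rfl⟩ := ha
        induction x using TT.induction with
        | tt b x =>
          have hx : a • x = 0 := hf (by rw [map_smul, map_zero]; exact hY a ha _)
          rw [smul_tt, mul_comm]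
          exact (tt_smul (phi p n) b a x).symm.trans (by rw [hx, tt_zero])
        | add y z hy hz => rw [smul_add, hy, hz, add_zero]
      | zero => exact zero_smul _ x
      | add y z _ _ hy hz => rw [add_smul, hy, hz, add_zero]
      | smul b y _ hy => rw [smul_eq_mul, mul_smul, hy, smul_zero]
    have hu : (cD p n).hom ((toEn p n).hom (vv p n)) ∈ (invIdeal p (n + 1)).map (phi p n).hom := by
      rw [map_phi_invIdeal]
      exact Ideal.mem_map_of_mem _ (Ideal.mem_map_of_mem _ (vv_mem_invIdeal p (Nat.lt_succ_self n)))
    have h0 : ∀ x : TT (phi p n) X, x = 0 := fun x => by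
      have := hX _ hu x
      exact ((isUnit_cD p n).smul_eq_zero).1 this
    intro x y _
    exact (h0 x).trans (h0 y).symm
  | of_succ k hk ih =>
    rw [invIdeal_succ] at ih
    refine ih.of_regular ?_ ?_ ?_
    · intro x hx
      rw [← invPow_one] at hx ⊢
      exact mem_invPow_of_vv_mul p hx
    · intro d hd
      rw [mem_smul_top_iff] at hd ⊢
      exact mem_map_phi_of_mul p n (Nat.lt_succ_iff.1 hk) hd
    · intro X Y _ _ _ _ hY f hf x hx
      obtain ⟨s, hs⟩ := exists_pow_smul_eq_zero_of_ttMap p n (Nat.lt_succ_iff.1 hk) hY f hf x hx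
      refine ⟨s, ?_⟩
      have := smul_ten_eq p n (vv p k ^ s) x
      rw [map_pow] at this
      exact this.symm.trans hs

instance flat_phi : Module.Flat (BP p) (Tw (phi p n)) := by
  have := flatOn_invIdeal p n 0 (Nat.zero_le _)
  have e : invIdeal p 0 = ⊥ := by simp [invIdeal]
  rw [e] at this
  exact this.flat

end Flat

/-! ## Exactness of `E(n)_* ⊗ -` on comodules -/

section Retract

variable (p : ℕ) [hp : Fact p.Prime] (n : ℕ)

/-- The augmentation of `E(n)_*[t_1, t_2, …]`. -/
abbrev augD : Dn p n →+* En p n := (aug p (En p n)).hom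

lemma augD_polyMap (x : BPBP p) :
    augD p n ((polyMap (wt p) (toEn p n)).hom x) = (toEn p n).hom ((eps p).hom x) := by
  refine poly_ext (wt p) (f := (augD p n).comp (polyMap (wt p) (toEn p n)).hom)
    (g := (toEn p n).hom.comp (eps p).hom) ?_ ?_ x
  · intro a
    change augD p n ((polyMap (wt p) (toEn p n)).hom ((polyC (wt p) (BP p)).hom a)) =
      (toEn p n).hom ((eps p).hom ((polyC (wt p) (BP p)).hom a))
    rw [polyMap_C, aug_C, aug_C]
  · intro i
    change augD p n ((polyMap (wt p) (toEn p n)).hom (polyX (wt p) (BP p) i)) =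
      (toEn p n).hom ((eps p).hom (polyX (wt p) (BP p) i))
    rw [polyMap_X, polyDesc_X, polyDesc_X, map_zero]

lemma augD_phi (a : BP p) : (toEn p n).hom a = augD p n ((phi p n).hom a) := by
  have := augD_polyMap p n ((etaR p).hom a)
  rw [eps_etaR] at this
  exact this.symm

lemma augD_theta (γ : BPBP p) : augD p n (theta p n γ) = (toEn p n).hom ((eps p).hom γ) := by
  have := augD_polyMap p n (conj p γ)
  rw [eps_conj] at this
  exact this

variable (M : BPComod p)

lemma thetaT_psi_smul (a : BP p) (x : und M) : thetaT p n (psi M (a • x)) =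
    (cD p n).hom ((toEn p n).hom a) • thetaT p n (psi M x) := by
  rw [psi_smul, thetaT_smul, theta_etaR]

/-- The section `e ⊗ x ↦ e ∑ c(γ_i) ⊗ x_i`, where `∑ γ_i ⊗ x_i` is the coaction of `x`. -/
def secT : TT (toEn p n) (und M) →+ TT (phi p n) (und M) :=
  TT.lift (toEn p n)
    { toFun := fun e => 
        { toFun := fun x => (cD p n).hom e • thetaT p n (psi M x)
          map_zero' := by rw [map_zero, map_zero, smul_zero]
          map_add' := fun x y => by rw [map_add, map_add, smul_add] }
      map_zero' := by
        ext x
        change (cD p n).hom 0 • thetaT p n (psi M x) = 0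
        rw [map_zero, zero_smul]
      map_add' := fun e e' => by
        ext x
        change (cD p n).hom (e + e') • thetaT p n (psi M x) =
          (cD p n).hom e • thetaT p n (psi M x) + (cD p n).hom e' • thetaT p n (psi M x)
        rw [map_add, add_smul] }
    (fun e a x => by
      change (cD p n).hom (e * (toEn p n).hom a) • thetaT p n (psi M x) =
        (cD p n).hom e • thetaT p n (psi M (a • x))
      rw [thetaT_psi_smul, map_mul, mul_smul])

lemma secT_tt (e : En p n) (x : und M) :
    secT p n M (tt (toEn p n) e x) = (cD p n).hom e • thetaT p n (psi M x) := rfl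

/-- The retraction given by the augmentation. -/
def retT (X : Type) [AddCommGroup X] [Module (BP p) X] : TT (phi p n) X →+ TT (toEn p n) X :=
  ttChange (phi p n) (augD p n) (toEn p n) (augD_phi p n)

lemma retT_thetaT (z : PT (wt p) (BP p) (und M)) :
    retT p n (und M) (thetaT p n z) = tt (toEn p n) 1 (cuHom (und M) z) := by
  induction z using TT.induction with
  | tt γ x =>
    change tt (toEn p n) (augD p n (theta p n γ)) x = tt (toEn p n) 1 ((eps p).hom γ • x)
    rw [augD_theta, tt_smul, one_mul]
  | add y z hy hz => rw [map_add, map_add, map_add, tt_add, hy, hz]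

lemma retT_secT (y : TT (toEn p n) (und M)) : retT p n (und M) (secT p n M y) = y := by
  induction y using TT.induction with
  | tt e x =>
    rw [secT_tt, retT, ttChange_smul]
    change augD p n ((cD p n).hom e) • retT p n (und M) (thetaT p n (psi M x)) = _
    rw [retT_thetaT, cuHom_eq_cf, cf_psi_zero, aug_C, smul_tt, mul_one]
  | add y z hy hz => rw [map_add, map_add, hy, hz]

variable {M} {N : BPComod p}

lemma secT_hom (f : M ⟶ N) (y : TT (toEn p n) (und M)) :
    secT p n N (ttMap (toEn p n) ((BPforget p).map f).lin y) =
      ttMap (phi p n) ((BPforget p).map f).lin (secT p n M y) := by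
  induction y using TT.induction with
  | tt e x =>
    rw [ttMap_tt, secT_tt, secT_tt, psi_hom, thetaT, ttChange_ttMap, map_smul]
    rfl
  | add y z hy hz => rw [map_add, map_add, map_add, map_add, hy, hz]

lemma ttMap_phi_injective {X Y : Type} [AddCommGroup X] [Module (BP p) X] [AddCommGroup Y]
    [Module (BP p) Y] (f : X →ₗ[BP p] Y) (hf : Function.Injective f) :
    Function.Injective (ttMap (phi p n) f) :=
  Module.Flat.lTensor_preserves_injective_linearMap (M := Tw (phi p n)) f hf

/-- The functor `E(n)_* ⊗ -` preserves injectivity of comodule maps. -/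
theorem ttMap_toEn_injective (f : M ⟶ N) (hf : Function.Injective ((BPforget p).map f).lin) :
    Function.Injective (ttMap (toEn p n) ((BPforget p).map f).lin) := by
  intro x y hxy
  have := congrArg (secT p n N) hxy
  rw [secT_hom, secT_hom] at this
  rw [← retT_secT p n M x, ttMap_phi_injective p n _ hf this, retT_secT]

end Retract

/-! ## Comodules killed by `E(n)_* ⊗ -` -/

section Acyclic

variable (p : ℕ) [hp : Fact p.Prime] (n : ℕ)

section

variable (M : BPComod p)

/-- The map `a ↦ a ⊗ 1`. -/
abbrev leftUnit2 : (BP p).Hom (BPBP2 p) := (polyC (wt p) (BPBP p)).comp (polyC (wt p) (BP p))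

lemma conjMul_leftUnit2 (a : BP p) : (phi p n).hom a =
    ((polyMap (wt p) (toEn p n)).hom.comp (conjMul p)) ((leftUnit2 p).hom a) := by
  change (polyMap (wt p) (toEn p n)).hom ((etaR p).hom a) = (polyMap (wt p) (toEn p n)).hom
    (conjMul p ((polyC (wt p) (BPBP p)).hom ((polyC (wt p) (BP p)).hom a)))
  rw [conjMul_C, conj_C]

/-- The map on `M ⊗ BP_*BP ⊗ BP_*BP` given by the conjugation on the first factor. -/
def conjMulT (X : GMod (BP p)) : (BPH p).W.obj ((BPH p).W.obj X) →+ TT (phi p n) X :=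
  (ttChange (leftUnit2 p) ((polyMap (wt p) (toEn p n)).hom.comp (conjMul p)) (phi p n)
    (conjMul_leftUnit2 p n)).comp
    (show (BPH p).W.obj ((BPH p).W.obj X) →+ TT (leftUnit2 p) X from (BPH p).b2' X)

lemma conjMulT_t1 (X : GMod (BP p)) (γ : BPBP p) (z : PT (wt p) (BP p) X) :
    conjMulT p n X ((BPH p).t1 γ (show (BPH p).W.obj X from z)) =
      (polyMap (wt p) (toEn p n)).hom γ • thetaT p n z := by
  induction z using TT.induction with
  | tt γ' x =>
    refine (congrArg (ttChange (leftUnit2 p) ((polyMap (wt p) (toEn p n)).hom.comp (conjMul p))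
      (phi p n) (conjMul_leftUnit2 p n)) ((BPH p).b2'_t2 γ γ' x)).trans ?_
    change tt (phi p n) ((polyMap (wt p) (toEn p n)).hom (conjMul p
      ((polyMap (wt p) (etaR p)).hom γ * (polyC (wt p) (BPBP p)).hom γ'))) x =
      (polyMap (wt p) (toEn p n)).hom γ • tt (phi p n) (theta p n γ') x
    rw [map_mul, conjMul_map_etaR, conjMul_C, map_mul, smul_tt]
    rfl
  | add y z hy hz =>
    have h1 : (BPH p).t1 γ (show (BPH p).W.obj X from y + z) =
      (BPH p).t1 γ (show (BPH p).W.obj X from y) + (BPH p).t1 γ (show (BPH p).W.obj X from z) :=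
      tt_add (BPH p).etaL γ (show (BPH p).W.obj X from y) (show (BPH p).W.obj X from z)
    rw [h1, map_add, hy, hz, map_add, smul_add]

lemma conjMulT_cm (X : GMod (BP p)) (z : PT (wt p) (BP p) X) :
    conjMulT p n X (((BPH p).cm X).lin z) = tt (phi p n) 1 (cuHom X z) := by
  induction z using TT.induction with
  | tt γ x =>
    refine (congrArg (ttChange (leftUnit2 p) ((polyMap (wt p) (toEn p n)).hom.comp (conjMul p))
      (phi p n) (conjMul_leftUnit2 p n)) ((BPH p).b2'_cm γ x)).trans ?_
    change tt (phi p n) ((polyMap (wt p) (toEn p n)).hom (conjMul p ((Delta p).hom γ))) x =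
      tt (phi p n) 1 ((eps p).hom γ • x)
    rw [conjMul_Delta, tt_smul, one_mul]
    rfl
  | add y z hy hz =>
    have h1 : ((BPH p).cm X).lin (y + z) = ((BPH p).cm X).lin y + ((BPH p).cm X).lin z :=
      map_add ((BPH p).cm X).lin _ _
    rw [h1, map_add, hy, hz, map_add, tt_add]

/-- If all the elements `1 ⊗ x` of `E(n)_* ⊗ M` vanish, then so do those of `E(n)_*[t] ⊗ M`. -/
lemma tt_phi_one_eq_zero (h : ∀ x : und M, tt (toEn p n) 1 x = 0) (x : und M) :
    tt (phi p n) 1 x = 0 := by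
  have h0 : ∀ y : und M, thetaT p n (psi M y) = 0 := by
    intro y
    have := secT_tt p n M 1 y
    rw [h, map_zero, map_one, one_smul] at this
    exact this.symm
  have h1 : ∀ z : PT (wt p) (BP p) (und M),
      conjMulT p n (und M) (((BPH p).W.map M.a).lin z) = 0 := by
    intro z
    induction z using TT.induction with
    | tt γ y =>
      refine (congrArg (conjMulT p n (und M)) ((BPH p).W_map_t1 M.a γ y)).trans ?_
      refine (conjMulT_t1 p n (und M) γ (psi M y)).trans ?_
      rw [h0, smul_zero]
    | add y z hy hz =>
      have e : ((BPH p).W.map M.a).lin (y + z) =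
        ((BPH p).W.map M.a).lin y + ((BPH p).W.map M.a).lin z := map_add ((BPH p).W.map M.a).lin _ _
      refine (congrArg (conjMulT p n (und M)) e).trans ((map_add (conjMulT p n (und M)) _ _).trans ?_)
      exact (congrArg₂ (· + ·) hy hz).trans (add_zero 0)
  have h2 := conjMulT_cm p n (und M) (psi M x)
  rw [cuHom_eq_cf, cf_psi_zero] at h2
  have h3 : ((BPH p).cm (und M)).lin (psi M x) = ((BPH p).W.map M.a).lin (psi M x) :=
    congrArg (fun g : M.A ⟶ (BPH p).W.obj ((BPH p).W.obj M.A) => g.lin x) M.coassoc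
  rw [← h2, h3, h1]

end

section Points

variable {L : Type} [Field L] (u : BP p →+* L)

lemma exists_sequence (P : ℕ → (ℕ → L) → L → Prop) (hP : ∀ j τ, ∃ x, P j τ x)
    (hc : ∀ j τ τ' x, (∀ i < j, τ i = τ' i) → P j τ x → P j τ' x) :
    ∃ τ : ℕ → L, ∀ j, P j τ (τ j) := by
  classical
  choose r hr using hP
  let σ : ℕ → ℕ → L := fun m => Nat.rec (fun _ => 0) (fun j τ => Function.update τ j (r j τ)) m
  have hs : ∀ j, σ (j + 1) = Function.update (σ j) j (r j (σ j)) := fun j => rfl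
  have hst : ∀ j m, σ (j + 1 + m) j = r j (σ j) := by
    intro j m
    induction m with
    | zero => rw [add_zero, hs, Function.update_self]
    | succ m ih =>
      rw [← add_assoc, hs, Function.update_of_ne (by omega), ih]
  refine ⟨fun j => σ (j + 1) j, fun j => ?_⟩
  have e : σ (j + 1) j = r j (σ j) := hst j 0
  refine hc j (σ j) _ _ (fun i hi => ?_) (by
    change P j (σ j) (σ (j + 1) j)
    rw [e]; exact hr j (σ j))
  obtain ⟨m, rfl⟩ := Nat.exists_eq_add_of_le (Nat.succ_le_of_lt hi)
  exact (hst i m).trans (hst i 0).symm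

/-- The evaluation of `BP_*BP` at `t_{j+1} = τ_j`. -/
def evalAt (τ : ℕ → L) : BPBP p →+* L := MvPolynomial.eval₂Hom (R := BP p) u τ

lemma evalAt_C (τ : ℕ → L) (a : BP p) : evalAt p u τ ((polyC (wt p) (BP p)).hom a) = u a :=
  MvPolynomial.eval₂Hom_C (R := BP p) _ _ a

lemma evalAt_ts (τ : ℕ → L) (j : ℕ) : evalAt p u τ (ts p (BP p) (j + 1)) = τ j :=
  MvPolynomial.eval₂Hom_X' (R := BP p) _ _ j

lemma evalAt_invIdealL (τ : ℕ → L) {k : ℕ} (hu : ∀ i < k, u (vv p i) = 0) {γ : BPBP p}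
    (hγ : γ ∈ invIdealL p k) : evalAt p u τ γ = 0 := by
  have : invIdealL p k ≤ RingHom.ker (evalAt p u τ) := by
    rw [invIdealL, invIdeal, Ideal.map_span, Ideal.span_le]
    rintro _ ⟨_, ⟨i, hi, rfl⟩, rfl⟩
    exact (evalAt_C p u τ _).trans (hu i hi)
  exact this hγ

lemma evalAt_congr {τ τ' : ℕ → L} {l : ℕ} (h : ∀ j < l, τ j = τ' j) {s : BPBP p}
    (hs : s ∈ lowPoly p l) : evalAt p u τ s = evalAt p u τ' s := by
  have hs' : s ∈ MvPolynomial.supported (BP p) (Set.Iio l) := hs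
  exact MvPolynomial.eval₂Hom_congr' rfl (fun i hi _ => h i (MvPolynomial.mem_supported.1 hs' hi)) rfl

lemma evalAt_zero (s : BPBP p) : evalAt p u (fun _ => 0) s = u ((eps p).hom s) := by
  refine poly_ext (wt p) (f := evalAt p u fun _ => 0) (g := u.comp (eps p).hom) ?_ ?_ s
  · intro a
    change evalAt p u _ ((polyC (wt p) (BP p)).hom a) = u ((eps p).hom ((polyC (wt p) (BP p)).hom a))
    rw [evalAt_C, aug_C]
  · intro i
    change evalAt p u _ (ts p (BP p) (i + 1)) = u ((eps p).hom (polyX (wt p) (BP p) i))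
    rw [evalAt_ts, polyDesc_X, map_zero]

/-- Over an algebraically closed field, a point of height at most `n` of `BP_*` is isomorphic to one
of `E(n)_*`. -/
lemma exists_point [IsAlgClosed L] {k l : ℕ} (hu : ∀ i < k, u (vv p i) = 0) (hk : u (vv p k) ≠ 0)
    (hn : u (vv p (k + l)) ≠ 0) : ∃ τ : ℕ → L, evalAt p u τ ((etaR p).hom (vv p (k + l))) ≠ 0 ∧
      ∀ i, evalAt p u τ (highEta p (k + l) i) = 0 := by
  choose b s hs hb hr using exists_lead p k
  obtain ⟨τ, hτ⟩ := exists_sequence (L := L)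
    (fun j τ x => if j < l then x = 0 else
      u (vv p k) * x ^ p ^ k + u (b j) * x + evalAt p u τ (s j) = 0) (by
      intro j τ
      split_ifs with h
      · exact ⟨0, rfl⟩
      · obtain ⟨x, hx⟩ := IsAlgClosed.exists_root (Polynomial.C (u (vv p k)) * Polynomial.X ^ p ^ k +
          Polynomial.C (u (b j)) * Polynomial.X + Polynomial.C (evalAt p u τ (s j))) (by
          by_cases h0 : k = 0
          · subst h0
            rw [hb j rfl, map_zero, map_zero, zero_mul, add_zero, pow_zero, pow_one,
              Polynomial.degree_linear hk]
            exact one_ne_zero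
          · have h1 : 1 < p ^ k := Nat.one_lt_pow h0 hp.out.one_lt
            rw [add_assoc, Polynomial.degree_add_eq_left_of_degree_lt]
            · rw [Polynomial.degree_C_mul_X_pow _ hk]
              exact_mod_cast (by omega : p ^ k ≠ 0)
            · rw [Polynomial.degree_C_mul_X_pow _ hk]
              refine (Polynomial.degree_linear_le).trans_lt ?_
              exact_mod_cast h1)
        refine ⟨x, ?_⟩
        simpa [Polynomial.IsRoot] using hx) (by
      intro j τ τ' x h
      split_ifs
      · exact id
      · rw [evalAt_congr p u h (hs j)]
        exact id)
  have h0 : ∀ j < l, τ j = 0 := fun j hj => by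
    have := hτ j
    beta_reduce at this
    rwa [if_pos hj] at this
  refine ⟨τ, ?_, ?_⟩
  · obtain ⟨s', hs', h1⟩ := exists_low p k l (k + l) le_rfl
    have h2 := evalAt_invIdealL p u τ hu h1
    have h3 := evalAt_invIdealL p u (fun _ => 0) hu h1
    rw [map_sub, sub_eq_zero] at h2 h3
    rwa [h2, evalAt_congr p u (τ' := fun _ => 0) h0 hs', ← h3, evalAt_zero, eps_etaR]
  · intro i
    have h1 := evalAt_invIdealL p u τ hu (hr (l + i))
    have := hτ (l + i)
    beta_reduce at this
    rw [if_neg (by omega)] at this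
    simp only [map_sub, map_add, map_mul, map_pow, evalAt_C, evalAt_ts, this, sub_zero] at h1
    rw [highEta, show k + l + i + 1 = k + (l + i) + 1 by omega]
    exact h1

end Points

section

variable {L : Type} [Field L]

lemma exists_factor (ω : BPBP p →+* L) (h0 : ω ((etaR p).hom (vv p n)) ≠ 0)
    (h1 : ∀ i, ω (highEta p n i) = 0) : ∃ χ : Dn p n →+* L, ∀ γ, χ (theta p n γ) = ω γ := by
  let ω₁ : QuotHigh p n →+* L := Ideal.Quotient.lift _ ω fun a ha => by
    have : Ideal.span (Set.range (highEta p n)) ≤ RingHom.ker ω := by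
      rw [Ideal.span_le]
      rintro _ ⟨i, rfl⟩
      exact h1 i
    exact this ha
  let ω₂ : LocHigh p n →+* L := IsLocalization.lift (M := etaPowers p n) (g := ω₁) (by
    rintro ⟨_, s, rfl⟩
    refine IsUnit.mk0 _ ?_
    beta_reduce
    rw [map_pow]
    exact pow_ne_zero _ h0)
  refine ⟨ω₂.comp (dnToLoc p n), fun γ => ?_⟩
  change ω₂ (dnToLoc p n (theta p n γ)) = _
  rw [dnToLoc_theta]
  exact IsLocalization.lift_eq (M := etaPowers p n) (S := LocHigh p n) _ _

/-- A comodule `M` with `E(n)_* ⊗ M = 0` is `v_n`-torsion. -/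
theorem exists_pow_smul_of_tt_eq_zero (M : BPComod p) (h : ∀ x : und M, tt (toEn p n) 1 x = 0)
    (x : und M) : ∃ s : ℕ, vv p n ^ s • x = 0 := by
  by_contra hx
  push Not at hx
  let I : Ideal (BP p) := LinearMap.ker (LinearMap.toSpanSingleton (BP p) (und M) x)
  have hI : ∀ a, a ∈ I ↔ a • x = 0 := fun a => Iff.rfl
  obtain ⟨P, hP, hIP, hdis⟩ := Ideal.exists_le_prime_disjoint I (Submonoid.powers (vv p n)) (by
    rw [Set.disjoint_left]
    rintro a ha ⟨s, rfl⟩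
    exact hx s ((hI _).1 ha))
  let K := FractionRing (BP p ⧸ P)
  let L := AlgebraicClosure K
  let u : BP p →+* L := (algebraMap K L).comp ((algebraMap (BP p ⧸ P) K).comp (Ideal.Quotient.mk P))
  have hu : ∀ a, u a = 0 ↔ a ∈ P := fun a => by
    change algebraMap K L (algebraMap (BP p ⧸ P) K (Ideal.Quotient.mk P a)) = 0 ↔ _
    rw [map_eq_zero, IsFractionRing.to_map_eq_zero_iff, Ideal.Quotient.eq_zero_iff_mem]
  have hn : u (vv p n) ≠ 0 := fun h0 =>
    Set.disjoint_left.1 hdis ((hu _).1 h0) ⟨1, pow_one _⟩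
  classical
  have hex : ∃ k, u (vv p k) ≠ 0 := ⟨n, hn⟩
  obtain ⟨l, hl⟩ := Nat.exists_eq_add_of_le (Nat.find_min' hex hn)
  obtain ⟨τ, h1, h2⟩ := exists_point p u (k := Nat.find hex) (l := l)
    (fun i hi => not_not.1 (Nat.find_min hex hi)) (Nat.find_spec hex) (hl ▸ hn)
  rw [← hl] at h1 h2
  obtain ⟨χ, hχ⟩ := exists_factor p n (evalAt p u τ) h1 h2
  let S : Submodule (BP p) (und M) := Submodule.span (BP p) {x}
  have hS : ∀ y : S, ∃ a : BP p, a • x = y := fun y => Submodule.mem_span_singleton.1 y.2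
  choose c hc using hS
  have hcu : ∀ (y : S) (a : BP p), a • x = y → u a = u (c y) := by
    intro y a ha
    rw [← sub_eq_zero, ← map_sub, hu]
    refine hIP ((hI _).2 ?_)
    rw [sub_smul, ha, hc, sub_self]
  let g : S →+ L :=
    { toFun := fun y => u (c y)
      map_zero' := by rw [← hcu 0 0 (zero_smul _ _), map_zero]
      map_add' := fun y z => by
        rw [← map_add]
        exact (hcu (y + z) (c y + c z) (by rw [add_smul, hc, hc]; rfl)).symm }
  have hg : ∀ a y, g (a • y) = u a * g y := fun a y => by
    change u (c (a • y)) = u a * u (c y)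
    rw [← map_mul]
    exact (hcu (a • y) (a * c y) (by rw [mul_smul, hc]; rfl)).symm
  let Λ : TT (phi p n) S →+ L := TT.lift (phi p n)
    ((AddMonoidHom.mul (R := L)).comp χ.toAddMonoidHom |>.compr₂ (AddMonoidHom.id L) |>.compl₂ g)
    (fun d a y => by
      change χ (d * (phi p n).hom a) * g y = χ d * g (a • y)
      rw [map_mul, ← theta_C, hχ, evalAt_C, hg, mul_assoc])
  let x' : S := ⟨x, Submodule.mem_span_singleton_self x⟩
  have h3 : tt (phi p n) 1 x' = 0 := by
    refine ttMap_phi_injective p n S.subtype S.injective_subtype ?_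
    rw [map_zero, ttMap_tt]
    exact tt_phi_one_eq_zero p n M h x
  have h4 : Λ (tt (phi p n) 1 x') = χ 1 * g x' := rfl
  have h5 : g x' = 1 := by
    change u (c x') = 1
    rw [← hcu x' 1 (one_smul _ _), map_one]
  rw [h3, map_zero, map_one, one_mul, h5] at h4
  exact zero_ne_one h4

end

end Acyclic

/-! ## Exactness for graded modules -/

section Exact

variable {A : GRing}

lemma GMod.exact_iff (S : ShortComplex (GMod A)) :
    S.Exact ↔ ∀ x, S.g.lin x = 0 → ∃ y, S.f.lin y = x := by
  rw [S.exact_iff_kernel_ι_comp_cokernel_π_zero]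
  constructor
  · intro h x hx
    have h1 : S.X₂.subι _ (GMod.ker_homogeneous S.g) ≫ S.X₂.quotπ _ (GMod.range_homogeneous S.f) = 0 := by
      rw [← kernel.lift_ι S.g _ (GMod.kernel_w S.g), ← cokernel.π_desc S.f _ (GMod.cokernel_w S.f),
        Category.assoc, reassoc_of% h, zero_comp, comp_zero]
    have h2 := congrArg (fun k : (S.X₂.sub _ (GMod.ker_homogeneous S.g)) ⟶ _ =>
      k.lin (⟨x, hx⟩ : LinearMap.ker S.g.lin)) h1
    exact (Submodule.Quotient.mk_eq_zero _).1 h2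
  · intro h
    ext x
    have h1 : S.g.lin ((kernel.ι S.g).lin x) = 0 :=
      congrArg (fun k => GMod.Hom.lin k x) (kernel.condition S.g)
    obtain ⟨y, hy⟩ := h _ h1
    have h2 : (cokernel.π S.f).lin (S.f.lin y) = 0 :=
      congrArg (fun k => GMod.Hom.lin k y) (cokernel.condition S.f)
    rw [GMod.comp_apply, ← hy, h2]
    rfl

lemma GMod.epi_of_surjective {M N : GMod A} (f : M ⟶ N) (h : Function.Surjective f.lin) : Epi f :=
  ⟨fun g k e => by
    ext x
    obtain ⟨y, rfl⟩ := h x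
    exact congrArg (fun k => GMod.Hom.lin k y) e⟩

lemma GMod.isZero_iff (M : GMod A) : IsZero M ↔ ∀ x : M, x = 0 := by
  rw [IsZero.iff_id_eq_zero]
  constructor
  · intro h x
    exact congrArg (fun k : M ⟶ M => k.lin x) h
  · intro h
    ext x
    exact (h x).trans (h _).symm

end Exact

/-! ## The unit of the adjunction between comodule categories -/

section Comparison

open Comonad ComonadicityInternal

variable {C D : Type 1} [Category.{0} C] [Category.{0} D] {F : C ⥤ D} {G : D ⥤ C} (adj : F ⊣ G)

lemma isIso_map_of_fork {B E : C} (u : B ⟶ E) (ι : E ⟶ G.obj (F.obj B)) (hι : u ≫ ι = adj.unit.app B)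
    (h : ι ≫ G.map (F.map (adj.unit.app B)) = ι ≫ adj.unit.app (G.obj (F.obj B)))
    (hm : Mono (F.map ι)) : IsIso (F.map u) := by
  have h1 : F.map (adj.unit.app B) ≫ adj.counit.app (F.obj B) = 𝟙 _ := adj.left_triangle_components B
  have h2 : (F.map ι ≫ adj.counit.app (F.obj B)) ≫ F.map (adj.unit.app B) = F.map ι := by
    have e2 : F.map (G.map (F.map (adj.unit.app B))) ≫ adj.counit.app (F.obj (G.obj (F.obj B))) =
      adj.counit.app (F.obj B) ≫ F.map (adj.unit.app B) := adj.counit_naturality _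
    have e3 : F.map (adj.unit.app (G.obj (F.obj B))) ≫ adj.counit.app (F.obj (G.obj (F.obj B))) =
      𝟙 _ := adj.left_triangle_components _
    have e4 := congrArg (fun g => F.map g) h
    simp only [Functor.map_comp] at e4
    refine (Category.assoc _ _ _).trans ((congrArg (fun g => F.map ι ≫ g) e2.symm).trans ?_)
    refine (Category.assoc _ _ _).symm.trans ((congrArg (fun g => g ≫ adj.counit.app _) e4).trans ?_)
    refine (Category.assoc _ _ _).trans ((congrArg (fun g => F.map ι ≫ g) e3).trans ?_)
    exact Category.comp_id _
  refine ⟨F.map ι ≫ adj.counit.app (F.obj B), ?_, ?_⟩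
  · rw [← Category.assoc, ← F.map_comp, hι, h1]; rfl
  · rw [← cancel_mono (F.map ι), Category.assoc, ← F.map_comp, hι, h2, Category.id_comp]

variable [∀ A : adj.toComonad.Coalgebra, HasEqualizer (G.map A.a) (adj.unit.app (G.obj A.A))]

/-- The inclusion of the equalizer that defines the right adjoint. -/
def forkι (X : adj.toComonad.Coalgebra) : (rightAdjointComparison adj).obj X ⟶ G.obj X.A :=
  equalizer.ι (G.map X.a) (adj.unit.app (G.obj X.A))

instance (X : adj.toComonad.Coalgebra) : Mono (forkι adj X) :=
  ⟨fun _ _ e => equalizer.hom_ext e⟩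

lemma forkι_condition (X : adj.toComonad.Coalgebra) :
    forkι adj X ≫ G.map X.a = forkι adj X ≫ adj.unit.app (G.obj X.A) :=
  equalizer.condition (G.map X.a) (adj.unit.app (G.obj X.A))

lemma unit_forkι (B : C) : (comparisonAdjunction adj).unit.app B ≫
    forkι adj ((comparison adj).obj B) = adj.unit.app B := by
  rw [comparisonAdjunction_unit_app]
  exact limit.lift_π (unitFork adj B) WalkingParallelPair.zero

lemma isIso_map_comparison_unit [F.PreservesMonomorphisms] (B : C) :
    IsIso (F.map ((comparisonAdjunction adj).unit.app B)) :=
  isIso_map_of_fork adj ((comparisonAdjunction adj).unit.app B) (forkι adj ((comparison adj).obj B))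
    (unit_forkι adj B) (forkι_condition adj ((comparison adj).obj B))
    (F.map_mono (forkι adj ((comparison adj).obj B)))

end Comparison

/-! ## The unit `M ⟶ L_n M` -/

section LnUnit

variable (p : ℕ) [hp : Fact p.Prime] (n : ℕ)

/-- The functor `M ↦ E(n)_* ⊗ M` on comodules. -/
abbrev EF : BPComod p ⥤ GMod (En p n) := BPforget p ⋙ ext (toEn p n)

instance BPforget_preservesFiniteLimits : PreservesFiniteLimits (BPforget p) :=
  inferInstanceAs (PreservesFiniteLimits (BPH p).comonad.forget)

instance BPforget_preservesMonomorphisms : (BPforget p).PreservesMonomorphisms := inferInstance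

instance EF_preservesMonomorphisms : (EF p n).PreservesMonomorphisms where
  preserves {M N} f _ := by
    refine GMod.mono_of_injective _ ?_
    have h := ttMap_toEn_injective p n f (GMod.injective_of_mono ((BPforget p).map f))
    intro x y hxy
    refine h ?_
    exact (ext_map_eq_ttMap (toEn p n) ((BPforget p).map f) x).symm.trans
      (hxy.trans (ext_map_eq_ttMap (toEn p n) ((BPforget p).map f) y))

/-- The unit `M ⟶ L_n M`. -/
def LnUnit : 𝟭 (BPComod p) ⟶ Ln p n := (PhiAdj (BPH p) (toEn p n)).unit

variable (M : BPComod p)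

/-- The unit `M ⟶ L_n M`, for a fixed comodule. -/
abbrev lnUnit : M ⟶ (Ln p n).obj M := (LnUnit p n).app M

instance : IsIso ((EF p n).map (lnUnit p n M)) :=
  haveI : ((BPH p).U ⋙ ext (A := (BPH p).A) (toEn p n)).PreservesMonomorphisms :=
    EF_preservesMonomorphisms p n
  isIso_map_comparison_unit (adjB (BPH p) (toEn p n)) M

lemma tt_eq_zero_of_isZero (h : IsZero ((EF p n).obj M)) (x : und M) : tt (toEn p n) 1 x = 0 :=
  (GMod.isZero_iff _).1 h (tm (toEn p n) 1 x)

lemma torsBelow_of_isZero (h : IsZero ((EF p n).obj M)) (x : und M) : TorsBelow p (n + 1) x :=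
  torsBelow_of_powTorsion n M x
    (exists_pow_smul_of_tt_eq_zero p n M (tt_eq_zero_of_isZero p n M h) x)

instance BPforget_preservesFiniteColimits : PreservesFiniteColimits (BPforget p) :=
  haveI : PreservesColimitsOfSize.{0, 0} (BPH p).comonad.forget :=
    (BPH p).comonad.adj.leftAdjoint_preservesColimits
  PreservesColimitsOfSize.preservesFiniteColimits.{0, 0} (BPH p).comonad.forget

instance EF_isLeftAdjoint : (EF p n).IsLeftAdjoint := (adjB (BPH p) (toEn p n)).isLeftAdjoint

variable {M} in
/-- The functor that forgets the coaction preserves exactness. -/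
lemma exists_of_exact {K N : BPComod p} {f : K ⟶ M} {g : M ⟶ N} {w : f ≫ g = 0}
    (h : (ShortComplex.mk f g w).Exact) {x : und M} (hx : ((BPforget p).map g).lin x = 0) :
    ∃ y : und K, ((BPforget p).map f).lin y = x :=
  (GMod.exact_iff _).1 (h.map (BPforget p)) x hx

lemma torsBelow_of_LnUnit_eq_zero {x : und M} (h : ((BPforget p).map (lnUnit p n M)).lin x = 0) :
    TorsBelow p (n + 1) x := by
  obtain ⟨y, rfl⟩ := exists_of_exact p ((ShortComplex.mk _ _
    (kernel.condition (lnUnit p n M))).exact_of_f_is_kernel (kernelIsKernel _)) h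
  have h2 : (EF p n).map (kernel.ι (lnUnit p n M)) = 0 := by
    rw [← cancel_mono ((EF p n).map (lnUnit p n M)), ← (EF p n).map_comp, kernel.condition,
      zero_comp, Functor.map_zero]
  have h3 := torsBelow_of_isZero p n (kernel (lnUnit p n M)) (IsZero.of_mono_eq_zero _ h2) y
  intro l hl
  obtain ⟨s, hs⟩ := h3 l hl
  exact ⟨s, by rw [← map_smul, hs, map_zero]⟩

lemma exists_pow_smul_eq_LnUnit (y : und ((Ln p n).obj M)) {i : ℕ} (hi : i ≤ n) :
    ∃ (s : ℕ) (x : und M), ((BPforget p).map (lnUnit p n M)).lin x = vv p i ^ s • y := by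
  have h2 : (EF p n).map (cokernel.π (lnUnit p n M)) = 0 := by
    rw [← cancel_epi ((EF p n).map (lnUnit p n M)), ← (EF p n).map_comp, cokernel.condition,
      comp_zero, Functor.map_zero]
  obtain ⟨s, hs⟩ := torsBelow_of_isZero p n (cokernel (lnUnit p n M))
    (IsZero.of_epi_eq_zero _ h2) (((BPforget p).map (cokernel.π (lnUnit p n M))).lin y) i
    (Nat.lt_succ_of_le hi)
  rw [← map_smul] at hs
  exact ⟨s, exists_of_exact p ((ShortComplex.mk _ _
    (cokernel.condition (lnUnit p n M))).exact_of_g_is_cokernel (cokernelIsCokernel _)) hs⟩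

/-- There is no `v_n`-torsion in `L_n M`. -/
lemma eq_zero_of_pow_smul_Ln (y : und ((Ln p n).obj M)) (h : ∃ s : ℕ, vv p n ^ s • y = 0) : y = 0 := by
  let T := (Tn p n).obj ((Ln p n).obj M)
  let i : T ⟶ (Ln p n).obj M := (TnIncl p n).app _
  have hT : ∀ x : und T, ∃ s : ℕ, vv p n ^ s • x = 0 := by
    intro x
    obtain ⟨s, hs⟩ := (mem_range_TnIncl n ((Ln p n).obj M) (((BPforget p).map i).lin x)).1 ⟨x, rfl⟩
    refine ⟨s, ?_⟩
    have hi : Mono i := inferInstanceAs (Mono (tors_isSubcomodule _ _).incl)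
    refine GMod.injective_of_mono ((BPforget p).map i) ?_
    rw [map_smul, hs, map_zero]
  have h0 : ∀ z : TT (toEn p n) (und T), z = 0 := by
    intro z
    induction z using TT.induction with
    | tt e x =>
      obtain ⟨s, hs⟩ := hT x
      have h1 : (toEn p n).hom (vv p n) ^ s • tt (toEn p n) e x = 0 := by
        rw [smul_tt, mul_comm, ← map_pow, ← tt_smul, hs, tt_zero]
      exact (((isUnit_toEn p n).pow s).smul_eq_zero).1 h1
    | add y z hy hz => rw [hy, hz, add_zero]
  have hz : IsZero ((EF p n).obj T) := (GMod.isZero_iff _).2 h0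
  have h1 : i = 0 := by
    refine ((PhiAdj (BPH p) (toEn p n)).homEquiv T _).symm.injective ?_
    refine Comonad.Coalgebra.Hom.ext ?_
    exact hz.eq_of_src _ _
  obtain ⟨x, rfl⟩ := (mem_range_TnIncl n ((Ln p n).obj M) y).2 h
  change ((BPforget p).map i).lin x = 0
  rw [h1, Functor.map_zero]
  rfl

end LnUnit

/-! ## Divisibility in injective comodules -/

section Divisible

/-- An element that is torsion for all of `v_0, …, v_{i-1}`. -/
def TorsLt {A : Type} [CommRing A] (v : ℕ → A) (i : ℕ) {X : Type} [AddCommGroup X] [Module A X]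
    (x : X) : Prop := ∀ l < i, ∃ s : ℕ, v l ^ s • x = 0

/-- The local cohomology of `X` for `(v_0, …, v_{i-1})` in degree zero is `v_i`-divisible. -/
def TorsDivisible {A : Type} [CommRing A] (v : ℕ → A) (X : Type) [AddCommGroup X] [Module A X] : Prop :=
  ∀ (i : ℕ) (y : X), TorsLt v i y → ∃ z : X, TorsLt v i z ∧ v i • z = y

lemma TorsDivisible.of_retract {A : Type} [CommRing A] {v : ℕ → A} {X Y : Type} [AddCommGroup X]
    [Module A X] [AddCommGroup Y] [Module A Y] (h : TorsDivisible v Y) (f : X →ₗ[A] Y)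
    (g : Y →ₗ[A] X) (hgf : ∀ x, g (f x) = x) : TorsDivisible v X := by
  intro i y hy
  obtain ⟨z, hz, hzy⟩ := h i (f y) fun l hl => by
    obtain ⟨s, hs⟩ := hy l hl
    exact ⟨s, by rw [← map_smul, hs, map_zero]⟩
  refine ⟨g z, fun l hl => ?_, by rw [← map_smul, hzy, hgf]⟩
  obtain ⟨s, hs⟩ := hz l hl
  exact ⟨s, by rw [← map_smul, hs, map_zero]⟩

variable (p : ℕ) [hp : Fact p.Prime]

/-- Divisibility of the elements killed by `v_0 ^ r, …, v_{i-1} ^ r`. -/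
def PowDivisible (X : Type) [AddCommGroup X] [Module (BP p) X] : Prop :=
  ∀ (i r R : ℕ) (y : X), (∀ l < i, vv p l ^ r • y = 0) →
    ∃ z : X, (∀ l < i, vv p l ^ r • z = 0) ∧ vv p i ^ R • z = y

lemma mem_invPow_of_vv_pow_mul {r k R : ℕ} {a : BP p} (h : vv p k ^ R * a ∈ invPow p r k) :
    a ∈ invPow p r k := by
  induction R with
  | zero => rwa [pow_zero, one_mul] at h
  | succ R ih =>
    rw [pow_succ', mul_assoc] at h
    exact ih (mem_invPow_of_vv_mul p h)

lemma powDivisible_of_injective (N : ModuleCat.{0} (BP p)) [Injective N] : PowDivisible p N := by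
  intro i r R y hy
  let J := invPow p r i
  let f : (BP p ⧸ J) →ₗ[BP p] (BP p ⧸ J) := LinearMap.lsmul (BP p) (BP p ⧸ J) (vv p i ^ R)
  have hf : Function.Injective f := by
    rw [injective_iff_map_eq_zero]
    intro x hx
    obtain ⟨a, rfl⟩ := Submodule.Quotient.mk_surjective J x
    change (Submodule.Quotient.mk (vv p i ^ R * a) : BP p ⧸ J) = 0 at hx
    rw [Submodule.Quotient.mk_eq_zero] at hx ⊢
    exact mem_invPow_of_vv_pow_mul p hx
  have hJ : J ≤ LinearMap.ker (LinearMap.toSpanSingleton (BP p) N y) := by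
    refine Submodule.span_le.2 ?_
    rintro _ ⟨l, hl, rfl⟩
    exact hy l hl
  let g : (BP p ⧸ J) →ₗ[BP p] N := J.liftQ (LinearMap.toSpanSingleton (BP p) N y) hJ
  have : Mono (ModuleCat.ofHom f) := (ModuleCat.mono_iff_injective _).2 hf
  let h := Injective.factorThru (ModuleCat.ofHom g) (ModuleCat.ofHom f)
  have hh : ∀ x, h.hom (f x) = g x := fun x =>
    congrArg (fun k : ModuleCat.of (BP p) (BP p ⧸ J) ⟶ N => k.hom x)
      (Injective.comp_factorThru (ModuleCat.ofHom g) (ModuleCat.ofHom f))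
  refine ⟨h.hom (Submodule.Quotient.mk 1 : BP p ⧸ J), fun l hl => ?_, ?_⟩
  · rw [← map_smul, ← Submodule.Quotient.mk_smul, smul_eq_mul, mul_one,
      (Submodule.Quotient.mk_eq_zero J).2 (Submodule.subset_span ⟨l, hl, rfl⟩), map_zero]
  · rw [← map_smul]
    refine (hh _).trans ?_
    exact one_smul _ y

variable {p}

lemma PowDivisible.finsupp {X : Type} [AddCommGroup X] [Module (BP p) X] (h : PowDivisible p X)
    {ι κ : Type} (σ : ℕ → ι ≃ κ) (i r R : ℕ) (y : κ →₀ X) (hy : ∀ l < i, ∀ k, vv p l ^ r • y k = 0) :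
    ∃ z : ι →₀ X, (∀ l < i, ∀ k, vv p l ^ r • z k = 0) ∧ ∀ k, vv p i ^ R • z k = y (σ R k) := by
  classical
  choose z hz hzy using fun k => h i r R (y k) fun l hl => hy l hl k
  refine ⟨Finsupp.onFinset (y.support.image (σ R).symm) (fun k => if y (σ R k) = 0 then 0 else
    z (σ R k)) ?_, fun l hl k => ?_, fun k => ?_⟩
  · intro k hk
    rw [Finset.mem_image]
    refine ⟨σ R k, ?_, (σ R).symm_apply_apply k⟩
    rw [Finsupp.mem_support_iff]
    intro h0
    exact hk (if_pos h0)
  · rw [Finsupp.onFinset_apply]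
    split_ifs
    · rw [smul_zero]
    · exact hz _ l hl
  · rw [Finsupp.onFinset_apply]
    split_ifs with h0
    · rw [smul_zero, h0]
    · exact hzy _

lemma Cof.smul_apply {A : GRing} {N : ModuleCat.{0} A} {i : ℤ} {a : A} (ha : a ∈ A.deg i)
    (x : Cof A N) (j : ℤ) :
    (show ℤ →₀ N from a • x) (i + j) = a • (show ℤ →₀ N from x) j := by
  classical
  induction x using Cof.induction with
  | h k n =>
    rw [Cof.smul_single ha]
    change (Finsupp.single (i + k) (a • n) : ℤ →₀ N) (i + j) = a • (Finsupp.single k n : ℤ →₀ N) j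
    rw [Finsupp.single_apply, Finsupp.single_apply]
    by_cases hk : k = j
    · rw [if_pos hk, if_pos (by rw [hk])]
    · rw [if_neg hk, if_neg (by omega), smul_zero]
  | add y z hy hz =>
    have e1 : (show ℤ →₀ N from a • (y + z)) (i + j) =
      (show ℤ →₀ N from a • y) (i + j) + (show ℤ →₀ N from a • z) (i + j) := by
      rw [smul_add]; rfl
    have e2 : (show ℤ →₀ N from (y + z)) j = (show ℤ →₀ N from y) j + (show ℤ →₀ N from z) j := rfl
    rw [e1, e2, hy, hz, smul_add]

lemma pow_mem_deg {A : GRing} {i : ℤ} {a : A} (ha : a ∈ A.deg i) (s : ℕ) : a ^ s ∈ A.deg (s * i) := by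
  induction s with
  | zero => simpa using A.one_mem
  | succ s ih =>
    rw [pow_succ]
    have := A.mul_mem ih ha
    rwa [show (s : ℤ) * i + i = ((s + 1 : ℕ) : ℤ) * i by push_cast; ring] at this

lemma PowDivisible.cof {N : ModuleCat.{0} (BP p)} (h : PowDivisible p N) : PowDivisible p (cof (BP p) N) := by
  intro i r R y hy
  let y' : ℤ →₀ N := y
  obtain ⟨z, hz, hzy⟩ := h.finsupp (fun R => Equiv.addLeft ((R : ℤ) * dg p i)) i r R
    y' fun l hl k => by
      have := Cof.smul_apply (pow_mem_deg (vv_mem p l) r) y k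
      exact this.symm.trans (congrArg (fun w : ℤ →₀ N => w _) (hy l hl))
  refine ⟨z, fun l hl => ?_, ?_⟩
  · refine Finsupp.ext fun k => ?_
    have := Cof.smul_apply (pow_mem_deg (vv_mem p l) r) z (k - (r : ℤ) * dg p l)
    rw [add_sub_cancel] at this
    exact this.trans (hz l hl _)
  · refine Finsupp.ext fun k => ?_
    have := Cof.smul_apply (pow_mem_deg (vv_mem p i) R) z (k - (R : ℤ) * dg p i)
    rw [add_sub_cancel] at this
    exact this.trans ((hzy _).trans (congrArg y' (add_sub_cancel _ _)))

lemma PowDivisible.PT {X : Type} [AddCommGroup X] [Module (BP p) X] (h : PowDivisible p X) (i r R : ℕ)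
    (y : PT (wt p) (BP p) X) (hy : ∀ l < i, (polyC (wt p) (BP p)).hom (vv p l) ^ r • y = 0) :
    ∃ z : PT (wt p) (BP p) X, (∀ l < i, (polyC (wt p) (BP p)).hom (vv p l) ^ r • z = 0) ∧
      (polyC (wt p) (BP p)).hom (vv p i) ^ R • z = y := by
  obtain ⟨z, hz, hzy⟩ := h.finsupp (fun _ => Equiv.refl (ℕ →₀ ℕ)) i r R (cf y) fun l hl E => by
    rw [← cf_pow_smul, hy l hl, AddMonoidHom.map_zero, Finsupp.zero_apply]
  refine ⟨ofCf z, fun l hl => PT_ext fun E => ?_, PT_ext fun E => ?_⟩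
  · rw [cf_pow_smul, cf_ofCf, hz l hl, AddMonoidHom.map_zero, Finsupp.zero_apply]
  · rw [cf_pow_smul, cf_ofCf, hzy]; rfl

lemma torsBelow_cf_of_etaR {X : Type} [AddCommGroup X] [Module (BP p) X] {y : PT (wt p) (BP p) X} {i : ℕ}
    (hy : ∀ l < i, ∃ s : ℕ, (etaR p).hom (vv p l) ^ s • y = 0) (E : ℕ →₀ ℕ) :
    TorsBelow p i (cf y E) := by
  have key : ∀ k ≤ i, ∀ E, TorsBelow p k (cf y E) := by
    intro k
    induction k with
    | zero => intro _ E l hl; omega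
    | succ k ih =>
      intro hk E l hl
      rcases Nat.lt_succ_iff_lt_or_eq.1 hl with hl | rfl
      · exact ih (by omega) E l hl
      have h1 : (etaR p).hom (vv p l) ∈ (Ideal.torsionOf (BPBP p) (BPCom.PT (wt p) (BP p) X) y).radical := by
        obtain ⟨s, hs⟩ := hy l (by omega)
        exact ⟨s, hs⟩
      have h2 := sub_mem h1 (show _ ∈ _ from
        exists_pow_smul_of_torsBelow (ih (by omega)) (etaR_sub_mem_invIdealL p l))
      rw [sub_sub_cancel] at h2
      obtain ⟨s, hs⟩ := h2
      refine ⟨s, ?_⟩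
      have := congrArg (fun z => cf z E) hs
      beta_reduce at this
      rw [LinearMap.toSpanSingleton_apply, cf_pow_smul, AddMonoidHom.map_zero] at this
      exact this
  exact key i le_rfl E

lemma exists_pow_mem_map_invPow (r i : ℕ) {γ : BPBP p} (hγ : γ ∈ invIdealL p i) :
    ∃ R, γ ^ R ∈ (invPow p r i).map (polyC (wt p) (BP p)).hom := by
  have : invIdealL p i ≤ ((invPow p r i).map (polyC (wt p) (BP p)).hom).radical := by
    rw [invIdealL, invIdeal, Ideal.map_span, Ideal.span_le]
    rintro _ ⟨_, ⟨l, hl, rfl⟩, rfl⟩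
    refine ⟨r, ?_⟩
    rw [← map_pow]
    exact Ideal.mem_map_of_mem _ (Ideal.subset_span ⟨l, hl, rfl⟩)
  exact this hγ

lemma smul_eq_zero_of_mem_map_invPow {X : Type} [AddCommGroup X] [Module (BP p) X]
    {z : PT (wt p) (BP p) X} {r i : ℕ}
    (hz : ∀ l < i, (polyC (wt p) (BP p)).hom (vv p l) ^ r • z = 0) {γ : BPBP p}
    (hγ : γ ∈ (invPow p r i).map (polyC (wt p) (BP p)).hom) : γ • z = 0 := by
  have : (invPow p r i).map (polyC (wt p) (BP p)).hom ≤
      Ideal.torsionOf (BPBP p) (BPCom.PT (wt p) (BP p) X) z := by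
    rw [invPow, Ideal.map_span, Ideal.span_le]
    rintro _ ⟨_, ⟨l, hl, rfl⟩, rfl⟩
    have := hz l hl
    rw [← map_pow] at this
    exact this
  exact this hγ

variable (p) in
/-- The underlying module of a cofree comodule. -/
abbrev undCofree (X : GMod (BP p)) : GMod (BP p) := (BPH p).W.obj X

/-- Divisibility for cofree comodules. -/
lemma PowDivisible.W {X : GMod (BP p)} (h : PowDivisible p X) :
    TorsDivisible (vv p) (undCofree p X) := by
  intro i y hy
  let y' : BPCom.PT (wt p) (BP p) X := y
  have hy' : ∀ l < i, ∃ s : ℕ, (etaR p).hom (vv p l) ^ s • y' = 0 := fun l hl => by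
    obtain ⟨s, hs⟩ := hy l hl
    refine ⟨s, ?_⟩
    rw [← map_pow]
    exact hs
  have h1 : ∃ r : ℕ, ∀ l < i, (polyC (wt p) (BP p)).hom (vv p l) ^ r • y' = 0 := by
    have : ∀ l, ∃ s : ℕ, l < i → (polyC (wt p) (BP p)).hom (vv p l) ^ s • y' = 0 := by
      intro l
      by_cases hl : l < i
      · obtain ⟨s, hs⟩ := exists_pow_C_smul fun E => torsBelow_cf_of_etaR hy' E l hl
        exact ⟨s, fun _ => hs⟩
      · exact ⟨0, fun h => (hl h).elim⟩
    choose s hs using this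
    refine ⟨(Finset.range i).sup s, fun l hl => ?_⟩
    obtain ⟨t, ht⟩ := Nat.exists_eq_add_of_le (Finset.le_sup (f := s) (Finset.mem_range.2 hl))
    rw [ht, add_comm, pow_add, mul_smul, hs l hl, smul_zero]
  obtain ⟨r, hr⟩ := h1
  obtain ⟨R, hR⟩ := exists_pow_mem_map_invPow r i (neg_mem (etaR_sub_mem_invIdealL p i))
  obtain ⟨z, hz, hzy⟩ := h.PT i r R y' hr
  obtain ⟨q, hq⟩ := sub_dvd_pow_sub_pow ((polyC (wt p) (BP p)).hom (vv p i))
    (-((etaR p).hom (vv p i) - (polyC (wt p) (BP p)).hom (vv p i))) R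
  rw [sub_neg_eq_add, add_sub_cancel] at hq
  have h2 : (etaR p).hom (vv p i) • q • z = y' := by
    rw [smul_smul, ← hq, sub_smul, hzy, smul_eq_zero_of_mem_map_invPow hz hR, sub_zero]
  refine ⟨(show undCofree p X from q • z), fun l hl => ?_, h2⟩
  obtain ⟨s, hs⟩ := exists_pow_smul_of_torsBelow (z := q • z) (k := i) (fun E l hl => ⟨r, by
    rw [← cf_pow_smul, smul_comm, hz l hl, smul_zero, AddMonoidHom.map_zero, Finsupp.zero_apply]⟩)
    (etaR_mem_invIdealL p hl)
  refine ⟨s, ?_⟩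
  rw [← map_pow] at hs
  exact hs

lemma map_homEquiv_counit {C D : Type*} [Category* C] [Category* D] {F : C ⥤ D} {G : D ⥤ C}
    (adj : F ⊣ G) {X : C} {Y : D} (g : F.obj X ⟶ Y) :
    F.map (adj.homEquiv X Y g) ≫ adj.counit.app Y = g :=
  (adj.homEquiv_counit _ _ _).symm.trans ((adj.homEquiv X Y).symm_apply_apply g)

/-- Divisibility for injective comodules. -/
theorem torsDivisible_of_injective (J : BPComod p) [Injective J] : TorsDivisible (vv p) (und J) := by
  let N := Injective.under ((GMod.forget (BP p)).obj (und J))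
  let f : (und J) →ₗ[BP p] N := (Injective.ι ((GMod.forget (BP p)).obj (und J))).hom
  have hf : Function.Injective f := (ModuleCat.mono_iff_injective _).1 inferInstance
  let g : (BPforget p).obj J ⟶ cof (BP p) N := toCof f
  have hg : Function.Injective g.lin := fun x y hxy => hf (by
    rw [← cofSum_toCof f x, ← cofSum_toCof f y]; exact congrArg _ hxy)
  let u : J ⟶ (BPH p).comonad.cofree.obj (cof (BP p) N) := (BPH p).comonad.adj.homEquiv _ _ g
  have hm : Mono g := GMod.mono_of_injective _ hg
  have : Mono ((BPforget p).map u) := mono_of_mono_fac (map_homEquiv_counit (BPH p).comonad.adj g)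
  have hr : (BPH p).comonad.forget.ReflectsMonomorphisms := inferInstance
  have : Mono u := hr.reflects u this
  let ρ := Injective.factorThru (𝟙 J) u
  have hρ : u ≫ ρ = 𝟙 J := Injective.comp_factorThru _ _
  have hW : TorsDivisible (vv p) (undCofree p (cof (BP p) N)) :=
    (powDivisible_of_injective p N).cof.W
  refine hW.of_retract ((BPforget p).map u).lin ((BPforget p).map ρ).lin fun x => ?_
  have h1 : (BPforget p).map u ≫ (BPforget p).map ρ = 𝟙 (und J) := ((BPforget p).map_comp u ρ).symm.trans
    ((congrArg (BPforget p).map hρ).trans ((BPforget p).map_id J))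
  exact congrArg (fun k : und J ⟶ und J => k.lin x) h1

end Divisible

/-! ## Acyclicity of Koszul complexes, for families of elements -/

section Families

variable {m : ℕ}

/-- The elements of `S` that are less than `i`. -/
def lo (i : ℕ) (S : Finset (Fin m)) : Finset (Fin m) := S.filter fun j => (j : ℕ) < i

lemma mem_lo {i : ℕ} {S : Finset (Fin m)} {j : Fin m} : j ∈ lo i S ↔ j ∈ S ∧ (j : ℕ) < i :=
  Finset.mem_filter

/-- The elements of `S` that are at least `i` are those of `R`. -/
def HiEq (i : ℕ) (R S : Finset (Fin m)) : Prop := ∀ j : Fin m, i ≤ (j : ℕ) → (j ∈ S ↔ j ∈ R)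

lemma lo_succ_of_notMem {i : Fin m} {S : Finset (Fin m)} (h : i ∉ S) : lo (i + 1) S = lo i S := by
  ext j
  rw [mem_lo, mem_lo]
  refine and_congr_right fun hj => ?_
  have : (j : ℕ) ≠ i := fun e => h (Fin.ext e ▸ hj)
  omega

lemma lo_succ_of_mem {i : Fin m} {S : Finset (Fin m)} (h : i ∈ S) :
    lo (i + 1) S = insert i (lo i S) := by
  ext j
  rw [Finset.mem_insert, mem_lo, mem_lo, Nat.lt_succ_iff_lt_or_eq, ← Fin.ext_iff]
  constructor
  · rintro ⟨hj, hj' | rfl⟩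
    · exact Or.inr ⟨hj, hj'⟩
    · exact Or.inl rfl
  · rintro (rfl | ⟨hj, hj'⟩)
    · exact ⟨h, Or.inr rfl⟩
    · exact ⟨hj, Or.inl hj'⟩

lemma notMem_lo (i : Fin m) (S : Finset (Fin m)) : i ∉ lo i S := fun h =>
  lt_irrefl _ (mem_lo.1 h).2

lemma lo_erase (i : Fin m) (S : Finset (Fin m)) : lo i (S.erase i) = lo i S := by
  ext j
  rw [mem_lo, mem_lo, Finset.mem_erase]
  refine ⟨fun h => ⟨h.1.2, h.2⟩, fun h => ⟨⟨fun e => ?_, h.1⟩, h.2⟩⟩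
  rw [e] at h
  exact lt_irrefl _ h.2

variable {N : Finset (Fin m) → Type} [∀ S, AddCommGroup (N S)] (lm : ∀ S T, N S →+ N T)

/-- The part of the differential that belongs to the elements less than `i`. -/
def dd (i : ℕ) (x : ∀ S, N S) (T : Finset (Fin m)) : N T :=
  ∑ j ∈ lo i T, sgn j T • lm (T.erase j) T (x (T.erase j))

lemma dd_congr {i : ℕ} {x y : ∀ S, N S} {T : Finset (Fin m)}
    (h : ∀ j ∈ lo i T, x (T.erase j) = y (T.erase j)) : dd lm i x T = dd lm i y T :=
  Finset.sum_congr rfl fun j hj => by rw [h j hj]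

lemma dd_succ_of_notMem {i : Fin m} (x : ∀ S, N S) {T : Finset (Fin m)} (h : i ∉ T) :
    dd lm (i + 1) x T = dd lm i x T := by rw [dd, lo_succ_of_notMem h, dd]

lemma dd_succ_of_mem {i : Fin m} (x : ∀ S, N S) {T : Finset (Fin m)} (h : i ∈ T) :
    dd lm (i + 1) x T = sgn i T • lm (T.erase i) T (x (T.erase i)) + dd lm i x T := by
  rw [dd, lo_succ_of_mem h, Finset.sum_insert (notMem_lo i T), dd]

variable (hcomp : ∀ {S T R : Finset (Fin m)}, S ⊆ T → T ⊆ R → ∀ x, lm T R (lm S T x) = lm S R x)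
  (hlift : ∀ (i : Fin m) (R : Finset (Fin m)), (∀ j ∈ R, i < j) → ∀ x : N (insert i R),
    (∀ j < i, lm (insert i R) (insert j (insert i R)) x = 0) →
    ∃ w : N R, (∀ j < i, lm R (insert j R) w = 0) ∧ lm R (insert i R) w = x)

/-- The Koszul complex is acyclic in positive degrees. -/
def DDExact (i : ℕ) : Prop := ∀ R : Finset (Fin m), (∀ j ∈ R, i ≤ (j : ℕ)) → ∀ k : ℕ, 1 ≤ k → ∀ x : ∀ S, N S,
  (∀ T, HiEq i R T → (lo i T).card = k + 1 → dd lm i x T = 0) →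
  ∃ y : ∀ S, N S, ∀ S, HiEq i R S → (lo i S).card = k → dd lm i y S = x S

include hcomp in
lemma dd_correction {i : Fin m} {x y : ∀ S, N S} {T : Finset (Fin m)} (hi : i ∈ T)
    (hx : dd lm (i + 1) x T = 0) (hy : dd lm i y (T.erase i) = x (T.erase i)) :
    dd lm i (fun S => x S - sgn i S • lm (S.erase i) S (y (S.erase i))) T = 0 := by
  rw [dd_succ_of_mem lm x hi, ← hy] at hx
  have h1 : sgn i T • lm (T.erase i) T (dd lm i y (T.erase i)) = ∑ j ∈ lo i T,
      (sgn i T * sgn j T) • lm ((T.erase j).erase i) T (y ((T.erase j).erase i)) := by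
    rw [dd, lo_erase, map_sum, Finset.smul_sum]
    refine Finset.sum_congr rfl fun j hj => ?_
    have hji : j < i := (mem_lo.1 hj).2
    rw [map_zsmul, hcomp (Finset.erase_subset _ _) (Finset.erase_subset _ _), smul_smul,
      sgn_erase hi, if_neg hji.not_gt, Finset.erase_right_comm]
  have h2 : dd lm i (fun S => sgn i S • lm (S.erase i) S (y (S.erase i))) T =
      - ∑ j ∈ lo i T, (sgn i T * sgn j T) • lm ((T.erase j).erase i) T (y ((T.erase j).erase i)) := by
    rw [dd, ← Finset.sum_neg_distrib]
    refine Finset.sum_congr rfl fun j hj => ?_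
    have hji : j < i := (mem_lo.1 hj).2
    rw [map_zsmul, hcomp (Finset.erase_subset _ _) (Finset.erase_subset _ _), smul_smul,
      sgn_erase (mem_lo.1 hj).1, if_pos hji, mul_neg, neg_smul, mul_comm]
  have h3 : dd lm i (fun S => x S - sgn i S • lm (S.erase i) S (y (S.erase i))) T =
      dd lm i x T - dd lm i (fun S => sgn i S • lm (S.erase i) S (y (S.erase i))) T := by
    rw [dd, dd, dd, ← Finset.sum_sub_distrib]
    exact Finset.sum_congr rfl fun j _ => by rw [map_sub, smul_sub]
  rw [h3, h2, ← h1, sub_neg_eq_add, add_comm]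
  exact hx

lemma HiEq.succ {i : ℕ} {R S : Finset (Fin m)} (h : HiEq i R S) : HiEq (i + 1) R S :=
  fun j hj => h j (by omega)

lemma HiEq.of_succ_notMem {i : Fin m} {R S : Finset (Fin m)} (h : HiEq (i + 1) R S) (hR : i ∉ R)
    (hS : i ∉ S) : HiEq i R S := by
  intro j hj
  rcases hj.lt_or_eq with hj | hj
  · exact h j hj
  · rw [← Fin.ext hj]
    exact ⟨fun h => (hS h).elim, fun h => (hR h).elim⟩

lemma HiEq.of_succ_mem {i : Fin m} {R S : Finset (Fin m)} (h : HiEq (i + 1) R S) 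
    (hS : i ∈ S) : HiEq i (insert i R) S := by
  intro j hj
  rcases hj.lt_or_eq with hj | hj
  · rw [h j hj, Finset.mem_insert, or_iff_right]
    rintro rfl
    exact lt_irrefl _ hj
  · rw [← Fin.ext hj]
    exact ⟨fun _ => Finset.mem_insert_self _ _, fun _ => hS⟩

lemma HiEq.of_insert {i : Fin m} {R S : Finset (Fin m)} (h : HiEq i (insert i R) S) :
    i ∈ S ∧ HiEq (i + 1) R S := by
  refine ⟨(h i le_rfl).2 (Finset.mem_insert_self _ _), fun j hj => ?_⟩
  rw [h j (by omega), Finset.mem_insert, or_iff_right]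
  rintro rfl
  omega

lemma HiEq.erase {i : Fin m} {R S : Finset (Fin m)} (h : HiEq (i + 1) R S) (hR : i ∉ R) :
    HiEq i R (S.erase i) := by
  refine HiEq.of_succ_notMem (fun j hj => ?_) hR (Finset.notMem_erase _ _)
  rw [Finset.mem_erase, h j hj, and_iff_right]
  rintro rfl
  omega

lemma HiEq.eq_of_lo_eq_empty {i : ℕ} {R S : Finset (Fin m)} (h : HiEq i R S)
    (hR : ∀ j ∈ R, i ≤ (j : ℕ)) (hS : lo i S = ∅) : S = R := by
  ext j
  by_cases hj : i ≤ (j : ℕ)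
  · exact h j hj
  · constructor
    · intro hjS
      have : j ∈ lo i S := mem_lo.2 ⟨hjS, by omega⟩
      rw [hS] at this
      exact (Finset.notMem_empty _ this).elim
    · intro hjR
      exact (hj (hR j hjR)).elim

lemma HiEq.erase_eq {i : ℕ} {R S : Finset (Fin m)} (h : HiEq i R S) (hR : ∀ j ∈ R, i ≤ (j : ℕ))
    (hS : (lo i S).card = 1) {j : Fin m} (hj : j ∈ lo i S) : S.erase j = R := by
  obtain ⟨j', hj'⟩ := Finset.card_eq_one.1 hS
  rw [hj', Finset.mem_singleton] at hj
  subst hj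
  refine HiEq.eq_of_lo_eq_empty (i := i) (fun l hl => ?_) hR ?_
  · rw [Finset.mem_erase, h l hl, and_iff_right]
    rintro rfl
    have : l ∈ lo i S := by rw [hj']; exact Finset.mem_singleton_self _
    have := (mem_lo.1 this).2
    omega
  · ext l
    rw [mem_lo, Finset.mem_erase]
    refine ⟨fun hl => ?_, fun hl => (Finset.notMem_empty _ hl).elim⟩
    have : l ∈ lo i S := mem_lo.2 ⟨hl.1.2, hl.2⟩
    rw [hj', Finset.mem_singleton] at this
    exact (hl.1.1 this).elim

include hcomp hlift in
lemma DDExact.succ (i : Fin m) (ih : DDExact lm i) : DDExact lm (i + 1) := by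
  intro R hR k hk x hx
  have hiR : i ∉ R := fun h => by have := hR i h; omega
  obtain ⟨y, hy⟩ := ih R (fun j hj => by have := hR j hj; omega) k hk x fun T hT hc => by
    have hiT : i ∉ T := fun h => hiR ((hT i le_rfl).1 h)
    rw [← dd_succ_of_notMem lm x hiT]
    exact hx T hT.succ (by rw [lo_succ_of_notMem hiT, hc])
  set x' : ∀ S, N S := fun S => x S - sgn i S • lm (S.erase i) S (y (S.erase i)) with hx'
  have hcoc : ∀ T, HiEq i (insert i R) T → (lo i T).card = k → dd lm i x' T = 0 := by
    intro T hT hc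
    obtain ⟨hiT, hT'⟩ := hT.of_insert
    refine dd_correction lm hcomp hiT (hx T hT' ?_) (hy _ (hT'.erase hiR) ?_)
    · rw [lo_succ_of_mem hiT, Finset.card_insert_of_notMem (notMem_lo _ _), hc]
    · rw [lo_erase, hc]
  rcases hk.lt_or_eq with hk | rfl
  · obtain ⟨y', hy'⟩ := ih (insert i R) (fun j hj => by
      rcases Finset.mem_insert.1 hj with rfl | hj
      · exact le_rfl
      · have := hR j hj; omega) (k - 1) (by omega) x' fun T hT hc => hcoc T hT (by omega)
    refine ⟨fun S => if i ∈ S then y' S else y S, fun S hS hc => ?_⟩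
    by_cases hiS : i ∈ S
    · rw [lo_succ_of_mem hiS, Finset.card_insert_of_notMem (notMem_lo _ _)] at hc
      rw [dd_succ_of_mem lm _ hiS, if_neg (Finset.notMem_erase _ _), dd_congr lm (y := y') fun j hj =>
        if_pos (Finset.mem_erase.2 ⟨fun e => notMem_lo i S (by subst e; exact hj), hiS⟩),
        hy' S (hS.of_succ_mem hiS) (by omega), hx', add_sub_cancel]
    · rw [lo_succ_of_notMem hiS] at hc
      rw [dd_succ_of_notMem lm _ hiS, dd_congr lm (y := y) fun j hj =>
        if_neg fun h => hiS (Finset.mem_of_mem_erase h), hy S (hS.of_succ_notMem hiR hiS) hc]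
  · obtain ⟨w, hw, hwx⟩ := hlift i R (fun j hj => hR j hj) (x' (insert i R)) fun j hj => by
      have hji : j ∉ insert i R := by
        rw [Finset.mem_insert, not_or]
        exact ⟨hj.ne, fun h => by have := hR j h; have : (j : ℕ) < i := hj; omega⟩
      have hlo : lo i (insert j (insert i R)) = {j} := by
        ext l
        rw [mem_lo, Finset.mem_singleton, Finset.mem_insert, Finset.mem_insert]
        constructor
        · rintro ⟨rfl | rfl | hl, hl'⟩
          · rfl
          · exact (lt_irrefl _ hl').elim
          · have := hR l hl; omega
        · rintro rfl
          exact ⟨Or.inl rfl, hj⟩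
      have := hcoc (insert j (insert i R)) (fun l hl => by
        rw [Finset.mem_insert, or_iff_right]
        rintro rfl
        have : (l : ℕ) < i := hj
        omega) (by rw [hlo, Finset.card_singleton])
      rw [dd, hlo, Finset.sum_singleton, Finset.erase_insert hji] at this
      have h2 := congrArg (fun z => sgn j (insert j (insert i R)) • z) this
      beta_reduce at h2
      rwa [smul_smul, sgn, ← mul_pow, neg_one_mul, neg_neg, one_pow, one_smul, smul_zero] at h2
    set w' := sgn i (insert i R) • w with hw'
    refine ⟨fun S => y S + Pi.single R w' S, fun S hS hc => ?_⟩
    have hδ : ∀ j ∈ lo (i + 1) S, lm (S.erase j) S (Pi.single R w' (S.erase j)) = lm R S w' := by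
      intro j hj
      rw [hS.erase_eq hR hc hj, Pi.single_eq_same]
    have hadd : dd lm (i + 1) (fun S => y S + Pi.single R w' S) S =
        dd lm (i + 1) y S + ∑ j ∈ lo (i + 1) S, sgn j S • lm R S w' := by
      rw [dd, dd, ← Finset.sum_add_distrib]
      exact Finset.sum_congr rfl fun j hj => by rw [map_add, smul_add, hδ j hj]
    rw [hadd]
    obtain ⟨j, hj⟩ := Finset.card_eq_one.1 hc
    have hjm : j ∈ lo (i + 1) S := by rw [hj]; exact Finset.mem_singleton_self _
    have hjS : S = insert j R := by
      rw [← hS.erase_eq hR hc hjm, Finset.insert_erase (mem_lo.1 hjm).1]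
    rw [hj, Finset.sum_singleton]
    by_cases hiS : i ∈ S
    · have hij : j = i := by
        have : i ∈ lo (i + 1) S := mem_lo.2 ⟨hiS, Nat.lt_succ_self _⟩
        rw [hj, Finset.mem_singleton] at this
        exact this.symm
      subst hij
      subst hjS
      rw [dd_succ_of_mem lm _ hiS, hw', map_zsmul, hwx, hx', smul_smul, sgn, ← mul_pow, neg_one_mul,
        neg_neg, one_pow, one_smul]
      have h0 : lo j (insert j R) = ∅ := by
        rw [lo_succ_of_mem hiS, Finset.card_insert_of_notMem (notMem_lo _ _)] at hc
        exact Finset.card_eq_zero.1 (by omega)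
      rw [dd, h0, Finset.sum_empty, add_zero]
      exact add_sub_cancel _ _
    · have hji : j < i := by
        have := (mem_lo.1 hjm).2
        have hne : (j : ℕ) ≠ i := fun e => hiS (Fin.ext e ▸ (mem_lo.1 hjm).1)
        exact Fin.lt_def.2 (by omega)
      subst hjS
      rw [lo_succ_of_notMem hiS] at hc
      rw [dd_succ_of_notMem lm _ hiS, hy _ (hS.of_succ_notMem hiR hiS) hc, hw', map_zsmul, hw j hji,
        smul_zero, smul_zero, add_zero]

include hcomp hlift in
lemma ddExact (i : ℕ) (hi : i ≤ m) : DDExact lm i := by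
  induction i with
  | zero =>
    intro R _ k hk x _
    refine ⟨fun _ => 0, fun S _ hc => ?_⟩
    have : lo 0 S = ∅ := by
      ext j; rw [mem_lo]; simp
    rw [this, Finset.card_empty] at hc
    omega
  | succ i ih => exact DDExact.succ lm hcomp hlift ⟨i, hi⟩ (ih (by omega))

include hcomp hlift in
/-- A cocycle of positive degree is a coboundary. -/
theorem exists_coboundary {k : ℕ} (hk : 1 ≤ k) (x : ∀ S, N S) (hx : ∀ T : Finset (Fin m), T.card = k + 1 →
    ∑ j ∈ T, sgn j T • lm (T.erase j) T (x (T.erase j)) = 0) :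
    ∃ y : ∀ S, N S, ∀ S : Finset (Fin m), S.card = k →
      ∑ j ∈ S, sgn j S • lm (S.erase j) S (y (S.erase j)) = x S := by
  have hlo : ∀ S : Finset (Fin m), lo m S = S := fun S => Finset.filter_true_of_mem fun j _ => j.2
  obtain ⟨y, hy⟩ := ddExact lm hcomp hlift m le_rfl ∅ (fun j hj => (Finset.notMem_empty j hj).elim) k
    hk x fun T _ hc => by
      rw [hlo] at hc
      rw [dd, hlo]
      exact hx T hc
  refine ⟨y, fun S hc => ?_⟩
  have := hy S (fun j hj => by have := j.2; omega) (by rw [hlo, hc])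
  rwa [dd, hlo] at this

end Families

/-! ## The localizations of a graded module -/

section LocFacts

variable {A : GRing} {m : ℕ} (α : Fin m → A) {d : Fin m → ℤ} (hα : ∀ i, α i ∈ A.deg (d i))

instance (S : Finset (Fin m)) : IsLocalization (Submonoid.powers (∏ i ∈ S, α i)) (Tw (toS α hα S)) :=
  have h : IsLocalization (Submonoid.powers (∏ i ∈ S, α i)) (Localization.Away (∏ i ∈ S, α i)) :=
    inferInstance
  ⟨h.map_units, h.surj, h.exists_of_eq⟩

/-- The canonical map from a module to its localization. -/
def locIn (S : Finset (Fin m)) (M : GMod A) : M ⟶ (Loc α hα S).obj M := extUnit (toS α hα S) M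

variable {M N : GMod A} {S T : Finset (Fin m)}

lemma locIn_naturality (f : M ⟶ N) : locIn α hα S M ≫ (Loc α hα S).map f = f ≫ locIn α hα S N := by
  ext x
  exact ext_map_tm (toS α hα S) f 1 x

lemma locIn_locMap (h : S ⊆ T) : locIn α hα S M ≫ locMap α hα h M = locIn α hα T M := by
  ext x
  refine (locMap_tm α hα h 1 x).trans ?_
  rw [map_one]
  rfl

lemma locIn_locMap_apply (h : S ⊆ T) (x : M) :
    (locMap α hα h M).lin ((locIn α hα S M).lin x) = (locIn α hα T M).lin x :=
  congrArg (fun f => GMod.Hom.lin f x) (locIn_locMap α hα h)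

/-- Pure tensors. -/
def locTm (b : awayS α hα S) (x : M) : (Loc α hα S).obj M := tm (toS α hα S) b x

lemma smul_locTm (a : A) (b : awayS α hα S) (x : M) :
    a • locTm α hα b x = locTm α hα ((toS α hα S).hom a * b) x := rfl

@[elab_as_elim]
lemma Loc.induction {P : (Loc α hα S).obj M → Prop} (y : (Loc α hα S).obj M)
    (h : ∀ b x, P (locTm α hα b x)) (hadd : ∀ y z, P y → P z → P (y + z)) : P y :=
  Ten.induction (toS α hα S) (P := P) y h hadd

/-- The action of the localized ring. -/
def locAct (b : awayS α hα S) (y : (Loc α hα S).obj M) : (Loc α hα S).obj M :=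
  (b • (show (ext (toS α hα S)).obj M from y) : (ext (toS α hα S)).obj M)

lemma locAct_locAct (b c : awayS α hα S) (y : (Loc α hα S).obj M) :
    locAct α hα b (locAct α hα c y) = locAct α hα (b * c) y :=
  smul_smul b c (show (ext (toS α hα S)).obj M from y)

lemma one_locAct (y : (Loc α hα S).obj M) : locAct α hα 1 y = y :=
  one_smul _ (show (ext (toS α hα S)).obj M from y)

lemma locAct_hom (a : A) (y : (Loc α hα S).obj M) : locAct α hα ((toS α hα S).hom a) y = a • y := rfl

lemma exists_pow_smul_eq_locIn (y : (Loc α hα S).obj M) :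
    ∃ (s : ℕ) (x : M), (∏ i ∈ S, α i) ^ s • y = (locIn α hα S M).lin x := by
  refine Loc.induction α hα y (fun b x => ?_) fun y z hy hz => ?_
  · obtain ⟨s, a, h⟩ := IsLocalization.Away.surj (∏ i ∈ S, α i)
      (show Localization.Away (∏ i ∈ S, α i) from b)
    refine ⟨s, a • x, ?_⟩
    rw [smul_locTm, map_pow, mul_comm]
    refine Eq.trans ?_ (tm_smul (toS α hα S) 1 a x).symm
    rw [one_mul]
    exact congrArg (fun c => tm (toS α hα S) c x) h
  · obtain ⟨s, x, hx⟩ := hy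
    obtain ⟨t, w, hw⟩ := hz
    refine ⟨s + t, (∏ i ∈ S, α i) ^ t • x + (∏ i ∈ S, α i) ^ s • w, ?_⟩
    rw [map_add, map_smul, map_smul, ← hx, ← hw, smul_smul, smul_smul, ← pow_add, ← pow_add, add_comm t s]
    exact smul_add _ _ _

lemma locIn_eq_zero {x : M} (h : (locIn α hα S M).lin x = 0) :
    ∃ s : ℕ, (∏ i ∈ S, α i) ^ s • x = 0 := by
  have : IsLocalizedModule (Submonoid.powers (∏ i ∈ S, α i)) (TensorProduct.mk A (Tw (toS α hα S)) M 1) :=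
    (isLocalizedModule_iff_isBaseChange (Submonoid.powers (∏ i ∈ S, α i)) (Tw (toS α hα S)) _).2
      (TensorProduct.isBaseChange A M (Tw (toS α hα S)))
  obtain ⟨⟨_, s, rfl⟩, hc⟩ := (IsLocalizedModule.eq_zero_iff (Submonoid.powers (∏ i ∈ S, α i))
    (TensorProduct.mk A (Tw (toS α hα S)) M 1)).1 h
  exact ⟨s, hc⟩

lemma smul_prod_bijective (s : ℕ) :
    Function.Bijective fun y : (Loc α hα S).obj M => (∏ i ∈ S, α i) ^ s • y := by
  have hu : IsUnit ((toS α hα S).hom ((∏ i ∈ S, α i) ^ s)) := by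
    rw [map_pow]
    exact (toAway_unit A (∏ i ∈ S, α i)).pow s
  obtain ⟨u, hu⟩ := hu
  have e : ∀ y : (Loc α hα S).obj M, (∏ i ∈ S, α i) ^ s • y = locAct α hα u y := fun y => by
    rw [hu, locAct_hom]
  refine Function.bijective_iff_has_inverse.2 ⟨locAct α hα ((u⁻¹ : (awayS α hα S)ˣ) : awayS α hα S),
    fun y => ?_, fun y => ?_⟩
  · beta_reduce
    rw [e, locAct_locAct, Units.inv_mul, one_locAct]
  · beta_reduce
    rw [e, locAct_locAct, Units.mul_inv, one_locAct]

lemma eq_zero_of_dvd_prod {a : A} {s : ℕ} (ha : a ∣ (∏ i ∈ S, α i) ^ s) {y : (Loc α hα S).obj M}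
    (h : a • y = 0) : y = 0 := by
  obtain ⟨b, hb⟩ := ha
  refine (smul_prod_bijective α hα s).1 ?_
  change (∏ i ∈ S, α i) ^ s • y = (∏ i ∈ S, α i) ^ s • (0 : (Loc α hα S).obj M)
  rw [hb, mul_comm, mul_smul, h, smul_zero, smul_zero]

lemma eq_zero_of_pow_smul {i : Fin m} (hi : i ∈ S) {s : ℕ} {y : (Loc α hα S).obj M}
    (h : α i ^ s • y = 0) : y = 0 :=
  eq_zero_of_dvd_prod α hα (pow_dvd_pow_of_dvd (Finset.dvd_prod_of_mem α hi) s) h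

lemma eq_zero_of_prod_smul (hST : S ⊆ T) {s : ℕ} {y : (Loc α hα T).obj M}
    (h : (∏ i ∈ S, α i) ^ s • y = 0) : y = 0 :=
  eq_zero_of_dvd_prod α hα (pow_dvd_pow_of_dvd (Finset.prod_dvd_prod_of_subset _ _ α hST) s) h

lemma locMap_eq_zero_of_pow_smul (h : S ⊆ T) {j : Fin m} (hj : j ∈ T) {s : ℕ} {y : (Loc α hα S).obj M}
    (hy : α j ^ s • y = 0) : (locMap α hα h M).lin y = 0 :=
  eq_zero_of_pow_smul α hα hj (s := s) (by rw [← map_smul, hy, map_zero])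

lemma exists_pow_smul_of_locMap {j : Fin m} {y : (Loc α hα S).obj M}
    (hy : (locMap α hα (Finset.subset_insert j S) M).lin y = 0) : ∃ s : ℕ, α j ^ s • y = 0 := by
  obtain ⟨t, x, hx⟩ := exists_pow_smul_eq_locIn α hα y
  have h1 : (locIn α hα (insert j S) M).lin x = 0 := by
    rw [← locIn_locMap_apply α hα (Finset.subset_insert j S) x, ← hx, map_smul, hy, smul_zero]
  obtain ⟨s, hs⟩ := locIn_eq_zero α hα h1
  have hd : (∏ i ∈ insert j S, α i) ∣ α j * ∏ i ∈ S, α i := by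
    by_cases hj : j ∈ S
    · rw [Finset.insert_eq_of_mem hj]
      exact dvd_mul_left _ _
    · rw [Finset.prod_insert hj]
  obtain ⟨b, hb⟩ := pow_dvd_pow_of_dvd hd s
  have h2 : (α j ^ s * (∏ i ∈ S, α i) ^ s) • x = 0 := by
    rw [← mul_pow, hb, mul_comm, mul_smul, hs, smul_zero]
  refine ⟨s, eq_zero_of_prod_smul α hα (Finset.Subset.refl S) (s := s + t) ?_⟩
  have h3 := congrArg (locIn α hα S M).lin h2
  rw [map_smul, map_zero, ← hx, smul_smul] at h3
  rw [smul_smul, ← h3]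
  congr 1
  ring

lemma exists_uniform {P : ℕ → ℕ → Prop} (hP : ∀ {l s t}, P l s → s ≤ t → P l t) (i : ℕ)
    (h : ∀ l < i, ∃ s, P l s) : ∃ s, ∀ l < i, P l s := by
  induction i with
  | zero => exact ⟨0, fun l hl => (Nat.not_lt_zero l hl).elim⟩
  | succ i ih =>
    obtain ⟨s, hs⟩ := ih fun l hl => h l (by omega)
    obtain ⟨t, ht⟩ := h i (by omega)
    refine ⟨max s t, fun l hl => ?_⟩
    rcases (Nat.lt_succ_iff.1 hl).lt_or_eq with hl | rfl
    · exact hP (hs l hl) (le_max_left _ _)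
    · exact hP ht (le_max_right _ _)

lemma pow_smul_eq_zero_of_le {R X : Type} [CommRing R] [AddCommGroup X] [Module R X] {a : R} {x : X}
    {s t : ℕ} (h : a ^ s • x = 0) (hst : s ≤ t) : a ^ t • x = 0 := by
  obtain ⟨r, rfl⟩ := Nat.exists_eq_add_of_le hst
  rw [pow_add, mul_comm, mul_smul, h, smul_zero]

lemma TorsDivisible.pow {R X : Type} [CommRing R] [AddCommGroup X] [Module R X] {v : ℕ → R}
    (h : TorsDivisible v X) {i : ℕ} (s : ℕ) {y : X} (hy : TorsLt v i y) :
    ∃ z, TorsLt v i z ∧ v i ^ s • z = y := by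
  induction s generalizing y with
  | zero => exact ⟨y, hy, by rw [pow_zero, one_smul]⟩
  | succ s ih =>
    obtain ⟨z, hz, rfl⟩ := h i y hy
    obtain ⟨w, hw, rfl⟩ := ih hz
    exact ⟨w, hw, by rw [pow_succ', mul_smul]⟩

lemma TorsLt.smul_of_uniform {R X : Type} [CommRing R] [AddCommGroup X] [Module R X] {v : ℕ → R}
    {i : ℕ} {a : R} {x : X} (h : ∀ l < i, ∃ t s : ℕ, a ^ t • v l ^ s • x = 0) :
    ∃ t : ℕ, TorsLt v i (a ^ t • x) := by
  obtain ⟨t, ht⟩ := exists_uniform (P := fun l t => ∃ s, a ^ t • v l ^ s • x = 0)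
    (fun ⟨s, hs⟩ hst => ⟨s, pow_smul_eq_zero_of_le hs hst⟩) i h
  refine ⟨t, fun l hl => ?_⟩
  obtain ⟨s, hs⟩ := ht l hl
  exact ⟨s, by rw [smul_comm, hs]⟩

lemma TorsDivisible.loc {v : ℕ → A} (h : TorsDivisible v M) (S : Finset (Fin m)) :
    TorsDivisible v ((Loc α hα S).obj M) := by
  intro i y hy
  obtain ⟨s, x, hx⟩ := exists_pow_smul_eq_locIn α hα y
  obtain ⟨t, ht⟩ := TorsLt.smul_of_uniform (a := ∏ i ∈ S, α i) (x := x) (v := v) (i := i) fun l hl => by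
    obtain ⟨r, hr⟩ := hy l hl
    obtain ⟨t, ht⟩ := locIn_eq_zero α hα (S := S) (x := v l ^ r • x) (by
      rw [map_smul, ← hx, smul_comm, hr, smul_zero])
    exact ⟨t, r, ht⟩
  obtain ⟨z, hz, hzx⟩ := h i _ ht
  obtain ⟨w, hw⟩ := (smul_prod_bijective α hα (S := S) (M := M) (s + t)).2 ((locIn α hα S M).lin z)
  refine ⟨w, fun l hl => ?_, ?_⟩
  · obtain ⟨r, hr⟩ := hz l hl
    refine ⟨r, eq_zero_of_prod_smul α hα (Finset.Subset.refl S) (s := s + t) ?_⟩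
    rw [smul_comm]
    exact (congrArg (v l ^ r • ·) hw).trans (by rw [← map_smul, hr, map_zero])
  · refine (smul_prod_bijective α hα (s + t)).1 ?_
    beta_reduce at hw ⊢
    rw [smul_comm, hw, ← map_smul, hzx, map_smul, ← hx, smul_smul, ← pow_add, add_comm t s]

lemma exists_lift_loc {v : ℕ → A} (hv : ∀ i : Fin m, α i = v i) (h : TorsDivisible v M) (i : Fin m)
    (R : Finset (Fin m)) (x : (Loc α hα (insert i R)).obj M)
    (hx : ∀ j < i, (locMap α hα (Finset.subset_insert j (insert i R)) M).lin x = 0) :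
    ∃ w : (Loc α hα R).obj M, (∀ j < i, (locMap α hα (Finset.subset_insert j R) M).lin w = 0) ∧
      (locMap α hα (Finset.subset_insert i R) M).lin w = x := by
  have hiR := Finset.subset_insert i R
  have hx' : TorsLt v i x := fun l hl => by
    have hlm : l < m := hl.trans i.2
    obtain ⟨s, hs⟩ := exists_pow_smul_of_locMap α hα (hx ⟨l, hlm⟩ hl)
    exact ⟨s, by rw [hv] at hs; exact hs⟩
  obtain ⟨s, w0, hw0⟩ : ∃ (s : ℕ) (w0 : (Loc α hα R).obj M),
      α i ^ s • x = (locMap α hα hiR M).lin w0 := by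
    obtain ⟨s, y, hy⟩ := exists_pow_smul_eq_locIn α hα x
    obtain ⟨b, hb⟩ : (∏ l ∈ insert i R, α l) ∣ α i * ∏ l ∈ R, α l := by
      by_cases hi : i ∈ R
      · rw [Finset.insert_eq_of_mem hi]; exact dvd_mul_left _ _
      · rw [Finset.prod_insert hi]
    obtain ⟨w0, hw0⟩ := (smul_prod_bijective α hα (S := R) (M := M) s).2
      (b ^ s • (locIn α hα R M).lin y)
    beta_reduce at hw0
    refine ⟨s, w0, sub_eq_zero.1 (eq_zero_of_prod_smul α hα hiR (s := s) ?_)⟩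
    rw [smul_sub, ← map_smul, hw0, map_smul, locIn_locMap_apply, ← hy, smul_smul, smul_smul, ← mul_pow,
      ← mul_pow, mul_comm _ (α i), hb, mul_comm b, sub_self]
  obtain ⟨t, ht⟩ := TorsLt.smul_of_uniform (a := α i) (x := w0) (v := v) (i := i) fun l hl => by
    obtain ⟨r, hr⟩ := hx' l hl
    obtain ⟨t, ht⟩ := exists_pow_smul_of_locMap α hα (j := i) (y := v l ^ r • w0) (by
      rw [map_smul, ← hw0, smul_comm, hr, smul_zero])
    exact ⟨t, r, ht⟩
  obtain ⟨w, hw, hwe⟩ := (h.loc α hα R).pow (s + t) ht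
  refine ⟨w, fun j hj => ?_, ?_⟩
  · obtain ⟨r, hr⟩ := hw j hj
    exact locMap_eq_zero_of_pow_smul α hα _ (Finset.mem_insert_self j R) (s := r) (by rw [hv]; exact hr)
  · rw [← hv] at hwe
    refine sub_eq_zero.1 (eq_zero_of_pow_smul α hα (Finset.mem_insert_self i R) (s := s + t) ?_)
    rw [smul_sub, ← map_smul, hwe, map_smul, ← hw0, smul_smul, ← pow_add, add_comm t s, sub_self]

end LocFacts

/-! ## Exactness of Koszul complexes -/

section KoszulExact

lemma GMod.congr_lin {A : GRing} {M N : GMod A} {f g : M ⟶ N} (h : f = g) (x : M) :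
    f.lin x = g.lin x := by rw [h]

lemma GMod.sum_apply {A : GRing} {ι : Type} {M N : GMod A} (s : Finset ι) (f : ι → (M ⟶ N)) (x : M) :
    (∑ i ∈ s, f i).lin x = ∑ i ∈ s, (f i).lin x := by
  classical
  induction s using Finset.induction_on with
  | empty => rfl
  | insert i s hi ih => rw [Finset.sum_insert hi, Finset.sum_insert hi, GMod.add_apply, ih]

variable {A : GRing} {m : ℕ} (α : Fin m → A) {d : Fin m → ℤ} (hα : ∀ i, α i ∈ A.deg (d i)) (c : ℕ)

section Biproduct

variable {ι : Type} [Finite ι] (F : ι → GMod A)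

lemma biproduct_elt_ext {x y : (⨁ F : GMod A)}
    (h : ∀ i, (biproduct.π F i).lin x = (biproduct.π F i).lin y) : x = y := by
  classical
  have := Fintype.ofFinite ι
  have e : ∀ z : (⨁ F : GMod A), z = ∑ i, (biproduct.ι F i).lin ((biproduct.π F i).lin z) := fun z => by
    have h1 := congrArg (fun f => GMod.Hom.lin f z) (biproduct.total (f := F))
    refine h1.symm.trans ((GMod.sum_apply _ _ z).trans ?_)
    rfl
  rw [e x, e y]
  exact Finset.sum_congr rfl fun i _ => by rw [h]

lemma exists_biproduct_elt (y : ∀ i, F i) : ∃ x : (⨁ F : GMod A), ∀ i, (biproduct.π F i).lin x = y i := by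
  classical
  have := Fintype.ofFinite ι
  refine ⟨∑ i, (biproduct.ι F i).lin (y i), fun i => ?_⟩
  rw [map_sum, Finset.sum_eq_single i]
  · exact congrArg (fun f => GMod.Hom.lin f (y i)) (biproduct.ι_π_self F i)
  · intro j _ hj
    exact congrArg (fun f => GMod.Hom.lin f (y j)) (biproduct.ι_π_ne F hj)
  · exact fun h => (h (Finset.mem_univ i)).elim

end Biproduct

variable {M N : GMod A}

/-- The component at `S` of an element of the Koszul complex. -/
def compAt {k : ℕ} (x : KX α hα c k M) (S : Finset (Fin m)) : (Loc α hα S).obj M :=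
  if h : S.card = k + c then
    (biproduct.π (fun S : {S : Finset (Fin m) // S.card = k + c} => (Loc α hα S.1).obj M) ⟨S, h⟩).lin x
  else 0

/-- The transition maps, extended by zero. -/
def locMap' (M : GMod A) (S T : Finset (Fin m)) : (Loc α hα S).obj M →+ (Loc α hα T).obj M :=
  open Classical in if h : S ⊆ T then (locMap α hα h M).lin.toAddMonoidHom else 0

lemma locMap'_of_subset {S T : Finset (Fin m)} (h : S ⊆ T) (x : (Loc α hα S).obj M) :
    locMap' α hα M S T x = (locMap α hα h M).lin x := by
  rw [locMap', dif_pos h]; rfl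

lemma compAt_pos {k : ℕ} {S : Finset (Fin m)} (h : S.card = k + c) (x : KX α hα c k M) :
    compAt α hα c x S = (biproduct.π (fun S : {S : Finset (Fin m) // S.card = k + c} =>
      (Loc α hα S.1).obj M) ⟨S, h⟩).lin x := dif_pos h

lemma KX_ext {k : ℕ} {x y : KX α hα c k M}
    (h : ∀ S : Finset (Fin m), S.card = k + c → compAt α hα c x S = compAt α hα c y S) : x = y :=
  biproduct_elt_ext _ fun S => by
    have := h S.1 S.2
    rwa [compAt_pos α hα c S.2, compAt_pos α hα c S.2] at this

lemma exists_KX (k : ℕ) (y : ∀ S : Finset (Fin m), (Loc α hα S).obj M) :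
    ∃ x : KX α hα c k M, ∀ S : Finset (Fin m), S.card = k + c → compAt α hα c x S = y S := by
  obtain ⟨x, hx⟩ := exists_biproduct_elt
    (fun S : {S : Finset (Fin m) // S.card = k + c} => (Loc α hα S.1).obj M) fun S => y S.1
  exact ⟨x, fun S h => (compAt_pos α hα c h x).trans (hx ⟨S, h⟩)⟩

lemma compAt_zero {k : ℕ} (S : Finset (Fin m)) : compAt α hα c (0 : KX α hα c k M) S = 0 := by
  unfold compAt
  split_ifs
  · exact map_zero _
  · rfl

lemma compAt_KXd {k : ℕ} (x : KX α hα c k M) {T : Finset (Fin m)} (hT : T.card = k + 1 + c) :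
    compAt α hα c ((KXd α hα c k M).lin x) T =
      ∑ j ∈ T, sgn j T • locMap' α hα M (T.erase j) T (compAt α hα c x (T.erase j)) := by
  rw [compAt_pos α hα c hT]
  have h1 : (biproduct.π (fun S : {S : Finset (Fin m) // S.card = k + 1 + c} =>
      (Loc α hα S.1).obj M) ⟨T, hT⟩).lin ((KXd α hα c k M).lin x) =
      (∑ j ∈ T, sgn j T • KXπ α hα c k M (T.erase j) T).lin x :=
    GMod.congr_lin (f := KXd α hα c k M ≫ biproduct.π (fun S : {S : Finset (Fin m) //
      S.card = k + 1 + c} => (Loc α hα S.1).obj M) ⟨T, hT⟩) (biproduct.lift_π _ _) x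
  rw [h1, GMod.sum_apply]
  refine Finset.sum_congr rfl fun j hj => ?_
  have hc : (T.erase j).card = k + c := by
    rw [Finset.card_erase_of_mem hj, hT]; omega
  rw [GMod.zsmul_apply, KXπ_pos α hα c k M hc (Finset.erase_subset j T),
    locMap'_of_subset α hα (Finset.erase_subset j T), compAt_pos α hα c hc]
  rfl

lemma compAt_KXmap {k : ℕ} (f : M ⟶ N) (x : KX α hα c k M) {S : Finset (Fin m)} (hS : S.card = k + c) :
    compAt α hα c ((KXmap α hα c k f).lin x) S = ((Loc α hα S).map f).lin (compAt α hα c x S) := by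
  rw [compAt_pos α hα c hS, compAt_pos α hα c hS]
  have h : KXmap α hα c k f ≫ biproduct.π (fun S : {S : Finset (Fin m) // S.card = k + c} =>
      (Loc α hα S.1).obj N) ⟨S, hS⟩ = biproduct.π (fun S : {S : Finset (Fin m) // S.card = k + c} =>
      (Loc α hα S.1).obj M) ⟨S, hS⟩ ≫ (Loc α hα S).map f := by
    rw [KXmap, biproduct.map_π]
  exact GMod.congr_lin h x

section Acyclic

variable {v : ℕ → A} (hv : ∀ i : Fin m, α i = v i) (hM : TorsDivisible v M)

include hv hM in
lemma exists_family {k : ℕ} (hk : 1 ≤ k) (x : ∀ S, (Loc α hα S).obj M)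
    (hx : ∀ T : Finset (Fin m), T.card = k + 1 →
      ∑ j ∈ T, sgn j T • locMap' α hα M (T.erase j) T (x (T.erase j)) = 0) :
    ∃ y : ∀ S, (Loc α hα S).obj M, ∀ S : Finset (Fin m), S.card = k →
      ∑ j ∈ S, sgn j S • locMap' α hα M (S.erase j) S (y (S.erase j)) = x S := by
  refine exists_coboundary (N := fun S => ((Loc α hα S).obj M : GMod A)) (locMap' α hα M) ?_ ?_ hk x hx
  · intro S T R h h' y
    rw [locMap'_of_subset α hα h, locMap'_of_subset α hα h', locMap'_of_subset α hα (h.trans h')]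
    exact congrArg (fun f => GMod.Hom.lin f y) (locMap_comp α hα h h' M)
  · intro i R _ y hy
    obtain ⟨w, hw, hwy⟩ := exists_lift_loc α hα hv hM i R y fun j hj =>
      (locMap'_of_subset α hα _ _).symm.trans (hy j hj)
    exact ⟨w, fun j hj => (locMap'_of_subset α hα _ _).trans (hw j hj),
      (locMap'_of_subset α hα _ _).trans hwy⟩

include hv hM in
lemma KXd_exact (k : ℕ) (x : KX α hα c (k + 1) M) (hx : (KXd α hα c (k + 1) M).lin x = 0) :
    ∃ y, (KXd α hα c k M).lin y = x := by
  obtain ⟨y, hy⟩ := exists_family α hα hv hM (k := k + 1 + c) (by omega) (compAt α hα c x) fun T hT => by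
    rw [← compAt_KXd α hα c x (by omega), hx, compAt_zero]
  obtain ⟨z, hz⟩ := exists_KX α hα c k y
  refine ⟨z, KX_ext α hα c fun S hS => ?_⟩
  rw [compAt_KXd α hα c z hS, ← hy S hS]
  refine Finset.sum_congr rfl fun j hj => ?_
  rw [hz _ (by rw [Finset.card_erase_of_mem hj, hS]; omega)]

end Acyclic

/-- The map from `M` to the product of the modules `A[1/α_i] ⊗ M`. -/
def cechIn (M : GMod A) : M ⟶ KX α hα 1 0 M := biproduct.lift fun S => locIn α hα S.1 M

/-- The map from `M` to the degree zero part of its stable Koszul complex. -/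
def koszulIn (M : GMod A) : M ⟶ KX α hα 0 0 M := biproduct.lift fun S => locIn α hα S.1 M

lemma comp_cechIn (x : M) {S : Finset (Fin m)} (hS : S.card = 1) :
    compAt α hα 1 ((cechIn α hα M).lin x) S = (locIn α hα S M).lin x := by
  rw [compAt_pos α hα 1 (k := 0) (hS.trans (zero_add 1).symm)]
  exact GMod.congr_lin (f := cechIn α hα M ≫ biproduct.π (fun S : {S : Finset (Fin m) //
    S.card = 0 + 1} => (Loc α hα S.1).obj M) ⟨S, hS.trans (zero_add 1).symm⟩) (biproduct.lift_π _ _) x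

lemma comp_koszulIn (x : M) : compAt α hα 0 ((koszulIn α hα M).lin x) ∅ = (locIn α hα ∅ M).lin x := by
  rw [compAt_pos α hα 0 (k := 0) Finset.card_empty]
  exact GMod.congr_lin (f := koszulIn α hα M ≫ biproduct.π (fun S : {S : Finset (Fin m) //
    S.card = 0 + 0} => (Loc α hα S.1).obj M) ⟨∅, Finset.card_empty⟩) (biproduct.lift_π _ _) x

lemma cechIn_naturality (f : M ⟶ N) : cechIn α hα M ≫ KXmap α hα 1 0 f = f ≫ cechIn α hα N := by
  refine biproduct.hom_ext _ _ fun S => ?_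
  rw [Category.assoc, Category.assoc, KXmap, biproduct.map_π, cechIn, cechIn, biproduct.lift_π,
    biproduct.lift_π_assoc, locIn_naturality]

lemma koszulIn_naturality (f : M ⟶ N) : koszulIn α hα M ≫ KXmap α hα 0 0 f = f ≫ koszulIn α hα N := by
  refine biproduct.hom_ext _ _ fun S => ?_
  rw [Category.assoc, Category.assoc, KXmap, biproduct.map_π, koszulIn, koszulIn, biproduct.lift_π,
    biproduct.lift_π_assoc, locIn_naturality]

lemma sgn_singleton (j : Fin m) : sgn j {j} = 1 := by
  have : ({j} : Finset (Fin m)).filter (fun i => i < j) = ∅ := by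
    ext i; simp only [Finset.mem_filter, Finset.mem_singleton, Finset.notMem_empty, iff_false]
    rintro ⟨rfl, h⟩
    exact lt_irrefl _ h
  rw [sgn, this, Finset.card_empty, pow_zero]

lemma exists_locIn_empty (y : (Loc α hα ∅).obj M) : ∃ x, (locIn α hα ∅ M).lin x = y := by
  obtain ⟨s, x, hx⟩ := exists_pow_smul_eq_locIn α hα y
  rw [Finset.prod_empty, one_pow, one_smul] at hx
  exact ⟨x, hx.symm⟩

lemma locIn_empty_injective : Function.Injective (locIn α hα ∅ M).lin := by
  rw [injective_iff_map_eq_zero]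
  intro x hx
  obtain ⟨s, hs⟩ := locIn_eq_zero α hα hx
  rwa [Finset.prod_empty, one_pow, one_smul] at hs

lemma koszulIn_bijective (M : GMod A) : Function.Bijective (koszulIn α hα M).lin := by
  constructor
  · intro x y h
    refine locIn_empty_injective α hα ?_
    rw [← comp_koszulIn, ← comp_koszulIn, h]
  · intro y
    obtain ⟨x, hx⟩ := exists_locIn_empty α hα (compAt α hα 0 y ∅)
    refine ⟨x, KX_ext α hα 0 fun S hS => ?_⟩
    obtain rfl : S = ∅ := Finset.card_eq_zero.1 hS
    rw [comp_koszulIn, hx]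

lemma cechIn_exact {v : ℕ → A} (hv : ∀ i : Fin m, α i = v i) (hM : TorsDivisible v M)
    (x : KX α hα 1 0 M) (hx : (KXd α hα 1 0 M).lin x = 0) : ∃ y, (cechIn α hα M).lin y = x := by
  obtain ⟨y, hy⟩ := exists_family α hα hv hM (k := 1) le_rfl (compAt α hα 1 x) fun T hT => by
    rw [← compAt_KXd α hα 1 x (by omega), hx, compAt_zero]
  obtain ⟨z, hz⟩ := exists_locIn_empty α hα (y ∅)
  refine ⟨z, KX_ext α hα 1 fun S hS => ?_⟩
  obtain ⟨j, rfl⟩ := Finset.card_eq_one.1 (hS.trans (zero_add 1))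
  rw [comp_cechIn α hα z (by omega), ← hy _ (by omega), Finset.sum_singleton, sgn_singleton, one_smul]
  have he : ({j} : Finset (Fin m)).erase j = ∅ := by
    rw [Finset.erase_singleton]
  rw [he, ← hz, locMap'_of_subset α hα (Finset.empty_subset _), locIn_locMap_apply]

lemma cechIn_KXd (M : GMod A) : cechIn α hα M ≫ KXd α hα 1 0 M = 0 := by
  refine GMod.hom_ext fun x => ?_
  refine KX_ext α hα 1 fun T hT => ?_
  rw [GMod.comp_apply, compAt_KXd α hα 1 _ hT, GMod.zero_apply, compAt_zero]
  obtain ⟨i, j, hij, rfl⟩ := Finset.card_eq_two.1 hT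
  have h1 : ({i, j} : Finset (Fin m)).erase i = {j} := by
    rw [Finset.erase_insert]; simpa using hij
  have h2 : ({i, j} : Finset (Fin m)).erase j = {i} := by
    rw [Finset.pair_comm, Finset.erase_insert]; simpa using hij.symm
  have hl : ∀ l ∈ ({i, j} : Finset (Fin m)), locMap' α hα M (({i, j} : Finset (Fin m)).erase l) {i, j}
      (compAt α hα 1 ((cechIn α hα M).lin x) (({i, j} : Finset (Fin m)).erase l)) =
      (locIn α hα {i, j} M).lin x := fun l hl => by
    rw [comp_cechIn α hα x (by rw [Finset.card_erase_of_mem hl, hT]), locMap'_of_subset α hα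
      (Finset.erase_subset _ _), locIn_locMap_apply]
  rw [Finset.sum_congr rfl fun l h => by rw [hl l h], Finset.sum_pair hij, ← add_smul]
  have h3 := sgn_erase (l := j) (T := {i, j}) (Finset.mem_insert_self i {j})
  have h4 := sgn_erase (l := i) (T := {i, j}) (j := j) (by simp)
  rw [h1, sgn_singleton] at h3
  rw [h2, sgn_singleton] at h4
  have h5 : sgn i {i, j} + sgn j {i, j} = 0 := by
    rcases lt_or_gt_of_ne hij with h | h
    · rw [if_pos h] at h3
      rw [if_neg h.le.not_gt] at h4
      omega
    · rw [if_neg (not_lt_of_gt h)] at h3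
      rw [if_pos h] at h4
      omega
  rw [h5, zero_smul]

lemma exists_pow_smul_of_cechIn {x : M} (h : (cechIn α hα M).lin x = 0) (i : Fin m) :
    ∃ s : ℕ, α i ^ s • x = 0 := by
  obtain ⟨s, hs⟩ := locIn_eq_zero α hα (S := {i}) (x := x) (by
    rw [← comp_cechIn α hα x (Finset.card_singleton i), h, compAt_zero])
  exact ⟨s, by rwa [Finset.prod_singleton] at hs⟩

lemma koszulIn_KXd_eq_zero_iff (x : M) : (KXd α hα 0 0 M).lin ((koszulIn α hα M).lin x) = 0 ↔
    ∀ i, ∃ s : ℕ, α i ^ s • x = 0 := by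
  have h1 : ∀ i : Fin m, compAt α hα 0 ((KXd α hα 0 0 M).lin ((koszulIn α hα M).lin x)) {i} =
      (locIn α hα {i} M).lin x := fun i => by
    rw [compAt_KXd α hα 0 _ (Finset.card_singleton i), Finset.sum_singleton, sgn_singleton, one_smul,
      Finset.erase_singleton, comp_koszulIn, locMap'_of_subset α hα (Finset.empty_subset _),
      locIn_locMap_apply]
  constructor
  · intro h i
    obtain ⟨s, hs⟩ := locIn_eq_zero α hα (S := {i}) (x := x) (by rw [← h1, h, compAt_zero])
    exact ⟨s, by rwa [Finset.prod_singleton] at hs⟩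
  · intro h
    refine KX_ext α hα 0 fun S hS => ?_
    obtain ⟨i, rfl⟩ := Finset.card_eq_one.1 (show S.card = 1 by omega)
    obtain ⟨s, hs⟩ := h i
    rw [h1, compAt_zero]
    refine eq_zero_of_pow_smul α hα (Finset.mem_singleton_self i) (s := s) ?_
    rw [← map_smul, hs, map_zero]

end KoszulExact

/-! ## Derived functors of the degree zero cohomology of an exact functor to complexes -/

section Derived

variable {C D : Type*} [Category C] [Abelian C] [Category D] [Abelian D]

/-- Complexes of injective objects that are exact in positive degrees. -/
def resolutions (C : Type*) [Category C] [Abelian C] : ObjectProperty (CochainComplex C ℕ) :=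
  fun I => (∀ k, Injective (I.X k)) ∧ ∀ k, I.ExactAt (k + 1)

/-- The functor of cocycles of degree `j`. -/
def cocyc (C : Type*) [Category C] [Abelian C] (j : ℕ) : (resolutions C).FullSubcategory ⥤ C :=
  (resolutions C).ι ⋙ HomologicalComplex.cyclesFunctor C _ j

/-- The short complex `Z^j → I^j → Z^{j+1}`. -/
def cocycSeq (C : Type*) [Category C] [Abelian C] (j : ℕ) :
    (resolutions C).FullSubcategory ⥤ ShortComplex C where
  obj I := ShortComplex.mk (I.obj.iCycles j) (I.obj.toCycles j (j + 1)) (by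
    rw [← cancel_mono (I.obj.iCycles (j + 1)), Category.assoc, HomologicalComplex.toCycles_i,
      HomologicalComplex.iCycles_d, zero_comp])
  map {I J} f :=
    { τ₁ := HomologicalComplex.cyclesMap f.hom j
      τ₂ := f.hom.f j
      τ₃ := HomologicalComplex.cyclesMap f.hom (j + 1)
      comm₁₂ := by simp
      comm₂₃ := by
        rw [← cancel_mono (J.obj.iCycles (j + 1))]
        simp }
  map_id I := by ext <;> simp
  map_comp f g := by ext <;> simp [HomologicalComplex.cyclesMap_comp]

lemma cocycSeq_shortExact (j : ℕ) (I : (resolutions C).FullSubcategory) :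
    ((cocycSeq C j).obj I).ShortExact where
  exact := by
    have h : (ShortComplex.mk (I.obj.iCycles j) (I.obj.d j (j + 1)) (I.obj.iCycles_d j (j + 1))).Exact :=
      ShortComplex.exact_of_f_is_kernel _ (I.obj.cyclesIsKernel j (j + 1) (by simp))
    let φ : (cocycSeq C j).obj I ⟶ ShortComplex.mk (I.obj.iCycles j) (I.obj.d j (j + 1))
        (I.obj.iCycles_d j (j + 1)) :=
      { τ₁ := 𝟙 _
        τ₂ := 𝟙 _
        τ₃ := I.obj.iCycles (j + 1)
        comm₁₂ := (Category.id_comp _).trans (Category.comp_id _).symm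
        comm₂₃ := (Category.id_comp _).trans (I.obj.toCycles_i j (j + 1)).symm }
    have : Epi φ.τ₁ := inferInstanceAs (Epi (𝟙 _))
    have : IsIso φ.τ₂ := inferInstanceAs (IsIso (𝟙 _))
    have : Mono φ.τ₃ := inferInstanceAs (Mono (I.obj.iCycles (j + 1)))
    exact (ShortComplex.exact_iff_of_epi_of_isIso_of_mono φ).2 h
  mono_f := inferInstanceAs (Mono (I.obj.iCycles j))
  epi_g := by
    change Epi (I.obj.toCycles j (j + 1))
    have h1 : IsZero (I.obj.homology (j + 1)) :=
      (I.obj.exactAt_iff_isZero_homology (j + 1)).1 (I.property.2 j)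
    have h2 : (ShortComplex.mk (I.obj.toCycles j (j + 1)) (I.obj.homologyπ (j + 1))
      (I.obj.toCycles_comp_homologyπ j (j + 1))).Exact :=
      ShortComplex.exact_of_g_is_cokernel _ (I.obj.homologyIsCokernel j (j + 1) (by simp))
    exact h2.epi_f (h1.eq_of_tgt _ _)

variable (K : C ⥤ CochainComplex D ℕ) [K.Additive]

/-- The `i`-th cohomology of a functor to complexes. -/
abbrev coh (i : ℕ) : C ⥤ D := K ⋙ HomologicalComplex.homologyFunctor D _ i

variable (hK : ∀ S : ShortComplex C, S.ShortExact → (S.map K).ShortExact)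

include hK in
lemma coh_zero_preservesFiniteLimits : PreservesFiniteLimits (coh K 0) := by
  rw [Functor.preservesFiniteLimits_iff_forall_exact_map_and_mono]
  intro S hS
  have h := hK S hS
  refine ⟨h.homology_exact₂ 0, ?_⟩
  have := h.mono_f
  have h1 : Mono (HomologicalComplex.cyclesMap (K.map S.f) 0) := by
    have h2 : Mono ((K.map S.f).f 0) := by
      have : Mono (K.map S.f) := h.mono_f
      infer_instance
    have h3 : Mono (HomologicalComplex.cyclesMap (K.map S.f) 0 ≫ (K.obj S.X₂).iCycles 0) := by
      rw [HomologicalComplex.cyclesMap_i]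
      exact mono_comp _ _
    exact mono_of_mono _ ((K.obj S.X₂).iCycles 0)
  have e := HomologicalComplex.homologyπ_naturality (K.map S.f) 0
  have i1 : IsIso ((K.obj S.X₁).homologyπ 0) := (K.obj S.X₁).isIso_homologyπ _ 0 rfl (by simp)
  have i2 : IsIso ((K.obj S.X₂).homologyπ 0) := (K.obj S.X₂).isIso_homologyπ _ 0 rfl (by simp)
  have e2 : HomologicalComplex.homologyMap (K.map S.f) 0 = inv ((K.obj S.X₁).homologyπ 0) ≫
      HomologicalComplex.cyclesMap (K.map S.f) 0 ≫ (K.obj S.X₂).homologyπ 0 := by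
    rw [← e, IsIso.inv_hom_id_assoc]
  change Mono (HomologicalComplex.homologyMap (K.map S.f) 0)
  rw [e2]
  infer_instance

variable (hJ : ∀ J : C, Injective J → ∀ k, IsZero ((coh K (k + 1)).obj J))

/-- Dimension shifting along `Z^j → I^j → Z^{j+1}`. -/
def shiftIso (i j : ℕ) : cocyc C (j + 1) ⋙ coh K (i + 1) ≅ cocyc C j ⋙ coh K (i + 1 + 1) :=
  NatIso.ofComponents (fun I => (hK _ (cocycSeq_shortExact j I)).δIso (i + 1) (i + 1 + 1) rfl
      (hJ _ (I.property.1 j) i) (hJ _ (I.property.1 j) (i + 1))) fun {I J} f =>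
    (HomologicalComplex.HomologySequence.δ_naturality (K.mapShortComplex.map ((cocycSeq C j).map f))
      (hK _ (cocycSeq_shortExact j I)) (hK _ (cocycSeq_shortExact j J)) (i + 1) (i + 1 + 1) rfl).symm

/-- Iterated dimension shifting. -/
def shiftIsoIter : ∀ k i l : ℕ, i + k = l →
    (cocyc C k ⋙ coh K (i + 1) ≅ cocyc C 0 ⋙ coh K (l + 1))
  | 0, _, _, h => Functor.isoWhiskerLeft _ (eqToIso (by rw [← h, Nat.add_zero]))
  | k + 1, i, l, h => shiftIso K hK hJ i k ≪≫ shiftIsoIter k (i + 1) l (by omega)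

section LeftExact

variable (G : C ⥤ D) [G.Additive] [PreservesFiniteLimits G]

lemma exists_cyclesIso (j : ℕ) (I : CochainComplex C ℕ) :
    ∃ e : G.obj (I.cycles j) ≅ ((G.mapHomologicalComplex (ComplexShape.up ℕ)).obj I).cycles j,
      e.hom ≫ ((G.mapHomologicalComplex (ComplexShape.up ℕ)).obj I).iCycles j = G.map (I.iCycles j) := by
  have h : (ShortComplex.mk (I.iCycles j) (I.d j (j + 1)) (I.iCycles_d j (j + 1))).Exact :=
    ShortComplex.exact_of_f_is_kernel _ (I.cyclesIsKernel j (j + 1) (by simp))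
  have h1 : ∀ S : ShortComplex C, S.Exact ∧ Mono S.f → (S.map G).Exact ∧ Mono (G.map S.f) :=
    ((Functor.preservesFiniteLimits_tfae G).out 3 1).1 (inferInstance : PreservesFiniteLimits G)
  obtain ⟨hG, hG'⟩ := h1 _ ⟨h, inferInstanceAs (Mono (I.iCycles j))⟩
  have : Mono ((ShortComplex.mk (I.iCycles j) (I.d j (j + 1)) (I.iCycles_d j (j + 1))).map G).f := hG'
  exact ⟨IsLimit.conePointUniqueUpToIso hG.fIsKernel
    (((G.mapHomologicalComplex (ComplexShape.up ℕ)).obj I).cyclesIsKernel j (j + 1) (by simp)),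
    IsLimit.conePointUniqueUpToIso_hom_comp hG.fIsKernel
      (((G.mapHomologicalComplex (ComplexShape.up ℕ)).obj I).cyclesIsKernel j (j + 1) (by simp))
      WalkingParallelPair.zero⟩

/-- The cocycles of `G I` for a left exact functor `G`. -/
def cyclesIso (j : ℕ) (I : CochainComplex C ℕ) :
    G.obj (I.cycles j) ≅ ((G.mapHomologicalComplex (ComplexShape.up ℕ)).obj I).cycles j :=
  (exists_cyclesIso G j I).choose

lemma cyclesIso_hom_i (j : ℕ) (I : CochainComplex C ℕ) : (cyclesIso G j I).hom ≫
    ((G.mapHomologicalComplex (ComplexShape.up ℕ)).obj I).iCycles j = G.map (I.iCycles j) :=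
  (exists_cyclesIso G j I).choose_spec

lemma cyclesIso_naturality (j : ℕ) {I J : CochainComplex C ℕ} (f : I ⟶ J) :
    G.map (HomologicalComplex.cyclesMap f j) ≫ (cyclesIso G j J).hom = (cyclesIso G j I).hom ≫
      HomologicalComplex.cyclesMap ((G.mapHomologicalComplex (ComplexShape.up ℕ)).map f) j := by
  rw [← cancel_mono (((G.mapHomologicalComplex (ComplexShape.up ℕ)).obj J).iCycles j), Category.assoc,
    Category.assoc, cyclesIso_hom_i, HomologicalComplex.cyclesMap_i]
  have e := G.congr_map (HomologicalComplex.cyclesMap_i f j)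
  rw [G.map_comp, G.map_comp, ← cyclesIso_hom_i G j I] at e
  exact e.trans (Category.assoc _ _ _)

lemma map_toCycles_cyclesIso (j : ℕ) (I : CochainComplex C ℕ) :
    G.map (I.toCycles j (j + 1)) ≫ (cyclesIso G (j + 1) I).hom =
      ((G.mapHomologicalComplex (ComplexShape.up ℕ)).obj I).toCycles j (j + 1) := by
  refine (cancel_mono (((G.mapHomologicalComplex (ComplexShape.up ℕ)).obj I).iCycles (j + 1))).1 ?_
  refine (Category.assoc _ _ _).trans ((congrArg (_ ≫ ·) (cyclesIso_hom_i G (j + 1) I)).trans ?_)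
  refine Eq.trans ?_ 
    (((G.mapHomologicalComplex (ComplexShape.up ℕ)).obj I).toCycles_i j (j + 1)).symm
  exact (G.map_comp _ _).symm.trans (G.congr_map (I.toCycles_i j (j + 1)))

end LeftExact

/-- The cohomology of degree zero of `G I`. -/
def homologyZeroIso (G : C ⥤ D) [G.Additive] [PreservesFiniteLimits G] :
    (resolutions C).ι ⋙ G.mapHomologicalComplex _ ⋙ HomologicalComplex.homologyFunctor D _ 0 ≅
      cocyc C 0 ⋙ G :=
  (NatIso.ofComponents (fun I => cyclesIso G 0 I.obj ≪≫ CochainComplex.isoHomologyπ₀ _)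
    fun {I J} f => by
      have e1 := cyclesIso_naturality G 0 f.hom
      have e2 := HomologicalComplex.homologyπ_naturality
        ((G.mapHomologicalComplex (ComplexShape.up ℕ)).map f.hom) 0
      refine (Category.assoc _ _ _).symm.trans ((congrArg (· ≫ _) e1).trans ?_)
      refine (Category.assoc _ _ _).trans ((congrArg (_ ≫ ·) e2.symm).trans ?_)
      exact (Category.assoc _ _ _).symm).symm

section

variable [PreservesFiniteLimits (coh K 0)]

include hJ in
lemma exists_cokernelIso (k : ℕ) (I : (resolutions C).FullSubcategory) :
    ∃ e : (coh K 1).obj (I.obj.cycles k) ≅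
      (((coh K 0).mapHomologicalComplex (ComplexShape.up ℕ)).obj I.obj).homology (k + 1),
      (hK _ (cocycSeq_shortExact k I)).δ 0 1 rfl ≫ e.hom = (cyclesIso (coh K 0) (k + 1) I.obj).hom ≫
        (((coh K 0).mapHomologicalComplex (ComplexShape.up ℕ)).obj I.obj).homologyπ (k + 1) := by
  have h := hK _ (cocycSeq_shortExact k I)
  have he : Epi (h.δ 0 1 rfl) := h.epi_δ 0 1 rfl (hJ _ (I.property.1 k) 0)
  have h1 := h.homology_exact₃ 0 1 rfl
  have : Epi (ShortComplex.mk _ _ (h.comp_δ 0 1 rfl)).g := he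
  let φ : Arrow.mk (HomologicalComplex.homologyMap ((((cocycSeq C k).obj I).map K).g) 0) ≅
      Arrow.mk ((((coh K 0).mapHomologicalComplex (ComplexShape.up ℕ)).obj I.obj).toCycles k (k + 1)) :=
    Arrow.isoMk (Iso.refl _) (cyclesIso (coh K 0) (k + 1) I.obj)
      ((Category.id_comp _).trans (map_toCycles_cyclesIso (coh K 0) k I.obj).symm)
  have h2 := (((coh K 0).mapHomologicalComplex (ComplexShape.up ℕ)).obj I.obj).homologyIsCokernel k (k + 1)
    (by simp)
  exact ⟨CokernelCofork.mapIsoOfIsColimit h1.gIsCokernel h2 φ,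
    CokernelCofork.π_mapOfIsColimit h1.gIsCokernel _ φ.hom⟩

/-- The cohomology of positive degree of `H^0(K I)`. -/
def cokernelIso (k : ℕ) : cocyc C k ⋙ coh K 1 ≅ (resolutions C).ι ⋙
    (coh K 0).mapHomologicalComplex _ ⋙ HomologicalComplex.homologyFunctor D _ (k + 1) :=
  NatIso.ofComponents (fun I => (exists_cokernelIso K hK hJ k I).choose) fun {I J} f => by
    have h := hK _ (cocycSeq_shortExact k I)
    have he : Epi (h.δ 0 1 rfl) := h.epi_δ 0 1 rfl (hJ _ (I.property.1 k) 0)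
    refine (cancel_epi (h.δ 0 1 rfl)).1 ?_
    have e1 := (exists_cokernelIso K hK hJ k I).choose_spec
    have e2 := (exists_cokernelIso K hK hJ k J).choose_spec
    have e3 := HomologicalComplex.HomologySequence.δ_naturality
      (K.mapShortComplex.map ((cocycSeq C k).map f))
      (hK _ (cocycSeq_shortExact k I)) (hK _ (cocycSeq_shortExact k J)) 0 1 rfl
    have e4 := cyclesIso_naturality (coh K 0) (k + 1) f.hom
    have e5 := HomologicalComplex.homologyπ_naturality
      (((coh K 0).mapHomologicalComplex (ComplexShape.up ℕ)).map f.hom) (k + 1)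
    refine (Category.assoc _ _ _).symm.trans ((congrArg (· ≫ _) e3).trans ?_)
    refine (Category.assoc _ _ _).trans ((congrArg (_ ≫ ·) e2).trans ?_)
    refine (Category.assoc _ _ _).symm.trans ((congrArg (· ≫ _) e4).trans ?_)
    refine (Category.assoc _ _ _).trans ((congrArg (_ ≫ ·) e5.symm).trans ?_)
    refine (Category.assoc _ _ _).symm.trans ((congrArg (· ≫ _) e1.symm).trans ?_)
    exact Category.assoc _ _ _

/-- The cohomology of `H^0(K I)`. -/
def homologyIso : ∀ l : ℕ, (resolutions C).ι ⋙ (coh K 0).mapHomologicalComplex _ ⋙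
    HomologicalComplex.homologyFunctor D _ l ≅ cocyc C 0 ⋙ coh K l
  | 0 => homologyZeroIso (coh K 0)
  | l + 1 => (cokernelIso K hK hJ l).symm ≪≫ shiftIsoIter K hK hJ l 0 l (by omega)

end

/-- The object resolved by `I` is the object of cocycles of degree zero. -/
lemma exists_edgeIso {X : C} (I : InjectiveResolution X) :
    ∃ e : X ≅ I.cocomplex.cycles 0, e.hom ≫ I.cocomplex.iCycles 0 = I.ι.f 0 :=
  ⟨IsLimit.conePointUniqueUpToIso I.isLimitKernelFork
    (I.cocomplex.cyclesIsKernel 0 1 (by simp)),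
    IsLimit.conePointUniqueUpToIso_hom_comp I.isLimitKernelFork
      (I.cocomplex.cyclesIsKernel 0 1 (by simp)) WalkingParallelPair.zero⟩

lemma resolutions_cocomplex {X : C} (I : InjectiveResolution X) : resolutions C I.cocomplex :=
  ⟨fun k => I.injective k, fun k => I.cocomplex_exactAt_succ k⟩

/-- An injective resolution as a complex of injective objects. -/
def ofResolution {X : C} (I : InjectiveResolution X) : (resolutions C).FullSubcategory :=
  ⟨I.cocomplex, resolutions_cocomplex I⟩

variable {E : Type*} [Category E] [Abelian E]

/-- An exact functor commutes with cohomology. -/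
def mapHomologyNatIso (F : C ⥤ E) [F.Additive] (U : E ⥤ D) [U.Additive] [PreservesFiniteLimits U]
    [PreservesFiniteColimits U] (k : ℕ) :
    (resolutions C).ι ⋙ F.mapHomologicalComplex _ ⋙ HomologicalComplex.homologyFunctor E _ k ⋙ U ≅
      (resolutions C).ι ⋙ (F ⋙ U).mapHomologicalComplex _ ⋙ HomologicalComplex.homologyFunctor D _ k :=
  NatIso.ofComponents (fun I => ((((F.mapHomologicalComplex (ComplexShape.up ℕ)).obj I.obj).sc
      k).mapHomologyIso U).symm) fun f =>
    ShortComplex.mapHomologyIso_inv_naturality ((HomologicalComplex.shortComplexFunctor E _ k).map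
      ((F.mapHomologicalComplex (ComplexShape.up ℕ)).map f.hom)) U

/-- A transformation that is invertible on injective objects induces isomorphisms in cohomology. -/
def transHomologyIso {G G' : C ⥤ D} [G.Additive] [G'.Additive] (a : G ⟶ G')
    (ha : ∀ J : C, Injective J → IsIso (a.app J)) (k : ℕ) :
    (resolutions C).ι ⋙ G.mapHomologicalComplex _ ⋙ HomologicalComplex.homologyFunctor D _ k ≅
      (resolutions C).ι ⋙ G'.mapHomologicalComplex _ ⋙ HomologicalComplex.homologyFunctor D _ k :=
  have (I : (resolutions C).FullSubcategory) :
      IsIso ((NatTrans.mapHomologicalComplex a (ComplexShape.up ℕ)).app I.obj) :=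
    have (i : ℕ) : IsIso (((NatTrans.mapHomologicalComplex a (ComplexShape.up ℕ)).app I.obj).f i) :=
      ha _ (I.property.1 i)
    HomologicalComplex.Hom.isIso_of_components _
  NatIso.ofComponents (fun I => (HomologicalComplex.homologyFunctor D _ k).mapIso
      (asIso ((NatTrans.mapHomologicalComplex a (ComplexShape.up ℕ)).app I.obj))) fun {I J} f => by
    refine ((HomologicalComplex.homologyFunctor D _ k).map_comp _ _).symm.trans (Eq.trans ?_
      ((HomologicalComplex.homologyFunctor D _ k).map_comp _ _))
    exact (HomologicalComplex.homologyFunctor D _ k).congr_map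
      ((NatTrans.mapHomologicalComplex a (ComplexShape.up ℕ)).naturality f.hom)

include hK hJ in
/-- The derived functors of `F` are computed by the cohomology of `K`. -/
theorem rightDerived_iso_coh [HasInjectiveResolutions C] (F : C ⥤ E) [F.Additive] (U : E ⥤ D)
    [U.Additive] [PreservesFiniteLimits U] [PreservesFiniteColimits U] (a : F ⋙ U ⟶ coh K 0)
    (ha : ∀ J : C, Injective J → IsIso (a.app J)) (k : ℕ) :
    Nonempty (F.rightDerived k ⋙ U ≅ coh K k) := by
  have := coh_zero_preservesFiniteLimits K hK
  let e := mapHomologyNatIso F U k ≪≫ transHomologyIso a ha k ≪≫ homologyIso K hK hJ k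
  choose g hg using fun X : C => exists_edgeIso (injectiveResolution X)
  refine ⟨NatIso.ofComponents (fun X => U.mapIso ((injectiveResolution X).isoRightDerivedObj F k) ≪≫
    e.app (ofResolution (injectiveResolution X)) ≪≫ (coh K k).mapIso (g X).symm) fun {X Y} f => ?_⟩
  let φ := InjectiveResolution.desc f (injectiveResolution Y) (injectiveResolution X)
  have hφ : (injectiveResolution X).ι.f 0 ≫ φ.f 0 = f ≫ (injectiveResolution Y).ι.f 0 :=
    InjectiveResolution.desc_commutes_zero f _ _
  have e1 := U.congr_map (InjectiveResolution.isoRightDerivedObj_hom_naturality f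
    (injectiveResolution X) (injectiveResolution Y) φ hφ F k)
  rw [U.map_comp, U.map_comp] at e1
  have e2 := e.hom.naturality (X := ofResolution (injectiveResolution X))
    (Y := ofResolution (injectiveResolution Y)) (ObjectProperty.homMk φ)
  have e3 : HomologicalComplex.cyclesMap φ 0 ≫ (g Y).inv = (g X).inv ≫ f := by
    rw [Iso.comp_inv_eq, Category.assoc, Iso.eq_inv_comp]
    refine (cancel_mono ((injectiveResolution Y).cocomplex.iCycles 0)).1 ?_
    rw [Category.assoc, Category.assoc, HomologicalComplex.cyclesMap_i, hg, ← hφ, ← hg]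
    exact (Category.assoc _ _ _).symm
  have e4 := (coh K k).congr_map e3
  rw [(coh K k).map_comp, (coh K k).map_comp] at e4
  refine (Category.assoc _ _ _).symm.trans ((congrArg (· ≫ _) e1).trans ?_)
  refine (Category.assoc _ _ _).trans (Eq.trans (congrArg (_ ≫ ·) ?_) (Category.assoc _ _ _).symm)
  refine (Category.assoc _ _ _).symm.trans ((congrArg (· ≫ _) e2).trans ?_)
  refine (Category.assoc _ _ _).trans (Eq.trans (congrArg (_ ≫ ·) ?_) (Category.assoc _ _ _).symm)
  exact e4

end Derived

/-! ## Koszul complexes as exact functors -/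

section KoszulFunctor

variable {A : GRing} {m : ℕ} (α : Fin m → A) {d : Fin m → ℤ} (hα : ∀ i, α i ∈ A.deg (d i)) (c : ℕ)

section Loc

variable (S : Finset (Fin m)) {M N P : GMod A}

lemma Loc_map_locIn (f : M ⟶ N) (x : M) :
    ((Loc α hα S).map f).lin ((locIn α hα S M).lin x) = (locIn α hα S N).lin (f.lin x) :=
  GMod.congr_lin (locIn_naturality α hα f) x

lemma Loc_map_injective (f : M ⟶ N) (hf : Function.Injective f.lin) :
    Function.Injective ((Loc α hα S).map f).lin := by
  rw [injective_iff_map_eq_zero]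
  intro y hy
  obtain ⟨s, x, hx⟩ := exists_pow_smul_eq_locIn α hα y
  have h1 : (locIn α hα S N).lin (f.lin x) = 0 := by
    rw [← Loc_map_locIn, ← hx, map_smul, hy, smul_zero]
  obtain ⟨t, ht⟩ := locIn_eq_zero α hα h1
  have h2 : (∏ i ∈ S, α i) ^ t • x = 0 := hf (by rw [map_smul, ht, map_zero])
  refine eq_zero_of_prod_smul α hα (Finset.Subset.refl S) (s := t + s) ?_
  rw [pow_add, mul_smul, hx, ← map_smul, h2, map_zero]

lemma Loc_map_surjective (f : M ⟶ N) (hf : Function.Surjective f.lin) :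
    Function.Surjective ((Loc α hα S).map f).lin := by
  intro y
  obtain ⟨s, x, hx⟩ := exists_pow_smul_eq_locIn α hα y
  obtain ⟨w, rfl⟩ := hf x
  obtain ⟨z, hz⟩ := (smul_prod_bijective α hα (S := S) (M := M) s).2 ((locIn α hα S M).lin w)
  refine ⟨z, (smul_prod_bijective α hα s).1 ?_⟩
  beta_reduce at hz ⊢
  rw [← map_smul, hz, Loc_map_locIn, hx]

lemma Loc_map_exact (f : M ⟶ N) (g : N ⟶ P) (h : ∀ x, g.lin x = 0 → ∃ y, f.lin y = x)
    (y : (Loc α hα S).obj N) (hy : ((Loc α hα S).map g).lin y = 0) :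
    ∃ z, ((Loc α hα S).map f).lin z = y := by
  obtain ⟨s, x, hx⟩ := exists_pow_smul_eq_locIn α hα y
  have h1 : (locIn α hα S P).lin (g.lin x) = 0 := by
    rw [← Loc_map_locIn, ← hx, map_smul, hy, smul_zero]
  obtain ⟨t, ht⟩ := locIn_eq_zero α hα h1
  obtain ⟨w, hw⟩ := h ((∏ i ∈ S, α i) ^ t • x) (by rw [map_smul, ht])
  obtain ⟨z, hz⟩ := (smul_prod_bijective α hα (S := S) (M := M) (t + s)).2 ((locIn α hα S M).lin w)
  refine ⟨z, (smul_prod_bijective α hα (t + s)).1 ?_⟩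
  beta_reduce at hz ⊢
  rw [← map_smul, hz, Loc_map_locIn, hw, map_smul, ← hx, pow_add, mul_smul]

/-- Localization inverts maps with torsion kernel and cokernel. -/
lemma Loc_map_bijective {i : Fin m} (hi : i ∈ S) (f : M ⟶ N)
    (h1 : ∀ x, f.lin x = 0 → ∃ s : ℕ, α i ^ s • x = 0)
    (h2 : ∀ y, ∃ (s : ℕ) (x : M), f.lin x = α i ^ s • y) :
    Function.Bijective ((Loc α hα S).map f).lin := by
  constructor
  · rw [injective_iff_map_eq_zero]
    intro y hy
    obtain ⟨s, x, hx⟩ := exists_pow_smul_eq_locIn α hα y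
    obtain ⟨t, ht⟩ := locIn_eq_zero α hα (S := S) (x := f.lin x) (by
      rw [← Loc_map_locIn, ← hx, map_smul, hy, smul_zero])
    obtain ⟨r, hr⟩ := h1 ((∏ i ∈ S, α i) ^ t • x) (by rw [map_smul, ht])
    refine eq_zero_of_pow_smul α hα hi (s := r) (eq_zero_of_prod_smul α hα (Finset.Subset.refl S)
      (s := t + s) ?_)
    rw [smul_comm, pow_add, mul_smul, hx, ← map_smul, ← map_smul, hr, map_zero]
  · intro y
    obtain ⟨s, x, hx⟩ := exists_pow_smul_eq_locIn α hα y
    obtain ⟨t, w, hw⟩ := h2 x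
    obtain ⟨b, hb⟩ := pow_dvd_pow_of_dvd (Finset.dvd_prod_of_mem α hi) t
    obtain ⟨z, hz⟩ := (smul_prod_bijective α hα (S := S) (M := M) (t + s)).2
      ((locIn α hα S M).lin (b • w))
    refine ⟨z, (smul_prod_bijective α hα (t + s)).1 ?_⟩
    beta_reduce at hz ⊢
    rw [← map_smul, hz, Loc_map_locIn, map_smul, hw, pow_add, mul_smul, hx, ← map_smul, smul_smul,
      mul_comm b, ← hb]

end Loc

section KX

variable (k : ℕ) {M N P : GMod A}

lemma KXmap_injective (f : M ⟶ N)
    (hf : ∀ S : Finset (Fin m), S.card = k + c → Function.Injective ((Loc α hα S).map f).lin) :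
    Function.Injective (KXmap α hα c k f).lin := fun x y h =>
  KX_ext α hα c fun S hS => hf S hS (by
    rw [← compAt_KXmap α hα c f x hS, ← compAt_KXmap α hα c f y hS, h])

lemma KXmap_surjective (f : M ⟶ N)
    (hf : ∀ S : Finset (Fin m), S.card = k + c → Function.Surjective ((Loc α hα S).map f).lin) :
    Function.Surjective (KXmap α hα c k f).lin := by
  classical
  intro y
  obtain ⟨x, hx⟩ := exists_KX α hα c (M := M) k fun S => if h : S.card = k + c then
    (hf S h (compAt α hα c y S)).choose else 0
  refine ⟨x, KX_ext α hα c fun S hS => ?_⟩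
  rw [compAt_KXmap α hα c f x hS, hx S hS, dif_pos hS]
  exact (hf S hS (compAt α hα c y S)).choose_spec

lemma KXmap_exact (f : M ⟶ N) (g : N ⟶ P) (h : ∀ x, g.lin x = 0 → ∃ y, f.lin y = x)
    (y : KX α hα c k N) (hy : (KXmap α hα c k g).lin y = 0) : ∃ z, (KXmap α hα c k f).lin z = y := by
  have h1 : ∀ S : Finset (Fin m), ∃ z : (Loc α hα S).obj M, S.card = k + c →
      ((Loc α hα S).map f).lin z = compAt α hα c y S := fun S => by
    by_cases hS : S.card = k + c
    · obtain ⟨z, hz⟩ := Loc_map_exact α hα S f g h (compAt α hα c y S) (by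
        rw [← compAt_KXmap α hα c g y hS, hy, compAt_zero])
      exact ⟨z, fun _ => hz⟩
    · exact ⟨0, fun h => (hS h).elim⟩
  choose z hz using h1
  obtain ⟨x, hx⟩ := exists_KX α hα c (M := M) k z
  refine ⟨x, KX_ext α hα c fun S hS => ?_⟩
  rw [compAt_KXmap α hα c f x hS, hx S hS, hz S hS]

end KX

instance : (koszul α hα c).Additive where
  map_add {M N f g} := HomologicalComplex.hom_ext _ _ fun k => by
    change KXmap α hα c k (f + g) = KXmap α hα c k f + KXmap α hα c k g
    refine biproduct.hom_ext _ _ fun S => ?_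
    rw [Preadditive.add_comp, KXmap, KXmap, KXmap, biproduct.map_π, biproduct.map_π, biproduct.map_π,
      (Loc α hα S.1).map_add, Preadditive.comp_add]

/-- The functor that takes a module to its stable Koszul complex or its Čech complex is exact. -/
lemma koszul_shortExact (S : ShortComplex (GMod A)) (h : S.ShortExact) :
    (S.map (koszul α hα c)).ShortExact := by
  refine HomologicalComplex.shortExact_of_degreewise_shortExact _ fun k => ?_
  have := h.mono_f
  have := h.epi_g
  exact
    { exact := (GMod.exact_iff _).2 (KXmap_exact α hα c k S.f S.g ((GMod.exact_iff S).1 h.exact))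
      mono_f := GMod.mono_of_injective _ (KXmap_injective α hα c k S.f fun T _ =>
        Loc_map_injective α hα T S.f (GMod.injective_of_mono S.f))
      epi_g := GMod.epi_of_surjective _ (KXmap_surjective α hα c k S.g fun T _ =>
        Loc_map_surjective α hα T S.g (GMod.surjective_of_epi S.g)) }

/-- The cohomology in positive degrees vanishes for modules with divisible torsion. -/
lemma isZero_coh_koszul {v : ℕ → A} (hv : ∀ i : Fin m, α i = v i) {M : GMod A} (hM : TorsDivisible v M)
    (k : ℕ) : IsZero ((koszulObj α hα c M).homology (k + 1)) := by
  rw [← HomologicalComplex.exactAt_iff_isZero_homology,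
    HomologicalComplex.exactAt_iff' _ k (k + 1) (k + 1 + 1) (by simp) (by simp), GMod.exact_iff]
  intro x hx
  have e1 := koszulObj_d α hα c M (k + 1)
  have e2 := koszulObj_d α hα c M k
  obtain ⟨y, hy⟩ := KXd_exact α hα c hv hM k x ((GMod.congr_lin e1 x).symm.trans hx)
  exact ⟨y, (GMod.congr_lin e2 y).trans hy⟩

end KoszulFunctor

section ToCoh

variable {C D : Type*} [Category C] [Category D] [Abelian D] (K : C ⥤ CochainComplex D ℕ) {G : C ⥤ D}
  (b : ∀ M, G.obj M ⟶ (K.obj M).X 0) (hb : ∀ {M N : C} (f : M ⟶ N), G.map f ≫ b N = b M ≫ (K.map f).f 0)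
  (hd : ∀ M, b M ≫ (K.obj M).d 0 1 = 0)

/-- A transformation to cohomology in degree zero, from a transformation to cocycles. -/
def toCohZero : G ⟶ coh K 0 where
  app M := (K.obj M).liftCycles (b M) 1 (by simp) (hd M) ≫ (K.obj M).homologyπ 0
  naturality {M N} f := by
    have e := HomologicalComplex.homologyπ_naturality (K.map f) 0
    have e1 : G.map f ≫ (K.obj N).liftCycles (b N) 1 (by simp) (hd N) =
        (K.obj M).liftCycles (b M) 1 (by simp) (hd M) ≫ HomologicalComplex.cyclesMap (K.map f) 0 := by
      rw [← cancel_mono ((K.obj N).iCycles 0), Category.assoc, Category.assoc,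
        HomologicalComplex.liftCycles_i, HomologicalComplex.cyclesMap_i,
        HomologicalComplex.liftCycles_i_assoc, hb]
    refine (Category.assoc _ _ _).symm.trans ((congrArg (· ≫ _) e1).trans ?_)
    refine (Category.assoc _ _ _).trans ((congrArg (_ ≫ ·) e.symm).trans ?_)
    exact (Category.assoc _ _ _).symm

lemma isIso_toCohZero_app (M : C) (h : (ShortComplex.mk _ _ (hd M)).Exact) (hm : Mono (b M)) :
    IsIso ((toCohZero K b hb hd).app M) := by
  have h1 : IsIso ((K.obj M).liftCycles (b M) 1 (by simp) (hd M)) :=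
    (CochainComplex.isIso_liftCycles_iff _ _ _).2 ⟨h, hm⟩
  have h2 : IsIso ((K.obj M).homologyπ 0) := (K.obj M).isIso_homologyπ _ 0 rfl (by simp)
  exact IsIso.comp_isIso' h1 h2

end ToCoh

/-! ## The derived functors of `T_n` and `L_n` -/

section Main

lemma U_additive (H : Bialgebroid) : H.U.Additive := inferInstance

variable (p : ℕ) [hp : Fact p.Prime] (n : ℕ)

instance BPforget_additive : (BPforget p).Additive := U_additive (BPH p)

/-- The sequence `v_0, …, v_n`. -/
abbrev vFin : Fin (n + 1) → BP p := fun i => vv p i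

/-- The degrees of `v_0, …, v_n`. -/
abbrev dFin : Fin (n + 1) → ℤ := fun i => dg p i

lemma vFin_mem (i : Fin (n + 1)) : vFin p n i ∈ (BP p).deg (dFin p n i) := vv_mem p i

/-- The stable Koszul complex or the Čech complex of a graded module. -/
abbrev kosz (c : ℕ) : GMod (BP p) ⥤ CochainComplex (GMod (BP p)) ℕ :=
  koszul (vFin p n) (vFin_mem p n) c

/-- The stable Koszul complex or the Čech complex of a comodule. -/
def koszulBP (c : ℕ) : BPComod p ⥤ CochainComplex (GMod (BP p)) ℕ := BPforget p ⋙ kosz p n c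

instance (c : ℕ) : (koszulBP p n c).Additive := inferInstanceAs (BPforget p ⋙ kosz p n c).Additive

lemma koszulBP_shortExact (c : ℕ) (S : ShortComplex (BPComod p)) (h : S.ShortExact) :
    (S.map (koszulBP p n c)).ShortExact :=
  koszul_shortExact (vFin p n) (vFin_mem p n) c (S.map (BPforget p)) (h.map_of_exact (BPforget p))

lemma isZero_coh_koszulBP (c : ℕ) (J : BPComod p) (hJ : Injective J) (k : ℕ) :
    IsZero ((coh (koszulBP p n c) (k + 1)).obj J) :=
  isZero_coh_koszul (vFin p n) (vFin_mem p n) c (v := vv p) (fun _ => rfl) (torsDivisible_of_injective J) k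

/-- The inclusion of `T_n M` in the degree zero part of the stable Koszul complex. -/
def tnMap (M : BPComod p) : und ((Tn p n).obj M) ⟶ KX (vFin p n) (vFin_mem p n) 0 0 (und M) :=
  (BPforget p).map ((TnIncl p n).app M) ≫ koszulIn (vFin p n) (vFin_mem p n) (und M)

lemma tnMap_naturality {M N : BPComod p} (f : M ⟶ N) :
    (BPforget p).map ((Tn p n).map f) ≫ tnMap p n N =
      tnMap p n M ≫ KXmap (vFin p n) (vFin_mem p n) 0 0 ((BPforget p).map f) := by
  have h1 := (BPforget p).congr_map ((TnIncl p n).naturality f)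
  rw [(BPforget p).map_comp, (BPforget p).map_comp] at h1
  refine (Category.assoc _ _ _).symm.trans ((congrArg (· ≫ _) h1).trans ?_)
  refine (Category.assoc _ _ _).trans (Eq.trans (congrArg (_ ≫ ·) ?_) (Category.assoc _ _ _).symm)
  exact (koszulIn_naturality (vFin p n) (vFin_mem p n) ((BPforget p).map f)).symm

lemma mem_range_TnIncl_iff (M : BPComod p) (x : und M) :
    x ∈ LinearMap.range ((BPforget p).map ((TnIncl p n).app M)).lin ↔
      ∀ i : Fin (n + 1), ∃ s : ℕ, vFin p n i ^ s • x = 0 := by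
  rw [mem_range_TnIncl]
  constructor
  · intro h i
    exact torsBelow_of_powTorsion n M x h i i.2
  · intro h
    exact h (Fin.last n)

lemma tnMap_comp_eq_zero (M : BPComod p) :
    tnMap p n M ≫ KXd (vFin p n) (vFin_mem p n) 0 0 (und M) = 0 :=
  GMod.hom_ext fun x => (koszulIn_KXd_eq_zero_iff (vFin p n) (vFin_mem p n) _).2
    ((mem_range_TnIncl_iff p n M _).1 ⟨x, rfl⟩)

lemma tnMap_injective (M : BPComod p) : Function.Injective (tnMap p n M).lin := by
  have h : Mono ((TnIncl p n).app M) := inferInstanceAs (Mono (tors_isSubcomodule _ _).incl)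
  have h1 := GMod.injective_of_mono ((BPforget p).map ((TnIncl p n).app M))
  exact (koszulIn_bijective (vFin p n) (vFin_mem p n) (und M)).1.comp h1

lemma tnMap_exact (M : BPComod p) (x : KX (vFin p n) (vFin_mem p n) 0 0 (und M))
    (hx : (KXd (vFin p n) (vFin_mem p n) 0 0 (und M)).lin x = 0) : ∃ y, (tnMap p n M).lin y = x := by
  obtain ⟨z, rfl⟩ := (koszulIn_bijective (vFin p n) (vFin_mem p n) (und M)).2 x
  obtain ⟨y, hy⟩ := (mem_range_TnIncl_iff p n M z).2
    ((koszulIn_KXd_eq_zero_iff (vFin p n) (vFin_mem p n) z).1 hx)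
  exact ⟨y, congrArg (koszulIn (vFin p n) (vFin_mem p n) (und M)).lin hy⟩

/-- The derived functors of an additive functor whose values on injective comodules are the cohomology
of degree zero. -/
lemma rightDerived_iso_of_map (c : ℕ) (F : BPComod p ⥤ BPComod p) [F.Additive]
    (b : ∀ M : BPComod p, und (F.obj M) ⟶ KX (vFin p n) (vFin_mem p n) c 0 (und M))
    (hb : ∀ {M N : BPComod p} (f : M ⟶ N), (BPforget p).map (F.map f) ≫ b N =
      b M ≫ KXmap (vFin p n) (vFin_mem p n) c 0 ((BPforget p).map f))
    (hd : ∀ M, b M ≫ KXd (vFin p n) (vFin_mem p n) c 0 (und M) = 0)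
    (hi : ∀ J, Injective J → Function.Injective (b J).lin)
    (he : ∀ J, Injective J → ∀ x, (KXd (vFin p n) (vFin_mem p n) c 0 (und J)).lin x = 0 →
      ∃ y, (b J).lin y = x) (k : ℕ) :
    Nonempty (F.rightDerived k ⋙ BPforget p ≅ BPforget p ⋙ kosz p n c ⋙
      HomologicalComplex.homologyFunctor _ _ k) := by
  have hd' : ∀ M, b M ≫ ((koszulBP p n c).obj M).d 0 1 = 0 := fun M =>
    (congrArg (b M ≫ ·) (koszulObj_d (vFin p n) (vFin_mem p n) c (und M) 0)).trans (hd M)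
  refine rightDerived_iso_coh (koszulBP p n c) (koszulBP_shortExact p n c) (isZero_coh_koszulBP p n c)
    F (BPforget p) (toCohZero (koszulBP p n c) (G := F ⋙ BPforget p) b hb hd') (fun J hJ => ?_) k
  refine isIso_toCohZero_app (koszulBP p n c) (G := F ⋙ BPforget p) b hb hd' J ?_ ?_
  · refine (GMod.exact_iff _).2 fun x hx => he J hJ x ?_
    exact (GMod.congr_lin (koszulObj_d (vFin p n) (vFin_mem p n) c (und J) 0) x).symm.trans hx
  · exact GMod.mono_of_injective _ (hi J hJ)

lemma Loc_map_lnUnit_bijective (M : BPComod p) {S : Finset (Fin (n + 1))} (hS : S.Nonempty) :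
    Function.Bijective ((Loc (vFin p n) (vFin_mem p n) S).map ((BPforget p).map (lnUnit p n M))).lin := by
  obtain ⟨i, hi⟩ := hS
  refine Loc_map_bijective (vFin p n) (vFin_mem p n) S hi _ (fun x hx => ?_) fun y => ?_
  · exact torsBelow_of_LnUnit_eq_zero p n M hx i i.2
  · exact exists_pow_smul_eq_LnUnit p n M y (Nat.lt_succ_iff.1 i.2)

lemma KXmap_lnUnit_bijective (M : BPComod p) (k : ℕ) : Function.Bijective
    (KXmap (vFin p n) (vFin_mem p n) 1 k ((BPforget p).map (lnUnit p n M))).lin :=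
  ⟨KXmap_injective _ _ 1 k _ fun S hS => (Loc_map_lnUnit_bijective p n M
      (Finset.card_pos.1 (by omega))).1,
    KXmap_surjective _ _ 1 k _ fun S hS => (Loc_map_lnUnit_bijective p n M
      (Finset.card_pos.1 (by omega))).2⟩

instance (M : BPComod p) (k : ℕ) :
    IsIso (KXmap (vFin p n) (vFin_mem p n) 1 k ((BPforget p).map (lnUnit p n M))) :=
  GMod.isIso_of_bijective _ (KXmap_lnUnit_bijective p n M k)

/-- The map from `L_n M` to the degree zero part of the Čech complex of `M`. -/
def lnMap (M : BPComod p) : und ((Ln p n).obj M) ⟶ KX (vFin p n) (vFin_mem p n) 1 0 (und M) :=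
  cechIn (vFin p n) (vFin_mem p n) (und ((Ln p n).obj M)) ≫
    inv (KXmap (vFin p n) (vFin_mem p n) 1 0 ((BPforget p).map (lnUnit p n M)))

lemma lnMap_KXmap (M : BPComod p) :
    lnMap p n M ≫ KXmap (vFin p n) (vFin_mem p n) 1 0 ((BPforget p).map (lnUnit p n M)) =
      cechIn (vFin p n) (vFin_mem p n) (und ((Ln p n).obj M)) := by
  rw [lnMap, Category.assoc, IsIso.inv_hom_id, Category.comp_id]

lemma lnMap_lnUnit (M : BPComod p) : (BPforget p).map (lnUnit p n M) ≫ lnMap p n M =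
    cechIn (vFin p n) (vFin_mem p n) (und M) := by
  rw [lnMap, ← Category.assoc, IsIso.comp_inv_eq]
  exact (cechIn_naturality (vFin p n) (vFin_mem p n) ((BPforget p).map (lnUnit p n M))).symm

lemma lnMap_naturality {M N : BPComod p} (f : M ⟶ N) :
    (BPforget p).map ((Ln p n).map f) ≫ lnMap p n N =
      lnMap p n M ≫ KXmap (vFin p n) (vFin_mem p n) 1 0 ((BPforget p).map f) := by
  have h1 := (BPforget p).congr_map ((LnUnit p n).naturality f)
  rw [(BPforget p).map_comp, (BPforget p).map_comp] at h1
  refine (cancel_mono (KXmap (vFin p n) (vFin_mem p n) 1 0 ((BPforget p).map (lnUnit p n N)))).1 ?_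
  rw [Category.assoc, Category.assoc, lnMap_KXmap, ← cechIn_naturality, ← KXmap_comp]
  refine Eq.trans ?_ (congrArg (fun g => lnMap p n M ≫ KXmap (vFin p n) (vFin_mem p n) 1 0 g) h1.symm)
  rw [KXmap_comp, ← Category.assoc]
  exact congrArg (· ≫ _) (lnMap_KXmap p n M).symm

lemma lnMap_comp_eq_zero (M : BPComod p) :
    lnMap p n M ≫ KXd (vFin p n) (vFin_mem p n) 1 0 (und M) = 0 := by
  refine (cancel_mono (KXmap (vFin p n) (vFin_mem p n) 1 1 ((BPforget p).map (lnUnit p n M)))).1 ?_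
  rw [zero_comp, Category.assoc, ← KXmap_KXd, ← Category.assoc, lnMap_KXmap, cechIn_KXd]

lemma lnMap_injective (M : BPComod p) : Function.Injective (lnMap p n M).lin := by
  rw [injective_iff_map_eq_zero]
  intro x hx
  have h1 := GMod.congr_lin (lnMap_KXmap p n M) x
  rw [GMod.comp_apply, hx, map_zero] at h1
  exact eq_zero_of_pow_smul_Ln p n M x
    (exists_pow_smul_of_cechIn (vFin p n) (vFin_mem p n) h1.symm (Fin.last n))

lemma lnMap_exact (J : BPComod p) (hJ : Injective J) (x : KX (vFin p n) (vFin_mem p n) 1 0 (und J))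
    (hx : (KXd (vFin p n) (vFin_mem p n) 1 0 (und J)).lin x = 0) : ∃ y, (lnMap p n J).lin y = x := by
  obtain ⟨z, rfl⟩ := cechIn_exact (vFin p n) (vFin_mem p n) (v := vv p) (fun _ => rfl)
    (torsDivisible_of_injective J) x hx
  exact ⟨_, GMod.congr_lin (lnMap_lnUnit p n J) z⟩

theorem Tn_rightDerived_iso (k : ℕ) :
    Nonempty ((Tn p n).rightDerived k ⋙ BPforget p ≅ BPforget p ⋙ HI p n k) :=
  rightDerived_iso_of_map p n 0 (Tn p n) (tnMap p n) (tnMap_naturality p n) (tnMap_comp_eq_zero p n)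
    (fun J _ => tnMap_injective p n J) (fun J _ => tnMap_exact p n J) k

theorem Ln_rightDerived_iso (k : ℕ) :
    Nonempty ((Ln p n).rightDerived k ⋙ BPforget p ≅ BPforget p ⋙ CHI p n k) :=
  rightDerived_iso_of_map p n 1 (Ln p n) (lnMap p n) (lnMap_naturality p n) (lnMap_comp_eq_zero p n)
    (fun J _ => lnMap_injective p n J) (lnMap_exact p n) k

theorem isZero_HI_of_injective (J : BPComod p) (hJ : Injective J) (k : ℕ) (hk : 0 < k) :
    IsZero ((HI p n k).obj ((BPforget p).obj J)) := by
  obtain ⟨k, rfl⟩ := Nat.exists_eq_succ_of_ne_zero hk.ne'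
  exact isZero_coh_koszulBP p n 0 J hJ k

end Main

end
end BPCom

theorem mainTheorem3 (p : ℕ) [Fact p.Prime] (n : ℕ) :
    (∀ (M : BPCom.BPComod p) (x : (BPCom.BPforget p).obj M),
      x ∈ LinearMap.range ((BPCom.BPforget p).map ((BPCom.TnIncl p n).app M)).lin ↔
        ∃ s : ℕ, BPCom.vv p n ^ s • x = 0) ∧
    (∀ k : ℕ, Nonempty ((BPCom.Tn p n).rightDerived k ⋙ BPCom.BPforget p ≅
      BPCom.BPforget p ⋙ BPCom.HI p n k)) ∧
    (∀ k : ℕ, Nonempty ((BPCom.Ln p n).rightDerived k ⋙ BPCom.BPforget p ≅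
      BPCom.BPforget p ⋙ BPCom.CHI p n k)) ∧
    (∀ J : BPCom.BPComod p, Injective J → ∀ k : ℕ, 0 < k →
      IsZero ((BPCom.HI p n k).obj ((BPCom.BPforget p).obj J))) :=
  ⟨BPCom.mem_range_TnIncl n, BPCom.Tn_rightDerived_iso p n, BPCom.Ln_rightDerived_iso p n,
    BPCom.isZero_HI_of_injective p n⟩
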